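/- Let $\mathcal O$ be a cyclic operad in real vector spaces, with spaces of operations $\mathcal O[m]$, $m\ge 1$, where the symmetric group of all $m+1$ slots (the $m$ inputs and the output) acts on $\mathcal O[m]$. For a finite set $S$, an $\mathcal O$-spider with leg set $S$ is an element of the coinvariants $\big(\bigoplus_{L}\mathcal O[|S|-1]\big)_{\Sigma_{|S|}}$, $L$ running over the bijections $S\to\{0,\dots,|S|-1\}$ ($|S|\ge 2$). Spiders are mated along a leg of each by operad composition. An $\mathcal O$-graph is a finite graph, possibly empty or disconnected, with all valences at least $2$, with an orientation (an ordering of the vertices and a direction of every edge, up to an even number of transpositions of vertices and reversals of edges), and with an $\mathcal O$-spider at each vertex whose legs are the half-edges there. Let $X=\bigoplus_{k\ge 0}X_k$ be the real vector space spanned by isomorphism classes of $\mathcal O$-graphs, graded by the number $k$ of vertices, modulo $(G,-or)=-(G,or)$ and linearity in the spider at each vertex. On $X$ one has the following operations. * $\partial_E(G)=\sum_e G_e$, the sum over all edges $e$, where $G_e=0$ if $e$ is a loop, and otherwise $G_e$ is obtained by collapsing $e$ and mating the spiders at its endpoints; if the orientation is represented so that $e$ is directed from the first to the second vertex, then in $G_e$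 the new vertex is first and everything else is kept. * $\partial_H(G)=\sum_{\{x,y\}}(G^{\pi_{xy}})_{x\cup y}$, the sum over unordered pairs of half-edges $x\ne y$ with $y\ne\bar x$, where $\bar x$ is the other half of the edge of $x$. The graph $G^{\pi_{xy}}$ is obtained by cutting the edges $x\bar x$, $y\bar y$ and gluing $x$ to $y$ and $\bar x$ to $\bar y$; if the orientation of $G$ is represented so that these two edges are directed $x\to\bar x$ and $\bar y\to y$, the new edges are directed $\bar x\to\bar y$ and $y\to x$. * The product is disjoint union (vertices of the second factor last), the unit is the empty graph, the counit is dual to it, the coproduct $\Delta$ is multiplicative with connected graphs primitive, and the antipode multiplies a graph with $c$ components by $(-1)^c$. * $T(G)=\sum_{\{x,y\}}\sum_{(I,J)}\epsilon(I,J)\,(X_I\cdot X')\otimes(X_J\cdot X'')$, where $\{x,y\}$ runs over the unordered pairs such that $x$ and $\bar x$ lie in different components $X'\ni x,y$ and $X''\ni\bar x,\bar y$ of $G^{\pi_{xy}}=X'\cdot X''\cdot X_1\cdots X_m$, $(I,J)$ runs over the ordered partitions of $\{1,\dots,m\}$ into two parts, $X_I=\prod_{i\in I}X_i$, and the sign is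 defined by $X'\cdot X''\cdot X_1\cdots X_m=\epsilon(I,J)\,X_I\cdot X'\cdot X_J\cdot X''$. Extend $\partial_E$ and $\partial_H$ to $X\otimes X$ as graded derivations, and put $\theta=\Delta\partial_H-\partial_H\Delta\colon X\to X\otimes X$. Then all these operations are well defined on $X$, $\partial_E^2=0$, and $$\theta=\partial_E T-T\partial_E .$$ Hence $\theta$ vanishes on homology: if $\partial_E z=0$, then $\theta(z)$ is a $\partial_E$-boundary in $X\otimes X$. Moreover, the operations above induce on the $\mathcal O$-graph homology $H_*(X)=\ker\partial_E/\operatorname{im}\partial_E$ the structure of a differential graded Hopf algebra whose differential, of degree $-1$, is induced by $\partial_H$ (for the coproduct, $H_*(X\otimes X)$ is identified with $H_*(X)\otimes H_*(X)$ by the Künneth isomorphism). -/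

import Mathlib

open scoped TensorProduct DirectSum

universe u

noncomputable section

/-! ### Cyclic operads -/

/-- Position, among the slots `0, …, k+1` of `p ∘ᵢ q`, of the slot `a` of `p`.  Here `p` has slots
`0, …, m+1` (`0` is the output), `q` has slots `0, …, n+1`, and `p ∘ᵢ q` plugs the output of `q`
into the slot `i + 1` of `p` (that is, `i` counts the inputs of `p` from zero).  The value at
`a = i + 1`, the slot that is used up, is irrelevant. -/
def slotL {m n k : ℕ} (h : m + n = k) (i : Fin (m + 1)) (a : Fin (m + 2)) : Fin (k + 2) :=
  ⟨if a.val ≤ i.val then a.val else a.val + n, by split_ifs <;> omega⟩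

/-- Position, among the slots `0, …, k+1` of `p ∘ᵢ q`, of the slot `b` of `q`.  The value at
`b = 0`, the slot that is used up, is irrelevant. -/
def slotR {m n k : ℕ} (h : m + n = k) (i : Fin (m + 1)) (b : Fin (n + 2)) : Fin (k + 2) :=
  ⟨i.val + b.val, by omega⟩

/-- A cyclic operad in real vector spaces, presented by its partial compositions.

`Op n` is the space `𝒪[n+1]` of operations with inputs `1, …, n+1` and output `0`.  The symmetric
group of all `n + 2` slots acts: `act n σ o` is `o` with its slot `a` renamed `σ a` (the right
action is `o · σ = act n σ⁻¹ o`).  `comp h i p q` is the composition of `q` into the `i`-th input of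
`p`, inputs being counted from `0`; the equation `h : m + n = k` only serves to avoid casts. -/
structure CyclicOperad where
  Op : ℕ → Type u
  [addCommGroup : ∀ n, AddCommGroup (Op n)]
  [module : ∀ n, Module ℝ (Op n)]
  act : ∀ n, Representation ℝ (Equiv.Perm (Fin (n + 2))) (Op n)
  comp : ∀ {m n k : ℕ}, m + n = k → Fin (m + 1) → Op m →ₗ[ℝ] Op n →ₗ[ℝ] Op k
  one : Op 0
  /-- The unit is invariant under exchanging its two slots. -/
  act_one : ∀ σ, act 0 σ one = one
  one_comp : ∀ {n : ℕ} (q : Op n), comp (zero_add n) 0 one q = q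
  comp_one : ∀ {m : ℕ} (i : Fin (m + 1)) (p : Op m), comp (add_zero m) i p one = p
  /-- Sequential associativity `(p ∘ᵢ q) ∘ r = p ∘ᵢ (q ∘ⱼ r)`. -/
  comp_assoc : ∀ {l m n lm mn k : ℕ} (h₁ : l + m = lm) (h₂ : lm + n = k) (h₃ : m + n = mn)
    (h₄ : l + mn = k) (i : Fin (l + 1)) (j : Fin (m + 1)) (c : Fin (lm + 1)),
    c.val = i.val + j.val → ∀ (p : Op l) (q : Op m) (r : Op n),
      comp h₂ c (comp h₁ i p q) r = comp h₄ i p (comp h₃ j q r)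
  /-- Parallel associativity: compositions into two different inputs `i < j` of `p` commute. -/
  comp_comm : ∀ {l m n lm ln k : ℕ} (h₁ : l + m = lm) (h₂ : lm + n = k) (h₃ : l + n = ln)
    (h₄ : ln + m = k) (i j : Fin (l + 1)) (i' : Fin (ln + 1)) (j' : Fin (lm + 1)),
    i < j → i'.val = i.val → j'.val = j.val + m → ∀ (p : Op l) (q : Op m) (r : Op n),
      comp h₂ j' (comp h₁ i p q) r = comp h₄ i' (comp h₃ j p r) q
  /-- Equivariance, when the output of `q` remains its output and stays plugged into an input of
  `p`: renaming slots of `p` and `q` renames slots of the composite by the corresponding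
  permutation `ρ`.  For `σ 0 = 0` this is the equivariance of an operad; for `σ` the rotation of
  all slots it is the axiom `(p ∘ᵢ q) · t = (p · t) ∘ᵢ₋₁ q` of a cyclic operad; these two cases
  generate the general one. -/
  act_comp : ∀ {m n k : ℕ} (h : m + n = k) (i i' : Fin (m + 1)) (σ : Equiv.Perm (Fin (m + 2)))
    (τ : Equiv.Perm (Fin (n + 2))) (ρ : Equiv.Perm (Fin (k + 2))),
    σ i.succ = i'.succ → τ 0 = 0 →
    (∀ a, a ≠ i.succ → ρ (slotL h i a) = slotL h i' (σ a)) →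
    (∀ b, b ≠ 0 → ρ (slotR h i b) = slotR h i' (τ b)) →
    ∀ (p : Op m) (q : Op n), act k ρ (comp h i p q) = comp h i' (act m σ p) (act n τ q)
  /-- Equivariance, when input and output are exchanged: `σ` turns the slot of `p` that is used
  into the output, and `τ` turns the output of `q` into an input.  For rotations this is the axiom
  `(p ∘₁ q) · t = (q · t) ∘ₙ (p · t)` of a cyclic operad, which together with `act_comp` generates
  the general case. -/
  act_comp_swap : ∀ {m n k : ℕ} (h : m + n = k) (h' : n + m = k) (i : Fin (m + 1))
    (j : Fin (n + 1)) (σ : Equiv.Perm (Fin (m + 2))) (τ : Equiv.Perm (Fin (n + 2)))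
    (ρ : Equiv.Perm (Fin (k + 2))),
    σ i.succ = 0 → τ 0 = j.succ →
    (∀ a, a ≠ i.succ → ρ (slotL h i a) = slotR h' j (σ a)) →
    (∀ b, b ≠ 0 → ρ (slotR h i b) = slotL h' j (τ b)) →
    ∀ (p : Op m) (q : Op n), act k ρ (comp h i p q) = comp h' j (act n τ q) (act m σ p)

attribute [instance] CyclicOperad.addCommGroup CyclicOperad.module

namespace CyclicOperad

variable (O : CyclicOperad.{u})

/-- The action of a bijection between the slots of an operation and `{0, …, n+1}`.  Such a
bijection forces `m = n`, so this is just the action of the symmetric group. -/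
def relabel {m n : ℕ} (e : Fin (m + 2) ≃ Fin (n + 2)) : O.Op m →ₗ[ℝ] O.Op n :=
  have h : m = n := by simpa using Fintype.card_congr e
  h.rec (motive := fun n _ => Fin (m + 2) ≃ Fin (n + 2) → (O.Op m →ₗ[ℝ] O.Op n))
    (fun e => O.act m e) e

theorem relabel_trans_act {m n : ℕ} (σ : Equiv.Perm (Fin (m + 2))) (e : Fin (m + 2) ≃ Fin (n + 2))
    (o : O.Op m) : O.relabel (σ.symm.trans e) (O.act m σ o) = O.relabel e o := by
  obtain rfl : m = n := by simpa using Fintype.card_congr e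
  change O.act m (e * σ⁻¹) (O.act m σ o) = O.act m e o
  rw [map_mul, Module.End.mul_apply, ← Module.End.mul_apply (O.act m σ⁻¹), ← map_mul]
  simp

/-! ### Spiders -/

/-- The direct sum, over all labelings `L` of the leg set `S` by `0, …, n+1`, of copies of
`𝒪[n+1]`.  (Only `n = |S| - 2` contributes.) -/
abbrev Labeled (S : Type) : Type u := ⨁ L : (Σ n : ℕ, S ≃ Fin (n + 2)), O.Op L.1

open Classical in
/-- The element `o_L`: the operation `o` in the summand of the labeling `L`. -/
def labeled {S : Type} {n : ℕ} (L : S ≃ Fin (n + 2)) : O.Op n →ₗ[ℝ] O.Labeled S :=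
  DirectSum.lof ℝ (Σ n : ℕ, S ≃ Fin (n + 2)) (fun L => O.Op L.1) ⟨n, L⟩

/-- The span of all `(σ · o)_{σ · L} - o_L`. -/
def spiderRel (S : Type) : Submodule ℝ (O.Labeled S) :=
  Submodule.span ℝ {z | ∃ (n : ℕ) (L : S ≃ Fin (n + 2)) (σ : Equiv.Perm (Fin (n + 2)))
    (o : O.Op n), z = O.labeled (L.trans σ) (O.act n σ o) - O.labeled L o}

/-- The space of `𝒪`-spiders with leg set `S`: the coinvariants of the symmetric group acting on
the labeled operations. -/
abbrev Spider (S : Type) : Type u := O.Labeled S ⧸ O.spiderRel S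

/-- The spider `[o_L]`. -/
def spiderMk {S : Type} {n : ℕ} (L : S ≃ Fin (n + 2)) : O.Op n →ₗ[ℝ] O.Spider S :=
  (O.spiderRel S).mkQ ∘ₗ O.labeled L

theorem spiderMk_act {S : Type} {n : ℕ} (L : S ≃ Fin (n + 2)) (σ : Equiv.Perm (Fin (n + 2)))
    (o : O.Op n) : O.spiderMk (L.trans σ) (O.act n σ o) = O.spiderMk L o := by
  refine (Submodule.Quotient.eq _).2 (Submodule.subset_span ⟨n, L, σ, o, rfl⟩)

open Classical in
/-- A linear map out of a space of spiders. -/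
def spiderLift {S : Type} {M : Type*} [AddCommGroup M] [Module ℝ M]
    (f : ∀ n : ℕ, (S ≃ Fin (n + 2)) → O.Op n →ₗ[ℝ] M)
    (hf : ∀ n (L : S ≃ Fin (n + 2)) σ o, f n (L.trans σ) (O.act n σ o) = f n L o) :
    O.Spider S →ₗ[ℝ] M :=
  (O.spiderRel S).liftQ (DirectSum.toModule ℝ _ M fun L => f L.1 L.2) <| by
    refine Submodule.span_le.2 ?_
    rintro _ ⟨n, L, σ, o, rfl⟩
    simp only [SetLike.mem_coe, LinearMap.mem_ker, map_sub, labeled, DirectSum.toModule_lof]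
    rw [hf, sub_self]

theorem spiderLift_mk {S : Type} {M : Type*} [AddCommGroup M] [Module ℝ M]
    (f : ∀ n : ℕ, (S ≃ Fin (n + 2)) → O.Op n →ₗ[ℝ] M) (hf) {n : ℕ} (L : S ≃ Fin (n + 2))
    (o : O.Op n) : O.spiderLift f hf (O.spiderMk L o) = f n L o := by
  classical
  exact DirectSum.toModule_lof (R := ℝ) (φ := fun L : (Σ n : ℕ, S ≃ Fin (n + 2)) => f L.1 L.2)
    ⟨n, L⟩ o

/-- Transport of spiders along a bijection of leg sets. -/
def spiderMap {S T : Type} (e : S ≃ T) : O.Spider S →ₗ[ℝ] O.Spider T :=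
  O.spiderLift (fun _ L => O.spiderMk (e.symm.trans L)) fun _ L σ o =>
    O.spiderMk_act (e.symm.trans L) σ o

/-- The operation `o` with `[o_L] = s`, for a given spider `s` and a given labeling `L`. -/
def spiderRep {S : Type} {n : ℕ} (L : S ≃ Fin (n + 2)) : O.Spider S →ₗ[ℝ] O.Op n :=
  O.spiderLift (fun _ L' => O.relabel (L'.symm.trans L)) fun _ L' σ o =>
    O.relabel_trans_act σ (L'.symm.trans L) o

theorem spiderRep_mk' {S : Type} {m n : ℕ} (L' : S ≃ Fin (m + 2)) (L : S ≃ Fin (n + 2))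
    (o : O.Op m) : O.spiderRep L (O.spiderMk L' o) = O.relabel (L'.symm.trans L) o :=
  O.spiderLift_mk _ _ L' o

/-- `spiderRep L` and `[·_L]` are mutually inverse. -/
theorem spiderMk_rep {S : Type} {n : ℕ} (L : S ≃ Fin (n + 2)) (s : O.Spider S) :
    O.spiderMk L (O.spiderRep L s) = s := by
  classical
  obtain ⟨z, rfl⟩ := Submodule.mkQ_surjective _ s
  induction z using DirectSum.induction_on with
  | zero => rw [map_zero, map_zero, map_zero]
  | of L' o =>
    obtain ⟨n', L'⟩ := L'
    obtain rfl : n' = n := by simpa using Fintype.card_congr (L'.symm.trans L)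
    change O.spiderMk L (O.spiderRep L (O.spiderMk L' o)) = O.spiderMk L' o
    rw [spiderRep_mk']
    have := O.spiderMk_act L' (L'.symm.trans L) o
    rwa [← Equiv.trans_assoc, Equiv.self_trans_symm, Equiv.refl_trans] at this
  | add x y hx hy => rw [map_add, map_add, map_add, hx, hy]

theorem spiderRep_mk {S : Type} {n : ℕ} (L : S ≃ Fin (n + 2)) (o : O.Op n) :
    O.spiderRep L (O.spiderMk L o) = o := by
  rw [spiderRep_mk', Equiv.symm_trans_self]
  change O.act n 1 o = o
  simp

/-- The labeling of the legs of a mated spider: `L₁` labels the legs of the first spider with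
`L₁ a = 0`, and `L₂` labels the legs of the second one with `L₂ b = 1`; the remaining legs of the
first are inserted, in order, into the ordered legs of the second at the slot occupied by `b`. -/
def mateLabeling {S T : Type} {m n : ℕ} (a : S) (b : T) (L₁ : S ≃ Fin (m + 2))
    (L₂ : T ≃ Fin (n + 2)) (h₁ : L₁ a = 0) (h₂ : L₂ b = 1) :
    {s : S // s ≠ a} ⊕ {t : T // t ≠ b} ≃ Fin (n + m + 2) := by
  classical
  letI : Fintype S := Fintype.ofEquiv _ L₁.symm
  letI : Fintype T := Fintype.ofEquiv _ L₂.symm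
  refine Equiv.ofBijective
    (Sum.elim (fun s => slotR (rfl : n + m = n + m) 0 (L₁ s.1))
      (fun t => slotL (rfl : n + m = n + m) 0 (L₂ t.1)))
    ((Fintype.bijective_iff_injective_and_card _).2 ⟨?_, ?_⟩)
  · have e₁ : ∀ s : {s : S // s ≠ a}, (L₁ s.1).val ≠ 0 := fun s hs =>
      s.2 (L₁.injective (by rw [h₁]; exact Fin.ext hs))
    have e₂ : ∀ t : {t : T // t ≠ b}, (L₂ t.1).val ≠ 1 := fun t ht =>
      t.2 (L₂.injective (by rw [h₂]; exact Fin.ext (by simpa using ht)))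
    rintro (s | t) (s' | t') hst
    · refine congrArg Sum.inl (Subtype.ext (L₁.injective (Fin.ext ?_)))
      simpa [slotR] using hst
    · have := e₁ s; have := e₂ t'; have := (L₁ s.1).2
      simp only [Sum.elim_inl, Sum.elim_inr, slotR, slotL, Fin.mk.injEq] at hst
      grind
    · have := e₁ s'; have := e₂ t; have := (L₁ s'.1).2
      simp only [Sum.elim_inl, Sum.elim_inr, slotR, slotL, Fin.mk.injEq] at hst
      grind
    · have := e₂ t; have := e₂ t'
      refine congrArg Sum.inr (Subtype.ext (L₂.injective (Fin.ext ?_)))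
      simp only [Sum.elim_inr, slotL, Fin.mk.injEq] at hst
      grind
  · have hS : Fintype.card S = m + 2 := by simpa using Fintype.card_congr L₁
    have hT : Fintype.card T = n + 2 := by simpa using Fintype.card_congr L₂
    have hS' : Fintype.card {s : S // s ≠ a} = m + 1 := by
      rw [Fintype.card_subtype_compl, hS]; simp
    have hT' : Fintype.card {t : T // t ≠ b} = n + 1 := by
      rw [Fintype.card_subtype_compl, hT]; simp
    rw [Fintype.card_sum, hS', hT', Fintype.card_fin]; omega

open Classical in
/-- The mating law `(s, a) ∘ (b, t)`: choose representatives `s = [(o₁)_{L₁}]`, `t = [(o₂)_{L₂}]`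
with `L₁ a = 0` and `L₂ b = 1`, and take the class of `o₂ ∘₁ o₁` with the induced labeling.  The
representatives exist as soon as both spiders have at least two legs; the spaces of spiders with
fewer legs are zero. -/
def mate {S T : Type} (a : S) (b : T) :
    O.Spider S →ₗ[ℝ] O.Spider T →ₗ[ℝ] O.Spider ({s : S // s ≠ a} ⊕ {t : T // t ≠ b}) :=
  if h : (∃ (m : ℕ) (L₁ : S ≃ Fin (m + 2)), L₁ a = 0) ∧
      (∃ (n : ℕ) (L₂ : T ≃ Fin (n + 2)), L₂ b = 1) then
    ((O.comp rfl 0).flip.compl₁₂ (O.spiderRep h.1.choose_spec.choose)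
      (O.spiderRep h.2.choose_spec.choose)).compr₂
      (O.spiderMk (mateLabeling a b _ _ h.1.choose_spec.choose_spec h.2.choose_spec.choose_spec))
  else 0

end CyclicOperad

/-! ### Oriented graphs -/

/-- The sign of a bijection between finite linearly ordered sets: the sign of the permutation
obtained by identifying both sets monotonically with `{0, …, n-1}`. -/
def orderSign {V W : Type} [LinearOrder V] [Fintype V] [LinearOrder W] [Fintype W] (f : V ≃ W) :
    ℤˣ :=
  Equiv.Perm.sign ((Fintype.orderIsoFinOfCardEq V rfl).toEquiv.trans
    (f.trans (Fintype.orderIsoFinOfCardEq W (Fintype.card_congr f).symm).symm.toEquiv))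

/-- A finite graph (possibly empty or disconnected, loops and multiple edges allowed) all of whose
vertices have valence at least two, with a representative of an orientation.

`V` is the set of vertices, `H` the set of half-edges, `inv` the involution whose orbits are the
edges, and `vert h` the vertex at which `h` sits.  The orientation is represented by an ordering of
the vertices and a direction of every edge: `dir h = 1` if `h` is the initial half-edge of its
edge, and `dir h = -1` if it is the terminal one. -/
structure OrientedGraph where
  V : Type
  H : Type
  [linearOrder : LinearOrder V]
  [fintypeV : Fintype V]
  [decidableEqH : DecidableEq H]
  [fintypeH : Fintype H]
  inv : H → H
  inv_inv : ∀ h, inv (inv h) = h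
  inv_ne : ∀ h, inv h ≠ h
  vert : H → V
  dir : H → ℤˣ
  dir_inv : ∀ h, dir (inv h) = -dir h
  two_le_valence : ∀ v, ∃ h h', h ≠ h' ∧ vert h = v ∧ vert h' = v

attribute [instance] OrientedGraph.linearOrder OrientedGraph.fintypeV OrientedGraph.decidableEqH
  OrientedGraph.fintypeH

namespace OrientedGraph

variable (G : OrientedGraph)

/-- The half-edges at the vertex `v`. -/
abbrev Legs (v : G.V) : Type := {h : G.H // G.vert h = v}

/-- The set of connected components. -/
def Components : Type := Quot fun u v : G.V => ∃ h, G.vert h = u ∧ G.vert (G.inv h) = v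

/-- The component of a vertex. -/
def component (v : G.V) : G.Components := Quot.mk _ v

instance : Finite G.Components := inferInstanceAs (Finite (Quot _))

instance : Fintype G.Components := Fintype.ofFinite _

theorem component_vert_inv (h : G.H) :
    G.component (G.vert (G.inv h)) = G.component (G.vert h) :=
  (Quot.sound ⟨h, rfl, rfl⟩).symm

/-- The empty graph. -/
def empty : OrientedGraph where
  V := Empty
  H := Empty
  inv := id
  inv_inv h := h.elim
  inv_ne h := h.elim
  vert := id
  dir h := h.elim
  dir_inv h := h.elim
  two_le_valence v := v.elim

/-- Disjoint union; the vertices of the second graph come after those of the first. -/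
def union (G G' : OrientedGraph) : OrientedGraph where
  V := G.V ⊕ₗ G'.V
  H := G.H ⊕ G'.H
  inv := Sum.map G.inv G'.inv
  inv_inv := by rintro (h | h) <;> simp [inv_inv]
  inv_ne := by rintro (h | h) <;> simp [inv_ne]
  vert h := toLex (Sum.map G.vert G'.vert h)
  dir := Sum.elim G.dir G'.dir
  dir_inv := by rintro (h | h) <;> simp [dir_inv]
  two_le_valence v := by
    rcases v with v | v
    · obtain ⟨h, h', hne, e, e'⟩ := G.two_le_valence v
      exact ⟨.inl h, .inl h', by simpa using hne, congrArg _ (congrArg Sum.inl e),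
        congrArg _ (congrArg Sum.inl e')⟩
    · obtain ⟨h, h', hne, e, e'⟩ := G'.two_le_valence v
      exact ⟨.inr h, .inr h', by simpa using hne, congrArg _ (congrArg Sum.inr e),
        congrArg _ (congrArg Sum.inr e')⟩

open Classical in
/-- The union of the components in `K`, with the induced vertex ordering and edge directions. -/
def restrict (K : Set G.Components) : OrientedGraph where
  V := {v : G.V // G.component v ∈ K}
  H := {h : G.H // G.component (G.vert h) ∈ K}
  inv h := ⟨G.inv h.1, by rw [component_vert_inv]; exact h.2⟩
  inv_inv h := Subtype.ext (G.inv_inv h.1)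
  inv_ne h e := G.inv_ne h.1 (congrArg Subtype.val e)
  vert h := ⟨G.vert h.1, h.2⟩
  dir h := G.dir h.1
  dir_inv h := G.dir_inv h.1
  two_le_valence v := by
    obtain ⟨h, h', hne, e, e'⟩ := G.two_le_valence v.1
    exact ⟨⟨h, by rw [e]; exact v.2⟩, ⟨h', by rw [e']; exact v.2⟩, by simpa using hne,
      Subtype.ext e, Subtype.ext e'⟩

open Classical in
/-- The sign of the reordering of the vertices that moves those in the components of `K` to the
front, keeping the order among them and among the others. -/
def splitSign (K : Set G.Components) : ℤˣ :=
  orderSign (V := G.V) (W := {v : G.V // G.component v ∈ K} ⊕ₗ {v : G.V // ¬ G.component v ∈ K})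
    ((Equiv.sumCompl fun v => G.component v ∈ K).symm.trans toLex)

/-- Cut all edges and glue the half-edges again along the pairing `π_{xy}`, which pairs `x` with
`y`, pairs `x̄` with `ȳ`, and agrees with the standard pairing elsewhere.  The new edges are directed
from `y` to `x` and from `x̄` to `ȳ`.  This represents `reglueSign` times the orientation induced
from `G`. -/
def reglue (x y : G.H) (hxy : y ≠ x) (hxy' : y ≠ G.inv x) : OrientedGraph where
  V := G.V
  H := G.H
  inv h := if h = x then y else if h = y then x else if h = G.inv x then G.inv y else
    if h = G.inv y then G.inv x else G.inv h
  inv_inv h := by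
    have := G.inv_inv
    have := G.inv_ne
    grind
  inv_ne h := by
    have := G.inv_inv
    have := G.inv_ne
    grind
  vert := G.vert
  dir h := if h = x then -1 else if h = y then 1 else if h = G.inv x then 1 else
    if h = G.inv y then -1 else G.dir h
  dir_inv h := by
    have h₁ := G.inv_inv
    have h₂ := G.inv_ne
    have h₃ := G.dir_inv
    have h₄ : -(-1 : ℤˣ) = 1 := neg_neg 1
    by_cases e₁ : h = x
    · grind
    by_cases e₂ : h = y
    · grind
    by_cases e₃ : h = G.inv x
    · grind
    by_cases e₄ : h = G.inv y
    · grind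
    rw [if_neg e₁, if_neg e₂, if_neg e₃, if_neg e₄, if_neg e₁, if_neg e₂, if_neg e₃, if_neg e₄]
    grind
  two_le_valence := G.two_le_valence

/-- The sign relating the orientation of `G` to its representative in which the edges of `x` and
`y` are directed `x → x̄` and `ȳ → y`, that is, coherently around the circle `x, x̄, ȳ, y` formed by
the chords of the standard pairing and of `π_{xy}`. -/
def reglueSign (x y : G.H) : ℤˣ := G.dir x * G.dir (G.inv y)

/-- The pair `x`, `y` is separating: `x` and `x̄` lie in different components of the graph glued
along `π_{xy}`. -/
def Separating (x y : G.H) (hxy : y ≠ x) (hxy' : y ≠ G.inv x) : Prop :=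
  (G.reglue x y hxy hxy').component (G.vert x) ≠
    (G.reglue x y hxy hxy').component (G.vert (G.inv x))

/-- The vertices other than the endpoints of the edge of `x`. -/
abbrev Rest (x : G.H) : Type := {u : G.V // u ≠ G.vert x ∧ u ≠ G.vert (G.inv x)}

/-- The reordering of the vertices that puts `vert x` first and `vert x̄` second. -/
def endpointsFirst (x : G.H) (hx : G.vert x ≠ G.vert (G.inv x)) :
    G.V ≃ WithBot (WithBot (G.Rest x)) where
  toFun u := if h : u = G.vert x then ⊥ else if h' : u = G.vert (G.inv x) then
    WithBot.some (⊥ : WithBot (G.Rest x)) else WithBot.some (WithBot.some ⟨u, h, h'⟩)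
  invFun
    | none => G.vert x
    | some none => G.vert (G.inv x)
    | some (some u) => u.1
  left_inv u := by
    by_cases h : u = G.vert x
    · dsimp only; rw [dif_pos h]; exact h.symm
    · by_cases h' : u = G.vert (G.inv x)
      · dsimp only; rw [dif_neg h, dif_pos h']; exact h'.symm
      · dsimp only; rw [dif_neg h, dif_neg h']
  right_inv u := by
    rcases u with _ | _ | u
    · exact dif_pos rfl
    · exact (dif_neg hx.symm).trans (dif_pos rfl)
    · exact (dif_neg u.2.1).trans (dif_neg u.2.2)

/-- The sign relating the orientation of `G` to its representative in which `vert x` is the first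
vertex, `vert x̄` is the second one, and the edge of `x` is directed from `x` to `x̄`. -/
def contractSign (x : G.H) (hx : G.vert x ≠ G.vert (G.inv x)) : ℤˣ :=
  G.dir x * orderSign (G.endpointsFirst x hx)

/-- Collapse of the edge of `x`, which is not a loop.  The new vertex `⊥` comes first, and the other
vertices retain their ordering. -/
def contract (x : G.H) (hx : G.vert x ≠ G.vert (G.inv x)) : OrientedGraph where
  V := WithBot (G.Rest x)
  H := {h : G.H // h ≠ x ∧ h ≠ G.inv x}
  inv h := ⟨G.inv h.1, fun e => h.2.2 ((G.inv_inv h.1).symm.trans (congrArg G.inv e)),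
    fun e => h.2.1 <| by
      have := congrArg G.inv e
      rwa [G.inv_inv, G.inv_inv] at this⟩
  inv_inv h := Subtype.ext (G.inv_inv h.1)
  inv_ne h e := G.inv_ne h.1 (congrArg Subtype.val e)
  vert h := if hh : G.vert h.1 ≠ G.vert x ∧ G.vert h.1 ≠ G.vert (G.inv x) then
    ((⟨G.vert h.1, hh⟩ : G.Rest x) : WithBot (G.Rest x)) else ⊥
  dir h := G.dir h.1
  dir_inv h := G.dir_inv h.1
  two_le_valence v := by
    have other : ∀ y : G.H, ∃ h, h ≠ y ∧ G.vert h = G.vert y := fun y => by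
      obtain ⟨h, h', hne, e, e'⟩ := G.two_le_valence (G.vert y)
      by_cases hy : h = y
      · exact ⟨h', fun e => hne (hy.trans e.symm), e'⟩
      · exact ⟨h, hy, e⟩
    rcases v with _ | u
    · obtain ⟨h, hne, e⟩ := other x
      obtain ⟨h', hne', e'⟩ := other (G.inv x)
      refine ⟨⟨h, hne, fun he => hx (by rw [← e, he])⟩,
        ⟨h', fun he => hx (by rw [← e', he]), hne'⟩, ?_, ?_, ?_⟩
      · intro he
        exact hx (by rw [← e, ← e', show h = h' from congrArg Subtype.val he])
      · rw [dif_neg (fun hh => hh.1 e)]; rfl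
      · rw [dif_neg (fun hh => hh.2 e')]; rfl
    · obtain ⟨h, h', hne, e, e'⟩ := G.two_le_valence u.1
      refine ⟨⟨h, fun he => u.2.1 (by rw [← e, he]), fun he => u.2.2 (by rw [← e, he])⟩,
        ⟨h', fun he => u.2.1 (by rw [← e', he]), fun he => u.2.2 (by rw [← e', he])⟩,
        fun he => hne (congrArg Subtype.val he), ?_, ?_⟩
      · rw [dif_pos (by rw [e]; exact u.2)]
        exact congrArg some (Subtype.ext e)
      · rw [dif_pos (by rw [e']; exact u.2)]
        exact congrArg some (Subtype.ext e')

/-- The half-edges at the new vertex of the collapsed graph are the remaining half-edges at the two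
endpoints. -/
def legsMerged (x : G.H) (hx : G.vert x ≠ G.vert (G.inv x)) :
    {h : G.Legs (G.vert x) // h ≠ ⟨x, rfl⟩} ⊕
      {h : G.Legs (G.vert (G.inv x)) // h ≠ ⟨G.inv x, rfl⟩} ≃
    (G.contract x hx).Legs (⊥ : WithBot (G.Rest x)) where
  toFun := Sum.elim
    (fun h => ⟨⟨h.1.1, fun e => h.2 (Subtype.ext e), fun e => hx (by rw [← h.1.2, e])⟩,
      dif_neg fun hh => hh.1 h.1.2⟩)
    (fun h => ⟨⟨h.1.1, fun e => hx (by rw [← h.1.2, e]), fun e => h.2 (Subtype.ext e)⟩,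
      dif_neg fun hh => hh.2 h.1.2⟩)
  invFun h :=
    if hv : G.vert h.1.1 = G.vert x then
      .inl ⟨⟨h.1.1, hv⟩, fun e => h.1.2.1 (congrArg Subtype.val e)⟩
    else .inr ⟨⟨h.1.1, by
      by_contra hw
      have h2 : (G.contract x hx).vert h.1 = _ := h.2
      have h3 : (G.contract x hx).vert h.1 = some _ := dif_pos ⟨hv, hw⟩
      cases h3.symm.trans h2⟩, fun e => h.1.2.2 (congrArg Subtype.val e)⟩
  left_inv := by
    rintro (h | h)
    · simp [h.1.2]
    · have : G.vert h.1.1 ≠ G.vert x := fun e => hx (by rw [← e, h.1.2])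
      simp [this]
  right_inv h := by
    dsimp only
    split_ifs <;> rfl

/-- The half-edges at the other vertices of the collapsed graph. -/
def legsRest (x : G.H) (hx : G.vert x ≠ G.vert (G.inv x)) (u : G.Rest x) :
    G.Legs u.1 ≃ (G.contract x hx).Legs (u : WithBot (G.Rest x)) where
  toFun h := ⟨⟨h.1, fun e => u.2.1 (by rw [← h.2, e]), fun e => u.2.2 (by rw [← h.2, e])⟩, by
    refine (dif_pos (by rw [h.2]; exact u.2)).trans ?_
    exact congrArg some (Subtype.ext h.2)⟩
  invFun h := ⟨h.1.1, by
    have h2 : (G.contract x hx).vert h.1 = some u := h.2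
    by_cases hh : G.vert h.1.1 ≠ G.vert x ∧ G.vert h.1.1 ≠ G.vert (G.inv x)
    · have h3 : (G.contract x hx).vert h.1 = some ⟨_, hh⟩ := dif_pos hh
      exact congrArg Subtype.val (Option.some_injective _ (h3.symm.trans h2))
    · have h3 : (G.contract x hx).vert h.1 = none := dif_neg hh
      cases h3.symm.trans h2⟩
  left_inv _ := rfl
  right_inv _ := rfl

/-- The half-edges at a vertex of the first graph in a disjoint union. -/
def legsInl (G G' : OrientedGraph) (v : G.V) :
    G.Legs v ≃ (G.union G').Legs (toLex (Sum.inl v)) where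
  toFun h := ⟨Sum.inl h.1, congrArg toLex (congrArg Sum.inl h.2)⟩
  invFun
    | ⟨.inl h, e⟩ => ⟨h, Sum.inl_injective (toLex.injective e)⟩
    | ⟨.inr _, e⟩ => (Sum.inr_ne_inl (toLex.injective e)).elim
  left_inv _ := rfl
  right_inv := by
    rintro ⟨h | h, e⟩
    · rfl
    · exact (Sum.inr_ne_inl (toLex.injective e)).elim

/-- The half-edges at a vertex of the second graph in a disjoint union. -/
def legsInr (G G' : OrientedGraph) (v : G'.V) :
    G'.Legs v ≃ (G.union G').Legs (toLex (Sum.inr v)) where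
  toFun h := ⟨Sum.inr h.1, congrArg toLex (congrArg Sum.inr h.2)⟩
  invFun
    | ⟨.inr h, e⟩ => ⟨h, Sum.inr_injective (toLex.injective e)⟩
    | ⟨.inl _, e⟩ => (Sum.inl_ne_inr (toLex.injective e)).elim
  left_inv _ := rfl
  right_inv := by
    rintro ⟨h | h, e⟩
    · exact (Sum.inl_ne_inr (toLex.injective e)).elim
    · rfl

/-- The half-edges at a vertex of a union of components. -/
def legsRestrict (K : Set G.Components) (v : (G.restrict K).V) :
    G.Legs v.1 ≃ (G.restrict K).Legs v where
  toFun h := ⟨⟨h.1, by rw [h.2]; exact v.2⟩, Subtype.ext h.2⟩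
  invFun h := ⟨h.1.1, congrArg Subtype.val h.2⟩
  left_inv _ := rfl
  right_inv _ := rfl

end OrientedGraph

/-! ### Graphs colored by spiders, and the chain space -/

/-- An `𝒪`-graph: an oriented graph with an `𝒪`-spider at every vertex, whose legs are identified
with the half-edges at the vertex. -/
structure OGraph (O : CyclicOperad.{u}) extends OrientedGraph where
  color : ∀ v : V, O.Spider (toOrientedGraph.Legs v)

namespace OGraph

variable {O : CyclicOperad.{u}}

/-- An isomorphism of `𝒪`-graphs, not required to preserve the orientations. -/
structure Iso (G G' : OGraph O) where
  onV : G.V ≃ G'.V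
  onH : G.H ≃ G'.H
  vert_onH : ∀ h, G'.vert (onH h) = onV (G.vert h)
  inv_onH : ∀ h, G'.inv (onH h) = onH (G.inv h)
  color_onV : ∀ v, G'.color (onV v) =
    O.spiderMap (onH.subtypeEquiv fun h => by rw [vert_onH, onV.apply_eq_iff_eq]) (G.color v)

/-- `1` if the isomorphism maps the orientation of `G` to that of `G'`, and `-1` if it maps it to the
opposite one: the sign of the vertex reordering, times `-1` for every edge whose direction is
reversed. -/
def Iso.sign {G G' : OGraph O} (f : Iso G G') : ℤˣ :=
  orderSign f.onV * ∏ h : G.H with G.dir h = 1, G'.dir (f.onH h)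

/-- `G` with another coloring. -/
def recolor (G : OGraph O) (c : ∀ v : G.V, O.Spider (G.Legs v)) : OGraph O := { G with color := c }

/-- The relations among `𝒪`-graphs: isomorphic `𝒪`-graphs are identified up to the sign that
compares their orientations, and an `𝒪`-graph is linear in the spider at each vertex. -/
inductive Rel : (OGraph O →₀ ℝ) → Prop
  | orientation {G G' : OGraph O} (f : Iso G G') :
      Rel (Finsupp.single G 1 - f.sign • Finsupp.single G' 1)
  | linearity (G : OGraph O) (v : G.V) (a b : ℝ) (S T : O.Spider (G.Legs v)) :
      Rel (Finsupp.single (G.recolor (Function.update G.color v (a • S + b • T))) 1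
        - a • Finsupp.single (G.recolor (Function.update G.color v S)) 1
        - b • Finsupp.single (G.recolor (Function.update G.color v T)) 1)

end OGraph

/-- The space of chains `X`, spanned by `𝒪`-graphs with any number of vertices, the empty graph
included. -/
def Chains (O : CyclicOperad.{u}) : Type (max 1 u) :=
  (OGraph O →₀ ℝ) ⧸ Submodule.span ℝ {z : OGraph O →₀ ℝ | OGraph.Rel z}

namespace Chains

variable (O : CyclicOperad.{u})

instance : AddCommGroup (Chains O) :=
  inferInstanceAs (AddCommGroup ((OGraph O →₀ ℝ) ⧸ Submodule.span ℝ {z | OGraph.Rel z}))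

instance : Module ℝ (Chains O) :=
  inferInstanceAs (Module ℝ ((OGraph O →₀ ℝ) ⧸ Submodule.span ℝ {z | OGraph.Rel z}))

/-- The space `X_k` of chains spanned by the `𝒪`-graphs with `k` vertices. -/
def degree (k : ℕ) : Submodule ℝ (Chains O) :=
  Submodule.span ℝ {z | ∃ G : OGraph O, Fintype.card G.V = k ∧
    z = Submodule.Quotient.mk (Finsupp.single G 1)}

end Chains

namespace OGraph

variable {O : CyclicOperad.{u}} (G : OGraph O)

/-- The chain represented by an `𝒪`-graph. -/
def chain : Chains O := Submodule.Quotient.mk (Finsupp.single G 1)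

/-- The empty `𝒪`-graph. -/
def empty : OGraph O where
  toOrientedGraph := .empty
  color v := v.elim

/-- Disjoint union. -/
def union (G G' : OGraph O) : OGraph O where
  toOrientedGraph := G.toOrientedGraph.union G'.toOrientedGraph
  color v := match v with
    | .inl v => O.spiderMap (G.toOrientedGraph.legsInl G'.toOrientedGraph v) (G.color v)
    | .inr v => O.spiderMap (G.toOrientedGraph.legsInr G'.toOrientedGraph v) (G'.color v)

/-- The union of the components in `K`. -/
def restrict (K : Set G.Components) : OGraph O where
  toOrientedGraph := G.toOrientedGraph.restrict K
  color v := O.spiderMap (G.toOrientedGraph.legsRestrict K v) (G.color v.1)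

/-- Gluing the half-edges along `π_{xy}`; the half-edges at each vertex, and the spiders, are
unchanged. -/
def reglue (x y : G.H) (hxy : y ≠ x) (hxy' : y ≠ G.inv x) : OGraph O where
  toOrientedGraph := G.toOrientedGraph.reglue x y hxy hxy'
  color := G.color

/-- Collapse of an edge that is not a loop; the spiders at its endpoints are mated along the two
half-edges of the edge. -/
def contract (x : G.H) (hx : G.vert x ≠ G.vert (G.inv x)) : OGraph O where
  toOrientedGraph := G.toOrientedGraph.contract x hx
  color v := match v with
    | none => O.spiderMap (G.toOrientedGraph.legsMerged x hx)
        (O.mate ⟨x, rfl⟩ ⟨G.inv x, rfl⟩ (G.color (G.vert x)) (G.color (G.vert (G.inv x))))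
    | some u => O.spiderMap (G.toOrientedGraph.legsRest x hx u) (G.color u.1)

/-- The chain `G_e`, for the edge `e` of the half-edge `x`; it is zero if `e` is a loop. -/
def collapse (x : G.H) : Chains O :=
  if hx : G.vert x ≠ G.vert (G.inv x) then G.contractSign x hx • (G.contract x hx).chain else 0

/-- `∂_E G`, the sum of `G_e` over all edges `e`; every edge has exactly one initial half-edge. -/
def boundaryE : Chains O := ∑ x : G.H with G.dir x = 1, G.collapse x

/-- `∂_H G`, the sum of the collapses `(G^{π_{xy}})_{x ∪ y}` over all unordered pairs of half-edges
`x ≠ y` with `y ≠ x̄`.  The sum below runs over ordered pairs, whence the factor `1/2`. -/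
def boundaryH : Chains O :=
  (1 / 2 : ℝ) • ∑ x : G.H, ∑ y : G.H, if h : y ≠ x ∧ y ≠ G.inv x then
    G.reglueSign x y • (G.reglue x y h.1 h.2).collapse x else 0

/-- The term of the coproduct that puts the components in `K` to the left and the others to the
right. -/
def split (K : Set G.Components) : Chains O ⊗[ℝ] Chains O :=
  G.splitSign K • ((G.restrict K).chain ⊗ₜ[ℝ] (G.restrict Kᶜ).chain)

/-- The coproduct `Δ G`: the sum over all ordered partitions of the set of components into two
parts.  It makes connected graphs primitive and is multiplicative. -/
def coproduct : Chains O ⊗[ℝ] Chains O := ∑ K : Set G.Components, G.split K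

open Classical in
/-- `T G`: the sum over all unordered separating pairs `x`, `y` of half-edges, and over all ordered
partitions `(I, J)` of those components of `G^{π_{xy}}` which are neither the component `X'` of `x`
and `y` nor the component `X''` of `x̄` and `ȳ`, of the terms
`± (X_I · X') ⊗ (X_J · X'')`; here `I ∪ {X'}` is `K`.  The sum below runs over ordered pairs,
whence the factor `1/2`. -/
def separate : Chains O ⊗[ℝ] Chains O :=
  (1 / 2 : ℝ) • ∑ x : G.H, ∑ y : G.H, if h : y ≠ x ∧ y ≠ G.inv x then
    if G.Separating x y h.1 h.2 then
      G.reglueSign x y • ∑ K : Set (G.reglue x y h.1 h.2).Components with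
        (G.reglue x y h.1 h.2).component (G.vert x) ∈ K ∧
          (G.reglue x y h.1 h.2).component (G.vert (G.inv x)) ∉ K,
        (G.reglue x y h.1 h.2).split K
    else 0
  else 0

end OGraph

/-! ### Graded tensor products and differential graded Hopf algebras -/

section Graded

variable {A : Type*} [AddCommGroup A] [Module ℝ A]

/-- The extension `a ⊗ b ↦ D a ⊗ b + (-1)^{|a|} a ⊗ D b` of an operator `D` of odd degree to the
tensor square as a graded derivation; `γ` is the operator `a ↦ (-1)^{|a|} a`. -/
def gradedExtend (γ D : A →ₗ[ℝ] A) : A ⊗[ℝ] A →ₗ[ℝ] A ⊗[ℝ] A :=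
  TensorProduct.map D LinearMap.id + TensorProduct.map γ D

/-- The product `(a ⊗ b) (c ⊗ d) = (-1)^{|b| |c|} ac ⊗ bd` on the tensor square of a graded algebra;
`γ` is the operator `a ↦ (-1)^{|a|} a`, and
`(-1)^{|b| |c|} = (1 + (-1)^{|b|} + (-1)^{|c|} - (-1)^{|b|} (-1)^{|c|}) / 2`. -/
def gradedTensorMul (γ : A →ₗ[ℝ] A) (μ : A ⊗[ℝ] A →ₗ[ℝ] A) :
    (A ⊗[ℝ] A) ⊗[ℝ] (A ⊗[ℝ] A) →ₗ[ℝ] A ⊗[ℝ] A :=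
  TensorProduct.map μ μ ∘ₗ (TensorProduct.tensorTensorTensorComm ℝ A A A A).toLinearMap ∘ₗ
    ((1 / 2 : ℝ) • (LinearMap.id
      + TensorProduct.map (TensorProduct.map LinearMap.id γ) LinearMap.id
      + TensorProduct.map LinearMap.id (TensorProduct.map γ LinearMap.id)
      - TensorProduct.map (TensorProduct.map LinearMap.id γ) (TensorProduct.map γ LinearMap.id)))

/-- A differential graded Hopf algebra structure on the real vector space `A` with grading `𝒜`,
whose differential has degree `-1`. -/
structure DGHopfAlgebra (A : Type*) [AddCommGroup A] [Module ℝ A] (𝒜 : ℕ → Submodule ℝ A) where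
  mul : A ⊗[ℝ] A →ₗ[ℝ] A
  one : A
  comul : A →ₗ[ℝ] A ⊗[ℝ] A
  counit : A →ₗ[ℝ] ℝ
  antipode : A →ₗ[ℝ] A
  d : A →ₗ[ℝ] A
  /-- The operator `a ↦ (-1)^{|a|} a`. -/
  parity : A →ₗ[ℝ] A
  isInternal : DirectSum.IsInternal 𝒜
  parity_apply : ∀ k, ∀ a ∈ 𝒜 k, parity a = (-1 : ℝ) ^ k • a
  mul_mem : ∀ i j, ∀ a ∈ 𝒜 i, ∀ b ∈ 𝒜 j, mul (a ⊗ₜ b) ∈ 𝒜 (i + j)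
  one_mem : one ∈ 𝒜 0
  comul_mem : ∀ k, ∀ a ∈ 𝒜 k, comul a ∈ ⨆ p ∈ Finset.HasAntidiagonal.antidiagonal k,
    LinearMap.range (TensorProduct.map (𝒜 p.1).subtype (𝒜 p.2).subtype)
  counit_eq_zero : ∀ k, k ≠ 0 → ∀ a ∈ 𝒜 k, counit a = 0
  antipode_mem : ∀ k, ∀ a ∈ 𝒜 k, antipode a ∈ 𝒜 k
  d_mem : ∀ k, ∀ a ∈ 𝒜 (k + 1), d a ∈ 𝒜 k
  d_eq_zero : ∀ a ∈ 𝒜 0, d a = 0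
  mul_assoc : ∀ a b c, mul (mul (a ⊗ₜ b) ⊗ₜ c) = mul (a ⊗ₜ mul (b ⊗ₜ c))
  one_mul : ∀ a, mul (one ⊗ₜ a) = a
  mul_one : ∀ a, mul (a ⊗ₜ one) = a
  coassoc : (TensorProduct.assoc ℝ A A A).toLinearMap ∘ₗ
    TensorProduct.map comul LinearMap.id ∘ₗ comul = TensorProduct.map LinearMap.id comul ∘ₗ comul
  counit_comul : ∀ a, TensorProduct.lid ℝ A (TensorProduct.map counit LinearMap.id (comul a)) = a
  comul_counit : ∀ a, TensorProduct.rid ℝ A (TensorProduct.map LinearMap.id counit (comul a)) = a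
  comul_one : comul one = one ⊗ₜ one
  comul_mul : comul ∘ₗ mul = gradedTensorMul parity mul ∘ₗ TensorProduct.map comul comul
  counit_one : counit one = 1
  counit_mul : ∀ a b, counit (mul (a ⊗ₜ b)) = counit a * counit b
  antipode_left : ∀ a, mul (TensorProduct.map antipode LinearMap.id (comul a)) = counit a • one
  antipode_right : ∀ a, mul (TensorProduct.map LinearMap.id antipode (comul a)) = counit a • one
  d_d : ∀ a, d (d a) = 0
  /-- The differential is a graded derivation. -/
  d_mul : d ∘ₗ mul = mul ∘ₗ gradedExtend parity d
  /-- The differential is a graded coderivation. -/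
  comul_d : comul ∘ₗ d = gradedExtend parity d ∘ₗ comul
  counit_d : ∀ a, counit (d a) = 0
  antipode_d : ∀ a, antipode (d a) = d (antipode a)

end Graded

/-! ### The operations on chains, and graph homology -/

namespace Chains

open Classical in
/-- The linear map on chains with prescribed values on the `𝒪`-graphs.  It is determined by them,
since the `𝒪`-graphs span, and it is set to zero if the prescription is not compatible with the
relations. -/
def extend {O : CyclicOperad.{u}} {M : Type*} [AddCommGroup M] [Module ℝ M] (F : OGraph O → M) :
    Chains O →ₗ[ℝ] M :=
  if h : ∃ φ : Chains O →ₗ[ℝ] M, ∀ G : OGraph O, φ G.chain = F G then h.choose else 0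

variable (O : CyclicOperad.{u})

/-- The operator `(-1)^k` on `X_k`. -/
def parity : Chains O →ₗ[ℝ] Chains O := extend fun G => (-1 : ℝ) ^ Fintype.card G.V • G.chain

/-- The boundary operator `∂_E`. -/
def boundaryE : Chains O →ₗ[ℝ] Chains O := extend fun G => G.boundaryE

/-- The operator `∂_H`. -/
def boundaryH : Chains O →ₗ[ℝ] Chains O := extend fun G => G.boundaryH

/-- The product: disjoint union. -/
def mul : Chains O ⊗[ℝ] Chains O →ₗ[ℝ] Chains O :=
  TensorProduct.lift (extend fun G => extend fun G' => (G.union G').chain)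

/-- The coproduct `Δ`. -/
def comul : Chains O →ₗ[ℝ] Chains O ⊗[ℝ] Chains O := extend fun G => G.coproduct

/-- The counit, dual to the empty graph. -/
def counit : Chains O →ₗ[ℝ] ℝ :=
  extend fun G => open Classical in if IsEmpty G.V then 1 else 0

/-- The antipode: it reverses the orientation of connected graphs and is multiplicative. -/
def antipode : Chains O →ₗ[ℝ] Chains O :=
  extend fun G => (-1 : ℝ) ^ Fintype.card G.Components • G.chain

/-- The map `T`. -/
def separate : Chains O →ₗ[ℝ] Chains O ⊗[ℝ] Chains O := extend fun G => G.separate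

/-- `∂_E` on `X ⊗ X`. -/
def boundaryE₂ : Chains O ⊗[ℝ] Chains O →ₗ[ℝ] Chains O ⊗[ℝ] Chains O :=
  gradedExtend (parity O) (boundaryE O)

/-- `∂_H` on `X ⊗ X`, where it is extended as a graded derivation. -/
def boundaryH₂ : Chains O ⊗[ℝ] Chains O →ₗ[ℝ] Chains O ⊗[ℝ] Chains O :=
  gradedExtend (parity O) (boundaryH O)

/-- The map `θ = Δ ∂_H - ∂_H Δ`. -/
def theta : Chains O →ₗ[ℝ] Chains O ⊗[ℝ] Chains O :=
  comul O ∘ₗ boundaryH O - boundaryH₂ O ∘ₗ comul O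

/-- The formulas for `∂_E`, `∂_H`, `Δ`, `T`, the product, the counit, the antipode and the sign
operator on `𝒪`-graphs are compatible with the relations among `𝒪`-graphs, so that they do define
linear maps on chains. -/
structure WellDefined : Prop where
  parity_chain : ∀ G : OGraph O, parity O G.chain = (-1 : ℝ) ^ Fintype.card G.V • G.chain
  boundaryE_chain : ∀ G : OGraph O, boundaryE O G.chain = G.boundaryE
  boundaryH_chain : ∀ G : OGraph O, boundaryH O G.chain = G.boundaryH
  mul_chain : ∀ G G' : OGraph O, mul O (G.chain ⊗ₜ[ℝ] G'.chain) = (G.union G').chain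
  comul_chain : ∀ G : OGraph O, comul O G.chain = G.coproduct
  counit_chain_of_isEmpty : ∀ G : OGraph O, IsEmpty G.V → counit O G.chain = 1
  counit_chain_of_nonempty : ∀ G : OGraph O, Nonempty G.V → counit O G.chain = 0
  antipode_chain : ∀ G : OGraph O,
    antipode O G.chain = (-1 : ℝ) ^ Fintype.card G.Components • G.chain
  separate_chain : ∀ G : OGraph O, separate O G.chain = G.separate

/-- The cycles with respect to `∂_E`. -/
def cycles : Submodule ℝ (Chains O) := LinearMap.ker (boundaryE O)

/-- The boundaries with respect to `∂_E`, among the cycles. -/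
def boundaries : Submodule ℝ (cycles O) := (LinearMap.range (boundaryE O)).submoduleOf (cycles O)

end Chains

/-- `𝒪`-graph homology: the homology of the chains with respect to `∂_E`. -/
abbrev GraphHomology (O : CyclicOperad.{u}) : Type (max 1 u) :=
  Chains.cycles O ⧸ Chains.boundaries O

namespace GraphHomology

variable (O : CyclicOperad.{u})

/-- The homology class of a cycle. -/
def cls : Chains.cycles O →ₗ[ℝ] GraphHomology O := (Chains.boundaries O).mkQ

/-- The homology in degree `k`: classes of the cycles spanned by graphs with `k` vertices. -/
def degree (k : ℕ) : Submodule ℝ (GraphHomology O) :=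
  ((Chains.degree O k).submoduleOf (Chains.cycles O)).map (cls O)

variable {O}

/-- The operations of `A` are those induced on homology by the operations on chains; the
differential is the one induced by `∂_H`.  For the coproduct, `H(X ⊗ X)` is identified with
`H(X) ⊗ H(X)`: if `z` is a cycle, then `Δ z` is homologous to a tensor `t` in the tensor square of
the space of cycles, and the coproduct of the class of `z` is the class of any such `t`. -/
structure IsInduced (A : DGHopfAlgebra (GraphHomology O) (degree O)) : Prop where
  mul_cls : ∀ a b : Chains.cycles O, ∃ c : Chains.cycles O,
    (c : Chains O) = Chains.mul O ((a : Chains O) ⊗ₜ[ℝ] (b : Chains O)) ∧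
      A.mul (cls O a ⊗ₜ[ℝ] cls O b) = cls O c
  one_eq : ∃ c : Chains.cycles O, (c : Chains O) = (OGraph.empty : OGraph O).chain ∧
    A.one = cls O c
  exists_comul : ∀ z : Chains.cycles O,
    ∃ (t : Chains.cycles O ⊗[ℝ] Chains.cycles O) (w : Chains O ⊗[ℝ] Chains O),
      Chains.comul O z =
        TensorProduct.map (Chains.cycles O).subtype (Chains.cycles O).subtype t
          + Chains.boundaryE₂ O w
  comul_cls : ∀ (z : Chains.cycles O) (t : Chains.cycles O ⊗[ℝ] Chains.cycles O)
    (w : Chains O ⊗[ℝ] Chains O),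
      Chains.comul O z =
        TensorProduct.map (Chains.cycles O).subtype (Chains.cycles O).subtype t
          + Chains.boundaryE₂ O w →
      A.comul (cls O z) = TensorProduct.map (cls O) (cls O) t
  counit_cls : ∀ z : Chains.cycles O, A.counit (cls O z) = Chains.counit O z
  antipode_cls : ∀ z : Chains.cycles O, ∃ c : Chains.cycles O,
    (c : Chains O) = Chains.antipode O z ∧ A.antipode (cls O z) = cls O c
  d_cls : ∀ z : Chains.cycles O, ∃ c : Chains.cycles O,
    (c : Chains O) = Chains.boundaryH O z ∧ A.d (cls O z) = cls O c

end GraphHomology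

end

/-! The proof rests on one auxiliary operator R on X, `Chains.reglueSum`: the signed sum of the
graphs G^{π_xy}, with no collapse. Gluing keeps the vertices and their spiders, so R has degree 0.
It satisfies two commutator identities.

First, ∂_H = ∂_E R − R ∂_E (`OGraph.boundaryE_reglueSum`). An edge of G^{π_xy} not touched by the
gluing is an edge of G, and its collapse commutes with the gluing, so these terms cancel against R
∂_E. What remains are the collapses of the two new edges, and these make up ∂_H.

Second, T = Δ R − (R ⊗ 1 + 1 ⊗ R) Δ (`OGraph.comul_reglueSum_sub`). A term of Δ(G^{π_xy}) is given
by a set W of vertices that is a union of components of G^{π_xy}. If x and x̄ are attached on the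
same side of W, then W is already a union of components of G and the gluing takes place inside one
tensor factor. If they lie on different sides, the pair is separating and the term belongs to T.

Both identities also show that ∂_H and T respect the relations among graphs: it is enough to check
R, ∂_E and Δ directly. Since Δ commutes with ∂_E (`Chains.comul_boundaryE`), the formula θ = ∂_E T −
T ∂_E is then formal: both sides are the double commutator of Δ, ∂_E and R (`Chains.theta_eq`).

The equation ∂_E² = 0 holds because collapsing two edges in the opposite order changes the sign
(`OGraph.collapseTwo_swap`). For edges with one common endpoint this uses the associativity of
mating; for disjoint edges the sign comes from the order of the two new vertices; in all other cases
both terms vanish.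

On chains, disjoint union and Δ form a graded Hopf algebra compatible with ∂_E; the antipode
identity is the vanishing of an alternating sum over all sets of components. To descend to homology,
the chains are retracted onto their homology by a homotopy (`nonempty_homologySplitting`), and each
operation is conjugated by the retraction. The delicate point is that Δ z, for a cycle z, is a cycle
of X ⊗ X but not visibly a sum of tensors of cycles; `map_eq_of_gradedExtend_eq_zero_left` and its
mirror image deal with it. By the first identity ∂_H sends cycles to boundaries, so the induced
differential is zero and the axioms that involve it are immediate.

Two devices keep the bookkeeping small. Graphs are compared after their half-edges have been
embedded in a common type (`OGraph.exists_iso_of_embed`), with spiders whose legs are elements of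
that type (`CyclicOperad.SpiderIn`). Orientation signs are written as products of comparison signs
over pairs of vertices (`orderSign_eq_prod`). -/

noncomputable section

namespace CyclicOperad

variable (O : CyclicOperad.{u})

/-! ### Functoriality of spiders -/

theorem spider_hom_ext {S : Type} {M : Type*} [AddCommGroup M] [Module ℝ M]
    {φ ψ : O.Spider S →ₗ[ℝ] M}
    (h : ∀ (n : ℕ) (L : S ≃ Fin (n + 2)) (o : O.Op n), φ (O.spiderMk L o) = ψ (O.spiderMk L o)) :
    φ = ψ := by
  classical
  refine Submodule.linearMap_qext _ (DirectSum.linearMap_ext ℝ fun L => LinearMap.ext fun o => ?_)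
  exact h L.1 L.2 o

theorem spiderMap_mk {S T : Type} (e : S ≃ T) {n : ℕ} (L : S ≃ Fin (n + 2)) (o : O.Op n) :
    O.spiderMap e (O.spiderMk L o) = O.spiderMk (e.symm.trans L) o :=
  O.spiderLift_mk _ _ L o

theorem spiderMap_spiderMap {S T U : Type} (e : S ≃ T) (f : T ≃ U) (s : O.Spider S) :
    O.spiderMap f (O.spiderMap e s) = O.spiderMap (e.trans f) s := by
  have : O.spiderMap f ∘ₗ O.spiderMap e = O.spiderMap (e.trans f) :=
    O.spider_hom_ext fun n L o => by
      rw [LinearMap.comp_apply, spiderMap_mk, spiderMap_mk, spiderMap_mk]; rfl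
  exact LinearMap.congr_fun this s

theorem spiderMap_refl {S : Type} (s : O.Spider S) : O.spiderMap (Equiv.refl S) s = s := by
  have : O.spiderMap (Equiv.refl S) = LinearMap.id :=
    O.spider_hom_ext fun n L o => by rw [spiderMap_mk]; rfl
  exact LinearMap.congr_fun this s

theorem spiderMap_injective {S T : Type} (e : S ≃ T) : Function.Injective (O.spiderMap e) :=
  Function.LeftInverse.injective (g := O.spiderMap e.symm) fun s => by
    rw [spiderMap_spiderMap, Equiv.self_trans_symm, spiderMap_refl]

theorem relabel_eq_act {n : ℕ} (e : Fin (n + 2) ≃ Fin (n + 2)) : O.relabel e = O.act n e := rfl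

/-- The mating law in terms of arbitrary labelings that make the first leg an output and the second
one an input. -/
theorem mate_mk {S T : Type} (a : S) (b : T) {m n k : ℕ} (L₁ : S ≃ Fin (m + 2))
    (L₂ : T ≃ Fin (n + 2)) (i : Fin (n + 1)) (h₁ : L₁ a = 0) (h₂ : L₂ b = i.succ)
    (h : n + m = k) (L : {s : S // s ≠ a} ⊕ {t : T // t ≠ b} ≃ Fin (k + 2))
    (hl : ∀ s, L (.inl s) = slotR h i (L₁ s.1)) (hr : ∀ t, L (.inr t) = slotL h i (L₂ t.1))
    (o₁ : O.Op m) (o₂ : O.Op n) :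
    O.mate a b (O.spiderMk L₁ o₁) (O.spiderMk L₂ o₂) = O.spiderMk L (O.comp h i o₂ o₁) := by
  have hex : (∃ (m : ℕ) (L₁ : S ≃ Fin (m + 2)), L₁ a = 0) ∧
      (∃ (n : ℕ) (L₂ : T ≃ Fin (n + 2)), L₂ b = 1) :=
    ⟨⟨m, L₁, h₁⟩, ⟨n, L₂.trans (Equiv.swap i.succ 1), by simp [h₂]⟩⟩
  -- The representatives in the definition of `mate` come from arbitrary choices, so the identity is
  -- proved for every admissible pair of labelings.
  suffices key : ∀ (m' n' : ℕ) (M₁ : S ≃ Fin (m' + 2)) (M₂ : T ≃ Fin (n' + 2)) (e₁ : M₁ a = 0)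
      (e₂ : M₂ b = 1),
      ((O.comp rfl 0).flip.compl₁₂ (O.spiderRep M₁) (O.spiderRep M₂)).compr₂
        (O.spiderMk (mateLabeling a b _ _ e₁ e₂)) (O.spiderMk L₁ o₁) (O.spiderMk L₂ o₂) =
      O.spiderMk L (O.comp h i o₂ o₁) by
    unfold mate
    rw [dif_pos hex]
    exact key _ _ _ _ hex.1.choose_spec.choose_spec hex.2.choose_spec.choose_spec
  intro m' n' M₁ M₂ e₁ e₂
  obtain rfl : m = m' := by simpa using Fintype.card_congr (L₁.symm.trans M₁)
  obtain rfl : n = n' := by simpa using Fintype.card_congr (L₂.symm.trans M₂)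
  subst h
  simp only [LinearMap.compr₂_apply, LinearMap.compl₁₂_apply, LinearMap.flip_apply,
    spiderRep_mk', relabel_eq_act]
  set N := mateLabeling a b M₁ M₂ e₁ e₂ with hN
  have nl : ∀ s, N (.inl s) = slotR rfl 0 (M₁ s.1) := fun s => rfl
  have nr : ∀ t, N (.inr t) = slotL rfl 0 (M₂ t.1) := fun t => rfl
  -- Equivariance, for the permutations that compare the two pairs of labelings, turns one composite
  -- into the other.
  rw [← O.act_comp rfl i 0 (L₂.symm.trans M₂) (L₁.symm.trans M₁) (L.symm.trans N)]
  · have := O.spiderMk_act L (L.symm.trans N) (O.comp rfl i o₂ o₁)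
    rwa [← Equiv.trans_assoc, Equiv.self_trans_symm, Equiv.refl_trans] at this
  · simp [← h₂, e₂]
  · simp [← h₁, e₁]
  · intro c hc
    have hc' : L₂.symm c ≠ b := fun e => hc (by rw [← h₂, ← e, Equiv.apply_symm_apply])
    have := hr ⟨L₂.symm c, hc'⟩
    simp only [Equiv.apply_symm_apply] at this
    rw [← this]
    simp [nr]
  · intro c hc
    have hc' : L₁.symm c ≠ a := fun e => hc (by rw [← h₁, ← e, Equiv.apply_symm_apply])
    have := hl ⟨L₁.symm c, hc'⟩
    simp only [Equiv.apply_symm_apply] at this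
    rw [← this]
    simp [nl]

/-- The labeling of the legs of a mated spider, when the second leg is an arbitrary input. -/
theorem exists_mate_labeling {S T : Type} (a : S) (b : T) {m n k : ℕ} (L₁ : S ≃ Fin (m + 2))
    (L₂ : T ≃ Fin (n + 2)) (i : Fin (n + 1)) (h₁ : L₁ a = 0) (h₂ : L₂ b = i.succ)
    (h : n + m = k) : ∃ L : {s : S // s ≠ a} ⊕ {t : T // t ≠ b} ≃ Fin (k + 2),
      (∀ s, L (.inl s) = slotR h i (L₁ s.1)) ∧ (∀ t, L (.inr t) = slotL h i (L₂ t.1)) := by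
  classical
  subst h
  let _ : Fintype S := Fintype.ofEquiv _ L₁.symm
  let _ : Fintype T := Fintype.ofEquiv _ L₂.symm
  have e₁ : ∀ s : {s : S // s ≠ a}, (L₁ s.1).val ≠ 0 := fun s hs =>
    s.2 (L₁.injective (by rw [h₁]; exact Fin.ext hs))
  have e₂ : ∀ t : {t : T // t ≠ b}, (L₂ t.1).val ≠ i.val + 1 := fun t ht =>
    t.2 (L₂.injective (by rw [h₂]; exact Fin.ext (by simpa using ht)))
  refine ⟨Equiv.ofBijective
    (Sum.elim (fun s => slotR rfl i (L₁ s.1)) (fun t => slotL rfl i (L₂ t.1)))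
    ((Fintype.bijective_iff_injective_and_card _).2 ⟨?_, ?_⟩), fun s => rfl, fun t => rfl⟩
  · rintro (s | t) (s' | t') hst
    · refine congrArg Sum.inl (Subtype.ext (L₁.injective (Fin.ext ?_)))
      simpa [slotR] using hst
    · have := e₁ s; have := e₂ t'; have := (L₁ s.1).2
      simp only [Sum.elim_inl, Sum.elim_inr, slotR, slotL, Fin.mk.injEq] at hst
      grind
    · have := e₁ s'; have := e₂ t; have := (L₁ s'.1).2
      simp only [Sum.elim_inl, Sum.elim_inr, slotR, slotL, Fin.mk.injEq] at hst
      grind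
    · have := e₂ t; have := e₂ t'
      refine congrArg Sum.inr (Subtype.ext (L₂.injective (Fin.ext ?_)))
      simp only [Sum.elim_inr, slotL, Fin.mk.injEq] at hst
      grind
  · have hS : Fintype.card S = m + 2 := by simpa using Fintype.card_congr L₁
    have hT : Fintype.card T = n + 2 := by simpa using Fintype.card_congr L₂
    have hS' : Fintype.card {s : S // s ≠ a} = m + 1 := by
      rw [Fintype.card_subtype_compl, hS]; simp
    have hT' : Fintype.card {t : T // t ≠ b} = n + 1 := by
      rw [Fintype.card_subtype_compl, hT]; simp
    rw [Fintype.card_sum, hS', hT', Fintype.card_fin]; omega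

theorem exists_labeling (S : Type) [Finite S] [Nontrivial S] :
    ∃ (n : ℕ), Nonempty (S ≃ Fin (n + 2)) := by
  let _ := Fintype.ofFinite S
  have := Fintype.one_lt_card (α := S)
  obtain ⟨n, hn⟩ := Nat.exists_eq_add_of_le' this
  exact ⟨n, ⟨Fintype.equivFinOfCardEq hn⟩⟩

theorem exists_labeling_zero {S : Type} [Finite S] [Nontrivial S] (a : S) :
    ∃ (n : ℕ) (L : S ≃ Fin (n + 2)), L a = 0 := by
  obtain ⟨n, ⟨L⟩⟩ := exists_labeling S
  exact ⟨n, L.trans (Equiv.swap (L a) 0), by simp⟩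

theorem exists_labeling_succ {S : Type} [Finite S] [Nontrivial S] (a : S) :
    ∃ (n : ℕ) (L : S ≃ Fin (n + 2)) (i : Fin (n + 1)), L a = i.succ := by
  obtain ⟨n, ⟨L⟩⟩ := exists_labeling S
  exact ⟨n, L.trans (Equiv.swap (L a) 1), 0, by simp⟩

theorem exists_labeling_zero_succ {S : Type} [Finite S] {a b : S} (hab : a ≠ b) :
    ∃ (n : ℕ) (L : S ≃ Fin (n + 2)) (i : Fin (n + 1)), L a = 0 ∧ L b = i.succ := by
  have : Nontrivial S := ⟨a, b, hab⟩
  obtain ⟨n, L, h⟩ := exists_labeling_zero a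
  have : L b ≠ 0 := fun e => hab (L.injective (h.trans e.symm))
  obtain ⟨i, hi⟩ := Fin.exists_succ_eq.2 this
  exact ⟨n, L, i, h, hi.symm⟩

theorem exists_eq_mk {S : Type} {n : ℕ} (L : S ≃ Fin (n + 2)) (s : O.Spider S) :
    ∃ o, s = O.spiderMk L o := ⟨_, (O.spiderMk_rep L s).symm⟩

/-- Mating is natural. -/
theorem mate_map {S T S' T' : Type} [Finite S] [Nontrivial S] [Finite T] [Nontrivial T]
    (e : S ≃ S') (f : T ≃ T') (a : S) (b : T) (s : O.Spider S) (t : O.Spider T) :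
    O.mate (e a) (f b) (O.spiderMap e s) (O.spiderMap f t) =
      O.spiderMap (Equiv.sumCongr (e.subtypeEquiv fun x => by simp)
        (f.subtypeEquiv fun x => by simp)) (O.mate a b s t) := by
  obtain ⟨m, L₁, h₁⟩ := exists_labeling_zero a
  obtain ⟨n, L₂, i, h₂⟩ := exists_labeling_succ b
  obtain ⟨o₁, rfl⟩ := O.exists_eq_mk L₁ s
  obtain ⟨o₂, rfl⟩ := O.exists_eq_mk L₂ t
  obtain ⟨L, hl, hr⟩ := exists_mate_labeling a b L₁ L₂ i h₁ h₂ rfl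
  rw [O.mate_mk a b L₁ L₂ i h₁ h₂ rfl L hl hr, spiderMap_mk, spiderMap_mk, spiderMap_mk]
  refine O.mate_mk _ _ _ _ i ?_ ?_ rfl _ ?_ ?_ _ _
  · simpa
  · simpa
  · intro s; simp [hl]
  · intro t; simp [hr]

/-- Mating is symmetric. -/
theorem mate_comm {S T : Type} [Finite S] [Nontrivial S] [Finite T] [Nontrivial T]
    (a : S) (b : T) (s : O.Spider S) (t : O.Spider T) :
    O.mate b a t s = O.spiderMap (Equiv.sumComm _ _) (O.mate a b s t) := by
  obtain ⟨m, L₁, h₁⟩ := exists_labeling_zero a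
  obtain ⟨n, L₂, i, h₂⟩ := exists_labeling_succ b
  obtain ⟨o₁, rfl⟩ := O.exists_eq_mk L₁ s
  obtain ⟨o₂, rfl⟩ := O.exists_eq_mk L₂ t
  obtain ⟨L, hl, hr⟩ := exists_mate_labeling a b L₁ L₂ i h₁ h₂ rfl
  rw [O.mate_mk a b L₁ L₂ i h₁ h₂ rfl L hl hr, spiderMap_mk]
  -- The transpositions make `b` an output and `a` a first input, which is the situation of the
  -- axiom that exchanges input and output.
  set τ : Equiv.Perm (Fin (m + 2)) := Equiv.swap 0 1 with hτ
  set σ : Equiv.Perm (Fin (n + 2)) := Equiv.swap i.succ 0 with hσ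
  have hσ' : (L₂.trans σ) b = 0 := by simp [h₂, hσ]
  have hτ' : (L₁.trans τ) a = (0 : Fin (m + 1)).succ := by simp [h₁, hτ]
  obtain ⟨L', hl', hr'⟩ := exists_mate_labeling b a (L₂.trans σ) (L₁.trans τ) 0 hσ' hτ'
    (add_comm m n)
  rw [← O.spiderMk_act L₁ τ, ← O.spiderMk_act L₂ σ,
    O.mate_mk b a _ _ 0 hσ' hτ' (add_comm m n) L' hl' hr']
  rw [← O.act_comp_swap rfl (add_comm m n) i 0 σ τ
    (L.symm.trans ((Equiv.sumComm _ _).trans L'))]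
  · have := O.spiderMk_act ((Equiv.sumComm _ _).symm.trans L)
      (L.symm.trans ((Equiv.sumComm _ _).trans L')) (O.comp rfl i o₂ o₁)
    rw [← this]
    congr 2
    ext1 x
    simp
  · simp [hσ]
  · simp [hτ]
  · intro c hc
    have hc' : L₂.symm c ≠ b := fun e => hc (by rw [← h₂, ← e, Equiv.apply_symm_apply])
    have := hr ⟨L₂.symm c, hc'⟩
    simp only [Equiv.apply_symm_apply] at this
    rw [← this]
    simp [hl']
  · intro c hc
    have hc' : L₁.symm c ≠ a := fun e => hc (by rw [← h₁, ← e, Equiv.apply_symm_apply])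
    have := hl ⟨L₁.symm c, hc'⟩
    simp only [Equiv.apply_symm_apply] at this
    rw [← this]
    simp [hr']

/-- Mating is associative. -/
theorem mate_assoc {S T U : Type} [Finite S] [Nontrivial S] [Finite T] [Finite U] [Nontrivial U]
    (a : S) (b c : T) (d : U) (hbc : c ≠ b) (s : O.Spider S) (t : O.Spider T) (u : O.Spider U)
    (e : {p : {s : S // s ≠ a} ⊕ {t : T // t ≠ b} // p ≠ Sum.inr ⟨c, hbc⟩} ⊕ {u : U // u ≠ d} ≃
      {s : S // s ≠ a} ⊕ {p : {t : T // t ≠ c} ⊕ {u : U // u ≠ d} // p ≠ Sum.inl ⟨b, hbc.symm⟩})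
    (he₁ : ∀ s h, e (.inl ⟨.inl s, h⟩) = .inl s)
    (he₂ : ∀ t h h' h'', e (.inl ⟨.inr ⟨t, h⟩, h'⟩) = .inr ⟨.inl ⟨t, h''⟩, fun he =>
      h (congrArg Subtype.val (Sum.inl_injective he))⟩)
    (he₃ : ∀ u, e (.inr u) = .inr ⟨.inr u, Sum.inr_ne_inl⟩) :
    O.spiderMap e (O.mate (Sum.inr ⟨c, hbc⟩) d (O.mate a b s t) u) =
      O.mate a (Sum.inl ⟨b, hbc.symm⟩) s (O.mate c d t u) := by
  obtain ⟨l, L₁, h₁⟩ := exists_labeling_zero a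
  -- In the middle spider `c` is taken as the output and `b` as an input. Both bracketings then
  -- become nested compositions in a row, and sequential associativity suffices.
  obtain ⟨m, L₂, i, h₂, h₂'⟩ := exists_labeling_zero_succ hbc
  obtain ⟨n, L₃, j, h₃⟩ := exists_labeling_succ d
  obtain ⟨o₁, rfl⟩ := O.exists_eq_mk L₁ s
  obtain ⟨o₂, rfl⟩ := O.exists_eq_mk L₂ t
  obtain ⟨o₃, rfl⟩ := O.exists_eq_mk L₃ u
  obtain ⟨L, hl, hr⟩ := exists_mate_labeling a b L₁ L₂ i h₁ h₂' rfl
  obtain ⟨M, Ml, Mr⟩ := exists_mate_labeling c d L₂ L₃ j h₂ h₃ rfl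
  rw [O.mate_mk a b L₁ L₂ i h₁ h₂' rfl L hl hr, O.mate_mk c d L₂ L₃ j h₂ h₃ rfl M Ml Mr]
  have hL : L (Sum.inr ⟨c, hbc⟩) = 0 := by rw [hr]; simp [slotL, h₂]
  -- Plugging the middle operation into input `j` turns its input `i` into input `j + i` of the
  -- composite, inputs being counted from zero.
  have hM : M (Sum.inl ⟨b, hbc.symm⟩) = (⟨j.val + i.val, by omega⟩ : Fin (n + m + 1)).succ := by
    rw [Ml]; simp [slotR, h₂', Fin.ext_iff]; omega
  obtain ⟨A, Al, Ar⟩ := exists_mate_labeling (Sum.inr ⟨c, hbc⟩) d L L₃ j hL h₃ rfl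
  obtain ⟨B, Bl, Br⟩ := exists_mate_labeling a (Sum.inl ⟨b, hbc.symm⟩) L₁ M _ h₁ hM
    (add_assoc n m l)
  rw [O.mate_mk _ d L L₃ j hL h₃ rfl A Al Ar,
    O.mate_mk a _ L₁ M _ h₁ hM (add_assoc n m l) B Bl Br, spiderMap_mk,
    O.comp_assoc rfl (add_assoc n m l) rfl rfl j i ⟨j.val + i.val, by omega⟩ rfl]
  congr 2
  refine Equiv.ext fun p => ?_
  obtain ⟨p, rfl⟩ := e.surjective p
  rw [Equiv.trans_apply, Equiv.symm_apply_apply, Fin.ext_iff]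
  rcases p with ⟨s | t, h⟩ | u
  · simp [he₁, Al, Bl, hl, slotR]
    omega
  · obtain ⟨t, ht⟩ := t
    have h'' : t ≠ c := by rintro rfl; exact h rfl
    have : L₂ t ≠ 0 := fun hh => h'' (L₂.injective (hh.trans h₂.symm))
    have : (L₂ t).val ≠ 0 := fun hh => this (Fin.ext hh)
    simp [he₂ t ht h h'', Al, Br, hr, Ml, slotR, slotL]
    split_ifs <;> omega
  · have : L₃ u ≠ j.succ := fun hh => u.2 (L₃.injective (hh.trans h₃.symm))
    have : (L₃ u).val ≠ j.val + 1 := fun hh => this (Fin.ext hh)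
    simp [he₃, Ar, Br, Mr, slotL]
    split_ifs <;> omega

end CyclicOperad

namespace CyclicOperad

variable (O : CyclicOperad.{u})

/-! ### Spiders whose legs are elements of an ambient type -/

/-- A spider whose legs form a subset of `U`. -/
structure SpiderIn (U : Type) : Type u where
  legs : Set U
  spider : O.Spider legs

namespace SpiderIn

variable {O} {S T U U' U'' : Type}

/-- A spider with legs in `S`, whose leg set is embedded into `U`. -/
def push (j : S → U) (hj : j.Injective) (s : O.Spider S) : O.SpiderIn U :=
  ⟨Set.range j, O.spiderMap (Equiv.ofInjective j hj) s⟩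

theorem legs_push (j : S → U) (hj : j.Injective) (s : O.Spider S) :
    (push j hj s).legs = Set.range j := rfl

theorem mk_eq {P Q : Set U} (h : P = Q) (e : P ≃ Q) (he : ∀ p, (e p).1 = p.1) (s : O.Spider P) :
    (⟨P, s⟩ : O.SpiderIn U) = ⟨Q, O.spiderMap e s⟩ := by
  subst h
  obtain rfl : e = Equiv.refl _ := Equiv.ext fun p => Subtype.ext (he p)
  rw [spiderMap_refl]

/-- Once legs are named by elements of `U`, a bijection between abstract leg sets leaves no trace.
This replaces transport along changing leg sets by plain equations. -/
theorem push_spiderMap (j : T → U) (hj : j.Injective) (e : S ≃ T) (s : O.Spider S) :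
    push j hj (O.spiderMap e s) = push (j ∘ e) (hj.comp e.injective) s := by
  have h : Set.range (j ∘ e) = Set.range j := e.surjective.range_comp j
  symm
  refine (mk_eq h (((Equiv.ofInjective _ (hj.comp e.injective)).symm.trans e).trans
    (Equiv.ofInjective j hj)) ?_ _).trans ?_
  · rintro ⟨_, x, rfl⟩
    have : (Equiv.ofInjective (j ∘ e) (hj.comp e.injective)).symm ⟨(j ∘ e) x, x, rfl⟩ = x := by
      rw [Equiv.symm_apply_eq]; rfl
    simp only [Equiv.trans_apply, this]; rfl
  · rw [spiderMap_spiderMap]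
    unfold push
    rw [spiderMap_spiderMap, ← Equiv.trans_assoc, ← Equiv.trans_assoc, Equiv.self_trans_symm,
      Equiv.refl_trans, ← spiderMap_spiderMap]

theorem push_val (σ : O.SpiderIn U) :
    push (fun u : σ.legs => u.1) Subtype.val_injective σ.spider = σ := by
  refine (mk_eq (Subtype.range_coe) (Equiv.ofInjective (fun u : σ.legs => u.1) Subtype.val_injective).symm
    ?_ _).trans ?_
  · rintro ⟨_, x, rfl⟩
    exact congrArg Subtype.val ((Equiv.symm_apply_eq _).2 rfl)
  · rw [spiderMap_spiderMap, Equiv.self_trans_symm, spiderMap_refl]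

theorem exists_push (σ : O.SpiderIn U) : ∃ s : O.Spider σ.legs, σ = push _ Subtype.val_injective s :=
  ⟨σ.spider, σ.push_val.symm⟩

theorem push_injective (j : S → U) (hj : j.Injective) :
    Function.Injective (push (O := O) j hj) := by
  intro s t h
  exact O.spiderMap_injective _ (eq_of_heq (SpiderIn.mk.inj h).2)

theorem push_congr {j j' : S → U} (hj : j.Injective) (h : j = j') (s : O.Spider S) :
    push j hj s = push j' (h ▸ hj) s := by subst h; rfl

/-- Embedding of the ambient type. -/
def map (k : U → U') (hk : k.Injective) (σ : O.SpiderIn U) : O.SpiderIn U' :=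
  push (fun u : σ.legs => k u.1) (hk.comp Subtype.val_injective) σ.spider

theorem map_push (k : U → U') (hk : k.Injective) (j : S → U) (hj : j.Injective)
    (s : O.Spider S) : map k hk (push j hj s) = push (k ∘ j) (hk.comp hj) s := by
  unfold map
  exact push_spiderMap (fun u : Set.range j => k u.1) _ (Equiv.ofInjective j hj) s

theorem legs_map (k : U → U') (hk : k.Injective) (σ : O.SpiderIn U) :
    (map k hk σ).legs = k '' σ.legs := by
  unfold map
  rw [legs_push, Set.image_eq_range]

theorem map_map (k : U → U') (hk : k.Injective) (k' : U' → U'') (hk' : k'.Injective)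
    (σ : O.SpiderIn U) : map k' hk' (map k hk σ) = map (k' ∘ k) (hk'.comp hk) σ := by
  obtain ⟨s, hs⟩ := σ.exists_push
  rw [hs, map_push, map_push, map_push]; rfl

theorem map_id (σ : O.SpiderIn U) : map id Function.injective_id σ = σ := σ.push_val

theorem map_injective (k : U → U') (hk : k.Injective) :
    Function.Injective (map (O := O) k hk) := by
  intro σ τ h
  have hl : σ.legs = τ.legs := by
    have := congrArg legs h
    rw [legs_map, legs_map] at this
    exact hk.image_injective this
  obtain ⟨P, s⟩ := σ
  obtain ⟨Q, t⟩ := τ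
  obtain rfl : P = Q := hl
  exact congrArg (SpiderIn.mk P) (push_injective _ _ h)

/-- The condition under which spiders can be mated along given legs. -/
def Mateable (x y : U) (σ τ : O.SpiderIn U) : Prop :=
  x ∈ σ.legs ∧ y ∈ τ.legs ∧ Disjoint σ.legs τ.legs

theorem sum_elim_injective {a : S} {b : T} {j : S → U} {k : T → U} (hj : j.Injective)
    (hk : k.Injective) (hd : Disjoint (Set.range j) (Set.range k)) :
    Function.Injective (Sum.elim (fun s : {s : S // s ≠ a} => j s.1)
      (fun t : {t : T // t ≠ b} => k t.1)) := by
  refine (hj.comp Subtype.val_injective).sumElim (hk.comp Subtype.val_injective) ?_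
  intro s t h
  exact Set.disjoint_left.1 hd ⟨s.1, rfl⟩ ⟨t.1, h.symm⟩

open Classical in
/-- Mating along the legs `x` and `y`. -/
def mate (x y : U) (σ τ : O.SpiderIn U) : O.SpiderIn U :=
  if h : Mateable x y σ τ then
    push _ (sum_elim_injective (a := (⟨x, h.1⟩ : σ.legs)) (b := (⟨y, h.2.1⟩ : τ.legs))
      Subtype.val_injective Subtype.val_injective (by simpa using h.2.2))
      (O.mate (⟨x, h.1⟩ : σ.legs) (⟨y, h.2.1⟩ : τ.legs) σ.spider τ.spider)
  else σ

/-- By naturality of mating, the mated spider can be computed from any injective presentation of the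
two spiders, not just from the subsets of `U` used in the definition. -/
theorem mate_push [Finite S] [Nontrivial S] [Finite T] [Nontrivial T]
    (a : S) (b : T) (j : S → U) (k : T → U) (hj : j.Injective)
    (hk : k.Injective) (hd : Disjoint (Set.range j) (Set.range k)) (s : O.Spider S)
    (t : O.Spider T) : mate (j a) (k b) (push j hj s) (push k hk t) =
      push _ (sum_elim_injective (a := a) (b := b) hj hk hd) (O.mate a b s t) := by
  have hm : Mateable (j a) (k b) (push j hj s) (push k hk t) := ⟨⟨a, rfl⟩, ⟨b, rfl⟩, hd⟩
  unfold mate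
  rw [dif_pos hm]
  have h := O.mate_map (Equiv.ofInjective j hj) (Equiv.ofInjective k hk) a b s t
  refine (congrArg (push _ _) h).trans ((push_spiderMap _ _ _ _).trans (push_congr _ ?_ _))
  ext (x | x) <;> rfl

variable [Finite U]

theorem map_mate (k : U → U') (hk : k.Injective) {x y : U} {σ τ : O.SpiderIn U}
    (h : Mateable x y σ τ) (hσ : σ.legs.Nontrivial) (hτ : τ.legs.Nontrivial) :
    map k hk (mate x y σ τ) = mate (k x) (k y) (map k hk σ) (map k hk τ) := by
  obtain ⟨hx, hy, hd⟩ := h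
  have := hσ.coe_sort
  have := hτ.coe_sort
  obtain ⟨s, hs⟩ := σ.exists_push
  obtain ⟨t, ht⟩ := τ.exists_push
  -- With the leg sets turned into variables, the spiders can be replaced by their presentations.
  generalize σ.legs = P at *
  generalize τ.legs = Q at *
  subst hs ht
  have h₁ := mate_push (U := U) (⟨x, hx⟩ : P) (⟨y, hy⟩ : Q) _ _ Subtype.val_injective
    Subtype.val_injective (by simpa using hd) s t
  have h₂ := mate_push (U := U') (⟨x, hx⟩ : P) (⟨y, hy⟩ : Q) (k ∘ Subtype.val) (k ∘ Subtype.val)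
    (hk.comp Subtype.val_injective) (hk.comp Subtype.val_injective) (by
      rw [Set.range_comp, Set.range_comp, Set.disjoint_image_iff hk]; simpa using hd) s t
  rw [map_push, map_push]
  refine ((congrArg _ h₁).trans ?_).trans h₂.symm
  rw [map_push]
  refine push_congr _ ?_ _
  ext (x | x) <;> rfl

theorem mate_comm {x y : U} {σ τ : O.SpiderIn U}
    (h : Mateable x y σ τ) (hσ : σ.legs.Nontrivial) (hτ : τ.legs.Nontrivial) :
    mate y x τ σ = mate x y σ τ := by
  obtain ⟨hx, hy, hd⟩ := h
  have := hσ.coe_sort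
  have := hτ.coe_sort
  obtain ⟨s, hs⟩ := σ.exists_push
  obtain ⟨t, ht⟩ := τ.exists_push
  generalize σ.legs = P at *
  generalize τ.legs = Q at *
  subst hs ht
  have h₁ := mate_push (U := U) (⟨x, hx⟩ : P) (⟨y, hy⟩ : Q) _ _ Subtype.val_injective
    Subtype.val_injective (by simpa using hd) s t
  have h₂ := mate_push (U := U) (⟨y, hy⟩ : Q) (⟨x, hx⟩ : P) _ _ Subtype.val_injective
    Subtype.val_injective (by simpa using hd.symm) t s
  refine (h₂.trans ?_).trans h₁.symm
  rw [O.mate_comm, push_spiderMap]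
  refine push_congr _ ?_ _
  ext (x | x) <;> rfl

/-- The rearrangement of legs in the associativity of mating. -/
def assocEquiv (a : S) (b c : T) (d : U) (hbc : c ≠ b) :
    {p : {s : S // s ≠ a} ⊕ {t : T // t ≠ b} // p ≠ Sum.inr ⟨c, hbc⟩} ⊕ {u : U // u ≠ d} ≃
      {s : S // s ≠ a} ⊕
        {p : {t : T // t ≠ c} ⊕ {u : U // u ≠ d} // p ≠ Sum.inl ⟨b, hbc.symm⟩} where
  toFun
    | .inl ⟨.inl s, _⟩ => .inl s
    | .inl ⟨.inr t, h⟩ => .inr ⟨.inl ⟨t.1, fun e => h (congrArg Sum.inr (Subtype.ext e))⟩,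
        fun e => t.2 (congrArg Subtype.val (Sum.inl_injective e))⟩
    | .inr u => .inr ⟨.inr u, Sum.inr_ne_inl⟩
  invFun
    | .inl s => .inl ⟨.inl s, Sum.inl_ne_inr⟩
    | .inr ⟨.inl t, h⟩ => .inl ⟨.inr ⟨t.1, fun e => h (congrArg Sum.inl (Subtype.ext e))⟩,
        fun e => t.2 (congrArg Subtype.val (Sum.inr_injective e))⟩
    | .inr ⟨.inr u, _⟩ => .inr u
  left_inv := by rintro (⟨s | t, h⟩ | u) <;> rfl
  right_inv := by rintro (s | ⟨t | u, h⟩) <;> rfl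

/-- `mate_push` computes the inner and the outer matings from one triple of spiders, and the
rearrangement `assocEquiv` of the remaining legs is the identity inside `U`. -/
theorem mate_assoc {x y z w : U} {σ τ υ : O.SpiderIn U}
    (h : Mateable x y σ τ) (h' : Mateable z w τ υ) (hyz : z ≠ y) (hd' : Disjoint σ.legs υ.legs)
    (hσ : σ.legs.Nontrivial) (hυ : υ.legs.Nontrivial) :
    mate z w (mate x y σ τ) υ = mate x y σ (mate z w τ υ) := by
  obtain ⟨hx, hy, hd⟩ := h
  obtain ⟨hz, hw, hd''⟩ := h'
  have := hσ.coe_sort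
  have := hυ.coe_sort
  obtain ⟨s, hs⟩ := σ.exists_push
  obtain ⟨t, ht⟩ := τ.exists_push
  obtain ⟨v, hv⟩ := υ.exists_push
  generalize σ.legs = P at *
  generalize τ.legs = Q at *
  generalize υ.legs = R at *
  subst hs ht hv
  have hbc : (⟨z, hz⟩ : Q) ≠ ⟨y, hy⟩ := fun e => hyz (congrArg Subtype.val e)
  have : Nontrivial Q := ⟨_, _, hbc⟩
  obtain ⟨x', hx', hxx'⟩ := hσ.exists_ne x
  obtain ⟨w', hw', hww'⟩ := hυ.exists_ne w
  -- Each inner composite keeps two legs: the leg of the middle spider reserved for the other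
  -- mating, and a second leg of the outer spider.
  have n₁ : Nontrivial ({s : P // s ≠ ⟨x, hx⟩} ⊕ {t : Q // t ≠ ⟨y, hy⟩}) :=
    ⟨.inl ⟨⟨x', hx'⟩, by simpa using hxx'⟩, .inr ⟨⟨z, hz⟩, hbc⟩, Sum.inl_ne_inr⟩
  have n₂ : Nontrivial ({s : Q // s ≠ ⟨z, hz⟩} ⊕ {t : R // t ≠ ⟨w, hw⟩}) :=
    ⟨.inl ⟨⟨y, hy⟩, hbc.symm⟩, .inr ⟨⟨w', hw'⟩, by simpa using hww'⟩, Sum.inl_ne_inr⟩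
  have i₁ := sum_elim_injective (U := U) (a := (⟨x, hx⟩ : P)) (b := (⟨y, hy⟩ : Q))
    Subtype.val_injective Subtype.val_injective (by simpa using hd)
  have i₂ := sum_elim_injective (U := U) (a := (⟨z, hz⟩ : Q)) (b := (⟨w, hw⟩ : R))
    Subtype.val_injective Subtype.val_injective (by simpa using hd'')
  have m₁ := mate_push (U := U) (⟨x, hx⟩ : P) (⟨y, hy⟩ : Q) _ _ Subtype.val_injective
    Subtype.val_injective (by simpa using hd) s t
  have m₂ := mate_push (U := U) (⟨z, hz⟩ : Q) (⟨w, hw⟩ : R) _ _ Subtype.val_injective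
    Subtype.val_injective (by simpa using hd'') t v
  have m₃ := mate_push (U := U) (S := {s : P // s ≠ ⟨x, hx⟩} ⊕ {t : Q // t ≠ ⟨y, hy⟩})
    (Sum.inr ⟨⟨z, hz⟩, hbc⟩) (⟨w, hw⟩ : R) _ _ i₁ Subtype.val_injective (by
      rw [Set.disjoint_left] at hd hd' hd'' ⊢
      rintro _ ⟨p | p, rfl⟩ ⟨q, hq⟩
      · exact hd' p.1.2 (by simp only [Sum.elim_inl] at hq; rw [← hq]; exact q.2)
      · exact hd'' p.1.2 (by simp only [Sum.elim_inr] at hq; rw [← hq]; exact q.2))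
    (O.mate ⟨x, hx⟩ ⟨y, hy⟩ s t) v
  have m₄ := mate_push (U := U) (T := {s : Q // s ≠ ⟨z, hz⟩} ⊕ {t : R // t ≠ ⟨w, hw⟩})
    (⟨x, hx⟩ : P) (Sum.inl ⟨⟨y, hy⟩, hbc.symm⟩) _ _ Subtype.val_injective i₂ (by
      rw [Set.disjoint_left] at hd hd' hd'' ⊢
      rintro _ ⟨q, rfl⟩ ⟨p | p, hq⟩
      · exact hd q.2 (by simp only [Sum.elim_inl] at hq; rw [← hq]; exact p.1.2)
      · exact hd' q.2 (by simp only [Sum.elim_inr] at hq; rw [← hq]; exact p.1.2))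
    s (O.mate ⟨z, hz⟩ ⟨w, hw⟩ t v)
  rw [show mate x y (push _ _ s) (push _ _ t) = _ from m₁,
    show mate z w (push _ _ t) (push _ _ v) = _ from m₂]
  refine m₃.trans (Eq.trans ?_ m₄.symm)
  rw [← O.mate_assoc ⟨x, hx⟩ ⟨y, hy⟩ ⟨z, hz⟩ ⟨w, hw⟩ hbc s t v (assocEquiv _ _ _ _ hbc)
    (fun _ _ => rfl) (fun _ _ _ _ => rfl) (fun _ => rfl), push_spiderMap]
  refine push_congr _ ?_ _
  ext (⟨p | p, h⟩ | p) <;> rfl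

end SpiderIn

end CyclicOperad

/-! ### Signs of bijections between linearly ordered sets -/

section OrderSign

variable {V W U : Type} [LinearOrder V] [LinearOrder W] [LinearOrder U]

/-- `1` if the two elements are in increasing order, and `-1` otherwise. -/
def cmpSign (u v : V) : ℤˣ := if u < v then 1 else -1

theorem cmpSign_of_lt {u v : V} (h : u < v) : cmpSign u v = 1 := if_pos h

theorem cmpSign_of_gt {u v : V} (h : v < u) : cmpSign u v = -1 := if_neg h.not_gt

theorem cmpSign_swap {u v : V} (h : u ≠ v) : cmpSign v u = -cmpSign u v := by
  rcases h.lt_or_gt with h | h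
  · rw [cmpSign_of_lt h, cmpSign_of_gt h]
  · rw [cmpSign_of_lt h, cmpSign_of_gt h, neg_neg]

/-- The lexicographic sum of two bijections. -/
def sumLexMap {V W V' W' : Type} (f : V ≃ W) (f' : V' ≃ W') : V ⊕ₗ V' ≃ W ⊕ₗ W' :=
  ofLex.trans ((Equiv.sumCongr f f').trans toLex)

theorem strictMono_sumLexMap {V' W' : Type} [LinearOrder V'] [LinearOrder W'] (g : V ≃ W)
    (g' : V' ≃ W') (hg : StrictMono g) (hg' : StrictMono g') : StrictMono (sumLexMap g g') := by
  rintro (x | x) (y | y) h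
  · exact Sum.Lex.inl_lt_inl_iff.2 (hg (Sum.Lex.inl_lt_inl_iff.1 h))
  · exact Sum.Lex.inl_lt_inr _ _
  · exact (Sum.Lex.not_inr_lt_inl h).elim
  · exact Sum.Lex.inr_lt_inr_iff.2 (hg' (Sum.Lex.inr_lt_inr_iff.1 h))

variable [Fintype V] [Fintype W] [Fintype U]

/-- Order isomorphisms with `Fin n` are unique, so any that are at hand compute the sign. -/
theorem orderSign_eq_sign {n : ℕ} (a : Fin n ≃o V) (b : Fin n ≃o W) (f : V ≃ W) :
    orderSign f = Equiv.Perm.sign (a.toEquiv.trans (f.trans b.symm.toEquiv)) := by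
  obtain rfl : Fintype.card V = n := by simpa using (Fintype.card_congr a.toEquiv).symm
  obtain rfl : a = Fintype.orderIsoFinOfCardEq V rfl := Subsingleton.elim _ _
  obtain rfl : b = Fintype.orderIsoFinOfCardEq W (Fintype.card_congr f).symm :=
    Subsingleton.elim _ _
  rfl

theorem orderSign_trans (f : V ≃ W) (g : W ≃ U) :
    orderSign (f.trans g) = orderSign f * orderSign g := by
  have a := Fintype.orderIsoFinOfCardEq V rfl
  have b := Fintype.orderIsoFinOfCardEq W (Fintype.card_congr f).symm
  have c := Fintype.orderIsoFinOfCardEq U (Fintype.card_congr (f.trans g)).symm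
  rw [orderSign_eq_sign a b f, orderSign_eq_sign b c g, orderSign_eq_sign a c, mul_comm,
    ← Equiv.Perm.sign_trans]
  congr 1
  ext x
  simp

theorem orderSign_of_strictMono (f : V ≃ W) (hf : StrictMono f) : orderSign f = 1 := by
  have a := Fintype.orderIsoFinOfCardEq V rfl
  let g : V ≃o W := hf.orderIsoOfSurjective f f.surjective
  rw [orderSign_eq_sign a (a.trans g) f]
  convert Equiv.Perm.sign_refl
  ext x
  have : (a.trans g).symm (f (a x)) = x := (a.trans g).symm_apply_apply x
  exact congrArg Fin.val this

theorem orderSign_symm (f : V ≃ W) : orderSign f.symm = orderSign f := by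
  have := orderSign_trans f f.symm
  rw [Equiv.self_trans_symm, orderSign_of_strictMono _ strictMono_id] at this
  rw [← mul_one (orderSign f), this, ← mul_assoc, Int.units_mul_self, one_mul]

/-- The sign of a bijection is the parity of its number of inversions. -/
theorem orderSign_eq_prod (f : V ≃ W) :
    orderSign f = ∏ u, ∏ v, if u < v then cmpSign (f u) (f v) else 1 := by
  have a := Fintype.orderIsoFinOfCardEq V rfl
  have b := Fintype.orderIsoFinOfCardEq W (Fintype.card_congr f).symm
  rw [orderSign_eq_sign a b f, Equiv.Perm.sign_eq_prod_prod_Ioi]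
  rw [← a.toEquiv.prod_comp]
  refine Finset.prod_congr rfl fun i _ => ?_
  rw [← a.toEquiv.prod_comp, ← Finset.prod_filter]
  refine Finset.prod_congr ?_ fun j _ => ?_
  · ext j; simp
  · simp [cmpSign]

variable (V) in
/-- Every bijection between linearly ordered sets is a permutation followed by an isomorphism. -/
theorem exists_perm_trans_strictMono (f : V ≃ W) :
    ∃ (p : Equiv.Perm V) (g : V ≃ W), StrictMono g ∧ f = p.trans g := by
  have a := Fintype.orderIsoFinOfCardEq V rfl
  have b := Fintype.orderIsoFinOfCardEq W (Fintype.card_congr f).symm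
  let g : V ≃o W := a.symm.trans b
  exact ⟨f.trans g.symm.toEquiv, g.toEquiv, g.strictMono, by ext; simp⟩

theorem orderSign_perm (p : Equiv.Perm V) : orderSign p = Equiv.Perm.sign p := by
  have a := Fintype.orderIsoFinOfCardEq V rfl
  rw [orderSign_eq_sign a a p]
  exact Equiv.Perm.sign_trans_trans_symm p a.toEquiv

/-- The extension of a bijection by `⊥ ↦ ⊥`. -/
def withBotCongr {V W : Type} (f : V ≃ W) : WithBot V ≃ WithBot W := Equiv.optionCongr f

/-- After factoring into a permutation and a monotone bijection: a new fixed point does not change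
the sign of the permutation, and the monotone factor stays monotone when ⊥ is adjoined. -/
theorem orderSign_withBotCongr (f : V ≃ W) : orderSign (withBotCongr f) = orderSign f := by
  obtain ⟨p, g, hg, rfl⟩ := exists_perm_trans_strictMono V f
  have h : withBotCongr (p.trans g) = (withBotCongr p).trans (withBotCongr g) :=
    Equiv.ext fun v => by rcases v with _ | v <;> rfl
  have hg' : StrictMono (withBotCongr g) := hg.withBot_map
  have hp : orderSign (withBotCongr p) = orderSign p := by
    refine (orderSign_perm (V := WithBot V) (withBotCongr p)).trans
      (Eq.trans ?_ ((Equiv.optionCongr_sign p).trans (orderSign_perm p).symm))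
    congr!
  rw [h, orderSign_trans, orderSign_of_strictMono _ hg', mul_one, orderSign_trans,
    orderSign_of_strictMono _ hg, mul_one, hp]

theorem orderSign_sumLexMap {V' W' : Type} [LinearOrder V'] [Fintype V'] [LinearOrder W']
    [Fintype W'] (f : V ≃ W) (f' : V' ≃ W') :
    orderSign (sumLexMap f f') = orderSign f * orderSign f' := by
  obtain ⟨p, g, hg, rfl⟩ := exists_perm_trans_strictMono V f
  obtain ⟨p', g', hg', rfl⟩ := exists_perm_trans_strictMono V' f'
  have h : sumLexMap (p.trans g) (p'.trans g') = (sumLexMap p p').trans (sumLexMap g g') := by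
    ext x; rcases x with x | x <;> rfl
  rw [h, orderSign_trans, orderSign_of_strictMono _ (strictMono_sumLexMap g g' hg hg'),
    orderSign_trans, orderSign_trans, orderSign_of_strictMono _ hg, orderSign_of_strictMono _ hg',
    mul_one, mul_one, mul_one, orderSign_perm, orderSign_perm, orderSign_perm,
    ← Equiv.Perm.sign_sumCongr]
  have := Equiv.Perm.sign_trans_trans_symm (Equiv.Perm.sumCongr p p')
    (ofLex : V ⊕ₗ V' ≃ V ⊕ V')
  convert this
  rfl

/-- Exchanging the two smallest elements changes the sign. -/
theorem orderSign_swap (u v : V) (h : u ≠ v) : orderSign (Equiv.swap u v) = -1 := by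
  rw [orderSign_perm, Equiv.Perm.sign_swap h]

end OrderSign

/-! ### Products over the edges of a graph -/

section DirProd

variable {H M : Type*} [Fintype H] [DecidableEq H] [CommMonoid M]

/-- A product over the edges, taken over the initial half-edges, splits off any given edge. -/
theorem prod_dir_eq (inv : H → H) (inv_inv : ∀ h, inv (inv h) = h)
    (d : H → ℤˣ) (hd : ∀ h, d (inv h) = -d h) (φ : H → M) (hφ : ∀ h, φ (inv h) = φ h) (x : H) :
    ∏ h with d h = 1, φ h = φ x * ∏ h with d h = 1 ∧ h ≠ x ∧ h ≠ inv x, φ h := by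
  have hx : d x = 1 ∨ d (inv x) = 1 := by
    rw [hd]
    rcases Int.units_eq_one_or (d x) with h | h
    · exact .inl h
    · right; rw [h, neg_neg]
  have key : ∀ y, d y = 1 → ∏ h with d h = 1, φ h =
      φ y * ∏ h with d h = 1 ∧ h ≠ y ∧ h ≠ inv y, φ h := by
    intro y hy
    rw [← Finset.mul_prod_erase _ _ (show y ∈ Finset.univ.filter (fun h => d h = 1) by simpa)]
    congr 1
    refine Finset.prod_congr ?_ fun _ _ => rfl
    ext h
    simp only [Finset.mem_erase, Finset.mem_filter, Finset.mem_univ, true_and]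
    constructor
    · rintro ⟨h1, h2⟩
      refine ⟨h2, h1, ?_⟩
      rintro rfl
      rw [hd, hy] at h2
      exact absurd h2 (by decide)
    · rintro ⟨h1, h2, h3⟩
      exact ⟨h2, h1⟩
  rcases hx with hx | hx
  · exact key x hx
  · rw [key _ hx, hφ, inv_inv]
    congr 1
    refine Finset.prod_congr ?_ fun _ _ => rfl
    ext h
    simp only [Finset.mem_filter, Finset.mem_univ, true_and]
    tauto

end DirProd

/-- Because of the valence condition, half-edges see every vertex; maps and orderings of vertices
can therefore be checked on half-edges alone. -/
theorem OrientedGraph.vert_surjective (G : OrientedGraph) : Function.Surjective G.vert := fun v =>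
  let ⟨h, _, _, e, _⟩ := G.two_le_valence v
  ⟨h, e⟩

theorem units_smul_comm {M N : Type*} [AddCommGroup M] [Module ℝ M] [AddCommGroup N] [Module ℝ N]
    (φ : M →ₗ[ℝ] N) (ε : ℤˣ) (m : M) : φ (ε • m) = ε • φ m := by
  rcases Int.units_eq_one_or ε with rfl | rfl <;> simp [Units.smul_def]

theorem units_smul_real_comm {M : Type*} [AddCommGroup M] [Module ℝ M] (ε : ℤˣ) (r : ℝ) (m : M) :
    r • ε • m = ε • r • m := by
  rcases Int.units_eq_one_or ε with rfl | rfl <;> simp [Units.smul_def]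

theorem units_smul_tmul {M N : Type*} [AddCommGroup M] [Module ℝ M] [AddCommGroup N] [Module ℝ N]
    (ε : ℤˣ) (m : M) (n : N) : (ε • m) ⊗ₜ[ℝ] n = ε • (m ⊗ₜ[ℝ] n) := by
  rcases Int.units_eq_one_or ε with rfl | rfl <;> simp [Units.smul_def, TensorProduct.neg_tmul]

theorem units_tmul_smul {M N : Type*} [AddCommGroup M] [Module ℝ M] [AddCommGroup N] [Module ℝ N]
    (ε : ℤˣ) (m : M) (n : N) : m ⊗ₜ[ℝ] (ε • n) = ε • (m ⊗ₜ[ℝ] n) := by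
  rcases Int.units_eq_one_or ε with rfl | rfl <;> simp [Units.smul_def, TensorProduct.tmul_neg]

/-! ### Linear maps on chains -/

namespace OGraph

variable {O : CyclicOperad.{u}}

/-- The linear dependence of a function of `𝒪`-graphs on the spider at every vertex. -/
def IsMultilinear {M : Type*} [AddCommGroup M] [Module ℝ M] (F : OGraph O → M) : Prop :=
  ∀ (Γ : OrientedGraph) (v : Γ.V) (c₁ c₂ c₃ : ∀ v, O.Spider (Γ.Legs v)) (a b : ℝ),
    (∀ w, w ≠ v → c₂ w = c₁ w) → (∀ w, w ≠ v → c₃ w = c₁ w) → c₁ v = a • c₂ v + b • c₃ v →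
      F ⟨Γ, c₁⟩ = a • F ⟨Γ, c₂⟩ + b • F ⟨Γ, c₃⟩

/-- The compatibility of a function of `𝒪`-graphs with isomorphisms. -/
def IsOriented {M : Type*} [AddCommGroup M] [Module ℝ M] (F : OGraph O → M) : Prop :=
  ∀ (G G' : OGraph O) (f : Iso G G'), F G = f.sign • F G'

theorem isOriented_chain : IsOriented (chain : OGraph O → Chains O) := by
  intro G G' f
  have h : (Submodule.Quotient.mk (Finsupp.single G 1 - f.sign • Finsupp.single G' 1) :
      (OGraph O →₀ ℝ) ⧸ Submodule.span ℝ {z : OGraph O →₀ ℝ | OGraph.Rel z}) = 0 :=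
    (Submodule.Quotient.mk_eq_zero _).2 (Submodule.subset_span (Rel.orientation f))
  have h' := (map_sub (Submodule.mkQ (Submodule.span ℝ {z : OGraph O →₀ ℝ | OGraph.Rel z}))
    (Finsupp.single G 1) (f.sign • Finsupp.single G' 1)).symm.trans h
  rw [units_smul_comm] at h'
  exact sub_eq_zero.1 h'

/-- The relation is phrased with `Function.update`; any coloring that agrees with `c₁` away from `v`
is such an update. -/
theorem isMultilinear_chain : IsMultilinear (chain : OGraph O → Chains O) := by
  intro Γ v c₁ c₂ c₃ a b h₂ h₃ h₁
  have e : ∀ c : (∀ v, O.Spider (Γ.Legs v)), (∀ w, w ≠ v → c w = c₁ w) →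
      (⟨Γ, c⟩ : OGraph O) = recolor ⟨Γ, c₁⟩ (Function.update c₁ v (c v)) := by
    intro c hc
    refine congrArg (OGraph.mk Γ) (funext fun w => ?_)
    by_cases hw : w = v
    · subst hw; simp
    · simp [hw, hc w hw]
  have hr := Rel.linearity (⟨Γ, c₁⟩ : OGraph O) v a b (c₂ v) (c₃ v)
  have h := (Submodule.Quotient.mk_eq_zero _).2 (Submodule.subset_span (R := ℝ) hr)
  rw [e c₁ fun _ _ => rfl, e c₂ h₂, e c₃ h₃, h₁]
  have h' := (map_sub (Submodule.mkQ (Submodule.span ℝ {z : OGraph O →₀ ℝ | OGraph.Rel z}))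
    _ _).symm.trans h
  rw [map_sub, map_smul, map_smul, sub_sub] at h'
  exact sub_eq_zero.1 h'

/-- The existence of one linear map with the prescribed values is enough. For ∂_H and T this map is
a combination of operators already known to be well defined. -/
theorem extend_chain {M : Type*} [AddCommGroup M] [Module ℝ M] {F : OGraph O → M}
    (φ : Chains O →ₗ[ℝ] M) (hφ : ∀ G : OGraph O, φ G.chain = F G) (G : OGraph O) :
    Chains.extend F G.chain = F G := by
  have h : ∃ φ : Chains O →ₗ[ℝ] M, ∀ G : OGraph O, φ G.chain = F G := ⟨φ, hφ⟩
  unfold Chains.extend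
  rw [dif_pos h]
  exact h.choose_spec G

/-- The two hypotheses match the two kinds of relations that are divided out. -/
theorem extend_chain_of {M : Type*} [AddCommGroup M] [Module ℝ M] {F : OGraph O → M}
    (h : IsOriented F) (h' : IsMultilinear F) (G : OGraph O) :
    Chains.extend F G.chain = F G := by
  refine extend_chain (Submodule.liftQ _ (Finsupp.linearCombination ℝ F)
    (Submodule.span_le.2 ?_)) (fun G => ?_) G
  · rintro _ (⟨f⟩ | ⟨G, v, a, b, S, T⟩)
    · rw [SetLike.mem_coe, LinearMap.mem_ker, map_sub, units_smul_comm]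
      simp [← h _ _ f]
    · rw [SetLike.mem_coe, LinearMap.mem_ker, map_sub, map_sub, map_smul, map_smul, sub_sub,
        sub_eq_zero]
      simp only [Finsupp.linearCombination_single, one_smul]
      refine h' G.toOrientedGraph v _ _ _ a b ?_ ?_ ?_
      · intro w hw; simp [hw]
      · intro w hw; simp [hw]
      · simp
  · exact (Submodule.liftQ_apply _ _ _).trans (by simp)

theorem chains_hom_ext {M : Type*} [AddCommGroup M] [Module ℝ M] {φ ψ : Chains O →ₗ[ℝ] M}
    (h : ∀ G : OGraph O, φ G.chain = ψ G.chain) : φ = ψ :=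
  Submodule.linearMap_qext _ (Finsupp.lhom_ext' fun G => LinearMap.ext_ring (h G))

theorem span_chain : Submodule.span ℝ (Set.range (chain : OGraph O → Chains O)) = ⊤ := by
  have h : Submodule.mkQ (Submodule.span ℝ (Set.range (chain : OGraph O → Chains O))) = 0 :=
    chains_hom_ext fun G => (Submodule.Quotient.mk_eq_zero _).2 (Submodule.subset_span ⟨G, rfl⟩)
  rw [← Submodule.ker_mkQ (Submodule.span ℝ (Set.range (chain : OGraph O → Chains O))), h,
    LinearMap.ker_zero]

/-! ### Isomorphisms built from half-edges -/

variable (G : OGraph O)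

/-- The spider at a vertex, as a spider whose legs are half-edges. -/
def spiderAt (v : G.V) : O.SpiderIn G.H :=
  .push (fun h : G.Legs v => h.1) Subtype.val_injective (G.color v)

theorem legs_spiderAt (v : G.V) : (G.spiderAt v).legs = {h | G.vert h = v} := by
  unfold spiderAt
  rw [CyclicOperad.SpiderIn.legs_push]
  exact Subtype.range_coe

theorem nontrivial_legs (v : G.V) : (G.spiderAt v).legs.Nontrivial := by
  obtain ⟨h, h', hne, e, e'⟩ := G.two_le_valence v
  rw [legs_spiderAt]
  exact ⟨h, e, h', e', hne⟩

variable {G}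

theorem Iso.map_spiderAt {G' : OGraph O} (f : Iso G G') (v : G.V) :
    (G.spiderAt v).map f.onH f.onH.injective = G'.spiderAt (f.onV v) := by
  unfold spiderAt
  rw [CyclicOperad.SpiderIn.map_push, f.color_onV, CyclicOperad.SpiderIn.push_spiderMap]
  rfl

/-- Two graphs whose half-edges have the same image in `U` have identified half-edges. Vertices are
classes of half-edges, so the vertex bijection follows from `hvert`, and the spiders are compared
inside `U`, where no identification of legs is needed. -/
theorem exists_iso_of_embed {A B : OGraph O} {U : Type} (j : A.H → U) (k : B.H → U)
    (hj : j.Injective) (hk : k.Injective) (hr : Set.range j = Set.range k)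
    (hinv : ∀ h g, j h = k g → j (A.inv h) = k (B.inv g))
    (hvert : ∀ h h' g g', j h = k g → j h' = k g' → (A.vert h = A.vert h' ↔ B.vert g = B.vert g'))
    (hcol : ∀ h g, j h = k g →
      (A.spiderAt (A.vert h)).map j hj = (B.spiderAt (B.vert g)).map k hk) :
    ∃ f : Iso A B, ∀ h, k (f.onH h) = j h := by
  let e : A.H ≃ B.H := (Equiv.ofInjective j hj).trans
    ((Equiv.setCongr hr).trans (Equiv.ofInjective k hk).symm)
  have he : ∀ h, k (e h) = j h := fun h => by
    exact Equiv.apply_ofInjective_symm hk _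
  -- One half-edge is chosen at each vertex; by `hvert` the image vertex does not depend on the
  -- choice.
  let s : A.V → A.H := Function.surjInv A.vert_surjective
  have hs : ∀ v, A.vert (s v) = v := Function.surjInv_eq A.vert_surjective
  have hv : ∀ h, B.vert (e (s (A.vert h))) = B.vert (e h) := fun h =>
    (hvert _ _ _ _ (he _).symm (he _).symm).1 (hs _)
  let F : A.V ≃ B.V := Equiv.ofBijective (fun v => B.vert (e (s v))) ⟨fun v w h => by
      rw [← hs v, ← hs w]
      exact (hvert _ _ _ _ (he _).symm (he _).symm).2 h, fun w => by
      obtain ⟨g, rfl⟩ := B.vert_surjective w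
      refine ⟨A.vert (e.symm g), ?_⟩
      exact (hv _).trans (congrArg B.vert (e.apply_symm_apply g))⟩
  have hF : ∀ h, B.vert (e h) = F (A.vert h) := fun h => (hv h).symm
  refine ⟨⟨F, e, hF, fun h => hk ?_, fun v => ?_⟩, he⟩
  · rw [← hinv h (e h) (he h).symm, he]
  · obtain ⟨h, rfl⟩ := A.vert_surjective v
    refine CyclicOperad.SpiderIn.push_injective (fun g : B.Legs _ => k g.1)
      (hk.comp Subtype.val_injective) ?_
    rw [CyclicOperad.SpiderIn.push_spiderMap]
    have h₁ := hcol h (e h) (he h).symm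
    unfold spiderAt at h₁
    rw [CyclicOperad.SpiderIn.map_push, CyclicOperad.SpiderIn.map_push] at h₁
    have h₂ : ∀ v w : B.V, v = w → CyclicOperad.SpiderIn.push (fun g : B.Legs v => k g.1)
        (hk.comp Subtype.val_injective) (B.color v) = CyclicOperad.SpiderIn.push
        (fun g : B.Legs w => k g.1) (hk.comp Subtype.val_injective) (B.color w) := by
      rintro v _ rfl; rfl
    refine (h₂ _ _ (hF h).symm).trans (h₁.symm.trans ?_)
    exact CyclicOperad.SpiderIn.push_congr _ (funext fun g : A.Legs (A.vert h) => (he g.1).symm) _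

/-- The sign of the reversals of edges under a map of half-edges. -/
def edgeSign {A B : OrientedGraph} (f : A.H → B.H) : ℤˣ := ∏ h : A.H with A.dir h = 1, B.dir (f h)

theorem edgeSign_of_dir {A B : OrientedGraph} (f : A.H → B.H) (h : ∀ h, B.dir (f h) = A.dir h) :
    edgeSign f = 1 := by
  refine Finset.prod_eq_one fun x hx => ?_
  rw [h]
  simpa using hx

theorem Iso.sign_eq {A B : OGraph O} (f : Iso A B) : f.sign = orderSign f.onV * edgeSign f.onH :=
  rfl

theorem Iso.sign_eq_one {A B : OGraph O} (f : Iso A B)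
    (hmono : ∀ h h', A.vert h < A.vert h' → B.vert (f.onH h) < B.vert (f.onH h'))
    (hdir : ∀ h, B.dir (f.onH h) = A.dir h) : f.sign = 1 := by
  rw [f.sign_eq, edgeSign_of_dir _ hdir, mul_one]
  refine orderSign_of_strictMono _ fun v w hvw => ?_
  obtain ⟨h, rfl⟩ := A.vert_surjective v
  obtain ⟨h', rfl⟩ := A.vert_surjective w
  rw [← f.vert_onH, ← f.vert_onH]
  exact hmono h h' hvw

/-- Equality of chains, for two `𝒪`-graphs whose half-edges are embedded into a common type. -/
theorem chain_eq_of_embed {A B : OGraph O} {U : Type} (j : A.H → U) (k : B.H → U)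
    (hj : j.Injective) (hk : k.Injective) (hr : Set.range j = Set.range k)
    (hinv : ∀ h g, j h = k g → j (A.inv h) = k (B.inv g))
    (hvert : ∀ h h' g g', j h = k g → j h' = k g' → (A.vert h = A.vert h' ↔ B.vert g = B.vert g'))
    (hcol : ∀ h g, j h = k g →
      (A.spiderAt (A.vert h)).map j hj = (B.spiderAt (B.vert g)).map k hk)
    (hmono : ∀ h h' g g', j h = k g → j h' = k g' → A.vert h < A.vert h' → B.vert g < B.vert g')
    (hdir : ∀ h g, j h = k g → B.dir g = A.dir h) : A.chain = B.chain := by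
  obtain ⟨f, hf⟩ := exists_iso_of_embed j k hj hk hr hinv hvert hcol
  have := isOriented_chain _ _ f
  rwa [f.sign_eq_one (fun h h' => hmono _ _ _ _ (hf h).symm (hf h').symm)
    (fun h => hdir _ _ (hf h).symm), one_smul] at this

end OGraph

/-! ### Signs of shuffles -/

section Shuffle

variable {V V' A B A' B' : Type} [LinearOrder V] [Fintype V] [LinearOrder V'] [Fintype V']
  [LinearOrder A] [Fintype A] [LinearOrder B] [Fintype B]
  [LinearOrder A'] [Fintype A'] [LinearOrder B'] [Fintype B']

open Classical in
/-- The sign of the reordering that moves the elements of `W` to the front. -/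
def shuffleSign (W : Set V) : ℤˣ := ∏ u, ∏ v, if u ∈ W ∧ v ∉ W then cmpSign u v else 1

-- A shuffle preserves the order within `W` and within its complement, so it inverts exactly the
-- pairs of an element of `W` and a smaller element outside it.
open Classical in
theorem orderSign_shuffle (e : V ≃ A ⊕ₗ B) (W : Set V) (i : A → V) (k : B → V) (hi : StrictMono i)
    (hk : StrictMono k) (hei : ∀ a, e (i a) = toLex (Sum.inl a))
    (hek : ∀ b, e (k b) = toLex (Sum.inr b)) (hiW : ∀ a, i a ∈ W) (hkW : ∀ b, k b ∉ W) :
    orderSign e = shuffleSign W := by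
  have hex : ∀ u, (∃ a, i a = u) ∨ ∃ b, k b = u := fun u => by
    rcases h : e u with a | b
    · exact .inl ⟨a, e.injective ((hei a).trans h.symm)⟩
    · exact .inr ⟨b, e.injective ((hek b).trans h.symm)⟩
  unfold shuffleSign
  -- The products are exchanged so that the outer variable is the larger element of the pair, the
  -- one which lies in `W` when the pair is inverted.
  rw [orderSign_eq_prod, Finset.prod_comm]
  refine Finset.prod_congr rfl fun u _ => Finset.prod_congr rfl fun v _ => ?_
  obtain ⟨a, rfl⟩ | ⟨b, rfl⟩ := hex u <;> obtain ⟨a', rfl⟩ | ⟨b', rfl⟩ := hex v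
  · rw [if_neg (show ¬ (i a ∈ W ∧ i a' ∉ W) from fun h => h.2 (hiW a')), hei, hei]
    split_ifs with h
    · exact cmpSign_of_lt (Sum.Lex.inl_lt_inl_iff.2 (hi.lt_iff_lt.1 h))
    · rfl
  · rw [if_pos (show i a ∈ W ∧ k b' ∉ W from ⟨hiW a, hkW b'⟩), hei, hek]
    split_ifs with h
    · rw [cmpSign_of_gt h]
      exact cmpSign_of_gt (Sum.Lex.inl_lt_inr _ _)
    · refine (cmpSign_of_lt (lt_of_le_of_ne (not_lt.1 h) fun h => ?_)).symm
      exact hkW b' (h ▸ hiW a)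
  · rw [if_neg (show ¬ (k b ∈ W ∧ i a' ∉ W) from fun h => hkW b h.1), hei, hek]
    split_ifs with h
    · exact cmpSign_of_lt (Sum.Lex.inl_lt_inr _ _)
    · rfl
  · rw [if_neg (show ¬ (k b ∈ W ∧ k b' ∉ W) from fun h => hkW b h.1), hek, hek]
    split_ifs with h
    · exact cmpSign_of_lt (Sum.Lex.inr_lt_inr_iff.2 (hk.lt_iff_lt.1 h))
    · rfl

/-- The shuffle signs of corresponding sets under a bijection. -/
theorem orderSign_mul_shuffleSign (f : V ≃ V') (g : A ≃ A') (g' : B ≃ B') (W : Set V) (W' : Set V')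
    (i : A → V) (k : B → V) (i' : A' → V') (k' : B' → V') (hi : StrictMono i) (hk : StrictMono k)
    (hi' : StrictMono i') (hk' : StrictMono k') (hiW : Set.range i = W) (hkW : Set.range k = Wᶜ)
    (hiW' : Set.range i' = W') (hkW' : Set.range k' = W'ᶜ) (hg : ∀ a, i' (g a) = f (i a))
    (hg' : ∀ b, k' (g' b) = f (k b)) :
    orderSign f * shuffleSign W' = shuffleSign W * (orderSign g * orderSign g') := by
  have hb : ∀ {V A B : Type} (i : A → V) (k : B → V) (W : Set V), i.Injective → k.Injective →
      Set.range i = W → Set.range k = Wᶜ →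
      Function.Bijective fun x : A ⊕ₗ B => Sum.elim i k (ofLex x) := by
    intro V A B i k W hi hk hiW hkW
    constructor
    · refine (hi.sumElim hk fun a b h => ?_).comp ofLex.injective
      have : k b ∈ Wᶜ := hkW ▸ ⟨b, rfl⟩
      exact this (by rw [← h, ← hiW]; exact ⟨a, rfl⟩)
    · intro v
      by_cases hv : v ∈ W
      · obtain ⟨a, rfl⟩ := hiW.symm ▸ hv
        exact ⟨toLex (Sum.inl a), rfl⟩
      · obtain ⟨a, rfl⟩ := hkW.symm ▸ (show v ∈ Wᶜ from hv)
        exact ⟨toLex (Sum.inr a), rfl⟩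
  let e := Equiv.ofBijective _ (hb i k W hi.injective hk.injective hiW hkW)
  let e' := Equiv.ofBijective _ (hb i' k' W' hi'.injective hk'.injective hiW' hkW')
  have h₁ : orderSign e.symm = shuffleSign W := orderSign_shuffle e.symm W i k hi hk
    (fun a => (Equiv.symm_apply_eq _).2 rfl) (fun a => (Equiv.symm_apply_eq _).2 rfl)
    (fun a => hiW ▸ ⟨a, rfl⟩) (fun b => (hkW ▸ ⟨b, rfl⟩ : k b ∈ Wᶜ))
  have h₂ : orderSign e'.symm = shuffleSign W' := orderSign_shuffle e'.symm W' i' k' hi' hk'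
    (fun a => (Equiv.symm_apply_eq _).2 rfl) (fun a => (Equiv.symm_apply_eq _).2 rfl)
    (fun a => hiW' ▸ ⟨a, rfl⟩) (fun b => (hkW' ▸ ⟨b, rfl⟩ : k' b ∈ W'ᶜ))
  rw [← h₁, ← h₂, ← orderSign_sumLexMap g g', ← orderSign_trans, ← orderSign_trans]
  congr 1
  ext v
  obtain ⟨x, rfl⟩ := e.surjective v
  rw [Equiv.trans_apply, Equiv.trans_apply, Equiv.symm_apply_apply, Equiv.symm_apply_eq]
  rcases x with a | b
  · exact (hg a).symm
  · exact (hg' b).symm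

end Shuffle

/-! ### Unions of components, in terms of sets of vertices -/

namespace OrientedGraph

variable (G : OrientedGraph)

/-- A set of vertices is saturated if it is a union of components. -/
def Saturated (W : Set G.V) : Prop := ∀ h, G.vert h ∈ W ↔ G.vert (G.inv h) ∈ W

variable {G}

theorem Saturated.compl {W : Set G.V} (hW : G.Saturated W) : G.Saturated Wᶜ := fun h =>
  not_congr (hW h)

theorem saturated_preimage (K : Set G.Components) : G.Saturated (G.component ⁻¹' K) := fun h => by
  rw [Set.mem_preimage, Set.mem_preimage, component_vert_inv]

/-- Membership in `W` is invariant under adjacency, hence under the equivalence relation it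
generates. -/
theorem Saturated.exists_eq {W : Set G.V} (hW : G.Saturated W) : ∃ K, W = G.component ⁻¹' K := by
  have : ∀ u v, G.component u = G.component v → (u ∈ W ↔ v ∈ W) := by
    intro u v h
    have h' := Quot.eqvGen_exact h
    clear h
    induction h' with
    | rel u v h => obtain ⟨h, rfl, rfl⟩ := h; exact hW h
    | refl => rfl
    | symm _ _ _ ih => exact ih.symm
    | trans _ _ _ _ _ ih₁ ih₂ => exact ih₁.trans ih₂
  refine ⟨G.component '' W, Set.ext fun v => ⟨fun h => ⟨v, h, rfl⟩, ?_⟩⟩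
  rintro ⟨u, hu, h⟩
  exact (this u v h).1 hu

theorem component_surjective : Function.Surjective G.component := Quot.mk_surjective

variable (G)

open Classical in
/-- The subgraph on a saturated set of vertices. -/
def induce (W : Set G.V) (hW : G.Saturated W) : OrientedGraph where
  V := {v : G.V // v ∈ W}
  H := {h : G.H // G.vert h ∈ W}
  inv h := ⟨G.inv h.1, (hW h.1).1 h.2⟩
  inv_inv h := Subtype.ext (G.inv_inv h.1)
  inv_ne h e := G.inv_ne h.1 (congrArg Subtype.val e)
  vert h := ⟨G.vert h.1, h.2⟩
  dir h := G.dir h.1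
  dir_inv h := G.dir_inv h.1
  two_le_valence v := by
    obtain ⟨h, h', hne, e, e'⟩ := G.two_le_valence v.1
    exact ⟨⟨h, by rw [e]; exact v.2⟩, ⟨h', by rw [e']; exact v.2⟩, by simpa using hne,
      Subtype.ext e, Subtype.ext e'⟩

/-- The half-edges at a vertex of an induced subgraph. -/
def legsInduce (W : Set G.V) (hW : G.Saturated W) (v : (G.induce W hW).V) :
    G.Legs v.1 ≃ (G.induce W hW).Legs v where
  toFun h := ⟨⟨h.1, by rw [h.2]; exact v.2⟩, Subtype.ext h.2⟩
  invFun h := ⟨h.1.1, congrArg Subtype.val h.2⟩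
  left_inv _ := rfl
  right_inv _ := rfl

open Classical in
theorem splitSign_eq (K : Set G.Components) :
    G.splitSign K = shuffleSign (G.component ⁻¹' K) :=
  orderSign_shuffle _ _ _ _ (fun _ _ h => h) (fun _ _ h => h)
    (fun a => congrArg toLex (Equiv.sumCompl_symm_apply_of_pos
      (p := fun v => G.component v ∈ K) a.2))
    (fun b => congrArg toLex (Equiv.sumCompl_symm_apply_of_neg
      (p := fun v => G.component v ∈ K) b.2)) (fun a => a.2) (fun b => b.2)

end OrientedGraph

namespace OGraph

open CyclicOperad

variable {O : CyclicOperad.{u}} (G : OGraph O)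

/-- The subgraph on a saturated set of vertices. -/
def induce (W : Set G.V) (hW : G.Saturated W) : OGraph O where
  toOrientedGraph := G.toOrientedGraph.induce W hW
  color v := O.spiderMap (G.toOrientedGraph.legsInduce W hW v) (G.color v.1)

/-- The inclusion of the half-edges of an induced subgraph. -/
def inducedIncl (W : Set G.V) (hW : G.Saturated W) : (G.induce W hW).H → G.H := Subtype.val

theorem inducedIncl_injective (W : Set G.V) (hW : G.Saturated W) :
    (G.inducedIncl W hW).Injective := Subtype.val_injective

theorem range_inducedIncl (W : Set G.V) (hW : G.Saturated W) :
    Set.range (G.inducedIncl W hW) = {h | G.vert h ∈ W} := Subtype.range_coe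

theorem vert_induce_inj (W : Set G.V) (hW : G.Saturated W) {h h' : (G.induce W hW).H} :
    (G.induce W hW).vert h = (G.induce W hW).vert h' ↔
      G.vert (G.inducedIncl W hW h) = G.vert (G.inducedIncl W hW h') := Subtype.ext_iff

theorem vert_induce_lt (W : Set G.V) (hW : G.Saturated W) {h h' : (G.induce W hW).H} :
    (G.induce W hW).vert h < (G.induce W hW).vert h' ↔
      G.vert (G.inducedIncl W hW h) < G.vert (G.inducedIncl W hW h') := Iff.rfl

/-- The inclusion of the half-edges that remain after the collapse of an edge. -/
def contractIncl (x : G.H) (hx : G.vert x ≠ G.vert (G.inv x)) : (G.contract x hx).H → G.H :=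
  Subtype.val

theorem contractIncl_injective (x : G.H) (hx : G.vert x ≠ G.vert (G.inv x)) :
    (G.contractIncl x hx).Injective := Subtype.val_injective

theorem range_contractIncl (x : G.H) (hx : G.vert x ≠ G.vert (G.inv x)) :
    Set.range (G.contractIncl x hx) = {h | h ≠ x ∧ h ≠ G.inv x} := Subtype.range_coe

theorem contractIncl_inv (x : G.H) (hx : G.vert x ≠ G.vert (G.inv x)) (h : (G.contract x hx).H) :
    G.contractIncl x hx ((G.contract x hx).inv h) = G.inv (G.contractIncl x hx h) := rfl

theorem dir_contract (x : G.H) (hx : G.vert x ≠ G.vert (G.inv x)) (h : (G.contract x hx).H) :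
    (G.contract x hx).dir h = G.dir (G.contractIncl x hx h) := rfl

/-- The map on vertices induced by the collapse of an edge. -/
def contractVert (x : G.H) (hx : G.vert x ≠ G.vert (G.inv x)) (v : G.V) : (G.contract x hx).V :=
  if h : v ≠ G.vert x ∧ v ≠ G.vert (G.inv x) then ((⟨v, h⟩ : G.Rest x) : WithBot (G.Rest x))
  else (⊥ : WithBot (G.Rest x))

theorem vert_contract (x : G.H) (hx : G.vert x ≠ G.vert (G.inv x)) (h : (G.contract x hx).H) :
    (G.contract x hx).vert h = G.contractVert x hx (G.vert (G.contractIncl x hx h)) := rfl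

theorem contractVert_of_eq (x : G.H) (hx : G.vert x ≠ G.vert (G.inv x)) {v : G.V}
    (h : v = G.vert x ∨ v = G.vert (G.inv x)) :
    G.contractVert x hx v = (⊥ : WithBot (G.Rest x)) := dif_neg (by tauto)

theorem contractVert_of_ne (x : G.H) (hx : G.vert x ≠ G.vert (G.inv x)) {v : G.V}
    (h : v ≠ G.vert x ∧ v ≠ G.vert (G.inv x)) :
    G.contractVert x hx v = ((⟨v, h⟩ : G.Rest x) : WithBot (G.Rest x)) := dif_pos h

theorem contractVert_inj (x : G.H) (hx : G.vert x ≠ G.vert (G.inv x)) {v w : G.V} :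
    G.contractVert x hx v = G.contractVert x hx w ↔ v = w ∨
      ((v = G.vert x ∨ v = G.vert (G.inv x)) ∧ (w = G.vert x ∨ w = G.vert (G.inv x))) := by
  by_cases hv : v = G.vert x ∨ v = G.vert (G.inv x) <;>
    by_cases hw : w = G.vert x ∨ w = G.vert (G.inv x)
  · rw [contractVert_of_eq _ _ _ hv, contractVert_of_eq _ _ _ hw]; tauto
  · rw [contractVert_of_eq _ _ _ hv, contractVert_of_ne _ _ _ (by tauto)]
    refine iff_of_false (fun h => by cases h) ?_
    rintro (rfl | h) <;> tauto
  · rw [contractVert_of_ne _ _ _ (by tauto), contractVert_of_eq _ _ _ hw]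
    refine iff_of_false (fun h => by cases h) ?_
    rintro (rfl | h) <;> tauto
  · rw [contractVert_of_ne _ _ _ (by tauto), contractVert_of_ne _ _ _ (by tauto)]
    refine (WithBot.coe_inj).trans (Subtype.ext_iff.trans ?_)
    dsimp only
    tauto

/-- The merged vertex is ⊥, below all others, and the remaining vertices keep their order. -/
theorem contractVert_lt (x : G.H) (hx : G.vert x ≠ G.vert (G.inv x)) {v w : G.V} :
    G.contractVert x hx v < G.contractVert x hx w ↔
      (w ≠ G.vert x ∧ w ≠ G.vert (G.inv x)) ∧ ((v = G.vert x ∨ v = G.vert (G.inv x)) ∨ v < w) := by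
  by_cases hv : v = G.vert x ∨ v = G.vert (G.inv x) <;>
    by_cases hw : w = G.vert x ∨ w = G.vert (G.inv x)
  · rw [contractVert_of_eq _ _ _ hv, contractVert_of_eq _ _ _ hw]
    exact iff_of_false (lt_irrefl _) (by tauto)
  · rw [contractVert_of_eq _ _ _ hv, contractVert_of_ne _ _ _ (by tauto)]
    exact iff_of_true (WithBot.bot_lt_coe _) (by tauto)
  · rw [contractVert_of_ne _ _ _ (by tauto), contractVert_of_eq _ _ _ hw]
    exact iff_of_false (fun h => (not_lt_bot (α := WithBot (G.Rest x)) h)) (by tauto)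
  · rw [contractVert_of_ne _ _ _ (by tauto), contractVert_of_ne _ _ _ (by tauto)]
    refine (WithBot.coe_lt_coe).trans (Subtype.mk_lt_mk.trans ?_)
    tauto

theorem spiderAt_induce (W : Set G.V) (hW : G.Saturated W) (v : (G.induce W hW).V) :
    ((G.induce W hW).spiderAt v).map (G.inducedIncl W hW)
      (G.inducedIncl_injective W hW) = G.spiderAt v.1 := by
  exact (SpiderIn.map_push _ _ _ _ _).trans (SpiderIn.push_spiderMap _ _ _ _)

section Union

variable (G G' : OGraph O)

/-- The inclusion of the half-edges of the first graph in a disjoint union. -/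
def inlH : G.H → (G.union G').H := Sum.inl

/-- The inclusion of the half-edges of the second graph in a disjoint union. -/
def inrH : G'.H → (G.union G').H := Sum.inr

/-- The inclusion of the vertices of the first graph in a disjoint union. -/
def inlV (v : G.V) : (G.union G').V := toLex (Sum.inl v)

/-- The inclusion of the vertices of the second graph in a disjoint union. -/
def inrV (v : G'.V) : (G.union G').V := toLex (Sum.inr v)

variable {G G'} in
/-- A function on the half-edges of a disjoint union. -/
def unionElim {X : Type} (f : G.H → X) (g : G'.H → X) : (G.union G').H → X := Sum.elim f g

theorem union_cases (h : (G.union G').H) : (∃ k, h = inlH G G' k) ∨ ∃ k, h = inrH G G' k := by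
  rcases h with h | h
  · exact .inl ⟨h, rfl⟩
  · exact .inr ⟨h, rfl⟩

theorem union_vert_cases (v : (G.union G').V) :
    (∃ w, v = inlV G G' w) ∨ ∃ w, v = inrV G G' w := by
  rcases v with v | v
  · exact .inl ⟨v, rfl⟩
  · exact .inr ⟨v, rfl⟩

theorem inlH_injective : (inlH G G').Injective := Sum.inl_injective
theorem inrH_injective : (inrH G G').Injective := Sum.inr_injective
theorem inlV_injective : (inlV G G').Injective := toLex.injective.comp Sum.inl_injective
theorem inrV_injective : (inrV G G').Injective := toLex.injective.comp Sum.inr_injective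

theorem inlV_ne_inrV (v : G.V) (w : G'.V) : inlV G G' v ≠ inrV G G' w := fun h =>
  Sum.inl_ne_inr (toLex.injective h)

theorem inlH_ne_inrH (v : G.H) (w : G'.H) : inlH G G' v ≠ inrH G G' w := Sum.inl_ne_inr

theorem inlV_lt_inlV {v w : G.V} : inlV G G' v < inlV G G' w ↔ v < w := Sum.Lex.inl_lt_inl_iff
theorem inrV_lt_inrV {v w : G'.V} : inrV G G' v < inrV G G' w ↔ v < w := Sum.Lex.inr_lt_inr_iff
theorem inlV_lt_inrV (v : G.V) (w : G'.V) : inlV G G' v < inrV G G' w := Sum.Lex.inl_lt_inr _ _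

theorem vert_inlH (h : G.H) : (G.union G').vert (inlH G G' h) = inlV G G' (G.vert h) := rfl
theorem vert_inrH (h : G'.H) : (G.union G').vert (inrH G G' h) = inrV G G' (G'.vert h) := rfl
theorem inv_inlH (h : G.H) : (G.union G').inv (inlH G G' h) = inlH G G' (G.inv h) := rfl
theorem inv_inrH (h : G'.H) : (G.union G').inv (inrH G G' h) = inrH G G' (G'.inv h) := rfl
theorem dir_inlH (h : G.H) : (G.union G').dir (inlH G G' h) = G.dir h := rfl
theorem dir_inrH (h : G'.H) : (G.union G').dir (inrH G G' h) = G'.dir h := rfl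

variable {G G'} in
theorem unionElim_inlH {X : Type} (f : G.H → X) (g : G'.H → X) (h : G.H) :
    unionElim f g (inlH G G' h) = f h := rfl

variable {G G'} in
theorem unionElim_inrH {X : Type} (f : G.H → X) (g : G'.H → X) (h : G'.H) :
    unionElim f g (inrH G G' h) = g h := rfl

variable {G G'} in
theorem unionElim_injective {X : Type} {f : G.H → X} {g : G'.H → X} (hf : f.Injective)
    (hg : g.Injective) (h : ∀ a b, f a ≠ g b) : (unionElim f g).Injective := hf.sumElim hg h

variable {G G'} in
theorem prod_unionH {M : Type*} [CommMonoid M] (F : (G.union G').H → M) :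
    ∏ h, F h = (∏ h, F (inlH G G' h)) * ∏ h, F (inrH G G' h) := Fintype.prod_sum_type _

variable {G G'} in
theorem sum_unionH {M : Type*} [AddCommMonoid M] (F : (G.union G').H → M) :
    ∑ h, F h = (∑ h, F (inlH G G' h)) + ∑ h, F (inrH G G' h) := Fintype.sum_sum_type _

variable {G G'} in
theorem prod_unionV {M : Type*} [CommMonoid M] (F : (G.union G').V → M) :
    ∏ v, F v = (∏ v, F (inlV G G' v)) * ∏ v, F (inrV G G' v) := Fintype.prod_sum_type _

theorem spiderAt_inlV (v : G.V) :
    (G.union G').spiderAt (inlV G G' v) =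
      (G.spiderAt v).map (inlH G G') (inlH_injective G G') := by
  unfold spiderAt
  rw [SpiderIn.map_push]
  exact SpiderIn.push_spiderMap _ _ _ _

theorem spiderAt_inrV (v : G'.V) :
    (G.union G').spiderAt (inrV G G' v) =
      (G'.spiderAt v).map (inrH G G') (inrH_injective G G') := by
  unfold spiderAt
  rw [SpiderIn.map_push]
  exact SpiderIn.push_spiderMap _ _ _ _

theorem map_unionElim_spiderAt_inlV {X : Type} {f : G.H → X} {g : G'.H → X}
    (h : (unionElim f g).Injective) (v : G.V) :
    ((G.union G').spiderAt (inlV G G' v)).map _ h =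
      (G.spiderAt v).map f (h.comp (inlH_injective G G')) := by
  rw [spiderAt_inlV, SpiderIn.map_map]; rfl

theorem map_unionElim_spiderAt_inrV {X : Type} {f : G.H → X} {g : G'.H → X}
    (h : (unionElim f g).Injective) (v : G'.V) :
    ((G.union G').spiderAt (inrV G G' v)).map _ h =
      (G'.spiderAt v).map g (h.comp (inrH_injective G G')) := by
  rw [spiderAt_inrV, SpiderIn.map_map]; rfl

end Union

theorem spiderAt_contract_bot (x : G.H) (hx : G.vert x ≠ G.vert (G.inv x)) :
    ((G.contract x hx).spiderAt (⊥ : WithBot (G.Rest x))).map (G.contractIncl x hx)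
      (G.contractIncl_injective x hx) =
      SpiderIn.mate x (G.inv x) (G.spiderAt (G.vert x)) (G.spiderAt (G.vert (G.inv x))) := by
  have n₁ : ∀ v, Nontrivial (G.Legs v) := fun v => by
    obtain ⟨h, h', hne, e, e'⟩ := G.two_le_valence v
    exact ⟨⟨h, e⟩, ⟨h', e'⟩, fun e => hne (congrArg Subtype.val e)⟩
  refine (SpiderIn.map_push _ _ _ _ _).trans ((SpiderIn.push_spiderMap _ _ _ _).trans ?_)
  have hd : Disjoint (Set.range fun h : G.Legs (G.vert x) => h.1)
      (Set.range fun h : G.Legs (G.vert (G.inv x)) => h.1) := by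
    rw [Set.disjoint_left]
    rintro _ ⟨h, rfl⟩ ⟨h', e⟩
    exact hx (by rw [← h.2, ← h'.2]; exact congrArg G.vert e.symm)
  refine Eq.trans ?_ (SpiderIn.mate_push (⟨x, rfl⟩ : G.Legs (G.vert x))
    (⟨G.inv x, rfl⟩ : G.Legs (G.vert (G.inv x))) _ _ _ _ hd _ _).symm
  refine SpiderIn.push_congr _ ?_ _
  ext (h | h) <;> rfl

theorem spiderAt_contract_coe (x : G.H) (hx : G.vert x ≠ G.vert (G.inv x)) (u : G.Rest x) :
    ((G.contract x hx).spiderAt (u : WithBot (G.Rest x))).map (G.contractIncl x hx)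
      (G.contractIncl_injective x hx) =
      G.spiderAt u.1 := by
  exact (SpiderIn.map_push _ _ _ _ _).trans (SpiderIn.push_spiderMap _ _ _ _)

/-- The spider at a vertex after the collapse of an edge. -/
def mergedAt (x : G.H) (v : G.V) : O.SpiderIn G.H :=
  if v = G.vert x ∨ v = G.vert (G.inv x) then
    SpiderIn.mate x (G.inv x) (G.spiderAt (G.vert x)) (G.spiderAt (G.vert (G.inv x)))
  else G.spiderAt v

theorem spiderAt_contract (x : G.H) (hx : G.vert x ≠ G.vert (G.inv x)) (h : (G.contract x hx).H) :
    ((G.contract x hx).spiderAt ((G.contract x hx).vert h)).map (G.contractIncl x hx)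
      (G.contractIncl_injective x hx) =
      G.mergedAt x (G.vert (G.contractIncl x hx h)) := by
  rw [vert_contract]
  unfold mergedAt
  split_ifs with hh
  · rw [contractVert_of_eq _ _ _ hh, spiderAt_contract_bot]
  · rw [contractVert_of_ne _ _ _ (not_or.1 hh), spiderAt_contract_coe]

open Classical in
/-- The term of the coproduct that puts the vertices in `W` to the left; it is zero unless `W` is a
union of components. -/
def splitAt (W : Set G.V) : Chains O ⊗[ℝ] Chains O :=
  if hW : G.Saturated W then
    shuffleSign W • ((G.induce W hW).chain ⊗ₜ[ℝ] (G.induce Wᶜ hW.compl).chain)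
  else 0

theorem splitAt_of_saturated (W : Set G.V) (hW : G.Saturated W) :
    G.splitAt W = shuffleSign W • ((G.induce W hW).chain ⊗ₜ[ℝ] (G.induce Wᶜ hW.compl).chain) :=
  dif_pos hW

theorem split_eq_splitAt (K : Set G.Components) :
    G.split K = G.splitAt (G.component ⁻¹' K) := by
  rw [splitAt_of_saturated _ _ (OrientedGraph.saturated_preimage K), split, OrientedGraph.splitSign_eq]
  rfl

/-- Sums over sets of components are sums over saturated sets of vertices. -/
theorem sum_components {M : Type*} [AddCommMonoid M] (F : Set G.V → M)
    (hF : ∀ W, ¬ G.Saturated W → F W = 0) :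
    ∑ K : Set G.Components, F (G.component ⁻¹' K) = ∑ W : Set G.V, F W := by
  classical
  have hinj : Function.Injective fun K : Set G.Components => G.component ⁻¹' K :=
    Set.preimage_injective.2 OrientedGraph.component_surjective
  rw [← Finset.sum_image (s := Finset.univ) (f := F) (g := fun K : Set G.Components =>
    G.component ⁻¹' K) hinj.injOn]
  refine Finset.sum_subset (Finset.subset_univ _) fun W _ hW => hF W fun hs => hW ?_
  obtain ⟨K, rfl⟩ := hs.exists_eq
  exact Finset.mem_image_of_mem _ (Finset.mem_univ _)

/-- Sums over sets of vertices have an index type that does not depend on the edges, so that a graph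
and the graphs glued from it can be compared term by term. -/
theorem coproduct_eq : G.coproduct = ∑ W : Set G.V, G.splitAt W := by
  rw [coproduct, ← G.sum_components G.splitAt fun W hW => dif_neg hW]
  exact Finset.sum_congr rfl fun K _ => G.split_eq_splitAt K

end OGraph

theorem prod_subtype_ite {X M : Type*} [CommMonoid M] [Fintype X] (p : X → Prop)
    [DecidablePred p] [Fintype {x // p x}] (F : X → M) :
    ∏ x : {x // p x}, F x.1 = ∏ x, if p x then F x else 1 := by
  rw [← Finset.prod_filter, Finset.prod_subtype (p := p) (Finset.univ.filter p) (by simp)]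

namespace OGraph

open CyclicOperad

variable {O : CyclicOperad.{u}} {G G' : OGraph O}

/-! ### The coproduct is well defined -/

theorem Iso.saturated_image (f : Iso G G') {W : Set G.V} :
    G'.Saturated (f.onV '' W) ↔ G.Saturated W := by
  constructor
  · intro h g
    have := h (f.onH g)
    rwa [f.vert_onH, f.inv_onH, f.vert_onH, f.onV.injective.mem_set_image,
      f.onV.injective.mem_set_image] at this
  · intro h g
    obtain ⟨g, rfl⟩ := f.onH.surjective g
    rw [f.vert_onH, f.inv_onH, f.vert_onH, f.onV.injective.mem_set_image,
      f.onV.injective.mem_set_image]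
    exact h g

theorem Iso.exists_induce (f : Iso G G') (W : Set G.V) (W' : Set G'.V)
    (hW : G.Saturated W) (hW' : G'.Saturated W') (h : ∀ v, f.onV v ∈ W' ↔ v ∈ W) :
    ∃ g : Iso (G.induce W hW) (G'.induce W' hW'), (∀ h, (g.onH h).1 = f.onH h.1) ∧
      ∀ v, (g.onV v).1 = f.onV v.1 := by
  have key : ∀ (h : (G.induce W hW).H) (g : (G'.induce W' hW').H), f.onH h.1 = g.1 →
      ((G'.induce W' hW').vert g).1 = f.onV ((G.induce W hW).vert h).1 := fun h g e => by
    refine Eq.trans (congrArg G'.vert e.symm) ?_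
    exact f.vert_onH h.1
  suffices hex : ∃ g : Iso (G.induce W hW) (G'.induce W' hW'),
      ∀ h, G'.inducedIncl W' hW' (g.onH h) = f.onH (G.inducedIncl W hW h) by
    obtain ⟨g, hg⟩ := hex
    refine ⟨g, hg, fun v => ?_⟩
    obtain ⟨h, rfl⟩ := (G.induce W hW).vert_surjective v
    rw [← g.vert_onH]
    exact key h _ (hg h).symm
  refine exists_iso_of_embed (A := G.induce W hW) (B := G'.induce W' hW')
    (fun h => f.onH (G.inducedIncl W hW h)) (G'.inducedIncl W' hW')
    (f.onH.injective.comp (G.inducedIncl_injective W hW)) (G'.inducedIncl_injective W' hW') ?_ ?_ ?_ ?_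
  · ext x
    constructor
    · rintro ⟨y, rfl⟩
      exact ⟨⟨f.onH y.1, by rw [f.vert_onH, h]; exact y.2⟩, rfl⟩
    · rintro ⟨y, rfl⟩
      refine ⟨⟨f.onH.symm y.1, ?_⟩, f.onH.apply_symm_apply _⟩
      rw [← h, ← f.vert_onH, Equiv.apply_symm_apply]; exact y.2
  · intro h g e
    exact (f.inv_onH h.1).symm.trans (congrArg G'.inv e)
  · intro h h' g g' e e'
    rw [vert_induce_inj, vert_induce_inj, ← e, ← e', f.vert_onH, f.vert_onH, f.onV.apply_eq_iff_eq]
  · intro h g e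
    rw [spiderAt_induce, key h g e, ← f.map_spiderAt, ← G.spiderAt_induce W hW]
    exact (SpiderIn.map_map _ _ _ _ _).symm

theorem edgeSign_induce (f : G.H → G'.H) {W : Set G.V} {W' : Set G'.V}
    {hW : G.Saturated W} {hW' : G'.Saturated W'}
    (g : (G.induce W hW).H → (G'.induce W' hW').H)
    (g' : (G.induce Wᶜ hW.compl).H → (G'.induce W'ᶜ hW'.compl).H)
    (hg : ∀ h, (g h).1 = f h.1) (hg' : ∀ h, (g' h).1 = f h.1) :
    edgeSign (A := G.toOrientedGraph) (B := G'.toOrientedGraph) f =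
      edgeSign (A := (G.induce W hW).toOrientedGraph)
        (B := (G'.induce W' hW').toOrientedGraph) g *
      edgeSign (A := (G.induce Wᶜ hW.compl).toOrientedGraph)
        (B := (G'.induce W'ᶜ hW'.compl).toOrientedGraph) g' := by
  classical
  unfold edgeSign
  rw [Finset.prod_filter, Finset.prod_filter, Finset.prod_filter]
  have e₁ : ∀ h, (if (G.induce W hW).dir h = 1 then (G'.induce W' hW').dir (g h) else 1) =
      (fun h : G.H => if G.dir h = 1 then G'.dir (f h) else 1) h.1 := fun h => by
    dsimp only
    rw [← hg]; rfl
  have e₂ : ∀ h, (if (G.induce Wᶜ hW.compl).dir h = 1 then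
      (G'.induce W'ᶜ hW'.compl).dir (g' h) else 1) =
      (fun h : G.H => if G.dir h = 1 then G'.dir (f h) else 1) h.1 := fun h => by
    dsimp only
    rw [← hg']; rfl
  rw [Finset.prod_congr rfl fun h _ => e₁ h, Finset.prod_congr rfl fun h _ => e₂ h]
  refine Eq.trans ?_ (congrArg₂ (· * ·)
    (@prod_subtype_ite _ _ _ _ (fun h => G.vert h ∈ W) _ (G.induce W hW).fintypeH
      (fun h : G.H => if G.dir h = 1 then G'.dir (f h) else 1)).symm
    (@prod_subtype_ite _ _ _ _ (fun h => G.vert h ∈ Wᶜ) _ (G.induce Wᶜ hW.compl).fintypeH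
      (fun h : G.H => if G.dir h = 1 then G'.dir (f h) else 1)).symm)
  rw [← Finset.prod_mul_distrib]
  refine Finset.prod_congr rfl fun h _ => ?_
  by_cases h1 : G.vert h ∈ W
  · rw [if_pos h1, if_neg (show ¬ G.vert h ∈ Wᶜ from not_not_intro h1), mul_one]
  · rw [if_neg h1, if_pos (show G.vert h ∈ Wᶜ from h1), one_mul]

/-- An isomorphism restricts to the two induced subgraphs. Its edge sign is the product of theirs,
and its vertex sign is the product of theirs up to the two shuffle signs. -/
theorem Iso.splitAt (f : Iso G G') (W : Set G.V) :
    G.splitAt W = f.sign • G'.splitAt (f.onV '' W) := by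
  by_cases hW : G.Saturated W
  swap
  · rw [OGraph.splitAt, dif_neg hW, OGraph.splitAt, dif_neg (mt f.saturated_image.1 hW), smul_zero]
  have hW' := f.saturated_image.2 hW
  set W' := f.onV '' W with hdef
  have hm : ∀ v, f.onV v ∈ W' ↔ v ∈ W := fun v => f.onV.injective.mem_set_image
  obtain ⟨g, hg, hgv⟩ := f.exists_induce W W' hW hW' hm
  obtain ⟨g', hg', hgv'⟩ := f.exists_induce Wᶜ W'ᶜ hW.compl hW'.compl fun v => not_congr (hm v)
  rw [G.splitAt_of_saturated W hW, G'.splitAt_of_saturated W' hW', isOriented_chain _ _ g,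
    isOriented_chain _ _ g', units_smul_tmul, units_tmul_smul, smul_smul, smul_smul, smul_smul]
  congr 1
  have h₁ : orderSign f.onV * shuffleSign W' =
      shuffleSign W * (orderSign g.onV * orderSign g'.onV) := by
    refine orderSign_mul_shuffleSign f.onV g.onV g'.onV W W' (fun v => v.1) (fun v => v.1)
      (fun v => v.1) (fun v => v.1) (fun _ _ h => h) (fun _ _ h => h) (fun _ _ h => h)
      (fun _ _ h => h) Subtype.range_coe Subtype.range_coe Subtype.range_coe Subtype.range_coe
      hgv hgv'
  rw [f.sign_eq, g.sign_eq, g'.sign_eq, edgeSign_induce f.onH g.onH g'.onH hg hg']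
  have alg : ∀ a b c d e p q : ℤˣ, a * b = c * (d * e) →
      c * (d * p) * (e * q) = a * (p * q) * b := fun a b c d e p q h => by
    rw [mul_assoc, mul_mul_mul_comm d p, ← mul_assoc, ← h, mul_assoc, mul_assoc, mul_comm b]
  exact alg _ _ _ _ _ _ _ h₁

theorem isOriented_coproduct : IsOriented (coproduct : OGraph O → _) := by
  intro G G' f
  rw [coproduct_eq, coproduct_eq, Finset.smul_sum]
  exact Fintype.sum_equiv (Equiv.Set.congr f.onV) _ _ fun W => f.splitAt W

/-- The vertex `v` lies in exactly one of `W` and its complement, so only one tensor factor depends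
on the spider at `v`, and it does so linearly. -/
theorem isMultilinear_splitAt (Γ : OrientedGraph) (W : Set Γ.V) (v : Γ.V)
    (c₁ c₂ c₃ : ∀ v, O.Spider (Γ.Legs v)) (a b : ℝ)
    (h₂ : ∀ w, w ≠ v → c₂ w = c₁ w) (h₃ : ∀ w, w ≠ v → c₃ w = c₁ w)
    (h : c₁ v = a • c₂ v + b • c₃ v) :
    splitAt ⟨Γ, c₁⟩ W = a • splitAt ⟨Γ, c₂⟩ W + b • splitAt ⟨Γ, c₃⟩ W := by
  by_cases hW : Γ.Saturated W
  swap
  · simp [splitAt, dif_neg hW]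
  have hs : ∀ c : (∀ v, O.Spider (Γ.Legs v)), splitAt ⟨Γ, c⟩ W = shuffleSign W •
      ((induce ⟨Γ, c⟩ W hW).chain ⊗ₜ[ℝ] (induce ⟨Γ, c⟩ Wᶜ hW.compl).chain) :=
    fun c => splitAt_of_saturated _ _ _
  rw [hs, hs, hs, units_smul_real_comm, units_smul_real_comm, ← smul_add]
  congr 1
  have same : ∀ (U : Set Γ.V) (hU : Γ.Saturated U), v ∉ U → ∀ c : (∀ v, O.Spider (Γ.Legs v)),
      (∀ w, w ≠ v → c w = c₁ w) → (induce ⟨Γ, c⟩ U hU).chain = (induce ⟨Γ, c₁⟩ U hU).chain := by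
    intro U hU hv c hc
    refine congrArg chain (congrArg (OGraph.mk _) (funext fun w => congrArg (O.spiderMap _) ?_))
    exact hc w.1 fun e => hv (e ▸ w.2)
  have lin : ∀ (U : Set Γ.V) (hU : Γ.Saturated U), v ∈ U → (induce ⟨Γ, c₁⟩ U hU).chain =
      a • (induce ⟨Γ, c₂⟩ U hU).chain + b • (induce ⟨Γ, c₃⟩ U hU).chain := by
    intro U hU hv
    refine isMultilinear_chain (Γ.induce U hU) ⟨v, hv⟩ _ _ _ a b ?_ ?_ ?_
    · intro w hw
      exact congrArg (O.spiderMap _) (h₂ w.1 fun e => hw (Subtype.ext e))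
    · intro w hw
      exact congrArg (O.spiderMap _) (h₃ w.1 fun e => hw (Subtype.ext e))
    · dsimp only
      rw [h, map_add, map_smul, map_smul]
  by_cases hv : v ∈ W
  · rw [lin W hW hv, same Wᶜ hW.compl (fun h => h hv) c₂ h₂, same Wᶜ hW.compl (fun h => h hv) c₃ h₃,
      TensorProduct.add_tmul, TensorProduct.smul_tmul', TensorProduct.smul_tmul']
  · rw [lin Wᶜ hW.compl hv, same W hW hv c₂ h₂, same W hW hv c₃ h₃,
      TensorProduct.tmul_add, TensorProduct.tmul_smul, TensorProduct.tmul_smul]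

theorem isMultilinear_coproduct : IsMultilinear (coproduct : OGraph O → _) := by
  intro Γ v c₁ c₂ c₃ a b h₂ h₃ h
  rw [coproduct_eq, coproduct_eq, coproduct_eq, Finset.smul_sum, Finset.smul_sum,
    ← Finset.sum_add_distrib]
  exact Finset.sum_congr rfl fun W _ => isMultilinear_splitAt Γ W v c₁ c₂ c₃ a b h₂ h₃ h

theorem comul_chain (G : OGraph O) : Chains.comul O G.chain = G.coproduct :=
  extend_chain_of isOriented_coproduct isMultilinear_coproduct G

end OGraph

namespace OrientedGraph

variable (G : OrientedGraph)

theorem endpointsFirst_left (x : G.H) (hx : G.vert x ≠ G.vert (G.inv x)) :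
    G.endpointsFirst x hx (G.vert x) = ⊥ := dif_pos rfl

theorem endpointsFirst_right (x : G.H) (hx : G.vert x ≠ G.vert (G.inv x)) :
    G.endpointsFirst x hx (G.vert (G.inv x)) = ((⊥ : WithBot (G.Rest x)) : WithBot (WithBot _)) :=
  (dif_neg hx.symm).trans (dif_pos rfl)

theorem endpointsFirst_of_ne (x : G.H) (hx : G.vert x ≠ G.vert (G.inv x)) {u : G.V}
    (h : u ≠ G.vert x ∧ u ≠ G.vert (G.inv x)) :
    G.endpointsFirst x hx u = (((⟨u, h⟩ : G.Rest x) : WithBot (G.Rest x)) : WithBot (WithBot _)) :=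
  (dif_neg h.1).trans (dif_neg h.2)

end OrientedGraph

namespace OGraph

open CyclicOperad

variable {O : CyclicOperad.{u}} {G G' : OGraph O}

/-! ### The product is well defined -/

/-- The identity isomorphism. -/
def Iso.refl (G : OGraph O) : Iso G G where
  onV := Equiv.refl _
  onH := Equiv.refl _
  vert_onH _ := rfl
  inv_onH _ := rfl
  color_onV _ := (O.spiderMap_refl _).symm

theorem Iso.sign_refl (G : OGraph O) : (Iso.refl G).sign = 1 :=
  (Iso.refl G).sign_eq_one (fun _ _ h => h) fun _ => rfl

theorem Iso.exists_union {G₁ G₁' G₂ G₂' : OGraph O} (f : Iso G₁ G₁') (g : Iso G₂ G₂') :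
    ∃ k : Iso (G₁.union G₂) (G₁'.union G₂'), k.sign = f.sign * g.sign := by
  have hinj : (unionElim (fun h => inlH G₁' G₂' (f.onH h))
      fun h => inrH G₁' G₂' (g.onH h)).Injective :=
    unionElim_injective ((inlH_injective _ _).comp f.onH.injective)
      ((inrH_injective _ _).comp g.onH.injective) fun _ _ => inlH_ne_inrH _ _ _ _
  suffices hex : ∃ k : Iso (G₁.union G₂) (G₁'.union G₂'), ∀ h, k.onH h =
      unionElim (fun h => inlH G₁' G₂' (f.onH h)) (fun h => inrH G₁' G₂' (g.onH h)) h by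
    obtain ⟨k, hk⟩ := hex
    refine ⟨k, ?_⟩
    have hv : k.onV = sumLexMap f.onV g.onV := Equiv.ext fun v => by
      obtain ⟨h, rfl⟩ := (G₁.union G₂).vert_surjective v
      refine (k.vert_onH h).symm.trans ?_
      rw [hk]
      rcases union_cases G₁ G₂ h with ⟨h, rfl⟩ | ⟨h, rfl⟩
      · rw [unionElim_inlH, vert_inlH, f.vert_onH]; rfl
      · rw [unionElim_inrH, vert_inrH, g.vert_onH]; rfl
    rw [k.sign_eq, hv, f.sign_eq, g.sign_eq]
    have h₁ := orderSign_sumLexMap f.onV g.onV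
    have h₂ : edgeSign (A := (G₁.union G₂).toOrientedGraph) (B := (G₁'.union G₂').toOrientedGraph)
        k.onH = edgeSign f.onH * edgeSign g.onH := by
      unfold edgeSign
      rw [Finset.prod_filter, Finset.prod_filter, Finset.prod_filter, prod_unionH]
      congr 1
      · exact Finset.prod_congr rfl fun h _ => by rw [hk, dir_inlH, unionElim_inlH, dir_inlH]
      · exact Finset.prod_congr rfl fun h _ => by rw [hk, dir_inrH, unionElim_inrH, dir_inrH]
    rw [h₂, mul_mul_mul_comm, ← h₁]
    rfl
  refine exists_iso_of_embed (A := G₁.union G₂) (B := G₁'.union G₂') _ id hinj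
    Function.injective_id ?_ ?_ ?_ ?_
  · rw [Set.range_id, Set.eq_univ_iff_forall]
    intro h
    rcases union_cases _ _ h with ⟨h, rfl⟩ | ⟨h, rfl⟩
    · exact ⟨inlH _ _ (f.onH.symm h), by rw [unionElim_inlH, Equiv.apply_symm_apply]⟩
    · exact ⟨inrH _ _ (g.onH.symm h), by rw [unionElim_inrH, Equiv.apply_symm_apply]⟩
  · rintro h _ rfl
    rcases union_cases _ _ h with ⟨h, rfl⟩ | ⟨h, rfl⟩
    · rw [id, inv_inlH, unionElim_inlH, unionElim_inlH, inv_inlH, f.inv_onH]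
    · rw [id, inv_inrH, unionElim_inrH, unionElim_inrH, inv_inrH, g.inv_onH]
  · rintro h h' _ _ rfl rfl
    rcases union_cases _ _ h with ⟨h, rfl⟩ | ⟨h, rfl⟩ <;>
      rcases union_cases _ _ h' with ⟨h', rfl⟩ | ⟨h', rfl⟩ <;>
      simp only [unionElim_inlH, unionElim_inrH, vert_inlH, vert_inrH, f.vert_onH, g.vert_onH,
        (inlV_injective _ _).eq_iff, (inrV_injective _ _).eq_iff, inlV_ne_inrV,
        (inlV_ne_inrV _ _ _ _).symm, f.onV.apply_eq_iff_eq, g.onV.apply_eq_iff_eq]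
  · rintro h _ rfl
    rw [SpiderIn.map_id]
    rcases union_cases _ _ h with ⟨h, rfl⟩ | ⟨h, rfl⟩
    · rw [vert_inlH, map_unionElim_spiderAt_inlV, unionElim_inlH, vert_inlH, spiderAt_inlV,
        f.vert_onH, ← f.map_spiderAt, SpiderIn.map_map]; rfl
    · rw [vert_inrH, map_unionElim_spiderAt_inrV, unionElim_inrH, vert_inrH, spiderAt_inrV,
        g.vert_onH, ← g.map_spiderAt, SpiderIn.map_map]; rfl

theorem isOriented_union_left (G₂ : OGraph O) :
    IsOriented fun G : OGraph O => (G.union G₂).chain := fun G G' f => by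
  obtain ⟨k, hk⟩ := f.exists_union (Iso.refl G₂)
  rw [Iso.sign_refl, mul_one] at hk
  exact hk ▸ isOriented_chain _ _ k

theorem isOriented_union_right (G₁ : OGraph O) :
    IsOriented fun G : OGraph O => (G₁.union G).chain := fun G G' f => by
  obtain ⟨k, hk⟩ := (Iso.refl G₁).exists_union f
  rw [Iso.sign_refl, one_mul] at hk
  exact hk ▸ isOriented_chain _ _ k

theorem isMultilinear_union_left (G₂ : OGraph O) :
    IsMultilinear fun G : OGraph O => (G.union G₂).chain := by
  intro Γ v c₁ c₂ c₃ a b h₂ h₃ h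
  refine isMultilinear_chain (Γ.union G₂.toOrientedGraph) (toLex (Sum.inl v)) _ _ _ a b ?_ ?_ ?_
  · rintro (w | w) hw
    · exact congrArg (O.spiderMap _) (h₂ w fun e => hw (congrArg (inlV ⟨Γ, c₁⟩ G₂) e))
    · rfl
  · rintro (w | w) hw
    · exact congrArg (O.spiderMap _) (h₃ w fun e => hw (congrArg (inlV ⟨Γ, c₁⟩ G₂) e))
    · rfl
  · refine (congrArg (O.spiderMap _) h).trans ?_
    rw [map_add, map_smul, map_smul]; rfl

theorem isMultilinear_union_right (G₁ : OGraph O) :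
    IsMultilinear fun G : OGraph O => (G₁.union G).chain := by
  intro Γ v c₁ c₂ c₃ a b h₂ h₃ h
  refine isMultilinear_chain (G₁.toOrientedGraph.union Γ) (toLex (Sum.inr v)) _ _ _ a b ?_ ?_ ?_
  · rintro (w | w) hw
    · rfl
    · exact congrArg (O.spiderMap _) (h₂ w fun e => hw (congrArg (inrV G₁ ⟨Γ, c₁⟩) e))
  · rintro (w | w) hw
    · rfl
    · exact congrArg (O.spiderMap _) (h₃ w fun e => hw (congrArg (inrV G₁ ⟨Γ, c₁⟩) e))
  · refine (congrArg (O.spiderMap _) h).trans ?_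
    rw [map_add, map_smul, map_smul]; rfl

/-- The product is a nested extension. The inner one is justified for each fixed first graph; the
outer one takes values in linear maps, and its compatibility is tested on graphs in the second
variable. -/
theorem mul_chain (G G' : OGraph O) :
    Chains.mul O (G.chain ⊗ₜ[ℝ] G'.chain) = (G.union G').chain := by
  have h₁ : ∀ G G' : OGraph O,
      Chains.extend (fun G' => (G.union G').chain) G'.chain = (G.union G').chain := fun G G' =>
    extend_chain_of (isOriented_union_right G) (isMultilinear_union_right G) G'
  have h₂ : ∀ G : OGraph O, Chains.extend
      (fun G : OGraph O => Chains.extend (fun G' => (G.union G').chain)) G.chain =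
      Chains.extend (fun G' => (G.union G').chain) := by
    refine extend_chain_of ?_ ?_
    · intro G G' f
      refine chains_hom_ext fun G₂ => ?_
      refine (h₁ G G₂).trans ((isOriented_union_left G₂ G G' f).trans ?_)
      dsimp only
      rw [← h₁]
      rcases Int.units_eq_one_or f.sign with h | h <;> rw [h] <;> simp [Units.smul_def]
    · intro Γ v c₁ c₂ c₃ a b e₂ e₃ e
      refine chains_hom_ext fun G₂ => ?_
      rw [h₁, LinearMap.add_apply, LinearMap.smul_apply, LinearMap.smul_apply, h₁, h₁]
      exact isMultilinear_union_left G₂ Γ v c₁ c₂ c₃ a b e₂ e₃ e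
  unfold Chains.mul
  rw [TensorProduct.lift.tmul, h₂, h₁]

/-! ### Operations that multiply graphs by scalars -/

theorem extend_smul_chain (r : OGraph O → ℝ) (h : ∀ G G', Iso G G' → r G = r G')
    (h' : ∀ (Γ : OrientedGraph) (c c' : ∀ v, O.Spider (Γ.Legs v)), r ⟨Γ, c⟩ = r ⟨Γ, c'⟩)
    (G : OGraph O) : Chains.extend (fun G : OGraph O => r G • G.chain) G.chain = r G • G.chain := by
  refine extend_chain_of (F := fun G : OGraph O => r G • G.chain) ?_ ?_ G
  · intro G G' f
    dsimp only
    rw [h G G' f, isOriented_chain _ _ f, units_smul_real_comm]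
  · intro Γ v c₁ c₂ c₃ a b h₂ h₃ e
    dsimp only
    rw [isMultilinear_chain Γ v c₁ c₂ c₃ a b h₂ h₃ e, h' Γ c₂ c₁, h' Γ c₃ c₁, smul_add,
      smul_comm a, smul_comm b]

/-- The linear map that acts on graphs with `k` vertices by a given linear map `φ k`. -/
theorem extend_card {M : Type*} [AddCommGroup M] [Module ℝ M] (φ : ℕ → Chains O →ₗ[ℝ] M)
    (G : OGraph O) :
    Chains.extend (fun G : OGraph O => φ (Fintype.card G.V) G.chain) G.chain =
      φ (Fintype.card G.V) G.chain := by
  refine extend_chain_of (F := fun G : OGraph O => φ (Fintype.card G.V) G.chain) ?_ ?_ G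
  · intro G G' f
    dsimp only
    rw [Fintype.card_congr f.onV, isOriented_chain _ _ f, units_smul_comm]
  · intro Γ v c₁ c₂ c₃ a b h₂ h₃ e
    dsimp only
    rw [isMultilinear_chain Γ v c₁ c₂ c₃ a b h₂ h₃ e, map_add, map_smul, map_smul]

theorem parity_chain (G : OGraph O) :
    Chains.parity O G.chain = (-1 : ℝ) ^ Fintype.card G.V • G.chain :=
  extend_smul_chain (fun G => (-1 : ℝ) ^ Fintype.card G.V)
    (fun _ _ f => by rw [Fintype.card_congr f.onV]) (fun _ _ _ => rfl) G

theorem Iso.card_components (f : Iso G G') :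
    Fintype.card G.Components = Fintype.card G'.Components := by
  refine Fintype.card_congr (Quot.congr f.onV fun u v => ⟨?_, ?_⟩)
  · rintro ⟨h, rfl, rfl⟩
    exact ⟨f.onH h, f.vert_onH h, by rw [f.inv_onH, f.vert_onH]⟩
  · rintro ⟨h, e, e'⟩
    obtain ⟨h, rfl⟩ := f.onH.surjective h
    rw [f.vert_onH, f.onV.apply_eq_iff_eq] at e
    rw [f.inv_onH, f.vert_onH, f.onV.apply_eq_iff_eq] at e'
    exact ⟨h, e, e'⟩

theorem antipode_chain (G : OGraph O) :
    Chains.antipode O G.chain = (-1 : ℝ) ^ Fintype.card G.Components • G.chain :=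
  extend_smul_chain (fun G => (-1 : ℝ) ^ Fintype.card G.Components)
    (fun _ _ f => by rw [f.card_components]) (fun _ _ _ => rfl) G

open Classical in
theorem counit_chain (G : OGraph O) :
    Chains.counit O G.chain = if IsEmpty G.V then 1 else 0 := by
  refine extend_chain_of (F := fun G : OGraph O => if IsEmpty G.V then (1 : ℝ) else 0) ?_ ?_ G
  · intro G G' f
    dsimp only
    by_cases h : IsEmpty G'.V
    · have h' : IsEmpty G.V := f.onV.isEmpty_congr.2 h
      have hH : IsEmpty G.H := ⟨fun h => h'.elim (G.vert h)⟩
      have hs : f.sign = 1 := f.sign_eq_one (fun h => hH.elim h) fun h => hH.elim h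
      rw [if_pos h, if_pos h', hs, one_smul]
    · rw [if_neg h, if_neg (mt f.onV.isEmpty_congr.1 h), smul_zero]
  · intro Γ v c₁ c₂ c₃ a b h₂ h₃ h
    have : ¬ IsEmpty Γ.V := fun h => h.elim v
    simp [this]

/-! ### Collapses of edges -/

/-- The reorderings that put the endpoints first commute with the isomorphisms, which relates the
vertex signs. The edge sign of `f` has one factor more than that of `g`, the comparison of
directions at the collapsed edge, and it is absorbed by the `dir` factors in the two contraction
signs. -/
theorem Iso.exists_contract (f : Iso G G') (x : G.H) (x' : G'.H) (hfx : f.onH x = x')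
    (hx : G.vert x ≠ G.vert (G.inv x)) (hx' : G'.vert x' ≠ G'.vert (G'.inv x')) :
    ∃ g : Iso (G.contract x hx) (G'.contract x' hx'),
      (∀ h, G'.contractIncl x' hx' (g.onH h) = f.onH (G.contractIncl x hx h)) ∧
      G.contractSign x hx * g.sign = f.sign * G'.contractSign x' hx' := by
  subst hfx
  have hv : G'.vert (f.onH x) = f.onV (G.vert x) := f.vert_onH x
  have hv' : G'.vert (G'.inv (f.onH x)) = f.onV (G.vert (G.inv x)) := by
    rw [f.inv_onH, f.vert_onH]
  suffices hex : ∃ g : Iso (G.contract x hx) (G'.contract (f.onH x) hx'),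
      ∀ h, G'.contractIncl (f.onH x) hx' (g.onH h) = f.onH (G.contractIncl x hx h) by
    obtain ⟨g, hg⟩ := hex
    refine ⟨g, hg, ?_⟩
    have hgv : ∀ v, g.onV (G.contractVert x hx v) = G'.contractVert (f.onH x) hx' (f.onV v) := by
      intro v
      obtain ⟨h, e⟩ := (G.contract x hx).vert_surjective (G.contractVert x hx v)
      rw [← e, ← g.vert_onH, vert_contract, hg, f.vert_onH]
      rw [vert_contract, contractVert_inj] at e
      rw [contractVert_inj, hv, hv']
      simpa only [f.onV.apply_eq_iff_eq] using e
    let r : G.Rest x ≃ G'.Rest (f.onH x) := f.onV.subtypeEquiv fun v => by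
      rw [hv, hv', Ne, Ne, Ne, Ne, f.onV.apply_eq_iff_eq, f.onV.apply_eq_iff_eq]
    have h₁ : g.onV = withBotCongr r := by
      refine Equiv.ext fun w => ?_
      rcases w with _ | w
      · have := hgv (G.vert x)
        rw [contractVert_of_eq _ _ _ (.inl rfl), contractVert_of_eq _ _ _ (.inl hv.symm)] at this
        exact this
      · have := hgv w.1
        rw [contractVert_of_ne _ _ _ w.2] at this
        exact this.trans (contractVert_of_ne _ _ _ (r w).2)
    have h₂ : f.onV.trans (G'.endpointsFirst (f.onH x) hx') =
        (G.endpointsFirst x hx).trans (withBotCongr (withBotCongr r)) := by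
      refine Equiv.ext fun v => ?_
      refine (Equiv.trans_apply _ _ _).trans (Eq.trans ?_ (Equiv.trans_apply _ _ _).symm)
      by_cases h : v = G.vert x
      · rw [h, ← hv, OrientedGraph.endpointsFirst_left, OrientedGraph.endpointsFirst_left]; rfl
      by_cases h' : v = G.vert (G.inv x)
      · rw [h', ← hv', OrientedGraph.endpointsFirst_right, OrientedGraph.endpointsFirst_right]; rfl
      · rw [OrientedGraph.endpointsFirst_of_ne _ _ _ ⟨h, h'⟩,
          show f.onV v = (r ⟨v, h, h'⟩).1 from rfl,
          OrientedGraph.endpointsFirst_of_ne _ _ _ (r ⟨v, h, h'⟩).2]; rfl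
    have h₃ := congrArg orderSign h₂
    have h₄ : orderSign (withBotCongr r) = orderSign g.onV :=
      congrArg (orderSign (V := WithBot (G.Rest x)) (W := WithBot (G'.Rest (f.onH x)))) h₁.symm
    rw [orderSign_trans, orderSign_trans, orderSign_withBotCongr, h₄] at h₃
    have h₅ : edgeSign f.onH = G.dir x * G'.dir (f.onH x) * edgeSign g.onH := by
      -- The inserted factor is 1 on initial half-edges and makes the product invariant under
      -- reversal of an edge, so that a factor can be split off at either half.
      have e₁ : ∀ {A B : OGraph O} (f : Iso A B), edgeSign f.onH =
          ∏ h : A.H with A.dir h = 1, A.dir h * B.dir (f.onH h) := fun {A B} f =>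
        Finset.prod_congr rfl fun h hh => by rw [(Finset.mem_filter.1 hh).2, one_mul]
      rw [e₁ f, e₁ g, prod_dir_eq G.inv G.inv_inv G.dir G.dir_inv _ (fun h => by
        rw [← f.inv_onH, G.dir_inv, G'.dir_inv, neg_mul_neg]) x]
      congr 1
      rw [Finset.prod_filter, Finset.prod_filter]
      classical
      have := @prod_subtype_ite _ _ _ _ (fun h => h ≠ x ∧ h ≠ G.inv x) _
        (G.contract x hx).fintypeH
        (fun h => if G.dir h = 1 then G.dir h * G'.dir (f.onH h) else 1)
      refine Eq.trans ?_ (this.symm.trans ?_)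
      · refine Finset.prod_congr rfl fun h _ => ?_
        split_ifs <;> tauto
      · refine Finset.prod_congr rfl fun h _ => ?_
        exact congrArg (fun z => if G.dir h.1 = 1 then G.dir h.1 * G'.dir z else 1) (hg h).symm
    rw [f.sign_eq, g.sign_eq, h₅]
    unfold OrientedGraph.contractSign
    have alg : ∀ a b c d e p q : ℤˣ, a * b = c * d → p * c * (d * e) = a * (p * q * e) * (q * b) := by
      intro a b c d e p q h
      calc p * c * (d * e) = p * (c * d) * e := by simp only [mul_assoc]
        _ = p * (a * b) * e * (q * q) := by rw [h, Int.units_mul_self, mul_one]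
        _ = _ := by simp only [mul_left_comm, mul_comm]
    exact alg _ _ _ _ _ _ _ h₃
  refine exists_iso_of_embed (A := G.contract x hx) (B := G'.contract (f.onH x) hx')
    (fun h => f.onH (G.contractIncl x hx h)) (G'.contractIncl _ hx')
    (f.onH.injective.comp (G.contractIncl_injective x hx)) (G'.contractIncl_injective _ hx')
    ?_ ?_ ?_ ?_
  · rw [range_contractIncl]
    refine (Set.range_comp f.onH _).trans ?_
    rw [range_contractIncl]
    ext h
    obtain ⟨h, rfl⟩ := f.onH.surjective h
    rw [f.onH.injective.mem_set_image, f.inv_onH]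
    simp
  · intro h g e
    rw [contractIncl_inv, contractIncl_inv, ← f.inv_onH, e]
  · intro h h' g g' e e'
    rw [vert_contract, vert_contract, vert_contract, vert_contract, contractVert_inj,
      contractVert_inj, ← e, ← e', f.vert_onH, f.vert_onH, hv, hv']
    simp only [f.onV.apply_eq_iff_eq]
  · intro h g e
    rw [spiderAt_contract, ← e]
    refine (SpiderIn.map_map _ (G.contractIncl_injective x hx) f.onH f.onH.injective _).symm.trans ?_
    rw [spiderAt_contract, mergedAt, mergedAt, f.vert_onH, hv, hv']
    simp only [f.onV.apply_eq_iff_eq]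
    split_ifs with hh
    · rw [SpiderIn.map_mate, f.map_spiderAt, f.map_spiderAt, f.inv_onH]
      · exact ⟨by rw [legs_spiderAt]; rfl, by rw [legs_spiderAt]; rfl, by
          rw [legs_spiderAt, legs_spiderAt, Set.disjoint_left]
          intro h e e'
          exact hx (e.symm.trans e')⟩
      · exact nontrivial_legs _ _
      · exact nontrivial_legs _ _
    · exact f.map_spiderAt _

theorem Iso.collapse (f : Iso G G') (x : G.H) :
    G.collapse x = f.sign • G'.collapse (f.onH x) := by
  have hiff : G'.vert (f.onH x) = G'.vert (G'.inv (f.onH x)) ↔ G.vert x = G.vert (G.inv x) := by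
    rw [f.inv_onH, f.vert_onH, f.vert_onH, f.onV.apply_eq_iff_eq]
  unfold OGraph.collapse
  by_cases hx : G.vert x = G.vert (G.inv x)
  · rw [dif_neg (not_not_intro hx), dif_neg (not_not_intro (hiff.2 hx)), smul_zero]
  · rw [dif_pos hx, dif_pos (mt hiff.1 hx)]
    obtain ⟨g, -, hg⟩ := f.exists_contract x _ rfl hx (mt hiff.1 hx)
    rw [isOriented_chain _ _ g, smul_smul, hg, smul_smul]

end OGraph

/-! ### Signs of collapses in terms of the positions of the endpoints -/

section RankSign

variable {V : Type} [LinearOrder V]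

/-- The diagonal counts as an inversion, so `rankSign v` is −1 to the number of vertices at most
`v`. -/
theorem cmpSign_self (v : V) : cmpSign v v = -1 := if_neg (lt_irrefl v)

/-- The product of the comparison signs of an element with all elements. -/
def rankSign [Fintype V] (v : V) : ℤˣ := ∏ u, cmpSign v u

end RankSign

theorem prod_eq_ite_mul {V M : Type*} [Fintype V] [DecidableEq V] [CommMonoid M] (F F' : V → M)
    (a : V) (h : ∀ v, v ≠ a → F v = F' v) (m : M) (hm : F a = m * F' a) :
    ∏ v, F v = m * ∏ v, F' v := by
  rw [← Finset.mul_prod_erase _ F (Finset.mem_univ a),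
    ← Finset.mul_prod_erase _ F' (Finset.mem_univ a), hm, mul_assoc]
  congr 2
  exact Finset.prod_congr rfl fun v hv => h v (Finset.ne_of_mem_erase hv)

namespace OrientedGraph

variable (G : OrientedGraph)

/-- Moving the first endpoint to the front passes all vertices below it; moving the second one
behind it passes all vertices below the second except possibly the first endpoint. Each `rankSign`
also counts the endpoint itself, but these two signs cancel, and the exception gives the comparison
of the endpoints. -/
theorem orderSign_endpointsFirst (x : G.H) (hx : G.vert x ≠ G.vert (G.inv x)) :
    orderSign (G.endpointsFirst x hx) = cmpSign (G.vert (G.inv x)) (G.vert x) *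
      (rankSign (G.vert x) * rankSign (G.vert (G.inv x))) := by
  set a := G.vert x with ha
  set b := G.vert (G.inv x) with hb
  have hab : a ≠ b := hx
  -- The inversions of the reordering: pairs with upper element `a`, and pairs with upper element
  -- `b` and lower element other than `a`.
  have key : ∀ u v, (if u < v then cmpSign (G.endpointsFirst x hx u) (G.endpointsFirst x hx v)
      else 1) = (if v = a then (if u < a then -1 else 1) else 1) *
        (if v = b then (if u < b ∧ u ≠ a then -1 else 1) else 1) := by
    have e₁ := G.endpointsFirst_left x hx
    have e₂ := G.endpointsFirst_right x hx
    rw [← ha] at e₁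
    rw [← hb] at e₂
    intro u v
    by_cases huv : u < v
    swap
    · rw [if_neg huv]
      grind
    rw [if_pos huv]
    by_cases hva : v = a
    · subst hva
      rw [e₁, if_pos rfl, if_pos huv, if_neg hab, mul_one]
      exact if_neg not_lt_bot
    rw [if_neg hva, one_mul]
    by_cases hua : u = a
    · rw [hua, e₁, cmpSign_of_lt]
      · simp
      · rw [bot_lt_iff_ne_bot, ← e₁]
        exact fun h => hva ((G.endpointsFirst x hx).injective h)
    by_cases hvb : v = b
    · subst hvb
      rw [e₂, if_pos rfl, if_pos ⟨huv, hua⟩, G.endpointsFirst_of_ne x hx ⟨hua, huv.ne⟩]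
      exact if_neg fun h => not_lt_bot (WithBot.coe_lt_coe.1 h)
    rw [if_neg hvb, G.endpointsFirst_of_ne x hx ⟨hva, hvb⟩]
    by_cases hub : u = b
    · rw [hub, e₂]
      exact cmpSign_of_lt (WithBot.coe_lt_coe.2 (WithBot.bot_lt_coe _))
    · rw [G.endpointsFirst_of_ne x hx ⟨hua, hub⟩]
      exact cmpSign_of_lt (WithBot.coe_lt_coe.2 (WithBot.coe_lt_coe.2 huv))
  rw [orderSign_eq_prod]
  have h₁ : ∀ u, ∏ v, (if u < v then
      cmpSign (G.endpointsFirst x hx u) (G.endpointsFirst x hx v) else 1) =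
      (if u < a then -1 else 1) * (if u < b ∧ u ≠ a then -1 else 1) := fun u => by
    rw [Finset.prod_congr rfl fun v _ => key u v, Finset.prod_mul_distrib, Fintype.prod_ite_eq',
      Fintype.prod_ite_eq']
  rw [Finset.prod_congr rfl fun u _ => h₁ u, Finset.prod_mul_distrib]
  have h₂ : ∀ c : G.V, ∏ u, (if u < c then -1 else 1 : ℤˣ) = -1 * rankSign c := fun c => by
    refine prod_eq_ite_mul _ _ c (fun v hv => ?_) _ ?_
    · rcases hv.lt_or_gt with h | h
      · rw [if_pos h, cmpSign_of_gt h]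
      · rw [if_neg h.not_gt, cmpSign_of_lt h]
    · simp [cmpSign_self]
  have h₃ : ∏ u, (if u < b ∧ u ≠ a then -1 else 1 : ℤˣ) =
      (if a < b then -1 else 1) * ∏ u, (if u < b then -1 else 1 : ℤˣ) := by
    refine prod_eq_ite_mul _ _ a (fun v hv => by simp [hv]) _ ?_
    by_cases h : a < b <;> simp [h]
  have h₄ : (if a < b then -1 else 1 : ℤˣ) = cmpSign b a := by
    rcases hab.lt_or_gt with h | h
    · rw [if_pos h, cmpSign_of_gt h]
    · rw [if_neg h.not_gt, cmpSign_of_lt h]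
  rw [h₃, h₂, h₂, h₄, mul_left_comm, mul_mul_mul_comm]
  simp only [mul_neg, mul_one, neg_neg, one_mul]
  rfl

theorem contractSign_eq (x : G.H) (hx : G.vert x ≠ G.vert (G.inv x)) :
    G.contractSign x hx = G.dir x * (cmpSign (G.vert (G.inv x)) (G.vert x) *
      (rankSign (G.vert x) * rankSign (G.vert (G.inv x)))) := by
  rw [contractSign, orderSign_endpointsFirst]

/-- Reversing the edge and exchanging its endpoints each contribute −1. -/
theorem contractSign_inv (x : G.H) (hx : G.vert x ≠ G.vert (G.inv x))
    (hx' : G.vert (G.inv x) ≠ G.vert (G.inv (G.inv x))) :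
    G.contractSign (G.inv x) hx' = G.contractSign x hx := by
  rw [contractSign_eq, contractSign_eq]
  simp only [G.inv_inv]
  rw [G.dir_inv, cmpSign_swap hx.symm, mul_comm (rankSign (G.vert x))]
  simp

end OrientedGraph

namespace OGraph

open CyclicOperad

variable {O : CyclicOperad.{u}} (G : OGraph O)

/-- Over the vertices of `G` the value at the merged vertex is counted twice and cancels, being its
own inverse; the extra factor restores it. -/
theorem prod_contractV (x : G.H) (hx : G.vert x ≠ G.vert (G.inv x))
    (F : (G.contract x hx).V → ℤˣ) :
    ∏ w, F w = F (G.contractVert x hx (G.vert x)) * ∏ v, F (G.contractVert x hx v) := by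
  have h₀ := G.contractVert_of_eq x hx (.inl (rfl : G.vert x = G.vert x))
  have h₁ : ∏ w, F w = F (G.contractVert x hx (G.vert x)) *
      ∏ w : G.Rest x, F (G.contractVert x hx w.1) := by
    rw [h₀]
    refine (Fintype.prod_option (f := F)).trans (congrArg _ (Finset.prod_congr rfl fun w _ => ?_))
    rw [G.contractVert_of_ne x hx w.2]; rfl
  have h₂ : ∏ w : G.Rest x, F (G.contractVert x hx w.1) = ∏ v, F (G.contractVert x hx v) := by
    rw [prod_subtype_ite (fun u : G.V => u ≠ G.vert x ∧ u ≠ G.vert (G.inv x))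
      fun u => F (G.contractVert x hx u)]
    have hb : G.contractVert x hx (G.vert (G.inv x)) = G.contractVert x hx (G.vert x) :=
      (G.contractVert_of_eq x hx (.inr rfl)).trans h₀.symm
    rw [← Finset.mul_prod_erase _ _ (Finset.mem_univ (G.vert x)),
      ← Finset.mul_prod_erase _ _ (Finset.mem_erase.2 ⟨hx.symm, Finset.mem_univ _⟩),
      ← Finset.mul_prod_erase Finset.univ (fun v => F (G.contractVert x hx v))
        (Finset.mem_univ (G.vert x)),
      ← Finset.mul_prod_erase _ (fun v => F (G.contractVert x hx v))
        (Finset.mem_erase.2 ⟨hx.symm, Finset.mem_univ _⟩), hb,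
      ← mul_assoc (F (G.contractVert x hx (G.vert x))), Int.units_mul_self, one_mul]
    simp only [ne_eq, not_true_eq_false, false_and, and_false, if_false, one_mul]
    refine Finset.prod_congr rfl fun v hv => if_pos ?_
    rw [Finset.mem_erase, Finset.mem_erase] at hv
    exact ⟨hv.2.1, hv.1⟩
  rw [h₁, h₂]

variable {G}

theorem cmpSign_contractVert_of_eq {x : G.H} {hx : G.vert x ≠ G.vert (G.inv x)} {c u : G.V}
    (hc : c = G.vert x ∨ c = G.vert (G.inv x)) :
    cmpSign (G.contractVert x hx c) (G.contractVert x hx u) =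
      if u = G.vert x ∨ u = G.vert (G.inv x) then -1 else 1 := by
  unfold cmpSign
  simp only [contractVert_lt]
  split_ifs <;> tauto

theorem cmpSign_contractVert_of_ne {x : G.H} {hx : G.vert x ≠ G.vert (G.inv x)} {c u : G.V}
    (hc : c ≠ G.vert x ∧ c ≠ G.vert (G.inv x)) :
    cmpSign (G.contractVert x hx c) (G.contractVert x hx u) =
      if u = G.vert x ∨ u = G.vert (G.inv x) then -1 else cmpSign c u := by
  unfold cmpSign
  simp only [contractVert_lt]
  split_ifs <;> tauto

/-- The factors at `a` and `b` occur twice on the right and cancel, and on the left the two signs −1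
cancel. -/
theorem prod_two {V : Type} [Fintype V] [DecidableEq V] (F : V → ℤˣ) {a b : V} (hab : a ≠ b) :
    ∏ u, (if u = a ∨ u = b then -1 else F u) = F a * F b * ∏ u, F u := by
  rw [← Finset.mul_prod_erase _ _ (Finset.mem_univ a),
    ← Finset.mul_prod_erase _ _ (Finset.mem_erase.2 ⟨hab.symm, Finset.mem_univ _⟩),
    ← Finset.mul_prod_erase Finset.univ F (Finset.mem_univ a),
    ← Finset.mul_prod_erase _ F (Finset.mem_erase.2 ⟨hab.symm, Finset.mem_univ _⟩)]
  have : ∀ p q r : ℤˣ, p * q * (p * (q * r)) = r := fun p q r => by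
    rw [← mul_assoc p q r, ← mul_assoc, Int.units_mul_self, one_mul]
  rw [this, if_pos (.inl rfl), if_pos (.inr rfl), neg_one_mul, neg_one_mul, neg_neg]
  refine Finset.prod_congr rfl fun v hv => if_neg ?_
  rw [Finset.mem_erase, Finset.mem_erase] at hv
  tauto

theorem rankSign_contract_of_eq {x : G.H} {hx : G.vert x ≠ G.vert (G.inv x)} {c : G.V}
    (hc : c = G.vert x ∨ c = G.vert (G.inv x)) : rankSign (G.contractVert x hx c) = -1 := by
  unfold rankSign
  rw [prod_contractV, Finset.prod_congr rfl fun u _ => cmpSign_contractVert_of_eq hc,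
    prod_two (fun _ => 1) hx, cmpSign_contractVert_of_eq hc]
  simp

/-- The comparisons of `c` with the two endpoints drop out and are replaced by one comparison with
the merged vertex, which is below `c` and gives −1. -/
theorem rankSign_contract_of_ne {x : G.H} {hx : G.vert x ≠ G.vert (G.inv x)} {c : G.V}
    (hc : c ≠ G.vert x ∧ c ≠ G.vert (G.inv x)) : rankSign (G.contractVert x hx c) =
      -(cmpSign c (G.vert x) * cmpSign c (G.vert (G.inv x)) * rankSign c) := by
  unfold rankSign
  rw [prod_contractV, Finset.prod_congr rfl fun u _ => cmpSign_contractVert_of_ne hc,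
    prod_two (fun u => cmpSign c u) hx, cmpSign_contractVert_of_ne hc]
  simp

/-! ### The boundary operator is well defined -/

/-- A vertex off the collapsed edge keeps its spider; at an endpoint, linearity comes from the
bilinearity of mating. -/
theorem isMultilinear_collapse (Γ : OrientedGraph) (x : Γ.H) (v : Γ.V)
    (c₁ c₂ c₃ : ∀ v, O.Spider (Γ.Legs v)) (a b : ℝ)
    (h₂ : ∀ w, w ≠ v → c₂ w = c₁ w) (h₃ : ∀ w, w ≠ v → c₃ w = c₁ w)
    (h : c₁ v = a • c₂ v + b • c₃ v) :
    collapse ⟨Γ, c₁⟩ x = a • collapse ⟨Γ, c₂⟩ x + b • collapse ⟨Γ, c₃⟩ x := by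
  by_cases hx : Γ.vert x = Γ.vert (Γ.inv x)
  · have hs : ∀ c : (∀ v, O.Spider (Γ.Legs v)), collapse ⟨Γ, c⟩ x = 0 :=
      fun c => dif_neg (not_not_intro hx)
    rw [hs, hs, hs, smul_zero, smul_zero, add_zero]
  have hs : ∀ c : (∀ v, O.Spider (Γ.Legs v)), collapse ⟨Γ, c⟩ x = Γ.contractSign x hx •
      (contract ⟨Γ, c⟩ x hx).chain := fun c => dif_pos hx
  rw [hs, hs, hs, units_smul_real_comm, units_smul_real_comm, ← smul_add]
  congr 1
  have rest : ∀ c : (∀ v, O.Spider (Γ.Legs v)), (∀ w, w ≠ v → c w = c₁ w) →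
      ∀ w : Γ.Rest x, w.1 ≠ v → (contract ⟨Γ, c⟩ x hx).color (w : WithBot (Γ.Rest x)) =
        (contract ⟨Γ, c₁⟩ x hx).color (w : WithBot (Γ.Rest x)) := fun c hc w hw =>
    congrArg (O.spiderMap _) (hc w.1 hw)
  have bot : ∀ c : (∀ v, O.Spider (Γ.Legs v)), c (Γ.vert x) = c₁ (Γ.vert x) →
      c (Γ.vert (Γ.inv x)) = c₁ (Γ.vert (Γ.inv x)) →
      (contract ⟨Γ, c⟩ x hx).color (⊥ : WithBot (Γ.Rest x)) =
        (contract ⟨Γ, c₁⟩ x hx).color (⊥ : WithBot (Γ.Rest x)) := fun c h h' =>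
    congrArg (O.spiderMap _) (congrArg₂ (fun s t => O.mate _ _ s t) h h')
  by_cases hv : v ≠ Γ.vert x ∧ v ≠ Γ.vert (Γ.inv x)
  · refine isMultilinear_chain (Γ.contract x hx) ((⟨v, hv⟩ : Γ.Rest x) : WithBot (Γ.Rest x))
      _ _ _ a b ?_ ?_ ?_
    · rintro (_ | w) hw
      · exact bot c₂ (h₂ _ hv.1.symm) (h₂ _ hv.2.symm)
      · exact rest c₂ h₂ w fun e => hw (congrArg some (Subtype.ext e))
    · rintro (_ | w) hw
      · exact bot c₃ (h₃ _ hv.1.symm) (h₃ _ hv.2.symm)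
      · exact rest c₃ h₃ w fun e => hw (congrArg some (Subtype.ext e))
    · refine (congrArg (O.spiderMap _) h).trans ?_
      rw [map_add, map_smul, map_smul]
  · refine isMultilinear_chain (Γ.contract x hx) (⊥ : WithBot (Γ.Rest x)) _ _ _ a b ?_ ?_ ?_
    · rintro (_ | w) hw
      · exact (hw rfl).elim
      · exact rest c₂ h₂ w fun e => hv (e ▸ w.2)
    · rintro (_ | w) hw
      · exact (hw rfl).elim
      · exact rest c₃ h₃ w fun e => hv (e ▸ w.2)
    · by_cases hvx : v = Γ.vert x
      · subst hvx
        refine (congrArg (O.spiderMap _) (congrArg (fun s => O.mate _ _ s _) h)).trans ?_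
        rw [map_add, map_smul, map_smul, LinearMap.add_apply, LinearMap.smul_apply,
          LinearMap.smul_apply, map_add, map_smul, map_smul]
        exact congrArg₂ (fun s t => a • O.spiderMap _ (O.mate _ _ _ s) +
          b • O.spiderMap _ (O.mate _ _ _ t)) (h₂ _ (Ne.symm hx)).symm (h₃ _ (Ne.symm hx)).symm
      · obtain rfl : v = Γ.vert (Γ.inv x) := by tauto
        refine (congrArg (O.spiderMap _) (congrArg (fun s => O.mate _ _ _ s) h)).trans ?_
        rw [map_add, map_smul, map_smul, map_add, map_smul, map_smul]
        exact congrArg₂ (fun s t => a • O.spiderMap _ (O.mate _ _ s _) +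
          b • O.spiderMap _ (O.mate _ _ t _)) (h₂ _ hx).symm (h₃ _ hx).symm

/-- Both graphs carry the same half-edges and the same vertex ordering; the spiders at the merged
vertex agree because mating is symmetric. -/
theorem exists_contract_inv (x : G.H) (hx : G.vert x ≠ G.vert (G.inv x))
    (hx' : G.vert (G.inv x) ≠ G.vert (G.inv (G.inv x))) :
    ∃ g : Iso (G.contract x hx) (G.contract (G.inv x) hx'),
      (∀ h, G.contractIncl (G.inv x) hx' (g.onH h) = G.contractIncl x hx h) ∧ g.sign = 1 := by
  suffices hex : ∃ g : Iso (G.contract x hx) (G.contract (G.inv x) hx'),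
      ∀ h, G.contractIncl (G.inv x) hx' (g.onH h) = G.contractIncl x hx h by
    obtain ⟨g, hg⟩ := hex
    refine ⟨g, hg, g.sign_eq_one (fun h h' => ?_) fun h => ?_⟩
    · rw [vert_contract, vert_contract, vert_contract, vert_contract, contractVert_lt,
        contractVert_lt, hg, hg, G.inv_inv]
      tauto
    · rw [dir_contract, dir_contract, hg]
  refine exists_iso_of_embed (A := G.contract x hx) (B := G.contract (G.inv x) hx')
    (G.contractIncl x hx) (G.contractIncl (G.inv x) hx')
    (G.contractIncl_injective x hx) (G.contractIncl_injective _ hx') ?_ ?_ ?_ ?_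
  · rw [range_contractIncl, range_contractIncl, G.inv_inv]
    ext h
    exact and_comm
  · intro h g e
    rw [contractIncl_inv, contractIncl_inv, e]
  · intro h h' g g' e e'
    rw [vert_contract, vert_contract, vert_contract, vert_contract, contractVert_inj,
      contractVert_inj, ← e, ← e', G.inv_inv]
    tauto
  · intro h g e
    rw [spiderAt_contract, spiderAt_contract, ← e, mergedAt, mergedAt, G.inv_inv]
    refine if_congr or_comm ?_ rfl
    refine (SpiderIn.mate_comm ⟨by rw [legs_spiderAt]; rfl, by rw [legs_spiderAt]; rfl, ?_⟩
      (nontrivial_legs _ _) (nontrivial_legs _ _)).symm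
    rw [legs_spiderAt, legs_spiderAt, Set.disjoint_left]
    intro h e e'
    exact hx (e.symm.trans e')

theorem collapse_of_eq (x : G.H) (hx : G.vert x = G.vert (G.inv x)) : G.collapse x = 0 :=
  dif_neg (not_not_intro hx)

theorem collapse_of_ne (x : G.H) (hx : G.vert x ≠ G.vert (G.inv x)) :
    G.collapse x = G.contractSign x hx • (G.contract x hx).chain := dif_pos hx

theorem collapse_inv (x : G.H) : G.collapse (G.inv x) = G.collapse x := by
  by_cases hx : G.vert x = G.vert (G.inv x)
  · rw [collapse_of_eq x hx, collapse_of_eq _ (by rw [G.inv_inv, hx])]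
  · have hx' : G.vert (G.inv x) ≠ G.vert (G.inv (G.inv x)) := by rw [G.inv_inv]; exact Ne.symm hx
    obtain ⟨g, -, hg⟩ := exists_contract_inv x hx hx'
    rw [collapse_of_ne x hx, collapse_of_ne _ hx', isOriented_chain _ _ g, hg, one_smul,
      G.contractSign_inv x hx hx']

/-- Each edge has one initial and one terminal half-edge, and `F` takes the same value on both. Sums
over all half-edges avoid any reference to the direction. -/
theorem sum_dir_eq {M : Type*} [AddCommGroup M] [Module ℝ M] (F : G.H → M)
    (hF : ∀ h, F (G.inv h) = F h) : ∑ h with G.dir h = 1, F h = (1 / 2 : ℝ) • ∑ h, F h := by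
  have h₁ : ∑ h with ¬ G.dir h = 1, F h = ∑ h with G.dir h = 1, F h := by
    refine Finset.sum_bij' (fun h _ => G.inv h) (fun h _ => G.inv h) ?_ ?_
      (fun h _ => G.inv_inv h) (fun h _ => G.inv_inv h) fun h _ => (hF h).symm
    · intro h hh
      simp only [Finset.mem_filter, Finset.mem_univ, true_and] at hh ⊢
      rw [G.dir_inv, (Int.units_eq_one_or _).resolve_left hh, neg_neg]
    · intro h hh
      simp only [Finset.mem_filter, Finset.mem_univ, true_and] at hh ⊢
      rw [G.dir_inv, hh]
      decide
  rw [← Finset.sum_filter_add_sum_filter_not Finset.univ (fun h => G.dir h = 1), h₁, ← two_smul ℝ, smul_smul]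
  norm_num

theorem boundaryE_eq : G.boundaryE = (1 / 2 : ℝ) • ∑ x, G.collapse x :=
  sum_dir_eq _ collapse_inv

theorem isOriented_boundaryE : IsOriented (boundaryE : OGraph O → _) := by
  intro G G' f
  rw [boundaryE_eq, boundaryE_eq, ← units_smul_real_comm,
    Finset.sum_congr rfl fun x _ => f.collapse x, ← Finset.smul_sum,
    f.onH.sum_comp fun x => G'.collapse x]

theorem isMultilinear_boundaryE : IsMultilinear (boundaryE : OGraph O → _) := by
  intro Γ v c₁ c₂ c₃ a b h₂ h₃ h
  unfold boundaryE
  rw [Finset.smul_sum, Finset.smul_sum, ← Finset.sum_add_distrib]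
  exact Finset.sum_congr rfl fun x _ => isMultilinear_collapse Γ x v c₁ c₂ c₃ a b h₂ h₃ h

theorem boundaryE_chain (G : OGraph O) : Chains.boundaryE O G.chain = G.boundaryE :=
  extend_chain_of isOriented_boundaryE isMultilinear_boundaryE G

end OGraph

theorem sum_subtype_dite {X M : Type*} [AddCommMonoid M] [Fintype X] (p : X → Prop)
    [DecidablePred p] [inst : Fintype {x // p x}] (F : {x // p x} → M) :
    ∑ x, F x = ∑ x, if h : p x then F ⟨x, h⟩ else 0 := by
  have h := Finset.sum_subtype (p := p) (F := inst) (Finset.univ.filter p) (by simp)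
    (fun x => if h : p x then F ⟨x, h⟩ else 0)
  rw [Finset.sum_filter] at h
  refine Eq.trans ?_ (h.symm.trans (Finset.sum_congr rfl fun x _ => ?_))
  · exact Finset.sum_congr rfl fun x _ => by rw [dif_pos x.2]
  · by_cases hx : p x
    · rw [if_pos hx]
    · rw [if_neg hx, dif_neg hx]

namespace OGraph

open CyclicOperad

variable {O : CyclicOperad.{u}} {G : OGraph O}

/-! ### The boundary operator squares to zero -/

/-- A half-edge that remains after the collapse of an edge. -/
def contractMk (x : G.H) (hx : G.vert x ≠ G.vert (G.inv x)) (y : G.H)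
    (hy : y ≠ x ∧ y ≠ G.inv x) : (G.contract x hx).H := ⟨y, hy⟩

theorem contractIncl_mk (x : G.H) (hx : G.vert x ≠ G.vert (G.inv x)) (y : G.H)
    (hy : y ≠ x ∧ y ≠ G.inv x) : G.contractIncl x hx (contractMk x hx y hy) = y := rfl

theorem inv_ne_of_ne {x y : G.H} (hy : y ≠ x ∧ y ≠ G.inv x) :
    G.inv y ≠ x ∧ G.inv y ≠ G.inv x :=
  ⟨fun h => hy.2 (by rw [← h, G.inv_inv]), fun h => hy.1 (by rw [← G.inv_inv y, h, G.inv_inv])⟩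

theorem inv_contractMk (x : G.H) (hx : G.vert x ≠ G.vert (G.inv x)) (y : G.H)
    (hy : y ≠ x ∧ y ≠ G.inv x) : (G.contract x hx).inv (contractMk x hx y hy) =
      contractMk x hx (G.inv y) (inv_ne_of_ne hy) := rfl

theorem vert_contractMk (x : G.H) (hx : G.vert x ≠ G.vert (G.inv x)) (y : G.H)
    (hy : y ≠ x ∧ y ≠ G.inv x) : (G.contract x hx).vert (contractMk x hx y hy) =
      G.contractVert x hx (G.vert y) := rfl

/-- The successive collapse of two edges. -/
def collapseTwo (G : OGraph O) (x y : G.H) : Chains O :=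
  if hx : G.vert x ≠ G.vert (G.inv x) then
    if hy : y ≠ x ∧ y ≠ G.inv x then
      G.contractSign x hx • (G.contract x hx).collapse (contractMk x hx y hy)
    else 0
  else 0

theorem boundaryE_collapse (x : G.H) :
    Chains.boundaryE O (G.collapse x) = (1 / 2 : ℝ) • ∑ y, G.collapseTwo x y := by
  by_cases hx : G.vert x = G.vert (G.inv x)
  · simp [collapse_of_eq x hx, collapseTwo, hx]
  · rw [collapse_of_ne x hx, units_smul_comm, boundaryE_chain, boundaryE_eq,
      ← units_smul_real_comm, Finset.smul_sum]
    congr 1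
    refine (sum_subtype_dite (fun y => y ≠ x ∧ y ≠ G.inv x) _).trans
      (Finset.sum_congr rfl fun y _ => ?_)
    rw [collapseTwo, dif_pos hx]
    rfl

theorem collapseTwo_inv_left (x y : G.H) : G.collapseTwo (G.inv x) y = G.collapseTwo x y := by
  by_cases hx : G.vert x = G.vert (G.inv x)
  · simp [collapseTwo, hx, G.inv_inv]
  have hx' : G.vert (G.inv x) ≠ G.vert (G.inv (G.inv x)) := by rw [G.inv_inv]; exact Ne.symm hx
  by_cases hy : y ≠ x ∧ y ≠ G.inv x
  swap
  · rw [collapseTwo, collapseTwo, dif_pos hx, dif_pos hx', dif_neg hy, dif_neg]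
    rw [G.inv_inv]; tauto
  have hy' : y ≠ G.inv x ∧ y ≠ G.inv (G.inv x) := by rw [G.inv_inv]; exact hy.symm
  obtain ⟨g, hg, hs⟩ := exists_contract_inv x hx hx'
  rw [collapseTwo, collapseTwo, dif_pos hx, dif_pos hx', dif_pos hy, dif_pos hy',
    G.contractSign_inv x hx hx', g.collapse, hs, one_smul]
  congr 2
  exact (G.contractIncl_injective _ hx' ((hg _).trans rfl)).symm

theorem collapseTwo_inv_right (x y : G.H) : G.collapseTwo x (G.inv y) = G.collapseTwo x y := by
  unfold collapseTwo
  by_cases hx : G.vert x = G.vert (G.inv x)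
  · rw [dif_neg (not_not_intro hx), dif_neg (not_not_intro hx)]
  rw [dif_pos hx, dif_pos hx]
  by_cases hy : y ≠ x ∧ y ≠ G.inv x
  · rw [dif_pos hy, dif_pos (inv_ne_of_ne hy), ← inv_contractMk, collapse_inv]
  · rw [dif_neg hy, dif_neg]
    intro h
    have := inv_ne_of_ne h
    rw [G.inv_inv] at this
    exact hy this

/-- After the first collapse the second edge is a loop. This covers parallel edges as well as
original loops. -/
theorem collapseTwo_of_not (x y : G.H) (hx : G.vert x ≠ G.vert (G.inv x))
    (h : G.contractVert x hx (G.vert y) = G.contractVert x hx (G.vert (G.inv y))) :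
    G.collapseTwo x y = 0 := by
  rw [collapseTwo, dif_pos hx]
  by_cases hy : y ≠ x ∧ y ≠ G.inv x
  · rw [dif_pos hy, collapse_of_eq _ h, smul_zero]
  · rw [dif_neg hy]

/-- The spider at a vertex after the successive collapse of two edges. -/
def mergedTwiceAt (G : OGraph O) (x : G.H) (hx : G.vert x ≠ G.vert (G.inv x)) (y : G.H) (v : G.V) :
    O.SpiderIn G.H :=
  if G.contractVert x hx v = G.contractVert x hx (G.vert y) ∨
      G.contractVert x hx v = G.contractVert x hx (G.vert (G.inv y)) then
    SpiderIn.mate y (G.inv y) (G.mergedAt x (G.vert y)) (G.mergedAt x (G.vert (G.inv y)))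
  else G.mergedAt x v

section Twice

variable {x y : G.H} {hx : G.vert x ≠ G.vert (G.inv x)} {hyx : y ≠ x ∧ y ≠ G.inv x}
  {hxy : G.contractVert x hx (G.vert y) ≠ G.contractVert x hx (G.vert (G.inv y))}

/-- The graph obtained by the collapse of two edges. -/
def contractTwo (G : OGraph O) (x y : G.H) (hx : G.vert x ≠ G.vert (G.inv x))
    (hyx : y ≠ x ∧ y ≠ G.inv x)
    (hxy : G.contractVert x hx (G.vert y) ≠ G.contractVert x hx (G.vert (G.inv y))) : OGraph O :=
  (G.contract x hx).contract (contractMk x hx y hyx) hxy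

theorem collapseTwo_eq : G.collapseTwo x y = (G.contractSign x hx *
    (G.contract x hx).contractSign (contractMk x hx y hyx) hxy) •
      (G.contractTwo x y hx hyx hxy).chain := by
  rw [collapseTwo, dif_pos hx, dif_pos hyx, collapse_of_ne _ hxy, smul_smul]
  rfl

/-- The inclusion of the half-edges that remain after the collapse of two edges. -/
def contractTwoIncl (h : (G.contractTwo x y hx hyx hxy).H) : G.H :=
  G.contractIncl x hx ((G.contract x hx).contractIncl (contractMk x hx y hyx) hxy h)

theorem contractTwoIncl_injective :
    (contractTwoIncl : (G.contractTwo x y hx hyx hxy).H → G.H).Injective :=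
  (contractIncl_injective _ _ _).comp (contractIncl_injective _ _ _)

/-- The map on vertices induced by the collapse of two edges. -/
def contractTwoVert (v : G.V) : (G.contractTwo x y hx hyx hxy).V :=
  (G.contract x hx).contractVert (contractMk x hx y hyx) hxy (G.contractVert x hx v)

theorem vert_contractTwo (h : (G.contractTwo x y hx hyx hxy).H) :
    (G.contractTwo x y hx hyx hxy).vert h = contractTwoVert (G.vert (contractTwoIncl h)) := rfl

theorem contractTwoIncl_inv (h : (G.contractTwo x y hx hyx hxy).H) :
    contractTwoIncl ((G.contractTwo x y hx hyx hxy).inv h) = G.inv (contractTwoIncl h) := rfl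

theorem dir_contractTwo (h : (G.contractTwo x y hx hyx hxy).H) :
    (G.contractTwo x y hx hyx hxy).dir h = G.dir (contractTwoIncl h) := rfl

theorem range_contractTwoIncl :
    Set.range (contractTwoIncl : (G.contractTwo x y hx hyx hxy).H → G.H) =
      {h | (h ≠ x ∧ h ≠ G.inv x) ∧ h ≠ y ∧ h ≠ G.inv y} := by
  refine (Set.range_comp (G.contractIncl x hx) _).trans
    ((congrArg (Set.image _) (range_contractIncl _ _ _)).trans ?_)
  ext h
  constructor
  · rintro ⟨k, hk, rfl⟩
    exact ⟨k.2, fun e => hk.1 (Subtype.ext e), fun e => hk.2 (Subtype.ext e)⟩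
  · rintro ⟨h₁, h₂⟩
    exact ⟨contractMk x hx h h₁, ⟨fun e => h₂.1 (congrArg Subtype.val e),
      fun e => h₂.2 (congrArg Subtype.val e)⟩, rfl⟩

theorem contractTwoVert_inj {v w : G.V} :
    (contractTwoVert v : (G.contractTwo x y hx hyx hxy).V) = contractTwoVert w ↔
      G.contractVert x hx v = G.contractVert x hx w ∨
      ((G.contractVert x hx v = G.contractVert x hx (G.vert y) ∨
        G.contractVert x hx v = G.contractVert x hx (G.vert (G.inv y))) ∧
      (G.contractVert x hx w = G.contractVert x hx (G.vert y) ∨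
        G.contractVert x hx w = G.contractVert x hx (G.vert (G.inv y)))) :=
  contractVert_inj _ _ _

theorem contractTwoVert_lt {v w : G.V} :
    (contractTwoVert v : (G.contractTwo x y hx hyx hxy).V) < contractTwoVert w ↔
      (G.contractVert x hx w ≠ G.contractVert x hx (G.vert y) ∧
        G.contractVert x hx w ≠ G.contractVert x hx (G.vert (G.inv y))) ∧
      ((G.contractVert x hx v = G.contractVert x hx (G.vert y) ∨
        G.contractVert x hx v = G.contractVert x hx (G.vert (G.inv y))) ∨
      G.contractVert x hx v < G.contractVert x hx w) :=
  contractVert_lt _ _ _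

theorem spiderAt_contractTwo (h : (G.contractTwo x y hx hyx hxy).H) :
    ((G.contractTwo x y hx hyx hxy).spiderAt ((G.contractTwo x y hx hyx hxy).vert h)).map
      contractTwoIncl contractTwoIncl_injective =
      G.mergedTwiceAt x hx y (G.vert (contractTwoIncl h)) := by
  have key : ∀ v, ((G.contract x hx).spiderAt (G.contractVert x hx v)).map (G.contractIncl x hx)
      (G.contractIncl_injective x hx) = G.mergedAt x v := fun v => by
    obtain ⟨h, e⟩ := (G.contract x hx).vert_surjective (G.contractVert x hx v)
    rw [← e, spiderAt_contract]
    rw [vert_contract, contractVert_inj] at e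
    unfold mergedAt
    rcases e with e | e
    · rw [e]
    · rw [if_pos e.1, if_pos e.2]
  have h₁ := (G.contract x hx).spiderAt_contract (contractMk x hx y hyx) hxy h
  refine (SpiderIn.map_map _ ((G.contract x hx).contractIncl_injective _ _) _
    (G.contractIncl_injective x hx) _).symm.trans ?_
  refine (congrArg (SpiderIn.map _ (G.contractIncl_injective x hx)) h₁).trans ?_
  unfold mergedAt mergedTwiceAt
  rw [vert_contract, inv_contractMk, vert_contractMk, vert_contractMk]
  split_ifs with h₂ h₃ h₃
  · rw [SpiderIn.map_mate, key, key]
    · rfl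
    · refine ⟨by rw [legs_spiderAt]; rfl, by rw [legs_spiderAt]; rfl, ?_⟩
      rw [legs_spiderAt, legs_spiderAt, Set.disjoint_left]
      intro h e e'
      exact hxy (e.symm.trans e')
    · exact nontrivial_legs _ _
    · exact nontrivial_legs _ _
  · exact (h₃ h₂).elim
  · exact (h₂ h₃).elim
  · exact key _

/-- Both orders of collapse leave the same half-edges with the same directions. So it remains to
know that they identify the same vertices and produce the same spiders, and only the vertex ordering
contributes to the sign. -/
theorem exists_contractTwo_iso {hx : G.vert x ≠ G.vert (G.inv x)}
    {hyx : y ≠ x ∧ y ≠ G.inv x}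
    {hxy : G.contractVert x hx (G.vert y) ≠ G.contractVert x hx (G.vert (G.inv y))}
    {hy : G.vert y ≠ G.vert (G.inv y)} {hxy' : x ≠ y ∧ x ≠ G.inv y}
    {hyx' : G.contractVert y hy (G.vert x) ≠ G.contractVert y hy (G.vert (G.inv x))}
    (hV : ∀ v w, (contractTwoVert v : (G.contractTwo x y hx hyx hxy).V) = contractTwoVert w ↔
      (contractTwoVert v : (G.contractTwo y x hy hxy' hyx').V) = contractTwoVert w)
    (hm : ∀ v, G.mergedTwiceAt x hx y v = G.mergedTwiceAt y hy x v) :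
    ∃ f : Iso (G.contractTwo x y hx hyx hxy) (G.contractTwo y x hy hxy' hyx'),
      f.sign = orderSign f.onV ∧ ∀ v, f.onV (contractTwoVert v) = contractTwoVert v := by
  suffices hex : ∃ f : Iso (G.contractTwo x y hx hyx hxy) (G.contractTwo y x hy hxy' hyx'),
      ∀ h, contractTwoIncl (f.onH h) = contractTwoIncl h by
    obtain ⟨f, hf⟩ := hex
    refine ⟨f, ?_, fun v => ?_⟩
    · rw [f.sign_eq, edgeSign_of_dir, mul_one]
      intro h
      rw [dir_contractTwo, dir_contractTwo, hf]
    · obtain ⟨h, e⟩ := (G.contractTwo x y hx hyx hxy).vert_surjective (contractTwoVert v)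
      rw [← e, ← f.vert_onH, vert_contractTwo, hf]
      exact (hV _ _).1 e
  refine exists_iso_of_embed (A := G.contractTwo x y hx hyx hxy)
    (B := G.contractTwo y x hy hxy' hyx') contractTwoIncl contractTwoIncl
    contractTwoIncl_injective contractTwoIncl_injective ?_ ?_ ?_ ?_
  · rw [range_contractTwoIncl, range_contractTwoIncl]
    ext h
    exact and_comm
  · intro h g e
    rw [contractTwoIncl_inv, contractTwoIncl_inv, e]
  · intro h h' g g' e e'
    rw [vert_contractTwo, vert_contractTwo, vert_contractTwo, vert_contractTwo, hV, e, e']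
  · intro h g e
    rw [spiderAt_contractTwo, spiderAt_contractTwo, e, hm]

theorem contractSign_contract {hx : G.vert x ≠ G.vert (G.inv x)} {hyx : y ≠ x ∧ y ≠ G.inv x}
    {hxy : G.contractVert x hx (G.vert y) ≠ G.contractVert x hx (G.vert (G.inv y))} :
    (G.contract x hx).contractSign (contractMk x hx y hyx) hxy = G.dir y *
      (cmpSign (G.contractVert x hx (G.vert (G.inv y))) (G.contractVert x hx (G.vert y)) *
      (rankSign (G.contractVert x hx (G.vert y)) *
        rankSign (G.contractVert x hx (G.vert (G.inv y))))) :=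
  OrientedGraph.contractSign_eq _ _ _

theorem mateable_spiderAt (x y : G.H) (h : G.vert x ≠ G.vert y) :
    SpiderIn.Mateable x y (G.spiderAt (G.vert x)) (G.spiderAt (G.vert y)) := by
  refine ⟨by rw [legs_spiderAt]; rfl, by rw [legs_spiderAt]; rfl, ?_⟩
  rw [legs_spiderAt, legs_spiderAt, Set.disjoint_left]
  exact fun k e e' => h (e.symm.trans e')

/-- Two edges with exactly one common endpoint. -/
theorem collapseTwo_swap_of_eq (h₁ : G.vert x ≠ G.vert (G.inv x))
    (h₂ : G.vert y ≠ G.vert (G.inv y)) (h : G.vert (G.inv x) = G.vert y)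
    (h' : G.vert (G.inv y) ≠ G.vert x) : G.collapseTwo x y = -G.collapseTwo y x := by
  have h'' : G.vert (G.inv y) ≠ G.vert (G.inv x) := h ▸ h₂.symm
  have hyx : y ≠ x ∧ y ≠ G.inv x := ⟨fun e => h₁ (by rw [h, e]), fun e => h' (by rw [e, G.inv_inv])⟩
  have hxy : x ≠ y ∧ x ≠ G.inv y := ⟨hyx.1.symm, fun e => hyx.2 (by rw [e, G.inv_inv])⟩
  have hv : G.contractVert x h₁ (G.vert y) ≠ G.contractVert x h₁ (G.vert (G.inv y)) := by
    rw [Ne, contractVert_inj]; tauto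
  have hv' : G.contractVert y h₂ (G.vert x) ≠ G.contractVert y h₂ (G.vert (G.inv x)) := by
    rw [Ne, contractVert_inj, h]; grind
  have hm : ∀ v, G.mergedTwiceAt x h₁ y v = G.mergedTwiceAt y h₂ x v := by
    intro v
    unfold mergedTwiceAt mergedAt
    simp only [contractVert_inj]
    rw [← h]
    have m₁ := mateable_spiderAt x (G.inv x) h₁
    have m₂ := mateable_spiderAt y (G.inv y) h₂
    rw [← h] at m₂
    -- The spider at the common endpoint is the middle one of three that are mated in a row.
    have m₃ := SpiderIn.mate_assoc m₁ m₂ hyx.2 (by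
      rw [legs_spiderAt, legs_spiderAt, Set.disjoint_left]
      exact fun k e e' => h' (e'.symm.trans e)) (nontrivial_legs _ _) (nontrivial_legs _ _)
    by_cases e₁ : v = G.vert x <;> by_cases e₂ : v = G.vert (G.inv x) <;>
      by_cases e₃ : v = G.vert (G.inv y) <;>
      simp [e₁, e₂, e₃, h₁, h', h'', h₁.symm, h'.symm, h''.symm, m₃]
  obtain ⟨f, hf, hfv⟩ := exists_contractTwo_iso (hx := h₁) (hyx := hyx) (hxy := hv) (hy := h₂)
    (hxy' := hxy) (hyx' := hv') (fun v w => by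
      rw [contractTwoVert_inj, contractTwoVert_inj]
      simp only [contractVert_inj]
      grind) hm
  -- In both orders the three endpoints end up as a single vertex, which is first, and all other
  -- vertices keep their order.
  have hs : f.sign = 1 := by
    rw [hf]
    refine orderSign_of_strictMono _ fun v w hvw => ?_
    obtain ⟨v, rfl⟩ := (G.contractTwo x y _ _ _).vert_surjective v
    obtain ⟨w, rfl⟩ := (G.contractTwo x y _ _ _).vert_surjective w
    rw [vert_contractTwo, vert_contractTwo] at hvw ⊢
    rw [hfv, hfv]
    rw [contractTwoVert_lt] at hvw ⊢
    simp only [ne_eq, contractVert_inj, contractVert_lt] at hvw ⊢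
    grind
  rw [collapseTwo_eq (hx := h₁) (hyx := hyx) (hxy := hv),
    collapseTwo_eq (hx := h₂) (hyx := hxy) (hxy := hv'), isOriented_chain _ _ f, hs, one_smul,
    ← Units.neg_smul]
  congr 1
  -- The two products contain the same directions and rank signs, and the same comparisons of the
  -- three endpoints up to two reversals, which cancel. They differ in one sign: the merged vertex
  -- is the tail of `y` in one collapsed graph and the head of `x` in the other.
  rw [OrientedGraph.contractSign_eq, OrientedGraph.contractSign_eq, contractSign_contract,
    contractSign_contract, ← h, rankSign_contract_of_eq (.inr rfl), rankSign_contract_of_ne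
    ⟨h', h''⟩, rankSign_contract_of_eq (.inl h), rankSign_contract_of_ne (c := G.vert x)
    ⟨by rwa [← h], h'.symm⟩, cmpSign_contractVert_of_ne ⟨h', h''⟩, if_pos (.inr rfl),
    cmpSign_contractVert_of_eq (.inl h), if_neg (by rw [← h]; tauto), ← h, cmpSign_swap h₁.symm,
    cmpSign_swap h']
  simp only [mul_neg, neg_mul, neg_neg, one_mul, mul_one]
  ac_rfl

/-- Two edges without common endpoints. -/
theorem collapseTwo_swap_of_ne (h₁ : G.vert x ≠ G.vert (G.inv x))
    (h₂ : G.vert y ≠ G.vert (G.inv y))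
    (h : G.vert y ≠ G.vert x ∧ G.vert y ≠ G.vert (G.inv x))
    (h' : G.vert (G.inv y) ≠ G.vert x ∧ G.vert (G.inv y) ≠ G.vert (G.inv x)) :
    G.collapseTwo x y = -G.collapseTwo y x := by
  have hyx : y ≠ x ∧ y ≠ G.inv x := ⟨fun e => h.1 (by rw [e]), fun e => h.2 (by rw [e])⟩
  have hxy : x ≠ y ∧ x ≠ G.inv y := ⟨hyx.1.symm, fun e => hyx.2 (by rw [e, G.inv_inv])⟩
  have k : G.vert x ≠ G.vert y ∧ G.vert x ≠ G.vert (G.inv y) := ⟨h.1.symm, h'.1.symm⟩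
  have k' : G.vert (G.inv x) ≠ G.vert y ∧ G.vert (G.inv x) ≠ G.vert (G.inv y) :=
    ⟨h.2.symm, h'.2.symm⟩
  have hv : G.contractVert x h₁ (G.vert y) ≠ G.contractVert x h₁ (G.vert (G.inv y)) := by
    rw [Ne, contractVert_inj]; tauto
  have hv' : G.contractVert y h₂ (G.vert x) ≠ G.contractVert y h₂ (G.vert (G.inv x)) := by
    rw [Ne, contractVert_inj]; tauto
  have hm : ∀ v, G.mergedTwiceAt x h₁ y v = G.mergedTwiceAt y h₂ x v := by
    intro v
    unfold mergedTwiceAt mergedAt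
    simp only [contractVert_inj]
    grind
  have hV : ∀ v w, (contractTwoVert v : (G.contractTwo x y h₁ hyx hv).V) = contractTwoVert w ↔
      (contractTwoVert v : (G.contractTwo y x h₂ hxy hv').V) = contractTwoVert w := fun v w => by
    rw [contractTwoVert_inj, contractTwoVert_inj]
    simp only [contractVert_inj]
    grind
  obtain ⟨f, hf, hfv⟩ := exists_contractTwo_iso hV hm
  -- The edge collapsed last provides the first vertex and the other edge the second. So `f`
  -- exchanges the first two vertices and is monotone after a transposition.
  have hs : f.sign = -1 := by
    have hne : (contractTwoVert (G.vert x) : (G.contractTwo x y h₁ hyx hv).V) ≠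
        contractTwoVert (G.vert y) := by
      rw [Ne, contractTwoVert_inj]
      simp only [contractVert_inj]
      grind
    rw [hf]
    have hmono : StrictMono ((Equiv.swap (contractTwoVert (G.vert x))
        (contractTwoVert (G.vert y))).trans f.onV) := by
      intro v w hvw
      obtain ⟨v, rfl⟩ := (G.contractTwo x y _ _ _).vert_surjective v
      obtain ⟨w, rfl⟩ := (G.contractTwo x y _ _ _).vert_surjective w
      rw [vert_contractTwo, vert_contractTwo] at hvw ⊢
      generalize G.vert (contractTwoIncl v) = v at hvw ⊢
      generalize G.vert (contractTwoIncl w) = w at hvw ⊢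
      rw [Equiv.trans_apply, Equiv.trans_apply, Equiv.swap_apply_def, Equiv.swap_apply_def]
      rw [apply_ite f.onV, apply_ite f.onV, apply_ite f.onV, apply_ite f.onV, hfv, hfv, hfv, hfv]
      rw [contractTwoVert_lt] at hvw
      simp only [ne_eq, contractTwoVert_inj, contractVert_inj, contractVert_lt] at hvw ⊢
      split_ifs <;> rw [contractTwoVert_lt] <;> simp only [ne_eq, contractVert_inj, contractVert_lt] <;>
        grind
    have := orderSign_of_strictMono _ hmono
    rw [orderSign_trans, orderSign_swap _ _ hne] at this
    rw [neg_one_mul] at this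
    exact neg_eq_iff_eq_neg.1 this
  rw [collapseTwo_eq (hx := h₁) (hyx := hyx) (hxy := hv),
    collapseTwo_eq (hx := h₂) (hyx := hxy) (hxy := hv'), isOriented_chain _ _ f, hs, smul_smul,
    ← Units.neg_smul]
  congr 1
  -- Here the contraction signs agree: the comparisons of an endpoint of `x` with an endpoint of `y`
  -- are reversed, and there are four of them.
  rw [OrientedGraph.contractSign_eq, OrientedGraph.contractSign_eq, contractSign_contract,
    contractSign_contract, rankSign_contract_of_ne h, rankSign_contract_of_ne h',
    rankSign_contract_of_ne k, rankSign_contract_of_ne k', cmpSign_contractVert_of_ne h',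
    cmpSign_contractVert_of_ne k', if_neg (by tauto), if_neg (by tauto), cmpSign_swap k.1,
    cmpSign_swap k.2, cmpSign_swap k'.1, cmpSign_swap k'.2]
  simp only [mul_neg, neg_mul, neg_neg, mul_one]
  ac_rfl

end Twice

/-- Loops and edges with both endpoints in common contribute zero on both sides. If there is one
common endpoint, reversals of the edges, which do not affect `collapseTwo`, bring it to the head of
`x` and the tail of `y`. -/
theorem collapseTwo_swap (x y : G.H) : G.collapseTwo x y = -G.collapseTwo y x := by
  by_cases h₁ : G.vert x = G.vert (G.inv x)
  · have e : G.collapseTwo x y = 0 := dif_neg (not_not_intro h₁)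
    by_cases h₂ : G.vert y = G.vert (G.inv y)
    · have e' : G.collapseTwo y x = 0 := dif_neg (not_not_intro h₂)
      rw [e, e', neg_zero]
    · rw [e, collapseTwo_of_not y x h₂ (by rw [h₁]), neg_zero]
  by_cases h₂ : G.vert y = G.vert (G.inv y)
  · have e' : G.collapseTwo y x = 0 := dif_neg (not_not_intro h₂)
    rw [e', collapseTwo_of_not x y h₁ (by rw [h₂]), neg_zero]
  have hinv : ∀ z : G.H, G.inv (G.inv z) = z := G.inv_inv
  by_cases a₁ : G.vert y = G.vert x <;> by_cases a₂ : G.vert (G.inv y) = G.vert (G.inv x)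
  · rw [collapseTwo_of_not x y h₁ (by rw [contractVert_inj]; tauto),
      collapseTwo_of_not y x h₂ (by rw [contractVert_inj]; tauto), neg_zero]
  · rw [← collapseTwo_inv_left x y, ← collapseTwo_inv_right y x]
    refine collapseTwo_swap_of_eq ?_ h₂ ?_ a₂
    · rw [hinv]; exact Ne.symm h₁
    · rw [hinv, a₁]
  · rw [← collapseTwo_inv_right x y, ← collapseTwo_inv_left y x]
    refine collapseTwo_swap_of_eq h₁ ?_ a₂.symm ?_
    · rw [hinv]; exact Ne.symm h₂
    · rw [hinv]; exact a₁
  by_cases b₁ : G.vert y = G.vert (G.inv x) <;> by_cases b₂ : G.vert (G.inv y) = G.vert x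
  · rw [collapseTwo_of_not x y h₁ (by rw [contractVert_inj]; tauto),
      collapseTwo_of_not y x h₂ (by rw [contractVert_inj]; grind), neg_zero]
  · exact collapseTwo_swap_of_eq h₁ h₂ b₁.symm b₂
  · rw [← collapseTwo_inv_left x y, ← collapseTwo_inv_left y x, ← collapseTwo_inv_right (G.inv x),
      ← collapseTwo_inv_right (G.inv y)]
    refine collapseTwo_swap_of_eq ?_ ?_ ?_ ?_
    · rw [hinv]; exact Ne.symm h₁
    · rw [hinv]; exact Ne.symm h₂
    · rw [hinv, b₂]
    · rw [hinv]; exact b₁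
  · exact collapseTwo_swap_of_ne h₁ h₂ ⟨a₁, b₁⟩ ⟨b₂, a₂⟩

end OGraph

/-- The double sum over the half-edges is antisymmetric, so it equals its own negative. -/
theorem Chains.boundaryE_boundaryE (O : CyclicOperad.{u}) :
    Chains.boundaryE O ∘ₗ Chains.boundaryE O = 0 := by
  refine OGraph.chains_hom_ext fun G => ?_
  rw [LinearMap.comp_apply, OGraph.boundaryE_chain, OGraph.boundaryE_eq, map_smul, map_sum,
    Finset.sum_congr rfl fun x _ => G.boundaryE_collapse x, ← Finset.smul_sum]
  have h : ∑ x, ∑ y, G.collapseTwo x y = -∑ x, ∑ y, G.collapseTwo x y := by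
    conv_lhs => rw [Finset.sum_comm]
    rw [← Finset.sum_neg_distrib]
    refine Finset.sum_congr rfl fun x _ => ?_
    rw [← Finset.sum_neg_distrib]
    exact Finset.sum_congr rfl fun y _ => G.collapseTwo_swap y x
  rw [eq_neg_iff_add_eq_zero, ← two_smul ℝ] at h
  rw [(smul_eq_zero.1 h).resolve_left two_ne_zero, smul_zero, smul_zero]
  rfl

/-- A product over the edges splits off any two given edges. -/
theorem prod_dir_two {H M : Type*} [Fintype H] [DecidableEq H] [CommMonoid M] (inv : H → H)
    (inv_inv : ∀ h, inv (inv h) = h) (d : H → ℤˣ) (hd : ∀ h, d (inv h) = -d h) (φ : H → M)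
    (hφ : ∀ h, φ (inv h) = φ h) (x y : H) (hy : y ≠ x ∧ y ≠ inv x) :
    ∏ h with d h = 1, φ h = φ x * φ y *
      ∏ h with d h = 1, if (h = x ∨ h = inv x) ∨ h = y ∨ h = inv y then 1 else φ h := by
  have key : ∀ (φ : H → M) (hφ : ∀ h, φ (inv h) = φ h) (x : H), ∏ h with d h = 1, φ h =
      φ x * ∏ h with d h = 1, if h = x ∨ h = inv x then 1 else φ h := by
    intro φ hφ x
    rw [prod_dir_eq inv inv_inv d hd φ hφ x]
    congr 1
    rw [Finset.prod_filter, Finset.prod_filter]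
    refine Finset.prod_congr rfl fun h _ => ?_
    split_ifs <;> tauto
  have hc : ∀ h x, (inv h = x ∨ inv h = inv x) ↔ h = x ∨ h = inv x := by
    intro h x
    have h₁ : inv h = inv x ↔ h = x := ⟨fun e => by rw [← inv_inv h, e, inv_inv], fun e => e ▸ rfl⟩
    have h₂ : inv h = x ↔ h = inv x := ⟨fun e => by rw [← e, inv_inv], fun e => by rw [e, inv_inv]⟩
    rw [h₁, h₂, or_comm]
  rw [key φ hφ x, key _ (fun h => by simp only [hc, hφ]) y, if_neg (by tauto), mul_assoc]
  congr 2
  refine Finset.prod_congr rfl fun h _ => ?_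
  split_ifs <;> tauto

/-! ### The pairing of half-edges glued along π_{xy} -/

namespace OrientedGraph

variable {G : OrientedGraph} {x y : G.H}

/-- The involution of the half-edges of the graph glued along `π_{xy}`. -/
def reglueInv (x y h : G.H) : G.H :=
  if h = x then y else if h = y then x else if h = G.inv x then G.inv y else
    if h = G.inv y then G.inv x else G.inv h

/-- The directions of the edges of the graph glued along `π_{xy}`. -/
def reglueDir (x y h : G.H) : ℤˣ :=
  if h = x then -1 else if h = y then 1 else if h = G.inv x then 1 else
    if h = G.inv y then -1 else G.dir h

/-- The half-edges that are not affected by gluing along `π_{xy}`. -/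
def Apart (x y z : G.H) : Prop := (z ≠ x ∧ z ≠ G.inv x) ∧ z ≠ y ∧ z ≠ G.inv y

instance (x y z : G.H) : Decidable (Apart x y z) := inferInstanceAs (Decidable (_ ∧ _))

theorem not_apart {z : G.H} :
    ¬ Apart x y z ↔ (z = x ∨ z = G.inv x) ∨ z = y ∨ z = G.inv y := by
  unfold Apart; tauto

theorem reglueInv_left : reglueInv x y x = y := if_pos rfl

theorem reglueInv_right : reglueInv x y y = x := by
  unfold reglueInv
  grind

theorem reglueInv_inv_left (h : y ≠ G.inv x) : reglueInv x y (G.inv x) = G.inv y :=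
  (if_neg (G.inv_ne x)).trans ((if_neg h.symm).trans (if_pos rfl))

theorem reglueInv_of_apart {z : G.H} (hz : Apart x y z) : reglueInv x y z = G.inv z :=
  (if_neg hz.1.1).trans ((if_neg hz.2.1).trans ((if_neg hz.1.2).trans (if_neg hz.2.2)))

theorem reglueDir_of_apart {z : G.H} (hz : Apart x y z) : reglueDir x y z = G.dir z :=
  (if_neg hz.1.1).trans ((if_neg hz.2.1).trans ((if_neg hz.1.2).trans (if_neg hz.2.2)))

theorem reglueInv_inv (h₂ : y ≠ G.inv x) (z : G.H) :
    reglueInv (G.inv x) (G.inv y) z = reglueInv x y z := by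
  have := G.inv_inv
  have := G.inv_ne
  unfold reglueInv
  grind

theorem reglueSign_inv (x y : G.H) : G.reglueSign (G.inv x) (G.inv y) = G.reglueSign x y := by
  unfold reglueSign
  rw [G.inv_inv, G.dir_inv, G.dir_inv, neg_mul, mul_neg]

end OrientedGraph

namespace OGraph

open CyclicOperad OrientedGraph

variable {O : CyclicOperad.{u}} {G G' : OGraph O}

/-! ### The gluing operator -/

theorem Iso.edgeSign_eq (f : Iso G G') :
    edgeSign f.onH = ∏ h : G.H with G.dir h = 1, G.dir h * G'.dir (f.onH h) :=
  Finset.prod_congr rfl fun h hh => by rw [(Finset.mem_filter.1 hh).2, one_mul]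

theorem Iso.dir_mul_dir_inv (f : Iso G G') (h : G.H) :
    G.dir (G.inv h) * G'.dir (f.onH (G.inv h)) = G.dir h * G'.dir (f.onH h) := by
  rw [← f.inv_onH, G.dir_inv, G'.dir_inv, neg_mul_neg]

theorem Iso.apart_iff (f : Iso G G') (x y z : G.H) :
    Apart (f.onH x) (f.onH y) (f.onH z) ↔ Apart x y z := by
  unfold Apart
  rw [f.inv_onH, f.inv_onH]
  simp only [ne_eq, f.onH.apply_eq_iff_eq]

theorem Iso.reglueInv_onH (f : Iso G G') (x y h : G.H) :
    reglueInv (f.onH x) (f.onH y) (f.onH h) = f.onH (reglueInv x y h) := by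
  unfold reglueInv
  rw [f.inv_onH, f.inv_onH, f.inv_onH]
  simp only [f.onH.apply_eq_iff_eq, apply_ite f.onH]

/-- The new edges have prescribed directions, so they contribute nothing to the sign of the glued
isomorphism. For `f`, the edges of `x` and `y` contribute the comparison of their directions in `G`
and `G'`, and this is the quotient of the two values of `reglueSign`. -/
theorem Iso.exists_reglue (f : Iso G G') (x y : G.H) (h₁ : y ≠ x) (h₂ : y ≠ G.inv x)
    (h₁' : f.onH y ≠ f.onH x) (h₂' : f.onH y ≠ G'.inv (f.onH x)) :
    ∃ g : Iso (G.reglue x y h₁ h₂) (G'.reglue (f.onH x) (f.onH y) h₁' h₂'),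
      G.reglueSign x y * g.sign = f.sign * G'.reglueSign (f.onH x) (f.onH y) := by
  let g : Iso (G.reglue x y h₁ h₂) (G'.reglue (f.onH x) (f.onH y) h₁' h₂') :=
    ⟨f.onV, f.onH, f.vert_onH, f.reglueInv_onH x y, f.color_onV⟩
  refine ⟨g, ?_⟩
  have hg : g.sign = orderSign f.onV * ∏ h : G.H with reglueDir x y h = 1,
      reglueDir x y h * reglueDir (f.onH x) (f.onH y) (f.onH h) :=
    congrArg (orderSign f.onV * ·) g.edgeSign_eq
  have h₃ : (∏ h : G.H with reglueDir x y h = 1,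
      reglueDir x y h * reglueDir (f.onH x) (f.onH y) (f.onH h)) =
      ∏ h with G.dir h = 1, if (h = x ∨ h = G.inv x) ∨ h = y ∨ h = G.inv y then 1 else
        G.dir h * G'.dir (f.onH h) := by
    rw [Finset.prod_filter, Finset.prod_filter]
    refine Finset.prod_congr rfl fun h _ => ?_
    by_cases hh : Apart x y h
    · rw [if_neg (mt not_apart.2 (not_not_intro hh)), reglueDir_of_apart hh,
        reglueDir_of_apart ((f.apart_iff x y h).2 hh)]
    · have e₁ : reglueDir x y h * reglueDir (f.onH x) (f.onH y) (f.onH h) = 1 := by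
        unfold reglueDir
        rw [f.inv_onH, f.inv_onH]
        simp only [f.onH.apply_eq_iff_eq]
        rw [not_apart] at hh
        split_ifs <;> first | rfl | tauto
      rw [if_pos (not_apart.1 hh), ite_self, e₁, ite_self]
  have h₄ : G.reglueSign x y * G'.reglueSign (f.onH x) (f.onH y) =
      (G.dir x * G'.dir (f.onH x)) * (G.dir y * G'.dir (f.onH y)) := by
    rw [← f.dir_mul_dir_inv y, ← f.inv_onH]
    exact mul_mul_mul_comm _ _ _ _
  have h₅ : ∀ a b o p q r : ℤˣ, a * b = p * q → a * (o * r) = o * (p * q * r) * b := by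
    intro a b o p q r h
    rw [← h]
    calc a * (o * r) = a * (o * r) * (b * b) := by rw [Int.units_mul_self, mul_one]
      _ = _ := by ac_rfl
  rw [f.sign_eq, f.edgeSign_eq,
    prod_dir_two G.inv G.inv_inv G.dir G.dir_inv _ f.dir_mul_dir_inv x y ⟨h₁, h₂⟩, hg, h₃]
  exact h₅ _ _ _ _ _ _ h₄

/-- The pairs `x`, `y` and `x̄`, `ȳ` define the same pairing. Both new edges receive the opposite
direction, and the two signs cancel. -/
theorem exists_reglue_inv (x y : G.H) (h₁ : y ≠ x) (h₂ : y ≠ G.inv x)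
    (h₁' : G.inv y ≠ G.inv x) (h₂' : G.inv y ≠ G.inv (G.inv x)) :
    ∃ g : Iso (G.reglue x y h₁ h₂) (G.reglue (G.inv x) (G.inv y) h₁' h₂'),
      (∀ h : G.H, g.onH h = h) ∧ (∀ v : G.V, g.onV v = v) ∧ g.sign = 1 := by
  let g : Iso (G.reglue x y h₁ h₂) (G.reglue (G.inv x) (G.inv y) h₁' h₂') :=
    ⟨Equiv.refl G.V, Equiv.refl G.H, fun _ => rfl, reglueInv_inv h₂,
      fun v => (O.spiderMap_refl _).symm⟩
  refine ⟨g, fun _ => rfl, fun _ => rfl, ?_⟩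
  have ho : orderSign (Equiv.refl G.V) = 1 := orderSign_of_strictMono _ fun _ _ h => h
  let φ : G.H → ℤˣ := fun h => reglueDir x y h * reglueDir (G.inv x) (G.inv y) h
  have hp : (∏ h : G.H with reglueDir x y h = 1, φ h) = 1 := by
    have i₁ := G.inv_inv
    have i₂ := G.inv_ne
    have hφ : ∀ h, φ h = if Apart x y h then 1 else -1 := by
      intro h
      show reglueDir x y h * reglueDir (G.inv x) (G.inv y) h = _
      by_cases hh : Apart x y h
      · have hh' : Apart (G.inv x) (G.inv y) h := by
          unfold Apart at hh ⊢
          rw [i₁, i₁]; tauto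
        rw [if_pos hh, reglueDir_of_apart hh, reglueDir_of_apart hh', Int.units_mul_self]
      · rw [if_neg hh]
        rw [not_apart] at hh
        unfold reglueDir
        rw [i₁, i₁]
        split_ifs <;> first | (exfalso; grind) | simp
    have hφi : ∀ h, φ (reglueInv x y h) = φ h := fun h => by
      have e := reglueInv_inv h₂ h
      have e₁ : reglueDir x y (reglueInv x y h) = -reglueDir x y h :=
        (G.reglue x y h₁ h₂).dir_inv h
      have e₂ : reglueDir (G.inv x) (G.inv y) (reglueInv (G.inv x) (G.inv y) h) =
        -reglueDir (G.inv x) (G.inv y) h := (G.reglue (G.inv x) (G.inv y) h₁' h₂').dir_inv h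
      rw [e] at e₂
      show reglueDir x y _ * reglueDir (G.inv x) (G.inv y) _ = _
      rw [e₁, e₂, neg_mul_neg]
    have := prod_dir_two (reglueInv x y) (G.reglue x y h₁ h₂).inv_inv
      (reglueDir x y) (G.reglue x y h₁ h₂).dir_inv φ hφi x (G.inv x)
      ⟨G.inv_ne x, by rw [reglueInv_left]; exact h₂.symm⟩
    rw [this, hφ, hφ, if_neg (by unfold Apart; tauto), if_neg (by unfold Apart; tauto),
      reglueInv_left, reglueInv_inv_left h₂, neg_mul_neg, one_mul, one_mul]
    refine Finset.prod_eq_one fun h _ => ?_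
    split_ifs with hh
    · rfl
    · rw [hφ, if_pos (by unfold Apart; tauto)]
  exact (congrArg (orderSign (Equiv.refl G.V) * ·) g.edgeSign_eq).trans
    ((congrArg₂ (· * ·) ho hp).trans (one_mul 1))

/-- One quarter of the signed sum of the graphs `G^{π_{xy}}` over all ordered pairs of half-edges,
that is, their sum over the unordered pairs of edges. -/
def reglueSum (G : OGraph O) : Chains O :=
  (1 / 4 : ℝ) • ∑ x : G.H, ∑ y : G.H, if h : y ≠ x ∧ y ≠ G.inv x then
    G.reglueSign x y • (G.reglue x y h.1 h.2).chain else 0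

theorem isOriented_reglueSum : IsOriented (reglueSum : OGraph O → _) := by
  intro G G' f
  unfold reglueSum
  rw [← units_smul_real_comm]
  congr 1
  rw [Finset.smul_sum, ← f.onH.sum_comp]
  refine Finset.sum_congr rfl fun x _ => ?_
  rw [Finset.smul_sum, ← f.onH.sum_comp]
  refine Finset.sum_congr rfl fun y _ => ?_
  by_cases h : y ≠ x ∧ y ≠ G.inv x
  · have h' : f.onH y ≠ f.onH x ∧ f.onH y ≠ G'.inv (f.onH x) := by
      rw [f.inv_onH]; simpa only [ne_eq, f.onH.apply_eq_iff_eq] using h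
    obtain ⟨g, hg⟩ := f.exists_reglue x y h.1 h.2 h'.1 h'.2
    rw [dif_pos h, dif_pos h', isOriented_chain _ _ g, smul_smul, hg, smul_smul]
  · rw [dif_neg h, dif_neg, smul_zero]
    rw [f.inv_onH]; simpa only [ne_eq, f.onH.apply_eq_iff_eq] using h

theorem isMultilinear_reglueSum : IsMultilinear (reglueSum : OGraph O → _) := by
  intro Γ v c₁ c₂ c₃ a b h₂ h₃ h
  unfold reglueSum
  rw [smul_comm a, smul_comm b, ← smul_add]
  congr 1
  rw [Finset.smul_sum, Finset.smul_sum, ← Finset.sum_add_distrib]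
  refine Finset.sum_congr rfl fun x _ => ?_
  rw [Finset.smul_sum, Finset.smul_sum, ← Finset.sum_add_distrib]
  refine Finset.sum_congr rfl fun y _ => ?_
  by_cases hh : y ≠ x ∧ y ≠ Γ.inv x
  · have hs : ∀ c : (∀ v, O.Spider (Γ.Legs v)), (if h : y ≠ x ∧ y ≠ Γ.inv x then
        Γ.reglueSign x y • (reglue ⟨Γ, c⟩ x y h.1 h.2).chain else 0) =
        Γ.reglueSign x y • (reglue ⟨Γ, c⟩ x y hh.1 hh.2).chain := fun c => dif_pos hh
    refine (hs c₁).trans (Eq.trans ?_ (congrArg₂ (fun s t => a • s + b • t) (hs c₂) (hs c₃)).symm)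
    rw [units_smul_real_comm, units_smul_real_comm, ← smul_add]
    congr 1
    exact isMultilinear_chain (Γ.reglue x y hh.1 hh.2) v c₁ c₂ c₃ a b h₂ h₃ h
  · have hs : ∀ c : (∀ v, O.Spider (Γ.Legs v)), (if h : y ≠ x ∧ y ≠ Γ.inv x then
        Γ.reglueSign x y • (reglue ⟨Γ, c⟩ x y h.1 h.2).chain else 0) = 0 := fun c => dif_neg hh
    refine (hs c₁).trans (Eq.trans ?_ (congrArg₂ (fun s t => a • s + b • t) (hs c₂) (hs c₃)).symm)
    rw [smul_zero, smul_zero, add_zero]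

end OGraph

/-- The gluing operator on chains. -/
def Chains.reglueSum (O : CyclicOperad.{u}) : Chains O →ₗ[ℝ] Chains O :=
  extend fun G => G.reglueSum

namespace OGraph

open CyclicOperad

variable {O : CyclicOperad.{u}} {G G' : OGraph O}

theorem reglueSum_chain (G : OGraph O) : Chains.reglueSum O G.chain = G.reglueSum :=
  extend_chain_of isOriented_reglueSum isMultilinear_reglueSum G

end OGraph

theorem sum_four {H M : Type*} [Fintype H] [DecidableEq H] [AddCommGroup M] (F : H → M)
    (a b c d : H) (hab : a ≠ b) (hac : a ≠ c) (had : a ≠ d) (hbc : b ≠ c) (hbd : b ≠ d)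
    (hcd : c ≠ d) : ∑ h, F h =
      (∑ h, if (h = a ∨ h = b) ∨ h = c ∨ h = d then 0 else F h) + (F a + F b + (F c + F d)) := by
  rw [← sub_eq_iff_eq_add', ← Finset.sum_sub_distrib,
    ← Finset.sum_subset (Finset.subset_univ {a, b, c, d})]
  · rw [Finset.sum_insert (by simp [*]), Finset.sum_insert (by simp [*]),
      Finset.sum_pair hcd]
    simp [*, add_assoc]
  · intro h _ hh
    simp only [Finset.mem_insert, Finset.mem_singleton, not_or] at hh
    rw [if_neg (by tauto), sub_self]

namespace OGraph

open CyclicOperad OrientedGraph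

variable {O : CyclicOperad.{u}} {G G' : OGraph O}

/-- Gluing along `π_{xy}`, followed by the collapse of the edge of `z`. -/
def reglueCollapse (G : OGraph O) (x y z : G.H) : Chains O :=
  if h : y ≠ x ∧ y ≠ G.inv x then G.reglueSign x y • (G.reglue x y h.1 h.2).collapse z else 0

/-- In the glued graph `x` and `y` are the two halves of one edge. -/
theorem reglueCollapse_right (x y : G.H) : G.reglueCollapse x y y = G.reglueCollapse x y x := by
  by_cases h : y ≠ x ∧ y ≠ G.inv x
  · rw [reglueCollapse, reglueCollapse, dif_pos h, dif_pos h]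
    congr 1
    exact (congrArg (G.reglue x y h.1 h.2).collapse
      (reglueInv_left (G := G.toOrientedGraph) (x := x) (y := y))).symm.trans
      (collapse_inv (G := G.reglue x y h.1 h.2) x)
  · rw [reglueCollapse, reglueCollapse, dif_neg h, dif_neg h]

theorem reglueCollapse_inv_right (x y : G.H) :
    G.reglueCollapse x y (G.inv y) = G.reglueCollapse x y (G.inv x) := by
  by_cases h : y ≠ x ∧ y ≠ G.inv x
  · rw [reglueCollapse, reglueCollapse, dif_pos h, dif_pos h]
    congr 1
    exact (congrArg (G.reglue x y h.1 h.2).collapse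
      (reglueInv_inv_left (G := G.toOrientedGraph) h.2)).symm.trans
      (collapse_inv (G := G.reglue x y h.1 h.2) (G.inv x))
  · rw [reglueCollapse, reglueCollapse, dif_neg h, dif_neg h]

theorem inv_inj {x y : G.H} : G.inv x = G.inv y ↔ x = y :=
  ⟨fun h => by rw [← G.inv_inv x, h, G.inv_inv], fun h => by rw [h]⟩

theorem reglueCollapse_inv_inv (x y z : G.H) :
    G.reglueCollapse (G.inv x) (G.inv y) z = G.reglueCollapse x y z := by
  have hiff : (G.inv y ≠ G.inv x ∧ G.inv y ≠ G.inv (G.inv x)) ↔ y ≠ x ∧ y ≠ G.inv x := by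
    simp only [ne_eq, inv_inj]
  by_cases h : y ≠ x ∧ y ≠ G.inv x
  · have h' := hiff.2 h
    obtain ⟨g, hg, -, hs⟩ := exists_reglue_inv x y h.1 h.2 h'.1 h'.2
    rw [reglueCollapse, reglueCollapse, dif_pos h, dif_pos h', reglueSign_inv]
    congr 1
    have := g.collapse z
    rw [hs, one_smul] at this
    exact (this.trans (congrArg _ (hg z))).symm
  · rw [reglueCollapse, reglueCollapse, dif_neg h, dif_neg (mt hiff.1 h)]

/-- Passing to `x̄`, `ȳ` exchanges the two new edges of the same glued graph, so both contribute
equally to the total. -/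
theorem sum_reglueCollapse_inv :
    ∑ x, ∑ y, G.reglueCollapse x y (G.inv x) = ∑ x, ∑ y, G.reglueCollapse x y x := by
  let e : G.H ≃ G.H := ⟨G.inv, G.inv, G.inv_inv, G.inv_inv⟩
  rw [← e.sum_comp]
  refine Finset.sum_congr rfl fun x _ => ?_
  rw [← e.sum_comp]
  refine Finset.sum_congr rfl fun y _ => ?_
  show G.reglueCollapse (G.inv x) (G.inv y) (G.inv (G.inv x)) = _
  rw [reglueCollapse_inv_inv, G.inv_inv]

/-- Gluing changes neither the vertices nor the direction or the endpoints of an edge it does not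
touch. -/
theorem contractSign_reglue (x y z : G.H) (h : y ≠ x ∧ y ≠ G.inv x) (hz : Apart x y z)
    (h₁ : G.vert z ≠ G.vert (G.inv z))
    (h₂ : (G.reglue x y h.1 h.2).vert z ≠
      (G.reglue x y h.1 h.2).vert ((G.reglue x y h.1 h.2).inv z)) :
    (G.reglue x y h.1 h.2).contractSign z h₂ = G.contractSign z h₁ := by
  rw [G.contractSign_eq]
  refine ((G.reglue x y h.1 h.2).contractSign_eq z h₂).trans ?_
  have e₁ : reglueInv x y z = G.inv z := reglueInv_of_apart hz
  have e₂ : reglueDir x y z = G.dir z := reglueDir_of_apart hz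
  show reglueDir x y z * (cmpSign (G.vert (reglueInv x y z)) (G.vert z) *
    (rankSign (G.vert z) * rankSign (G.vert (reglueInv x y z)))) = _
  rw [e₁, e₂]

theorem contractMk_iff (z : G.H) (hz : G.vert z ≠ G.vert (G.inv z)) (b : (G.contract z hz).H)
    (w : G.H) (hw : w ≠ z ∧ w ≠ G.inv z) :
    b = contractMk z hz w hw ↔ G.contractIncl z hz b = w :=
  ⟨fun e => by rw [e]; rfl, fun e => G.contractIncl_injective z hz e⟩

theorem contractIncl_reglueInv (x y z : G.H) (hz : G.vert z ≠ G.vert (G.inv z))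
    (hx : x ≠ z ∧ x ≠ G.inv z) (hy : y ≠ z ∧ y ≠ G.inv z) (b : (G.contract z hz).H) :
    G.contractIncl z hz (reglueInv (contractMk z hz x hx) (contractMk z hz y hy) b) =
      reglueInv x y (G.contractIncl z hz b) := by
  unfold reglueInv
  rw [inv_contractMk, inv_contractMk]
  simp only [contractMk_iff, apply_ite (G.contractIncl z hz)]
  rfl

theorem reglueDir_contractMk (x y z : G.H) (hz : G.vert z ≠ G.vert (G.inv z))
    (hx : x ≠ z ∧ x ≠ G.inv z) (hy : y ≠ z ∧ y ≠ G.inv z) (b : (G.contract z hz).H) :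
    reglueDir (contractMk z hz x hx) (contractMk z hz y hy) b =
      reglueDir x y (G.contractIncl z hz b) := by
  unfold reglueDir
  rw [inv_contractMk, inv_contractMk]
  simp only [contractMk_iff]
  rfl

/-- The gluing and the collapse involve different half-edges. In either order what remains are the
half-edges of `G` other than those of `z`, paired and directed as for π_{xy}, with the endpoints of
`z` merged. -/
theorem chain_contract_reglue (x y z : G.H) (h : y ≠ x ∧ y ≠ G.inv x) (hz : Apart x y z)
    (hx : x ≠ z ∧ x ≠ G.inv z) (hy : y ≠ z ∧ y ≠ G.inv z)
    (h₁ : G.vert z ≠ G.vert (G.inv z))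
    (h₂ : (G.reglue x y h.1 h.2).vert z ≠
      (G.reglue x y h.1 h.2).vert ((G.reglue x y h.1 h.2).inv z))
    (h' : contractMk z h₁ y hy ≠ contractMk z h₁ x hx ∧
      contractMk z h₁ y hy ≠ (G.contract z h₁).inv (contractMk z h₁ x hx)) :
    ((G.reglue x y h.1 h.2).contract z h₂).chain =
      ((G.contract z h₁).reglue (contractMk z h₁ x hx) (contractMk z h₁ y hy) h'.1 h'.2).chain := by
  have e₁ : reglueInv x y z = G.inv z := reglueInv_of_apart hz
  let j : ((G.reglue x y h.1 h.2).contract z h₂).H → G.H :=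
    (G.reglue x y h.1 h.2).contractIncl z h₂
  let k : ((G.contract z h₁).reglue (contractMk z h₁ x hx) (contractMk z h₁ y hy) h'.1 h'.2).H →
    G.H := G.contractIncl z h₁
  have jinj : ∀ v w : G.V, (G.reglue x y h.1 h.2).contractVert z h₂ v =
      (G.reglue x y h.1 h.2).contractVert z h₂ w ↔
      G.contractVert z h₁ v = G.contractVert z h₁ w := fun v w => by
    refine ((G.reglue x y h.1 h.2).contractVert_inj z h₂).trans ?_
    rw [contractVert_inj, ← e₁]
    rfl
  have jlt : ∀ v w : G.V, (G.reglue x y h.1 h.2).contractVert z h₂ v <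
      (G.reglue x y h.1 h.2).contractVert z h₂ w ↔
      G.contractVert z h₁ v < G.contractVert z h₁ w := fun v w => by
    refine ((G.reglue x y h.1 h.2).contractVert_lt z h₂).trans ?_
    rw [contractVert_lt, ← e₁]
    rfl
  refine chain_eq_of_embed (U := G.H) j k (contractIncl_injective _ _ _)
    (contractIncl_injective _ _ _) ?_ ?_ ?_ ?_ ?_ ?_
  · refine ((G.reglue x y h.1 h.2).range_contractIncl z h₂).trans
      (Eq.trans ?_ (G.range_contractIncl z h₁).symm)
    ext a
    show (a ≠ z ∧ a ≠ reglueInv x y z) ↔ _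
    rw [e₁]; rfl
  · intro a b e
    refine Eq.trans ?_ (contractIncl_reglueInv x y z h₁ hx hy b).symm
    exact congrArg (reglueInv x y) e
  · intro a a' b b' e e'
    refine (jinj (G.vert (j a)) (G.vert (j a'))).trans ?_
    rw [e, e']
    rfl
  · intro a b e
    refine ((G.reglue x y h.1 h.2).spiderAt_contract z h₂ a).trans
      (Eq.trans ?_ (G.spiderAt_contract z h₁ b).symm)
    show (G.reglue x y h.1 h.2).mergedAt z (G.vert (j a)) = G.mergedAt z (G.vert (k b))
    rw [e]
    unfold mergedAt
    rw [← e₁]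
    rfl
  · intro a a' b b' e e' hlt
    have := (jlt (G.vert (j a)) (G.vert (j a'))).1 hlt
    rw [e, e'] at this
    exact this
  · intro a b e
    refine (reglueDir_contractMk x y z h₁ hx hy b).trans ?_
    exact congrArg (reglueDir x y) e.symm

/-- The term of `R ∂_E` given by a pair of half-edges and an edge. -/
theorem reglueSum_collapse (z : G.H) : Chains.reglueSum O (G.collapse z) =
    (1 / 4 : ℝ) • ∑ x, ∑ y, if (z = x ∨ z = G.inv x) ∨ z = y ∨ z = G.inv y then 0 else
      G.reglueCollapse x y z := by
  have hsymm : ∀ w : G.H, (w ≠ z ∧ w ≠ G.inv z) ↔ ¬(z = w ∨ z = G.inv w) := fun w => by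
    have : w = G.inv z ↔ z = G.inv w := ⟨fun e => by rw [e, G.inv_inv], fun e => by rw [e, G.inv_inv]⟩
    rw [ne_eq, ne_eq, this, eq_comm (a := w)]
    tauto
  -- An edge not touched by the gluing is a loop of the glued graph exactly if it is a loop of `G`,
  -- so in this case all terms vanish on both sides.
  by_cases hz : G.vert z = G.vert (G.inv z)
  · rw [collapse_of_eq z hz, map_zero]
    refine Eq.symm (smul_eq_zero.2 (.inr (Finset.sum_eq_zero fun x _ =>
      Finset.sum_eq_zero fun y _ => ?_)))
    split_ifs with hap
    · rfl
    unfold reglueCollapse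
    split_ifs with h
    · refine (congrArg _ (collapse_of_eq (G := G.reglue x y h.1 h.2) z ?_)).trans (smul_zero _)
      show G.vert z = G.vert (reglueInv x y z)
      rw [reglueInv_of_apart (by by_contra hc; exact hap (not_apart.1 hc)), hz]
    · rfl
  · rw [collapse_of_ne z hz, units_smul_comm, reglueSum_chain, reglueSum, ← units_smul_real_comm,
      Finset.smul_sum]
    congr 1
    refine (sum_subtype_dite (fun x => x ≠ z ∧ x ≠ G.inv z) _).trans
      (Finset.sum_congr rfl fun x _ => ?_)
    by_cases hx : x ≠ z ∧ x ≠ G.inv z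
    swap
    · rw [dif_neg hx]
      refine (Finset.sum_eq_zero fun y _ => if_pos (.inl ?_)).symm
      rw [hsymm] at hx; tauto
    rw [dif_pos hx, Finset.smul_sum]
    refine (sum_subtype_dite (fun y => y ≠ z ∧ y ≠ G.inv z) _).trans
      (Finset.sum_congr rfl fun y _ => ?_)
    by_cases hy : y ≠ z ∧ y ≠ G.inv z
    swap
    · rw [dif_neg hy]
      refine (if_pos (.inr ?_)).symm
      rw [hsymm] at hy; tauto
    rw [dif_pos hy, if_neg (by rw [hsymm] at hx hy; tauto)]
    have hap : Apart x y z := by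
      by_contra hc; rw [not_apart] at hc; rw [hsymm] at hx hy; tauto
    have hiff : (contractMk z hz y hy ≠ contractMk z hz x hx ∧
        contractMk z hz y hy ≠ (G.contract z hz).inv (contractMk z hz x hx)) ↔
        y ≠ x ∧ y ≠ G.inv x := by
      rw [inv_contractMk]
      simp only [ne_eq, ← (G.contractIncl_injective z hz).eq_iff, contractIncl_mk]
    unfold reglueCollapse
    by_cases h : y ≠ x ∧ y ≠ G.inv x
    · have h' := hiff.2 h
      have h₂ : (G.reglue x y h.1 h.2).vert z ≠
          (G.reglue x y h.1 h.2).vert ((G.reglue x y h.1 h.2).inv z) := by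
        show G.vert z ≠ G.vert (reglueInv x y z)
        rw [reglueInv_of_apart hap]; exact hz
      refine (congrArg (G.contractSign z hz • ·) (dif_pos h')).trans ?_
      rw [dif_pos h, collapse_of_ne _ h₂, contractSign_reglue x y z h hap hz h₂, smul_smul,
        smul_smul, mul_comm, chain_contract_reglue x y z h hap hx hy hz h₂ h']
      rfl
    · refine (congrArg (G.contractSign z hz • ·) (dif_neg (mt hiff.1 h))).trans ?_
      rw [dif_neg h, smul_zero]

/-- The half-edges of the glued graph are those untouched by the gluing and the four halves of the
two new edges; collapsing from either half of an edge gives the same chain. -/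
theorem boundaryE_reglue (x y : G.H) (h : y ≠ x ∧ y ≠ G.inv x) :
    Chains.boundaryE O (G.reglueSign x y • (G.reglue x y h.1 h.2).chain) = (1 / 2 : ℝ) •
      ((∑ z, if (z = x ∨ z = G.inv x) ∨ z = y ∨ z = G.inv y then 0 else G.reglueCollapse x y z) +
        ((2 : ℝ) • G.reglueCollapse x y x + (2 : ℝ) • G.reglueCollapse x y (G.inv x))) := by
  have hs : ∀ z, G.reglueSign x y • (G.reglue x y h.1 h.2).collapse z = G.reglueCollapse x y z :=
    fun z => by unfold reglueCollapse; rw [dif_pos h]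
  rw [units_smul_comm, boundaryE_chain, boundaryE_eq, ← units_smul_real_comm, Finset.smul_sum]
  congr 1
  refine (Finset.sum_congr rfl fun z _ => hs z).trans ?_
  have i₁ := G.inv_inv
  have i₂ := G.inv_ne
  refine (sum_four (G.reglueCollapse x y) x (G.inv x) y (G.inv y) (by grind) (by grind) (by grind)
    (by grind) (by grind) (by grind)).trans ?_
  rw [reglueCollapse_right, reglueCollapse_inv_right, two_smul, two_smul]
  congr 1
  abel

theorem boundaryH_eq : G.boundaryH = (1 / 2 : ℝ) • ∑ x, ∑ y, G.reglueCollapse x y x := rfl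

/-- The triples of a gluing and an untouched edge occur in both composites with the same coefficient
1/8. The rest consists of the collapses of the new edges. -/
theorem boundaryE_reglueSum (G : OGraph O) : Chains.boundaryE O (Chains.reglueSum O G.chain) -
    Chains.reglueSum O (Chains.boundaryE O G.chain) = G.boundaryH := by
  -- The factor 1/8 is the 1/4 of `reglueSum` times the 1/2 for the two halves of each edge. The
  -- coefficient 4 counts the four halves of the new edges, which all give the same total; 4/8 is
  -- the 1/2 in ∂_H.
  have h₁ : Chains.boundaryE O (Chains.reglueSum O G.chain) = (1 / 8 : ℝ) •
      ((∑ x, ∑ y, ∑ z, if (z = x ∨ z = G.inv x) ∨ z = y ∨ z = G.inv y then 0 else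
        G.reglueCollapse x y z) + (4 : ℝ) • ∑ x, ∑ y, G.reglueCollapse x y x) := by
    have h₃ : ∀ x y, Chains.boundaryE O (if h : y ≠ x ∧ y ≠ G.inv x then
        G.reglueSign x y • (G.reglue x y h.1 h.2).chain else 0) = (1 / 2 : ℝ) •
      ((∑ z, if (z = x ∨ z = G.inv x) ∨ z = y ∨ z = G.inv y then 0 else G.reglueCollapse x y z) +
        ((2 : ℝ) • G.reglueCollapse x y x + (2 : ℝ) • G.reglueCollapse x y (G.inv x))) := by
      intro x y
      by_cases h : y ≠ x ∧ y ≠ G.inv x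
      · rw [dif_pos h, boundaryE_reglue x y h]
      · have h₄ : ∀ z, G.reglueCollapse x y z = 0 := fun z => dif_neg h
        rw [dif_neg h, map_zero]
        simp only [h₄, ite_self, Finset.sum_const_zero, smul_zero, add_zero]
    rw [reglueSum_chain, reglueSum, map_smul, map_sum]
    simp only [map_sum, h₃, ← Finset.smul_sum, Finset.sum_add_distrib, sum_reglueCollapse_inv]
    module
  rw [h₁, boundaryE_chain, boundaryE_eq, map_smul, map_sum,
    Finset.sum_congr rfl fun z _ => reglueSum_collapse z, ← Finset.smul_sum, boundaryH_eq]
  have h₂ : (∑ z, ∑ x, ∑ y, if (z = x ∨ z = G.inv x) ∨ z = y ∨ z = G.inv y then 0 else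
        G.reglueCollapse x y z) = ∑ x, ∑ y, ∑ z,
      if (z = x ∨ z = G.inv x) ∨ z = y ∨ z = G.inv y then 0 else G.reglueCollapse x y z := by
    rw [Finset.sum_comm]
    exact Finset.sum_congr rfl fun x _ => Finset.sum_comm
  rw [h₂]
  module

/-- The compatibility of ∂_H with the relations is inherited from `boundaryE` and `reglueSum`; it
need not be checked on graphs. -/
theorem boundaryH_chain (G : OGraph O) : Chains.boundaryH O G.chain = G.boundaryH :=
  extend_chain (Chains.boundaryE O ∘ₗ Chains.reglueSum O - Chains.reglueSum O ∘ₗ Chains.boundaryE O)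
    boundaryE_reglueSum G

end OGraph

theorem Chains.boundaryH_eq (O : CyclicOperad.{u}) : Chains.boundaryH O =
    Chains.boundaryE O ∘ₗ Chains.reglueSum O - Chains.reglueSum O ∘ₗ Chains.boundaryE O :=
  OGraph.chains_hom_ext fun G => (OGraph.boundaryH_chain G).trans (OGraph.boundaryE_reglueSum G).symm

namespace OGraph

open CyclicOperad OrientedGraph

variable {O : CyclicOperad.{u}} {G G' : OGraph O}

/-! ### The map `T` is well defined -/

open Classical in
/-- The chain of the subgraph on a set of vertices, which is zero if the set is not saturated. -/
def inducePart (G : OGraph O) (U : Set G.V) : Chains O :=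
  if hU : G.Saturated U then (G.induce U hU).chain else 0

theorem inducePart_of_saturated (U : Set G.V) (hU : G.Saturated U) :
    G.inducePart U = (G.induce U hU).chain := dif_pos hU

theorem inducePart_of_not_saturated (U : Set G.V) (hU : ¬ G.Saturated U) :
    G.inducePart U = 0 := dif_neg hU

theorem splitAt_eq (W : Set G.V) :
    G.splitAt W = shuffleSign W • (G.inducePart W ⊗ₜ[ℝ] G.inducePart Wᶜ) := by
  by_cases hW : G.Saturated W
  · rw [G.splitAt_of_saturated W hW, inducePart_of_saturated W hW,
      inducePart_of_saturated _ hW.compl]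
  · rw [OGraph.splitAt, dif_neg hW, inducePart_of_not_saturated W hW, TensorProduct.zero_tmul, smul_zero]

open Classical in
/-- The chain of the subgraph, on a set of vertices, of the graph glued along `π_{xy}`. -/
def regluePart (G : OGraph O) (x y : G.H) (U : Set G.V) : Chains O :=
  if h : y ≠ x ∧ y ≠ G.inv x then (G.reglue x y h.1 h.2).inducePart U else 0

/-- If the edge of `x` does not cross the boundary of `U`, then the new edges do not cross it
exactly when both halves of the edge of `y` lie on the same side as `x`. -/
theorem saturated_reglue_iff (x y : G.H) (h : y ≠ x ∧ y ≠ G.inv x) (U : Set G.V)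
    (hx : G.vert x ∈ U ↔ G.vert (G.inv x) ∈ U) :
    (G.reglue x y h.1 h.2).Saturated U ↔ G.Saturated U ∧ (G.vert y ∈ U ↔ G.vert x ∈ U) := by
  have i₁ := G.inv_inv
  have i₂ := G.inv_ne
  have hiff : (G.reglue x y h.1 h.2).Saturated U ↔
    ∀ z, G.vert z ∈ U ↔ G.vert (reglueInv x y z) ∈ U := Iff.rfl
  rw [hiff]
  constructor
  · intro hs
    have h₁ := hs x
    have h₂ := hs (G.inv x)
    rw [reglueInv_left] at h₁
    rw [reglueInv_inv_left h.2] at h₂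
    refine ⟨fun z => ?_, h₁.symm⟩
    by_cases hz : Apart x y z
    · have := hs z
      rwa [reglueInv_of_apart hz] at this
    · rcases not_apart.1 hz with (rfl | rfl) | rfl | rfl
      · exact hx
      · rw [i₁]; exact hx.symm
      · tauto
      · rw [i₁]; tauto
  · rintro ⟨hs, hy⟩ z
    by_cases hz : Apart x y z
    · rw [reglueInv_of_apart hz]; exact hs z
    · have hy' := hs y
      rcases not_apart.1 hz with (rfl | rfl) | rfl | rfl
      · rw [reglueInv_left]; exact hy.symm
      · rw [reglueInv_inv_left h.2]; tauto
      · rw [reglueInv_right]; exact hy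
      · rw [← reglueInv_inv h.2, reglueInv_right]; tauto

theorem _root_.OrientedGraph.map_reglueInv {Γ Γ' : OrientedGraph} {ι : Γ.H → Γ'.H}
    (hι : Function.Injective ι) (hinv : ∀ h, Γ'.inv (ι h) = ι (Γ.inv h)) (x y h : Γ.H) :
    ι (reglueInv x y h) = reglueInv (ι x) (ι y) (ι h) := by
  unfold reglueInv
  simp only [hinv, hι.eq_iff]
  split_ifs <;> rfl

theorem _root_.OrientedGraph.reglueDir_map {Γ Γ' : OrientedGraph} {ι : Γ.H → Γ'.H}
    (hι : Function.Injective ι) (hinv : ∀ h, Γ'.inv (ι h) = ι (Γ.inv h))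
    (hdir : ∀ h, Γ'.dir (ι h) = Γ.dir h) (x y h : Γ.H) :
    reglueDir x y h = reglueDir (ι x) (ι y) (ι h) := by
  unfold reglueDir
  simp only [hinv, hι.eq_iff, hdir]

theorem chain_induce_reglue (x y : G.H) (h : y ≠ x ∧ y ≠ G.inv x) (U : Set G.V)
    (hU : G.Saturated U) (hU' : (G.reglue x y h.1 h.2).Saturated U) (hx : G.vert x ∈ U)
    (hy : G.vert y ∈ U)
    (h' : (⟨y, hy⟩ : (G.induce U hU).H) ≠ (⟨x, hx⟩ : (G.induce U hU).H) ∧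
      (⟨y, hy⟩ : (G.induce U hU).H) ≠ (G.induce U hU).inv (⟨x, hx⟩ : (G.induce U hU).H)) :
    ((G.reglue x y h.1 h.2).induce U hU').chain =
      ((G.induce U hU).reglue ⟨x, hx⟩ ⟨y, hy⟩ h'.1 h'.2).chain := by
  have hri : ∀ b : (G.induce U hU).H, G.inducedIncl U hU
      (reglueInv (G := (G.induce U hU).toOrientedGraph) ⟨x, hx⟩ ⟨y, hy⟩ b) =
      reglueInv x y (G.inducedIncl U hU b) :=
    map_reglueInv (G.inducedIncl_injective U hU) (fun _ => rfl) _ _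
  have hrd : ∀ b : (G.induce U hU).H,
      reglueDir (G := (G.induce U hU).toOrientedGraph) ⟨x, hx⟩ ⟨y, hy⟩ b =
      reglueDir x y (G.inducedIncl U hU b) :=
    reglueDir_map (G.inducedIncl_injective U hU) (fun _ => rfl) (fun _ => rfl) _ _
  have hr := (G.range_inducedIncl U hU).symm
  refine chain_eq_of_embed (U := G.H) ((G.reglue x y h.1 h.2).inducedIncl U hU')
    (G.inducedIncl U hU) (inducedIncl_injective _ _ _)
    (G.inducedIncl_injective U hU) ?_ ?_ ?_ ?_ ?_ ?_
  · exact ((G.reglue x y h.1 h.2).range_inducedIncl U hU').trans hr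
  · intro a b e
    exact (congrArg (reglueInv x y) e).trans (hri b).symm
  · intro a a' b b' e e'
    refine ((G.reglue x y h.1 h.2).vert_induce_inj U hU').trans
      (Iff.trans ?_ (G.vert_induce_inj U hU).symm)
    rw [e, e']; rfl
  · intro a b e
    refine ((G.reglue x y h.1 h.2).spiderAt_induce U hU' _).trans
      (Eq.trans ?_ (G.spiderAt_induce U hU _).symm)
    exact congrArg (fun z => G.spiderAt (G.vert z)) e
  · intro a a' b b' e e' hlt
    have hlt' : G.vert _ < G.vert _ := ((G.reglue x y h.1 h.2).vert_induce_lt U hU').1 hlt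
    rw [e, e'] at hlt'
    exact hlt'
  · intro a b e
    exact (hrd b).trans (congrArg (reglueDir x y) e.symm)

theorem chain_induce_reglue_of_notMem (x y : G.H) (h : y ≠ x ∧ y ≠ G.inv x) (U : Set G.V)
    (hU : G.Saturated U) (hU' : (G.reglue x y h.1 h.2).Saturated U) (hx : G.vert x ∉ U)
    (hy : G.vert y ∉ U) :
    ((G.reglue x y h.1 h.2).induce U hU').chain = (G.induce U hU).chain := by
  have hap : ∀ b : (G.induce U hU).H, Apart x y (G.inducedIncl U hU b) := fun b => by
    have hb : G.vert (G.inducedIncl U hU b) ∈ U := b.2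
    refine ⟨⟨fun e => hx (e ▸ hb), fun e => hx ((hU x).2 (e ▸ hb))⟩,
      fun e => hy (e ▸ hb), fun e => hy ((hU y).2 (e ▸ hb))⟩
  refine chain_eq_of_embed (U := G.H) ((G.reglue x y h.1 h.2).inducedIncl U hU')
    (G.inducedIncl U hU) (inducedIncl_injective _ _ _)
    (G.inducedIncl_injective U hU) ?_ ?_ ?_ ?_ ?_ ?_
  · exact ((G.reglue x y h.1 h.2).range_inducedIncl U hU').trans (G.range_inducedIncl U hU).symm
  · intro a b e
    exact (congrArg (reglueInv x y) e).trans (reglueInv_of_apart (hap b))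
  · intro a a' b b' e e'
    refine ((G.reglue x y h.1 h.2).vert_induce_inj U hU').trans
      (Iff.trans ?_ (G.vert_induce_inj U hU).symm)
    rw [e, e']; rfl
  · intro a b e
    refine ((G.reglue x y h.1 h.2).spiderAt_induce U hU' _).trans
      (Eq.trans ?_ (G.spiderAt_induce U hU _).symm)
    exact congrArg (fun z => G.spiderAt (G.vert z)) e
  · intro a a' b b' e e' hlt
    have hlt' : G.vert _ < G.vert _ := ((G.reglue x y h.1 h.2).vert_induce_lt U hU').1 hlt
    rw [e, e'] at hlt'
    exact hlt'
  · intro a b e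
    exact (reglueDir_of_apart (hap b)).symm.trans (congrArg (reglueDir x y) e.symm)

/-- Gluing inside the subgraph on `U` uses pairs of half-edges in `U`. No condition on `y` is needed
on the right: if `y` is attached outside `U`, then `U` is not saturated in the glued graph and
`regluePart` vanishes. -/
theorem reglueSum_inducePart (U : Set G.V) [DecidablePred (· ∈ U)] :
    Chains.reglueSum O (G.inducePart U) = (1 / 4 : ℝ) • ∑ x, ∑ y,
      if G.vert x ∈ U ∧ G.vert (G.inv x) ∈ U then G.reglueSign x y • G.regluePart x y U else 0 := by
  by_cases hU : G.Saturated U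
  swap
  · rw [inducePart_of_not_saturated U hU, map_zero]
    refine (smul_eq_zero.2 (.inr (Finset.sum_eq_zero fun x _ =>
      Finset.sum_eq_zero fun y _ => ?_))).symm
    split_ifs with hx
    · unfold regluePart
      split_ifs with h
      · refine (congrArg _ (inducePart_of_not_saturated (G := G.reglue x y h.1 h.2) U ?_)).trans
          (smul_zero _)
        intro hs
        rw [saturated_reglue_iff x y h U (iff_of_true hx.1 hx.2)] at hs
        exact hU hs.1
      · rw [smul_zero]
    · rfl
  rw [inducePart_of_saturated U hU, reglueSum_chain, reglueSum]
  congr 1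
  refine (@sum_subtype_dite _ _ _ _ (fun x => G.vert x ∈ U) _ (G.induce U hU).fintypeH _).trans
    (Finset.sum_congr rfl fun x _ => ?_)
  by_cases hx : G.vert x ∈ U
  swap
  · rw [dif_neg hx]
    exact (Finset.sum_eq_zero fun y _ => if_neg (fun h => hx h.1)).symm
  rw [dif_pos hx]
  refine (@sum_subtype_dite _ _ _ _ (fun x => G.vert x ∈ U) _ (G.induce U hU).fintypeH _).trans
    (Finset.sum_congr rfl fun y _ => ?_)
  rw [if_pos ⟨hx, (hU x).1 hx⟩]
  by_cases hy : G.vert y ∈ U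
  swap
  · rw [dif_neg hy]
    unfold regluePart
    split_ifs with h
    · refine ((congrArg _ (inducePart_of_not_saturated (G := G.reglue x y h.1 h.2) U ?_)).trans
        (smul_zero _)).symm
      rw [saturated_reglue_iff x y h U (hU x)]
      tauto
    · rw [smul_zero]
  rw [dif_pos hy]
  have hiff : ((⟨y, hy⟩ : (G.induce U hU).H) ≠ (⟨x, hx⟩ : (G.induce U hU).H) ∧
      (⟨y, hy⟩ : (G.induce U hU).H) ≠ (G.induce U hU).inv (⟨x, hx⟩ : (G.induce U hU).H)) ↔
      y ≠ x ∧ y ≠ G.inv x :=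
    and_congr (not_congr Subtype.ext_iff) (not_congr Subtype.ext_iff)
  unfold regluePart
  by_cases h : y ≠ x ∧ y ≠ G.inv x
  · have h' := hiff.2 h
    have hU' : (G.reglue x y h.1 h.2).Saturated U :=
      (saturated_reglue_iff x y h U (hU x)).2 ⟨hU, iff_of_true hy hx⟩
    refine (dif_pos h').trans (Eq.trans ?_ (congrArg _ (dif_pos h)).symm)
    refine congrArg (G.reglueSign x y • ·) ?_
    exact (chain_induce_reglue x y h U hU hU' hx hy h').symm.trans
      (inducePart_of_saturated (G := G.reglue x y h.1 h.2) U hU').symm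
  · refine (dif_neg (mt hiff.1 h)).trans ?_
    rw [dif_neg h, smul_zero]

/-- The gluing takes place inside `W`, so the subgraph on the complement is unchanged. The identity
is stated under the tensor product since it is used only when `W` is saturated in the glued graph;
otherwise the left factor is zero. -/
theorem regluePart_compl_of_mem (x y : G.H) (W : Set G.V)
    (hx : G.vert x ∈ W ∧ G.vert (G.inv x) ∈ W) :
    G.regluePart x y W ⊗ₜ[ℝ] G.regluePart x y Wᶜ = G.regluePart x y W ⊗ₜ[ℝ] G.inducePart Wᶜ := by
  unfold regluePart
  by_cases h : y ≠ x ∧ y ≠ G.inv x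
  swap
  · rw [dif_neg h, TensorProduct.zero_tmul, TensorProduct.zero_tmul]
  rw [dif_pos h, dif_pos h]
  by_cases hs : (G.reglue x y h.1 h.2).Saturated W
  · have h₁ := (saturated_reglue_iff x y h W (iff_of_true hx.1 hx.2)).1 hs
    refine congrArg (_ ⊗ₜ[ℝ] ·) ?_
    rw [inducePart_of_saturated _ h₁.1.compl]
    refine (inducePart_of_saturated (G := G.reglue x y h.1 h.2) Wᶜ hs.compl).trans ?_
    exact chain_induce_reglue_of_notMem x y h Wᶜ h₁.1.compl hs.compl (fun hc => hc hx.1)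
      fun hc => hc (h₁.2.2 hx.1)
  · have : (G.reglue x y h.1 h.2).inducePart W = 0 :=
      inducePart_of_not_saturated (G := G.reglue x y h.1 h.2) W hs
    rw [this, TensorProduct.zero_tmul, TensorProduct.zero_tmul]

theorem regluePart_of_notMem (x y : G.H) (W : Set G.V)
    (hx : G.vert x ∉ W ∧ G.vert (G.inv x) ∉ W) :
    G.regluePart x y W ⊗ₜ[ℝ] G.regluePart x y Wᶜ = G.inducePart W ⊗ₜ[ℝ] G.regluePart x y Wᶜ := by
  have := congrArg (TensorProduct.comm ℝ _ _) (G.regluePart_compl_of_mem x y Wᶜ hx)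
  rw [TensorProduct.comm_tmul, TensorProduct.comm_tmul, compl_compl] at this
  exact this

/-- The terms of the coproduct of the graph glued along `π_{xy}`. -/
def reglueSplit (G : OGraph O) (x y : G.H) (W : Set G.V) : Chains O ⊗[ℝ] Chains O :=
  (G.reglueSign x y * shuffleSign W) • (G.regluePart x y W ⊗ₜ[ℝ] G.regluePart x y Wᶜ)

theorem reglueSplit_eq (x y : G.H) (W : Set G.V) (h : y ≠ x ∧ y ≠ G.inv x) :
    G.reglueSplit x y W = G.reglueSign x y • (G.reglue x y h.1 h.2).splitAt W := by
  unfold reglueSplit regluePart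
  rw [dif_pos h, dif_pos h, mul_smul]
  exact congrArg _ ((G.reglue x y h.1 h.2).splitAt_eq W).symm

theorem reglueSplit_of_not (x y : G.H) (W : Set G.V) (h : ¬ (y ≠ x ∧ y ≠ G.inv x)) :
    G.reglueSplit x y W = 0 := by
  unfold reglueSplit regluePart
  rw [dif_neg h, TensorProduct.zero_tmul, smul_zero]

theorem reglueSplit_inv (x y : G.H) (W : Set G.V) :
    G.reglueSplit (G.inv x) (G.inv y) W = G.reglueSplit x y W := by
  have hiff : (G.inv y ≠ G.inv x ∧ G.inv y ≠ G.inv (G.inv x)) ↔ y ≠ x ∧ y ≠ G.inv x := by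
    simp only [ne_eq, inv_inj]
  by_cases h : y ≠ x ∧ y ≠ G.inv x
  · obtain ⟨g, -, hg, hs⟩ := exists_reglue_inv x y h.1 h.2 (hiff.2 h).1 (hiff.2 h).2
    rw [reglueSplit_eq x y W h, reglueSplit_eq _ _ W (hiff.2 h), reglueSign_inv]
    have h₁ := g.splitAt W
    have h₂ : g.onV '' W = W :=
      (Set.image_congr fun v _ => hg v).trans (Set.image_id W)
    rw [hs, one_smul] at h₁
    exact congrArg _ (h₁.trans (congrArg _ h₂)).symm
  · rw [reglueSplit_of_not x y W h, reglueSplit_of_not _ _ W (mt hiff.1 h)]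

-- The separating condition is automatic: a union of components of the glued graph which contains
-- the vertex of `x` and not that of `x̄` exists only if these lie in different components.
open Classical in
theorem separate_eq : G.separate = (1 / 2 : ℝ) • ∑ x, ∑ y, ∑ W : Set G.V,
    if G.vert x ∈ W ∧ G.vert (G.inv x) ∉ W then G.reglueSplit x y W else 0 := by
  unfold separate
  congr 1
  refine Finset.sum_congr rfl fun x _ => Finset.sum_congr rfl fun y _ => ?_
  by_cases h : y ≠ x ∧ y ≠ G.inv x
  swap
  · rw [dif_neg h]
    refine (Finset.sum_eq_zero fun W _ => ?_).symm
    rw [reglueSplit_of_not x y W h, ite_self]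
  rw [dif_pos h]
  have h₁ : ∑ K : Set (G.reglue x y h.1 h.2).Components with
        (G.reglue x y h.1 h.2).component (G.vert x) ∈ K ∧
          (G.reglue x y h.1 h.2).component (G.vert (G.inv x)) ∉ K,
        (G.reglue x y h.1 h.2).split K =
      ∑ W : Set G.V, if G.vert x ∈ W ∧ G.vert (G.inv x) ∉ W then
        (G.reglue x y h.1 h.2).splitAt W else 0 := by
    rw [Finset.sum_filter]
    refine Eq.trans (Finset.sum_congr rfl fun K _ => ?_)
      ((G.reglue x y h.1 h.2).sum_components (fun W => if G.vert x ∈ W ∧ G.vert (G.inv x) ∉ W then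
        (G.reglue x y h.1 h.2).splitAt W else 0) fun W hW => ?_)
    · rw [split_eq_splitAt]; rfl
    · have : (G.reglue x y h.1 h.2).splitAt W = 0 := dif_neg hW
      exact (congrArg (fun z => ite _ z 0) this).trans (ite_self _)
  by_cases hs : G.Separating x y h.1 h.2
  · rw [if_pos hs, h₁, Finset.smul_sum]
    refine Finset.sum_congr rfl fun W _ => ?_
    rw [reglueSplit_eq x y W h, smul_ite, smul_zero]
  · rw [if_neg hs]
    refine (Finset.sum_eq_zero fun W _ => ?_).symm
    split_ifs with hW
    · rw [reglueSplit_eq x y W h]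
      refine (congrArg _ (dif_neg fun hc => ?_)).trans (smul_zero _)
      obtain ⟨K, rfl⟩ := hc.exists_eq
      refine hs fun he => hW.2 ?_
      show (G.reglue x y h.1 h.2).component (G.vert (G.inv x)) ∈ K
      exact he ▸ hW.1
    · rfl

open Classical in
theorem reglueSum_splitAt_left (W : Set G.V) :
    TensorProduct.map (Chains.reglueSum O) LinearMap.id (G.splitAt W) = (1 / 4 : ℝ) • ∑ x, ∑ y,
      if G.vert x ∈ W ∧ G.vert (G.inv x) ∈ W then G.reglueSplit x y W else 0 := by
  rw [splitAt_eq, units_smul_comm, TensorProduct.map_tmul, reglueSum_inducePart,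
    ← TensorProduct.smul_tmul', ← units_smul_real_comm, TensorProduct.sum_tmul, Finset.smul_sum]
  congr 1
  refine Finset.sum_congr rfl fun x _ => ?_
  rw [TensorProduct.sum_tmul, Finset.smul_sum]
  refine Finset.sum_congr rfl fun y _ => ?_
  split_ifs with h
  · rw [reglueSplit, regluePart_compl_of_mem x y W h, units_smul_tmul, smul_smul, mul_comm]
    rfl
  · rw [TensorProduct.zero_tmul, smul_zero]

open Classical in
theorem reglueSum_splitAt_right (W : Set G.V) :
    TensorProduct.map LinearMap.id (Chains.reglueSum O) (G.splitAt W) = (1 / 4 : ℝ) • ∑ x, ∑ y,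
      if G.vert x ∉ W ∧ G.vert (G.inv x) ∉ W then G.reglueSplit x y W else 0 := by
  rw [splitAt_eq, units_smul_comm, TensorProduct.map_tmul, reglueSum_inducePart,
    TensorProduct.tmul_smul, ← units_smul_real_comm, TensorProduct.tmul_sum, Finset.smul_sum]
  congr 1
  refine Finset.sum_congr rfl fun x _ => ?_
  rw [TensorProduct.tmul_sum, Finset.smul_sum]
  refine Finset.sum_congr rfl fun y _ => ?_
  by_cases h : G.vert x ∉ W ∧ G.vert (G.inv x) ∉ W
  · rw [if_pos (show G.vert x ∈ Wᶜ ∧ G.vert (G.inv x) ∈ Wᶜ from h), if_pos h, reglueSplit, regluePart_of_notMem x y W h, units_tmul_smul, smul_smul,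
      mul_comm]
    rfl
  · rw [if_neg (show ¬ (G.vert x ∈ Wᶜ ∧ G.vert (G.inv x) ∈ Wᶜ) from h), if_neg h,
      TensorProduct.tmul_zero, smul_zero]

open Classical in
theorem comul_reglueSum : Chains.comul O G.reglueSum = (1 / 4 : ℝ) • ∑ x, ∑ y, ∑ W : Set G.V,
    G.reglueSplit x y W := by
  unfold reglueSum
  rw [map_smul, map_sum]
  congr 1
  refine Finset.sum_congr rfl fun x _ => ?_
  rw [map_sum]
  refine Finset.sum_congr rfl fun y _ => ?_
  by_cases h : y ≠ x ∧ y ≠ G.inv x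
  · rw [dif_pos h, units_smul_comm, comul_chain, coproduct_eq, Finset.smul_sum]
    exact Finset.sum_congr rfl fun W _ => (reglueSplit_eq x y W h).symm
  · rw [dif_neg h, map_zero]
    exact (Finset.sum_eq_zero fun W _ => reglueSplit_of_not x y W h).symm

/-- The terms of Δ R are sorted by the sides of `W` on which `x` and `x̄` are attached. Both inside
gives R ⊗ 1, both outside gives 1 ⊗ R, and the two mixed cases give T. -/
theorem comul_reglueSum_sub (G : OGraph O) :
    Chains.comul O (Chains.reglueSum O G.chain) -
      (TensorProduct.map (Chains.reglueSum O) LinearMap.id (Chains.comul O G.chain) +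
        TensorProduct.map LinearMap.id (Chains.reglueSum O) (Chains.comul O G.chain)) =
      G.separate := by
  classical
  have key : ∑ x, ∑ y, ∑ W : Set G.V, G.reglueSplit x y W =
      (∑ x, ∑ y, ∑ W : Set G.V,
        if G.vert x ∈ W ∧ G.vert (G.inv x) ∈ W then G.reglueSplit x y W else 0) +
      (∑ x, ∑ y, ∑ W : Set G.V,
        if G.vert x ∉ W ∧ G.vert (G.inv x) ∉ W then G.reglueSplit x y W else 0) +
      ((∑ x, ∑ y, ∑ W : Set G.V,
        if G.vert x ∈ W ∧ G.vert (G.inv x) ∉ W then G.reglueSplit x y W else 0) +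
      ∑ x, ∑ y, ∑ W : Set G.V,
        if G.vert x ∉ W ∧ G.vert (G.inv x) ∈ W then G.reglueSplit x y W else 0) := by
    simp only [← Finset.sum_add_distrib]
    refine Finset.sum_congr rfl fun x _ => Finset.sum_congr rfl fun y _ =>
      Finset.sum_congr rfl fun W _ => ?_
    by_cases h₁ : G.vert x ∈ W <;> by_cases h₂ : G.vert (G.inv x) ∈ W <;> simp [h₁, h₂]
  -- The substitution of `x̄`, `ȳ` for `x`, `y` exchanges the mixed cases, so they are equal; twice
  -- the 1/4 of `reglueSum` is the 1/2 of T.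
  have hsymm : (∑ x, ∑ y, ∑ W : Set G.V,
        if G.vert x ∉ W ∧ G.vert (G.inv x) ∈ W then G.reglueSplit x y W else 0) =
      ∑ x, ∑ y, ∑ W : Set G.V,
        if G.vert x ∈ W ∧ G.vert (G.inv x) ∉ W then G.reglueSplit x y W else 0 := by
    let e : G.H ≃ G.H := ⟨G.inv, G.inv, G.inv_inv, G.inv_inv⟩
    rw [← e.sum_comp]
    refine Finset.sum_congr rfl fun x _ => ?_
    rw [← e.sum_comp]
    refine Finset.sum_congr rfl fun y _ => Finset.sum_congr rfl fun W _ => ?_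
    show (if G.vert (G.inv x) ∉ W ∧ G.vert (G.inv (G.inv x)) ∈ W then
      G.reglueSplit (G.inv x) (G.inv y) W else 0) = _
    rw [reglueSplit_inv, G.inv_inv]
    exact if_congr and_comm rfl rfl
  have swap : ∀ F : G.H → G.H → Set G.V → Chains O ⊗[ℝ] Chains O,
      ∑ W, ∑ x, ∑ y, F x y W = ∑ x, ∑ y, ∑ W, F x y W := fun F => by
    rw [Finset.sum_comm]
    exact Finset.sum_congr rfl fun x _ => Finset.sum_comm
  rw [reglueSum_chain, comul_reglueSum, comul_chain, coproduct_eq, map_sum, map_sum,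
    Finset.sum_congr rfl fun W _ => reglueSum_splitAt_left W,
    Finset.sum_congr rfl fun W _ => reglueSum_splitAt_right W, ← Finset.smul_sum,
    ← Finset.smul_sum, swap, swap, separate_eq, key, hsymm]
  module

/-- As for ∂_H, the relations are respected because T is a commutator of operators for which this is
known. -/
theorem separate_chain (G : OGraph O) : Chains.separate O G.chain = G.separate :=
  extend_chain (Chains.comul O ∘ₗ Chains.reglueSum O -
    (TensorProduct.map (Chains.reglueSum O) LinearMap.id +
      TensorProduct.map LinearMap.id (Chains.reglueSum O)) ∘ₗ Chains.comul O)
    comul_reglueSum_sub G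

end OGraph

theorem Chains.separate_eq (O : CyclicOperad.{u}) : Chains.separate O =
    Chains.comul O ∘ₗ Chains.reglueSum O -
      (TensorProduct.map (Chains.reglueSum O) LinearMap.id +
        TensorProduct.map LinearMap.id (Chains.reglueSum O)) ∘ₗ Chains.comul O :=
  OGraph.chains_hom_ext fun G =>
    (OGraph.separate_chain G).trans (OGraph.comul_reglueSum_sub G).symm

theorem Chains.wellDefined (O : CyclicOperad.{u}) : Chains.WellDefined O where
  parity_chain := OGraph.parity_chain
  boundaryE_chain := OGraph.boundaryE_chain
  boundaryH_chain := OGraph.boundaryH_chain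
  mul_chain := OGraph.mul_chain
  comul_chain := OGraph.comul_chain
  counit_chain_of_isEmpty G h := (OGraph.counit_chain G).trans (if_pos h)
  counit_chain_of_nonempty G h := (OGraph.counit_chain G).trans (if_neg (not_isEmpty_iff.2 h))
  antipode_chain := OGraph.antipode_chain
  separate_chain := OGraph.separate_chain

/-! ### The sign of the exchange of two blocks -/

section Signs

variable {V W : Type} [LinearOrder V] [LinearOrder W] [Fintype V] [Fintype W]

/-- The bijection that exchanges the two summands. -/
def sumLexComm (V W : Type) : V ⊕ₗ W ≃ W ⊕ₗ V :=
  ofLex.trans ((Equiv.sumComm V W).trans toLex)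

/-- The inverted pairs are exactly those with one element in each summand. -/
theorem orderSign_sumLexComm :
    orderSign (sumLexComm V W) = (-1) ^ (Fintype.card V * Fintype.card W) := by
  have h : ∀ F : V ⊕ₗ W → ℤˣ, ∏ v, F v = (∏ v, F (toLex (.inl v))) * ∏ v, F (toLex (.inr v)) :=
    fun F => Fintype.prod_sum_type _
  rw [orderSign_eq_prod, h]
  simp only [h]
  have e₁ : ∀ v v' : V, sumLexComm V W (toLex (.inl v)) < sumLexComm V W (toLex (.inl v')) ↔
    v < v' := fun _ _ => Sum.Lex.inr_lt_inr_iff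
  have e₂ : ∀ v v' : W, sumLexComm V W (toLex (.inr v)) < sumLexComm V W (toLex (.inr v')) ↔
    v < v' := fun _ _ => Sum.Lex.inl_lt_inl_iff
  have h₁ : ∀ v v' : V, (if (toLex (.inl v) : V ⊕ₗ W) < toLex (.inl v') then
      cmpSign (sumLexComm V W (toLex (.inl v))) (sumLexComm V W (toLex (.inl v'))) else 1) = 1 := by
    intro v v'
    split_ifs with hv
    · exact cmpSign_of_lt ((e₁ _ _).2 (Sum.Lex.inl_lt_inl_iff.1 hv))
    · rfl
  have h₂ : ∀ v v' : W, (if (toLex (.inr v) : V ⊕ₗ W) < toLex (.inr v') then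
      cmpSign (sumLexComm V W (toLex (.inr v))) (sumLexComm V W (toLex (.inr v'))) else 1) = 1 := by
    intro v v'
    split_ifs with hv
    · exact cmpSign_of_lt ((e₂ _ _).2 (Sum.Lex.inr_lt_inr_iff.1 hv))
    · rfl
  have h₃ : ∀ (v : V) (w : W), (if (toLex (.inl v) : V ⊕ₗ W) < toLex (.inr w) then
      cmpSign (sumLexComm V W (toLex (.inl v))) (sumLexComm V W (toLex (.inr w))) else 1) = -1 :=
    fun v w => (if_pos (Sum.Lex.inl_lt_inr v w)).trans (cmpSign_of_gt (Sum.Lex.inl_lt_inr w v))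
  have h₄ : ∀ (v : V) (w : W), (if (toLex (.inr w) : V ⊕ₗ W) < toLex (.inl v) then
      cmpSign (sumLexComm V W (toLex (.inr w))) (sumLexComm V W (toLex (.inl v))) else 1) = 1 :=
    fun v w => if_neg (Sum.Lex.inl_lt_inr v w).not_gt
  simp only [h₁, h₂, h₃, h₄, Finset.prod_const, Finset.card_univ, one_pow, one_mul, mul_one,
    ← pow_mul, mul_comm]

end Signs

namespace OGraph

open CyclicOperad OrientedGraph

variable {O : CyclicOperad.{u}} {G G' : OGraph O}

/-! ### Embeddings of `𝒪`-graphs -/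

/-- An embedding onto a union of components that preserves the directions of the edges, but not
necessarily the vertex ordering. -/
structure Embed (A B : OGraph O) where
  onV : A.V → B.V
  onH : A.H → B.H
  onV_injective : onV.Injective
  onH_injective : onH.Injective
  vert_onH : ∀ h, B.vert (onH h) = onV (A.vert h)
  inv_onH : ∀ h, B.inv (onH h) = onH (A.inv h)
  dir_onH : ∀ h, B.dir (onH h) = A.dir h
  spiderAt_onV : ∀ v, B.spiderAt (onV v) = (A.spiderAt v).map onH onH_injective

namespace Embed

variable {A B C A' : OGraph O}

/-- The compatibility with spiders includes the equality of leg sets, so every half-edge at a vertex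
of the image comes from `A`. This is why the image is a union of components. -/
theorem exists_onH (e : Embed A B) {h : B.H} {v : A.V} (hv : B.vert h = e.onV v) :
    ∃ g, e.onH g = h ∧ A.vert g = v := by
  have h₁ : h ∈ (B.spiderAt (e.onV v)).legs := by rw [legs_spiderAt]; exact hv
  rw [e.spiderAt_onV, SpiderIn.legs_map, legs_spiderAt] at h₁
  obtain ⟨g, hg, hgh⟩ := h₁
  exact ⟨g, hgh, hg⟩

theorem range_onH (e : Embed A B) : Set.range e.onH = {h | B.vert h ∈ Set.range e.onV} := by
  ext h
  constructor
  · rintro ⟨g, rfl⟩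
    exact ⟨_, (e.vert_onH g).symm⟩
  · rintro ⟨v, hv⟩
    obtain ⟨g, hg, -⟩ := e.exists_onH hv.symm
    exact ⟨g, hg⟩

theorem saturated_range (e : Embed A B) : B.Saturated (Set.range e.onV) := by
  have h₁ : ∀ h, B.vert h ∈ Set.range e.onV → B.vert (B.inv h) ∈ Set.range e.onV := by
    rintro h ⟨v, hv⟩
    obtain ⟨g, rfl, rfl⟩ := e.exists_onH hv.symm
    exact ⟨_, by rw [e.inv_onH, e.vert_onH]⟩
  exact fun h => ⟨h₁ h, fun hh => B.inv_inv h ▸ h₁ _ hh⟩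

/-- Embeddings with the same image differ by an isomorphism. -/
theorem exists_iso (e : Embed A C) (e' : Embed B C) (h : Set.range e.onV = Set.range e'.onV) :
    ∃ f : Iso A B, (∀ v, e'.onV (f.onV v) = e.onV v) ∧ (∀ h, e'.onH (f.onH h) = e.onH h) ∧
      f.sign = orderSign f.onV := by
  obtain ⟨f, hf⟩ : ∃ f : Iso A B, ∀ h, e'.onH (f.onH h) = e.onH h := by
    refine exists_iso_of_embed e.onH e'.onH e.onH_injective e'.onH_injective ?_ ?_ ?_ ?_
    · rw [e.range_onH, e'.range_onH, h]
    · intro h g hg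
      rw [← e.inv_onH, ← e'.inv_onH, hg]
    · intro h h' g g' hg hg'
      rw [← e.onV_injective.eq_iff, ← e'.onV_injective.eq_iff, ← e.vert_onH, ← e.vert_onH,
        ← e'.vert_onH, ← e'.vert_onH, hg, hg']
    · intro h g hg
      rw [← e.spiderAt_onV, ← e'.spiderAt_onV, ← e.vert_onH, ← e'.vert_onH, hg]
  refine ⟨f, fun v => ?_, hf, ?_⟩
  · obtain ⟨h, rfl⟩ := A.vert_surjective v
    rw [← f.vert_onH, ← e'.vert_onH, hf, e.vert_onH]
  · rw [f.sign_eq, edgeSign_of_dir, mul_one]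
    intro h
    rw [← e'.dir_onH, hf, e.dir_onH]

theorem exists_iso_of_strictMono (e : Embed A C) (e' : Embed B C)
    (h : Set.range e.onV = Set.range e'.onV) (he : StrictMono e.onV) (he' : StrictMono e'.onV) :
    ∃ f : Iso A B, (∀ v, e'.onV (f.onV v) = e.onV v) ∧ (∀ h, e'.onH (f.onH h) = e.onH h) ∧
      f.sign = 1 := by
  obtain ⟨f, hf, hf', hs⟩ := e.exists_iso e' h
  refine ⟨f, hf, hf', hs.trans (orderSign_of_strictMono _ fun v w hvw => ?_)⟩
  rw [← he'.lt_iff_lt, hf, hf]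
  exact he hvw

theorem chain_eq (e : Embed A C) (e' : Embed B C) (h : Set.range e.onV = Set.range e'.onV)
    (he : StrictMono e.onV) (he' : StrictMono e'.onV) : A.chain = B.chain := by
  obtain ⟨f, -, -, hs⟩ := e.exists_iso_of_strictMono e' h he he'
  rw [isOriented_chain _ _ f, hs, one_smul]

/-- The identity. -/
def refl (A : OGraph O) : Embed A A :=
  ⟨id, id, Function.injective_id, Function.injective_id, fun _ => rfl, fun _ => rfl, fun _ => rfl,
    fun _ => (SpiderIn.map_id _).symm⟩

/-- Composition of embeddings. -/
def trans (e : Embed A B) (e' : Embed B C) : Embed A C where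
  onV := e'.onV ∘ e.onV
  onH := e'.onH ∘ e.onH
  onV_injective := e'.onV_injective.comp e.onV_injective
  onH_injective := e'.onH_injective.comp e.onH_injective
  vert_onH h := (e'.vert_onH _).trans (congrArg _ (e.vert_onH h))
  inv_onH h := (e'.inv_onH _).trans (congrArg _ (e.inv_onH h))
  dir_onH h := (e'.dir_onH _).trans (e.dir_onH h)
  spiderAt_onV v := by
    rw [Function.comp_apply, e'.spiderAt_onV, e.spiderAt_onV, SpiderIn.map_map]

/-- The inclusion of the first summand of a disjoint union. -/
def inl (A B : OGraph O) : Embed A (A.union B) :=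
  ⟨inlV A B, inlH A B, inlV_injective A B, inlH_injective A B, fun _ => rfl, fun _ => rfl,
    fun _ => rfl, spiderAt_inlV A B⟩

/-- The inclusion of the second summand of a disjoint union. -/
def inr (A B : OGraph O) : Embed B (A.union B) :=
  ⟨inrV A B, inrH A B, inrV_injective A B, inrH_injective A B, fun _ => rfl, fun _ => rfl,
    fun _ => rfl, spiderAt_inrV A B⟩

/-- The inclusion of an induced subgraph. -/
def induce (A : OGraph O) (W : Set A.V) (hW : A.Saturated W) : Embed (A.induce W hW) A :=
  ⟨Subtype.val, A.inducedIncl W hW, Subtype.val_injective, A.inducedIncl_injective W hW,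
    fun _ => rfl, fun _ => rfl, fun _ => rfl, fun v => (A.spiderAt_induce W hW v).symm⟩

theorem range_induce (A : OGraph O) (W : Set A.V) (hW : A.Saturated W) :
    Set.range (induce A W hW).onV = W := Subtype.range_coe

/-- The vertices of a disjoint union, mapped by two maps. -/
def unionElimV {X : Type} (f : A.V → X) (g : B.V → X) : (A.union B).V → X :=
  fun v => Sum.elim f g (ofLex v)

/-- Two disjoint embeddings define an embedding of the disjoint union. -/
def union (e : Embed A C) (e' : Embed B C) (h : ∀ v w, e.onV v ≠ e'.onV w) :
    Embed (A.union B) C where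
  onV := unionElimV e.onV e'.onV
  onH := unionElim e.onH e'.onH
  onV_injective := (e.onV_injective.sumElim e'.onV_injective h).comp ofLex.injective
  onH_injective := unionElim_injective e.onH_injective e'.onH_injective fun a b hab =>
    h _ _ (by rw [← e.vert_onH, ← e'.vert_onH, hab])
  vert_onH := by rintro (h | h); exacts [e.vert_onH h, e'.vert_onH h]
  inv_onH := by rintro (h | h); exacts [e.inv_onH h, e'.inv_onH h]
  dir_onH := by rintro (h | h); exacts [e.dir_onH h, e'.dir_onH h]
  spiderAt_onV v := by
    rcases union_vert_cases A B v with ⟨v, rfl⟩ | ⟨v, rfl⟩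
    · rw [map_unionElim_spiderAt_inlV]; exact e.spiderAt_onV v
    · rw [map_unionElim_spiderAt_inrV]; exact e'.spiderAt_onV v

theorem range_union (e : Embed A C) (e' : Embed B C) (h : ∀ v w, e.onV v ≠ e'.onV w) :
    Set.range (e.union e' h).onV = Set.range e.onV ∪ Set.range e'.onV :=
  (ofLex.surjective.range_comp (Sum.elim e.onV e'.onV)).trans (Set.Sum.elim_range _ _)

theorem strictMono_union (e : Embed A C) (e' : Embed B C) (h : ∀ v w, e.onV v ≠ e'.onV w)
    (he : StrictMono e.onV) (he' : StrictMono e'.onV) (hlt : ∀ v w, e.onV v < e'.onV w) :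
    StrictMono (e.union e' h).onV := by
  intro v w hvw
  rcases union_vert_cases A B v with ⟨v, rfl⟩ | ⟨v, rfl⟩ <;>
    rcases union_vert_cases A B w with ⟨w, rfl⟩ | ⟨w, rfl⟩
  · exact he ((inlV_lt_inlV A B).1 hvw)
  · exact hlt v w
  · exact absurd hvw (inlV_lt_inrV A B w v).not_gt
  · exact he' ((inrV_lt_inrV A B).1 hvw)

theorem mergedAt_onV (e : Embed A B) (x : A.H) (hx : A.vert x ≠ A.vert (A.inv x)) (v : A.V) :
    B.mergedAt (e.onH x) (e.onV v) = (A.mergedAt x v).map e.onH e.onH_injective := by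
  unfold mergedAt
  rw [apply_ite (SpiderIn.map e.onH e.onH_injective), e.inv_onH, e.vert_onH, e.vert_onH,
    e.spiderAt_onV, e.spiderAt_onV, e.spiderAt_onV,
    SpiderIn.map_mate _ _ (mateable_spiderAt x (A.inv x) hx) (nontrivial_legs _ _)
      (nontrivial_legs _ _)]
  exact if_congr (or_congr e.onV_injective.eq_iff e.onV_injective.eq_iff) rfl rfl

theorem ne_onV (e : Embed A B) {x : A.H} (hx : A.vert x ≠ A.vert (A.inv x)) :
    B.vert (e.onH x) ≠ B.vert (B.inv (e.onH x)) := by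
  rw [e.inv_onH, e.vert_onH, e.vert_onH]
  exact e.onV_injective.ne hx

theorem exists_contractVert (x : A.H) (hx : A.vert x ≠ A.vert (A.inv x)) (v : (A.contract x hx).V) :
    ∃ u, A.contractVert x hx u = v := by
  obtain ⟨h, rfl⟩ := (A.contract x hx).vert_surjective v
  exact ⟨_, rfl⟩

/-- The embedding of the graph with a collapsed edge. -/
theorem exists_contract (e : Embed A B) (x : A.H) (hx : A.vert x ≠ A.vert (A.inv x))
    (hx' : B.vert (e.onH x) ≠ B.vert (B.inv (e.onH x))) :
    ∃ k : Embed (A.contract x hx) (B.contract (e.onH x) hx'),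
      ∀ v, k.onV (A.contractVert x hx v) = B.contractVert (e.onH x) hx' (e.onV v) := by
  -- Vertices of the collapsed graph are represented by vertices of `A`; `hinj` shows that the image
  -- does not depend on the representative.
  choose rep hrep using exists_contractVert x hx
  have hinj : ∀ v w, B.contractVert (e.onH x) hx' (e.onV v) = B.contractVert (e.onH x) hx' (e.onV w)
      ↔ A.contractVert x hx v = A.contractVert x hx w := fun v w => by
    rw [contractVert_inj, contractVert_inj, e.inv_onH, e.vert_onH, e.vert_onH,
      e.onV_injective.eq_iff, e.onV_injective.eq_iff, e.onV_injective.eq_iff,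
      e.onV_injective.eq_iff, e.onV_injective.eq_iff]
  have hV : ∀ v, B.contractVert (e.onH x) hx' (e.onV (rep (A.contractVert x hx v))) =
      B.contractVert (e.onH x) hx' (e.onV v) := fun v => (hinj _ _).2 (hrep _)
  have hh : ∀ h, e.onH (A.contractIncl x hx h) ≠ e.onH x ∧
      e.onH (A.contractIncl x hx h) ≠ B.inv (e.onH x) := fun h => by
    rw [e.inv_onH, e.onH_injective.ne_iff, e.onH_injective.ne_iff]
    exact h.2
  refine ⟨⟨fun v => B.contractVert (e.onH x) hx' (e.onV (rep v)),
    fun h => contractMk _ hx' (e.onH (A.contractIncl x hx h)) (hh h), ?_, ?_, ?_, ?_, ?_, ?_⟩, hV⟩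
  · intro v w h
    rw [← hrep v, ← hrep w]
    exact (hinj _ _).1 h
  · intro h h' hhh
    exact A.contractIncl_injective x hx (e.onH_injective (congrArg (B.contractIncl _ hx') hhh))
  · intro h
    refine (vert_contractMk _ hx' _ _).trans ?_
    rw [e.vert_onH, vert_contract, hV]
  · intro h
    exact Subtype.ext (e.inv_onH _)
  · intro h
    exact e.dir_onH _
  · intro v
    -- Spiders are compared after inclusion of the remaining half-edges into those of `B`, where the
    -- merged spiders correspond by `mergedAt_onV`.
    refine SpiderIn.map_injective _ (B.contractIncl_injective _ hx') ?_
    obtain ⟨h, rfl⟩ := (A.contract x hx).vert_surjective v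
    have h₁ : (((A.contract x hx).spiderAt ((A.contract x hx).vert h)).map (A.contractIncl x hx)
      (A.contractIncl_injective x hx)).map e.onH e.onH_injective = _ :=
      congrArg _ (A.spiderAt_contract x hx h)
    rw [SpiderIn.map_map, ← e.mergedAt_onV x hx] at h₁
    refine Eq.trans ?_ (h₁.symm.trans (SpiderIn.map_map
      (fun h => contractMk _ hx' (e.onH (A.contractIncl x hx h)) (hh h)) _
      (B.contractIncl _ hx') _ _).symm)
    have := B.spiderAt_contract _ hx' (contractMk _ hx' (e.onH (A.contractIncl x hx h)) (hh h))
    rw [vert_contractMk, contractIncl_mk, e.vert_onH] at this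
    refine Eq.trans ?_ this
    rw [vert_contract, hV]

/-- The embedding of a subgraph into a graph with an edge collapsed outside the subgraph. -/
theorem exists_contract_of_notMem (e : Embed A B) (x : B.H) (hx : B.vert x ≠ B.vert (B.inv x))
    (hx' : B.vert x ∉ Set.range e.onV) :
    ∃ k : Embed A (B.contract x hx), ∀ v, k.onV v = B.contractVert x hx (e.onV v) := by
  have hx'' : B.vert (B.inv x) ∉ Set.range e.onV := mt (e.saturated_range x).2 hx'
  have hv : ∀ v, e.onV v ≠ B.vert x ∧ e.onV v ≠ B.vert (B.inv x) := fun v =>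
    ⟨fun h => hx' ⟨v, h⟩, fun h => hx'' ⟨v, h⟩⟩
  have hh : ∀ h, e.onH h ≠ x ∧ e.onH h ≠ B.inv x := fun h =>
    ⟨fun h' => (hv (A.vert h)).1 (by rw [← e.vert_onH, h']),
      fun h' => (hv (A.vert h)).2 (by rw [← e.vert_onH, h'])⟩
  refine ⟨⟨fun v => B.contractVert x hx (e.onV v), fun h => contractMk x hx (e.onH h) (hh h),
    ?_, ?_, ?_, ?_, ?_, ?_⟩, fun _ => rfl⟩
  · intro v w h
    rcases (B.contractVert_inj x hx).1 h with h | h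
    · exact e.onV_injective h
    · exact absurd h.1 (not_or.2 (hv v))
  · intro h h' hhh
    exact e.onH_injective (congrArg (B.contractIncl x hx) hhh)
  · intro h
    exact (vert_contractMk x hx _ _).trans (congrArg _ (e.vert_onH h))
  · intro h
    exact Subtype.ext (e.inv_onH h)
  · exact e.dir_onH
  · intro v
    refine SpiderIn.map_injective _ (B.contractIncl_injective x hx) ?_
    obtain ⟨h, rfl⟩ := A.vert_surjective v
    refine Eq.trans ?_ ((e.spiderAt_onV _).trans (SpiderIn.map_map
      (fun h => contractMk x hx (e.onH h) (hh h)) _ (B.contractIncl x hx) _ _).symm)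
    have := B.spiderAt_contract x hx (contractMk x hx (e.onH h) (hh h))
    rw [vert_contractMk, contractIncl_mk, e.vert_onH] at this
    exact this.trans (if_neg (not_or.2 (hv _)))

end Embed

/-! ### The product -/

/-- The right-hand bracketing embeds monotonically onto the whole of the left-hand one. -/
theorem union_assoc_chain (G₁ G₂ G₃ : OGraph O) :
    ((G₁.union G₂).union G₃).chain = (G₁.union (G₂.union G₃)).chain := by
  let e := ((Embed.inr G₁ G₂).trans (Embed.inl (G₁.union G₂) G₃)).union
    (Embed.inr (G₁.union G₂) G₃) fun _ _ => inlV_ne_inrV _ _ _ _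
  have h : ∀ v w, ((Embed.inl G₁ G₂).trans (Embed.inl (G₁.union G₂) G₃)).onV v < e.onV w := by
    intro v w
    rcases union_vert_cases _ _ w with ⟨w, rfl⟩ | ⟨w, rfl⟩
    · exact (inlV_lt_inlV _ _).2 (inlV_lt_inrV _ _ _ _)
    · exact inlV_lt_inrV _ _ _ _
  have hm : ∀ {A B : OGraph O}, StrictMono (Embed.inl A B).onV :=
    @fun _ _ _ _ h => (inlV_lt_inlV _ _).2 h
  have hm' : ∀ {A B : OGraph O}, StrictMono (Embed.inr A B).onV :=
    @fun _ _ _ _ h => (inrV_lt_inrV _ _).2 h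
  refine (Embed.refl _).chain_eq (((Embed.inl G₁ G₂).trans (Embed.inl (G₁.union G₂) G₃)).union e
    fun v w => (h v w).ne) ?_ strictMono_id
    (Embed.strictMono_union _ _ _ (hm.comp hm) ?_ h)
  · refine Eq.trans ?_ (Embed.range_union _ _ _).symm
    refine Set.range_id.trans (Set.eq_univ_of_forall fun v => ?_).symm
    rcases union_vert_cases _ _ v with ⟨v, rfl⟩ | ⟨v, rfl⟩
    · rcases union_vert_cases _ _ v with ⟨v, rfl⟩ | ⟨v, rfl⟩
      · exact .inl ⟨v, rfl⟩
      · exact .inr ⟨inlV _ _ v, rfl⟩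
    · exact .inr ⟨inrV _ _ v, rfl⟩
  · exact Embed.strictMono_union _ _ _ (hm.comp hm') hm' fun _ _ => inlV_lt_inrV _ _ _ _

theorem empty_union_chain (G : OGraph O) : ((empty : OGraph O).union G).chain = G.chain := by
  refine (Embed.refl _).chain_eq (Embed.inr _ G) ?_ strictMono_id fun _ _ h => (inrV_lt_inrV _ _).2 h
  refine Set.range_id.trans (Set.eq_univ_of_forall fun v => ?_).symm
  rcases union_vert_cases _ _ v with ⟨v, rfl⟩ | ⟨v, rfl⟩
  · exact v.elim
  · exact ⟨v, rfl⟩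

theorem union_empty_chain (G : OGraph O) : (G.union (empty : OGraph O)).chain = G.chain := by
  refine (Embed.refl _).chain_eq (Embed.inl G _) ?_ strictMono_id fun _ _ h => (inlV_lt_inlV _ _).2 h
  refine Set.range_id.trans (Set.eq_univ_of_forall fun v => ?_).symm
  rcases union_vert_cases _ _ v with ⟨v, rfl⟩ | ⟨v, rfl⟩
  · exact ⟨v, rfl⟩
  · exact v.elim

theorem exists_iso_union_comm (G G' : OGraph O) :
    ∃ f : Iso (G.union G') (G'.union G), (∀ h, f.onH (inrH G G' h) = inlH G' G h) ∧
      f.sign = (-1) ^ (Fintype.card G.V * Fintype.card G'.V) := by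
  obtain ⟨f, hf, hf', hs⟩ := ((Embed.inr G' G).union (Embed.inl G' G)
    fun _ _ => (inlV_ne_inrV _ _ _ _).symm).exists_iso (Embed.refl _) (by
      refine (Embed.range_union _ _ _).trans
        ((Set.eq_univ_of_forall fun v => ?_).trans Set.range_id.symm)
      rcases union_vert_cases _ _ v with ⟨v, rfl⟩ | ⟨v, rfl⟩
      · exact .inr ⟨v, rfl⟩
      · exact .inl ⟨v, rfl⟩)
  refine ⟨f, fun h => hf' _, hs.trans ?_⟩
  have hv : f.onV = sumLexComm G.V G'.V := Equiv.ext fun v => by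
    refine (hf v).trans ?_
    rcases union_vert_cases _ _ v with ⟨v, rfl⟩ | ⟨v, rfl⟩ <;> rfl
  rw [hv]
  exact orderSign_sumLexComm

theorem union_comm_chain (G G' : OGraph O) : (G.union G').chain =
    (-1 : ℤˣ) ^ (Fintype.card G.V * Fintype.card G'.V) • (G'.union G).chain := by
  obtain ⟨f, -, hs⟩ := exists_iso_union_comm G G'
  rw [isOriented_chain _ _ f, hs]

theorem card_union (G G' : OGraph O) :
    Fintype.card (G.union G').V = Fintype.card G.V + Fintype.card G'.V := Fintype.card_sum

theorem card_contract (x : G.H) (hx : G.vert x ≠ G.vert (G.inv x)) :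
    Fintype.card (G.contract x hx).V + 1 = Fintype.card G.V := by
  have := Fintype.card_congr (G.endpointsFirst x hx)
  rw [this]
  exact (Fintype.card_option (α := (G.contract x hx).V)).symm

/-- The vertices of `G'` come last, so they contribute no inversions. -/
theorem contractSign_inl (x : G.H) (hx : G.vert x ≠ G.vert (G.inv x))
    (hx' : (G.union G').vert (inlH G G' x) ≠ (G.union G').vert ((G.union G').inv (inlH G G' x))) :
    (G.union G').contractSign (inlH G G' x) hx' = G.contractSign x hx := by
  have hc : ∀ u v, cmpSign (inlV G G' u) (inlV G G' v) = cmpSign u v := fun u v =>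
    if_congr (inlV_lt_inlV G G') rfl rfl
  have hr : ∀ u, rankSign (inlV G G' u) = rankSign u := fun u => by
    unfold rankSign
    rw [prod_unionV]
    simp only [hc, cmpSign_of_lt (inlV_lt_inrV G G' u _), Finset.prod_const_one, mul_one]
  rw [OrientedGraph.contractSign_eq, OrientedGraph.contractSign_eq, inv_inlH, vert_inlH, vert_inlH, hc, hr, hr, dir_inlH]

/-- The collapsed first graph and the untouched second graph embed into the collapsed union; their
images are in increasing order and exhaust it, the merged vertex being first. -/
theorem collapse_inl (x : G.H) :
    (G.union G').collapse (inlH G G' x) = Chains.mul O (G.collapse x ⊗ₜ[ℝ] G'.chain) := by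
  by_cases hx : G.vert x = G.vert (G.inv x)
  · rw [collapse_of_eq x hx, TensorProduct.zero_tmul, map_zero]
    exact collapse_of_eq _ (congrArg (inlV G G') hx)
  have hx' := (Embed.inl G G').ne_onV hx
  obtain ⟨k, hk⟩ := (Embed.inl G G').exists_contract x hx hx'
  obtain ⟨k', hk'⟩ := (Embed.inr G G').exists_contract_of_notMem (inlH G G' x) hx'
    (by rintro ⟨w, hw⟩; exact inlV_ne_inrV _ _ _ _ hw.symm)
  have hlt : ∀ v w, k.onV v < k'.onV w := fun v w => by
    obtain ⟨v, rfl⟩ := Embed.exists_contractVert x hx v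
    refine hk v ▸ hk' w ▸ ((G.union G').contractVert_lt (inlH G G' x) hx').2 ⟨⟨?_, ?_⟩, .inr ?_⟩
    · exact (inlV_ne_inrV _ _ _ _).symm
    · exact (inlV_ne_inrV _ _ _ _).symm
    · exact inlV_lt_inrV _ _ _ _
  have hm : StrictMono k.onV := fun v w hvw => by
    obtain ⟨v, rfl⟩ := Embed.exists_contractVert x hx v
    obtain ⟨w, rfl⟩ := Embed.exists_contractVert x hx w
    rw [contractVert_lt] at hvw
    refine hk v ▸ hk w ▸ ((G.union G').contractVert_lt (inlH G G' x) hx').2 ⟨⟨?_, ?_⟩, ?_⟩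
    · exact (inlV_injective G G').ne hvw.1.1
    · exact (inlV_injective G G').ne hvw.1.2
    · exact hvw.2.imp (Or.imp (congrArg _) (congrArg _)) (inlV_lt_inlV G G').2
  have hm' : StrictMono k'.onV := fun v w hvw => by
    refine hk' v ▸ hk' w ▸ ((G.union G').contractVert_lt (inlH G G' x) hx').2 ⟨⟨?_, ?_⟩, .inr ?_⟩
    · exact (inlV_ne_inrV _ _ _ _).symm
    · exact (inlV_ne_inrV _ _ _ _).symm
    · exact (inrV_lt_inrV _ _).2 hvw
  have := (Embed.refl _).chain_eq (k.union k' fun v w => (hlt v w).ne) (by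
    refine (Set.range_id.trans (Set.eq_univ_of_forall fun v => ?_).symm).trans
      (Embed.range_union _ _ _).symm
    obtain ⟨v, rfl⟩ := Embed.exists_contractVert _ hx' v
    rcases union_vert_cases _ _ v with ⟨v, rfl⟩ | ⟨v, rfl⟩
    · exact .inl ⟨_, hk v⟩
    · exact .inr ⟨_, hk' v⟩) strictMono_id (k.strictMono_union k' _ hm hm' hlt)
  rw [collapse_of_ne x hx, units_smul_tmul, units_smul_comm, mul_chain, ← this,
    ← contractSign_inl x hx hx']
  exact collapse_of_ne _ hx'

theorem parity_chain_units (G : OGraph O) :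
    Chains.parity O G.chain = (-1 : ℤˣ) ^ Fintype.card G.V • G.chain := by
  rw [parity_chain]
  rcases Nat.even_or_odd (Fintype.card G.V) with h | h
  · rw [h.neg_one_pow, h.neg_one_pow, one_smul, one_smul]
  · rw [h.neg_one_pow, h.neg_one_pow, Units.neg_smul, neg_smul, one_smul, one_smul]

/-- The collapsed graph has one vertex less than `G`; the exponent uses one vertex more, which has
the same parity and avoids a subtraction. -/
theorem mul_collapse_comm (x : G.H) (G' : OGraph O) :
    Chains.mul O (G.collapse x ⊗ₜ[ℝ] G'.chain) = (-1 : ℤˣ) ^ ((Fintype.card G.V + 1) *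
      Fintype.card G'.V) • Chains.mul O (G'.chain ⊗ₜ[ℝ] G.collapse x) := by
  by_cases hx : G.vert x = G.vert (G.inv x)
  · rw [collapse_of_eq x hx, TensorProduct.zero_tmul, TensorProduct.tmul_zero, map_zero, smul_zero]
  · rw [collapse_of_ne x hx, units_smul_tmul, units_smul_comm, mul_chain, union_comm_chain,
      units_tmul_smul, units_smul_comm, mul_chain, smul_smul, smul_smul, ← card_contract x hx,
      mul_comm (G.contractSign x hx)]
    congr 2
    exact neg_one_pow_congr (by simp [parity_simps])

/-- Derived from the case of the first factor by exchanging the factors before and after the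
collapse. The two exchange signs differ by −1 to the number of vertices of `G`, since the second
involves one vertex less of `G'`. -/
theorem collapse_inr (x : G'.H) :
    (G.union G').collapse (inrH G G' x) =
      Chains.mul O (Chains.parity O G.chain ⊗ₜ[ℝ] G'.collapse x) := by
  obtain ⟨f, hf, hs⟩ := exists_iso_union_comm G G'
  rw [f.collapse, hf, collapse_inl, mul_collapse_comm, hs, smul_smul, parity_chain_units,
    units_smul_tmul, units_smul_comm, ← pow_add]
  congr 1
  exact neg_one_pow_congr (by simp only [parity_simps]; tauto)

theorem boundaryE_union (G G' : OGraph O) : (G.union G').boundaryE =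
    Chains.mul O (G.boundaryE ⊗ₜ[ℝ] G'.chain) +
      Chains.mul O (Chains.parity O G.chain ⊗ₜ[ℝ] G'.boundaryE) := by
  rw [boundaryE_eq, boundaryE_eq, boundaryE_eq, sum_unionH, smul_add]
  simp only [collapse_inl, collapse_inr, TensorProduct.tmul_smul, ← TensorProduct.smul_tmul',
    TensorProduct.tmul_sum, TensorProduct.sum_tmul, map_smul, map_sum]

end OGraph

namespace Chains

variable (O : CyclicOperad.{u})

variable {O} in
@[elab_as_elim]
theorem chain_induction {p : Chains O → Prop} (chain : ∀ G : OGraph O, p G.chain)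
    (add : ∀ a b, p a → p b → p (a + b)) (smul : ∀ (r : ℝ) a, p a → p (r • a)) (a : Chains O) :
    p a := by
  have ha : a ∈ Submodule.span ℝ (Set.range (OGraph.chain : OGraph O → Chains O)) :=
    OGraph.span_chain ▸ Submodule.mem_top
  induction ha using Submodule.span_induction with
  | mem _ h => obtain ⟨G, rfl⟩ := h; exact chain G
  | zero => exact zero_smul ℝ (OGraph.empty : OGraph O).chain ▸ smul 0 _ (chain _)
  | add a b _ _ ha hb => exact add a b ha hb
  | smul r a _ ha => exact smul r a ha

theorem hom_ext_tmul {M : Type*} [AddCommGroup M] [Module ℝ M]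
    {φ ψ : Chains O ⊗[ℝ] Chains O →ₗ[ℝ] M}
    (h : ∀ G G' : OGraph O, φ (G.chain ⊗ₜ G'.chain) = ψ (G.chain ⊗ₜ G'.chain)) : φ = ψ :=
  TensorProduct.ext <| OGraph.chains_hom_ext fun G => OGraph.chains_hom_ext fun G' => h G G'

theorem boundaryE_mul : boundaryE O ∘ₗ mul O = mul O ∘ₗ boundaryE₂ O := by
  refine hom_ext_tmul O fun G G' => ?_
  rw [LinearMap.comp_apply, OGraph.mul_chain, OGraph.boundaryE_chain, OGraph.boundaryE_union,
    LinearMap.comp_apply, boundaryE₂, gradedExtend, LinearMap.add_apply, map_add,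
    TensorProduct.map_tmul, TensorProduct.map_tmul, OGraph.boundaryE_chain, OGraph.boundaryE_chain]
  rfl

theorem mul_assoc (a b c : Chains O) :
    mul O (mul O (a ⊗ₜ b) ⊗ₜ c) = mul O (a ⊗ₜ mul O (b ⊗ₜ c)) := by
  induction a using chain_induction with
  | add a a' h h' => simp only [TensorProduct.add_tmul, map_add, h, h']
  | smul r a h => simp only [← TensorProduct.smul_tmul', map_smul, h]
  | chain G₁ =>
    induction b using chain_induction with
    | add a a' h h' => simp only [TensorProduct.add_tmul, TensorProduct.tmul_add, map_add, h, h']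
    | smul r a h => simp only [← TensorProduct.smul_tmul', TensorProduct.tmul_smul, map_smul, h]
    | chain G₂ =>
      induction c using chain_induction with
      | add a a' h h' => simp only [TensorProduct.tmul_add, map_add, h, h']
      | smul r a h => simp only [TensorProduct.tmul_smul, map_smul, h]
      | chain G₃ => simp only [OGraph.mul_chain, OGraph.union_assoc_chain]

theorem empty_mul (a : Chains O) : mul O ((OGraph.empty : OGraph O).chain ⊗ₜ a) = a := by
  have : mul O ∘ₗ TensorProduct.mk ℝ _ _ (OGraph.empty : OGraph O).chain = LinearMap.id :=
    OGraph.chains_hom_ext fun G => (OGraph.mul_chain _ _).trans (OGraph.empty_union_chain G)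
  exact LinearMap.congr_fun this a

theorem mul_empty (a : Chains O) : mul O (a ⊗ₜ (OGraph.empty : OGraph O).chain) = a := by
  have : mul O ∘ₗ (TensorProduct.mk ℝ _ _).flip (OGraph.empty : OGraph O).chain = LinearMap.id :=
    OGraph.chains_hom_ext fun G => (OGraph.mul_chain _ _).trans (OGraph.union_empty_chain G)
  exact LinearMap.congr_fun this a

end Chains

/-! ### Shuffle signs for nested sets and for ordered sums -/

open Classical in
/-- The sign of the reordering of `W` that moves `A` to the front. -/
def shuffleSignIn {V : Type} [LinearOrder V] [Fintype V] (W A : Set V) : ℤˣ :=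
  ∏ u, ∏ v, if u ∈ A ∧ v ∈ W \ A then cmpSign u v else 1

section

variable {V V' : Type} [LinearOrder V] [Fintype V] [LinearOrder V'] [Fintype V']

open Classical in
theorem shuffleSign_subtype (W : Set V) (A : Set {v // v ∈ W}) :
    shuffleSign A = shuffleSignIn W (Subtype.val '' A) := by
  unfold shuffleSign shuffleSignIn
  have h₁ : ∀ u : {v // v ∈ W}, u ∈ A ↔ u.1 ∈ Subtype.val '' A := fun u =>
    (Subtype.val_injective.mem_set_image).symm
  have h₂ : ∀ u v : {v // v ∈ W}, cmpSign u v = cmpSign u.1 v.1 := fun u v => rfl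
  simp only [h₁, h₂]
  rw [prod_subtype_ite (fun v => v ∈ W) (fun u => ∏ v : {v // v ∈ W},
    if u ∈ Subtype.val '' A ∧ v.1 ∉ Subtype.val '' A then cmpSign u v.1 else 1)]
  refine Finset.prod_congr rfl fun u _ => ?_
  rw [prod_subtype_ite (fun v => v ∈ W) (fun v =>
    if u ∈ Subtype.val '' A ∧ v ∉ Subtype.val '' A then cmpSign u v else 1)]
  split_ifs with hu
  · refine Finset.prod_congr rfl fun v _ => ?_
    by_cases hv : v ∈ W <;> simp [hv]
  · refine (Finset.prod_eq_one fun v _ => if_neg ?_).symm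
    rintro ⟨⟨u, -, rfl⟩, -⟩
    exact hu u.2

/-- Both sides are the sign of the reordering into the three blocks `A`, `B` and the rest; this is
the sign identity behind coassociativity. -/
theorem shuffleSign_mul_shuffleSignIn (A B : Set V) (h : Disjoint A B) :
    shuffleSign (A ∪ B) * shuffleSignIn (A ∪ B) A = shuffleSign A * shuffleSignIn Aᶜ B := by
  unfold shuffleSign shuffleSignIn
  simp only [← Finset.prod_mul_distrib]
  refine Finset.prod_congr rfl fun u _ => Finset.prod_congr rfl fun v _ => ?_
  rw [Set.disjoint_left] at h
  have := @h u
  have := @h v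
  by_cases h₁ : u ∈ A <;> by_cases h₂ : u ∈ B <;> by_cases h₃ : v ∈ A <;> by_cases h₄ : v ∈ B <;>
    simp_all

/-- Besides the inversions within each summand there are those between an element of `W` in the
second summand and an element outside `W` in the first. They give the Koszul sign of the product on
the tensor square. -/
theorem shuffleSign_sum (W : Set (V ⊕ₗ V')) : shuffleSign W =
    shuffleSign ((fun v => toLex (Sum.inl v)) ⁻¹' W) *
      shuffleSign ((fun v => toLex (Sum.inr v)) ⁻¹' W) *
      (-1) ^ ((((fun v => toLex (Sum.inl v)) ⁻¹' W : Set V)ᶜ).ncard *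
        ((fun v => toLex (Sum.inr v)) ⁻¹' W : Set V').ncard) := by
  classical
  have h : ∀ F : V ⊕ₗ V' → ℤˣ, ∏ v, F v = (∏ v, F (toLex (.inl v))) * ∏ v, F (toLex (.inr v)) :=
    fun F => Fintype.prod_sum_type _
  have h₁ : ∀ v v' : V, cmpSign (toLex (.inl v) : V ⊕ₗ V') (toLex (.inl v')) = cmpSign v v' :=
    fun _ _ => if_congr Sum.Lex.inl_lt_inl_iff rfl rfl
  have h₂ : ∀ v v' : V', cmpSign (toLex (.inr v) : V ⊕ₗ V') (toLex (.inr v')) = cmpSign v v' :=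
    fun _ _ => if_congr Sum.Lex.inr_lt_inr_iff rfl rfl
  have h₃ : ∀ (v : V) (w : V'), cmpSign (toLex (.inl v) : V ⊕ₗ V') (toLex (.inr w)) = 1 :=
    fun v w => cmpSign_of_lt (Sum.Lex.inl_lt_inr v w)
  have h₄ : ∀ (v : V) (w : V'), cmpSign (toLex (.inr w) : V ⊕ₗ V') (toLex (.inl v)) = -1 :=
    fun v w => cmpSign_of_gt (Sum.Lex.inl_lt_inr v w)
  unfold shuffleSign
  rw [h]
  simp only [h, h₁, h₂, h₃, h₄, ite_self, Finset.prod_const_one, mul_one, Finset.prod_mul_distrib,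
    Set.mem_preimage]
  rw [mul_assoc]
  congr 1
  rw [mul_comm]
  congr 1
  have h₅ : ∀ w : V', (∏ v : V, if (toLex (.inr w) : V ⊕ₗ V') ∈ W ∧ (toLex (.inl v) : V ⊕ₗ V') ∉ W
      then (-1 : ℤˣ) else 1) = if (toLex (.inr w) : V ⊕ₗ V') ∈ W then
      (-1) ^ (((fun v => toLex (Sum.inl v)) ⁻¹' W : Set V)ᶜ).ncard else 1 := by
    intro w
    split_ifs with hw
    · rw [Finset.prod_ite, Finset.prod_const, Finset.prod_const_one, mul_one,
        Set.ncard_eq_toFinset_card']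
      congr 2
      ext v
      simp [hw]
    · exact Finset.prod_eq_one fun v _ => if_neg fun h => hw h.1
  simp only [h₅]
  rw [Finset.prod_ite, Finset.prod_const, Finset.prod_const_one, mul_one, ← pow_mul,
    Set.ncard_eq_toFinset_card' ((fun v => toLex (Sum.inr v)) ⁻¹' W)]
  congr 3
  ext v
  simp

end

namespace OGraph

open CyclicOperad OrientedGraph

variable {O : CyclicOperad.{u}} {G G' : OGraph O}

/-! ### The coproduct -/

theorem saturated_image_val (W : Set G.V) (hW : G.Saturated W) (A : Set (G.induce W hW).V) :
    G.Saturated (Subtype.val '' A) ↔ (G.induce W hW).Saturated A := by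
  have hm : ∀ v : (G.induce W hW).V, v.1 ∈ Subtype.val '' A ↔ v ∈ A := fun v =>
    Subtype.val_injective.mem_set_image
  constructor
  · exact fun h k => (hm _).symm.trans ((h k.1).trans
      (hm ((G.induce W hW).vert ((G.induce W hW).inv k))))
  · intro h k
    by_cases hk : G.vert k ∈ W
    · exact (hm ⟨_, hk⟩).trans ((h ⟨k, hk⟩).trans (hm ⟨_, (hW k).1 hk⟩).symm)
    · refine iff_of_false ?_ ?_
      · rintro ⟨v, -, hv⟩; exact hk (hv ▸ v.2)
      · rintro ⟨v, -, hv⟩; exact hk ((hW k).2 (hv ▸ v.2))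

theorem inducePart_induce (W : Set G.V) (hW : G.Saturated W) (A : Set (G.induce W hW).V) :
    (G.induce W hW).inducePart A = G.inducePart (Subtype.val '' A) := by
  by_cases hA : (G.induce W hW).Saturated A
  · have hA' := (saturated_image_val W hW A).2 hA
    rw [inducePart_of_saturated _ hA, inducePart_of_saturated _ hA']
    refine ((Embed.induce _ A hA).trans (Embed.induce G W hW)).chain_eq (Embed.induce G _ hA')
      ?_ (fun _ _ h => h) fun _ _ h => h
    rw [Embed.range_induce]
    exact (Set.range_comp (Embed.induce G W hW).onV (Embed.induce _ A hA).onV).trans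
      (congrArg (Subtype.val '' ·) (Embed.range_induce _ A hA))
  · rw [inducePart_of_not_saturated _ hA,
      inducePart_of_not_saturated _ (mt (saturated_image_val W hW A).1 hA)]

theorem inducePart_of_embed {A : OGraph O} (e : Embed A G) (he : StrictMono e.onV) :
    G.inducePart (Set.range e.onV) = A.chain := by
  rw [inducePart_of_saturated _ e.saturated_range]
  exact (Embed.induce G _ _).chain_eq e (Embed.range_induce _ _ _) (fun _ _ h => h) he

theorem inducePart_univ : G.inducePart Set.univ = G.chain := by
  rw [← Set.range_id]
  exact inducePart_of_embed (Embed.refl G) strictMono_id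

open Classical in
theorem comul_inducePart (W : Set G.V) : Chains.comul O (G.inducePart W) =
    ∑ A : Set G.V with A ⊆ W,
      shuffleSignIn W A • (G.inducePart A ⊗ₜ[ℝ] G.inducePart (W \ A)) := by
  by_cases hW : G.Saturated W
  · rw [inducePart_of_saturated W hW, comul_chain, coproduct_eq]
    refine Finset.sum_bij' (fun A _ => Subtype.val '' A) (fun A _ => Subtype.val ⁻¹' A) ?_ ?_ ?_ ?_ ?_
    · intro A _
      refine Finset.mem_filter.2 ⟨Finset.mem_univ _, ?_⟩
      rintro _ ⟨v, -, rfl⟩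
      exact v.2
    · intro A _
      exact Finset.mem_univ _
    · intro A _
      exact Set.preimage_image_eq _ Subtype.val_injective
    · intro A hA
      simp only [Finset.mem_filter, Finset.mem_univ, true_and] at hA
      exact (Subtype.image_preimage_coe _ _).trans (Set.inter_eq_right.2 hA)
    · intro A _
      rw [splitAt_eq]
      refine congr_arg₂ (fun (a : ℤˣ) b => a • b) (shuffleSign_subtype W A) ?_
      refine congr_arg₂ (· ⊗ₜ[ℝ] ·) (inducePart_induce W hW A)
        ((inducePart_induce W hW Aᶜ).trans (congrArg _ ?_))
      exact (Set.image_compl_eq_range_sdiff_image Subtype.val_injective A).trans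
        (congrArg (· \ _) Subtype.range_coe)
  · rw [inducePart_of_not_saturated W hW, map_zero]
    refine (Finset.sum_eq_zero fun A hA => ?_).symm
    simp only [Finset.mem_filter, Finset.mem_univ, true_and] at hA
    -- If `A` and `W \ A` are both unions of components, then so is `W`. Hence every term vanishes
    -- when `W` is not.
    by_cases h₁ : G.Saturated A
    · by_cases h₂ : G.Saturated (W \ A)
      · refine absurd (fun h => ?_) hW
        rw [← Set.union_sdiff_cancel hA]
        exact or_congr (h₁ h) (h₂ h)
      · rw [inducePart_of_not_saturated _ h₂, TensorProduct.tmul_zero, smul_zero]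
    · rw [inducePart_of_not_saturated _ h₁, TensorProduct.zero_tmul, smul_zero]

theorem comul_chain_eq (G : OGraph O) : Chains.comul O G.chain =
    ∑ W : Set G.V, shuffleSign W • (G.inducePart W ⊗ₜ[ℝ] G.inducePart Wᶜ) := by
  rw [comul_chain, coproduct_eq]
  exact Finset.sum_congr rfl fun W _ => splitAt_eq W

/-- Both sides run over the ordered partitions of the vertices into three blocks: on the left a set
`W` and a subset `A`, on the right `A` and a subset of its complement, namely `W \ A`. -/
theorem coassoc_chain (G : OGraph O) :
    TensorProduct.assoc ℝ (Chains O) (Chains O) (Chains O)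
      (TensorProduct.map (Chains.comul O) LinearMap.id (Chains.comul O G.chain)) =
    TensorProduct.map LinearMap.id (Chains.comul O) (Chains.comul O G.chain) := by
  classical
  rw [comul_chain_eq]
  simp only [map_sum, units_smul_comm, TensorProduct.map_tmul, comul_inducePart,
    LinearMap.id_apply, TensorProduct.sum_tmul, TensorProduct.tmul_sum, units_smul_tmul,
    units_tmul_smul, Finset.smul_sum, smul_smul]
  simp only [← LinearEquiv.coe_coe, map_sum, units_smul_comm, Finset.smul_sum, smul_smul]
  simp only [LinearEquiv.coe_coe, TensorProduct.assoc_tmul]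
  rw [Finset.sum_sigma', Finset.sum_sigma']
  refine Finset.sum_bij' (fun p _ => ⟨p.2, p.1 \ p.2⟩) (fun p _ => ⟨p.1 ∪ p.2, p.1⟩) ?_ ?_ ?_ ?_ ?_
  · rintro ⟨W, A⟩ h
    simp only [Finset.mem_sigma, Finset.mem_filter, Finset.mem_univ, true_and] at h ⊢
    exact fun v hv => hv.2
  · rintro ⟨A, B⟩ h
    simp only [Finset.mem_sigma, Finset.mem_filter, Finset.mem_univ, true_and] at h ⊢
    exact Set.subset_union_left
  · rintro ⟨W, A⟩ h
    simp only [Finset.mem_sigma, Finset.mem_filter, Finset.mem_univ, true_and] at h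
    exact Sigma.ext (Set.union_sdiff_cancel h) HEq.rfl
  · rintro ⟨A, B⟩ h
    simp only [Finset.mem_sigma, Finset.mem_filter, Finset.mem_univ, true_and] at h
    have : (A ∪ B) \ A = B := Set.union_sdiff_cancel_left fun v hv => h hv.2 hv.1
    simp only [this]
  · rintro ⟨W, A⟩ h
    simp only [Finset.mem_sigma, Finset.mem_filter, Finset.mem_univ, true_and] at h
    have h₁ := shuffleSign_mul_shuffleSignIn A (W \ A) Set.disjoint_sdiff_right
    rw [Set.union_sdiff_cancel h] at h₁
    have h₂ : Aᶜ \ (W \ A) = Wᶜ := by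
      ext v
      have := @h v
      simp only [Set.mem_sdiff, Set.mem_compl_iff]
      tauto
    simp only [h₁, h₂]

theorem counit_inducePart (W : Set G.V) [Decidable (W = ∅)] :
    Chains.counit O (G.inducePart W) = if W = ∅ then 1 else 0 := by
  split_ifs with h
  · subst h
    rw [inducePart_of_saturated (∅ : Set G.V) (fun _ => Iff.rfl), counit_chain, if_pos]
    exact ⟨fun v => v.2⟩
  · by_cases hW : G.Saturated W
    · rw [inducePart_of_saturated W hW, counit_chain, if_neg]
      obtain ⟨v, hv⟩ := Set.nonempty_iff_ne_empty.2 h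
      exact fun hh => hh.false ⟨v, hv⟩
    · rw [inducePart_of_not_saturated W hW, map_zero]

theorem shuffleSign_empty {V : Type} [LinearOrder V] [Fintype V] :
    shuffleSign (∅ : Set V) = 1 :=
  Finset.prod_eq_one fun _ _ => Finset.prod_eq_one fun _ _ => if_neg fun h => h.1

theorem shuffleSign_univ {V : Type} [LinearOrder V] [Fintype V] :
    shuffleSign (Set.univ : Set V) = 1 :=
  Finset.prod_eq_one fun _ _ => Finset.prod_eq_one fun _ _ => if_neg fun h => h.2 trivial

theorem counit_comul_chain (G : OGraph O) : TensorProduct.lid ℝ (Chains O)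
    (TensorProduct.map (Chains.counit O) LinearMap.id (Chains.comul O G.chain)) = G.chain := by
  classical
  rw [comul_chain_eq, ← LinearEquiv.coe_coe, ← LinearMap.comp_apply, map_sum,
    Finset.sum_eq_single ∅]
  · rw [shuffleSign_empty, one_smul, LinearMap.comp_apply, TensorProduct.map_tmul,
      counit_inducePart, if_pos rfl, Set.compl_empty, inducePart_univ]
    exact one_smul ℝ G.chain
  · intro W _ hW
    rw [units_smul_comm, LinearMap.comp_apply, TensorProduct.map_tmul, counit_inducePart,
      if_neg hW, TensorProduct.zero_tmul, map_zero, smul_zero]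
  · exact fun h => absurd (Finset.mem_univ _) h

theorem comul_counit_chain (G : OGraph O) : TensorProduct.rid ℝ (Chains O)
    (TensorProduct.map LinearMap.id (Chains.counit O) (Chains.comul O G.chain)) = G.chain := by
  classical
  rw [comul_chain_eq, ← LinearEquiv.coe_coe, ← LinearMap.comp_apply, map_sum,
    Finset.sum_eq_single Set.univ]
  · rw [shuffleSign_univ, one_smul, LinearMap.comp_apply, TensorProduct.map_tmul,
      counit_inducePart, if_pos Set.compl_univ, inducePart_univ]
    exact one_smul ℝ G.chain
  · intro W _ hW
    rw [units_smul_comm, LinearMap.comp_apply, TensorProduct.map_tmul, counit_inducePart,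
      if_neg (mt Set.compl_empty_iff.1 hW), TensorProduct.tmul_zero, map_zero, smul_zero]
  · exact fun h => absurd (Finset.mem_univ _) h

theorem comul_empty : Chains.comul O (empty : OGraph O).chain =
    (empty : OGraph O).chain ⊗ₜ[ℝ] (empty : OGraph O).chain := by
  rw [comul_chain_eq]
  have h : ∀ W : Set (empty : OGraph O).V, W = Set.univ := fun W =>
    Set.eq_univ_of_forall fun v => v.elim
  rw [Fintype.sum_eq_single Set.univ fun W hW => absurd (h W) hW, h Set.univᶜ, shuffleSign_univ,
    inducePart_univ, one_smul]

theorem inducePart_union (W : Set (G.union G').V) : (G.union G').inducePart W =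
    Chains.mul O (G.inducePart (inlV G G' ⁻¹' W) ⊗ₜ[ℝ] G'.inducePart (inrV G G' ⁻¹' W)) := by
  by_cases h₁ : G.Saturated (inlV G G' ⁻¹' W)
  swap
  · rw [inducePart_of_not_saturated _ h₁, TensorProduct.zero_tmul, map_zero,
      inducePart_of_not_saturated]
    exact fun h => h₁ fun x => h (inlH G G' x)
  by_cases h₂ : G'.Saturated (inrV G G' ⁻¹' W)
  swap
  · rw [inducePart_of_not_saturated _ h₂, TensorProduct.tmul_zero, map_zero,
      inducePart_of_not_saturated]
    exact fun h => h₂ fun x => h (inrH G G' x)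
  rw [inducePart_of_saturated _ h₁, inducePart_of_saturated _ h₂, mul_chain]
  let e := ((Embed.induce G _ h₁).trans (Embed.inl G G')).union
    ((Embed.induce G' _ h₂).trans (Embed.inr G G')) fun _ _ => inlV_ne_inrV _ _ _ _
  have he : Set.range e.onV = W := by
    refine (Embed.range_union _ _ _).trans (Set.Subset.antisymm ?_ fun v hv => ?_)
    · rintro _ (⟨v, rfl⟩ | ⟨v, rfl⟩)
      exacts [v.2, v.2]
    · rcases union_vert_cases _ _ v with ⟨v, rfl⟩ | ⟨v, rfl⟩
      · exact .inl ⟨⟨v, hv⟩, rfl⟩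
      · exact .inr ⟨⟨v, hv⟩, rfl⟩
  conv_lhs => rw [← he]
  refine inducePart_of_embed e (Embed.strictMono_union _ _ _ ?_ ?_ ?_)
  · exact fun v w h => (inlV_lt_inlV G G').2 h
  · exact fun v w h => (inrV_lt_inrV G G').2 h
  · exact fun v w => inlV_lt_inrV G G' _ _

theorem parity_inducePart (W : Set G.V) :
    Chains.parity O (G.inducePart W) = (-1 : ℤˣ) ^ W.ncard • G.inducePart W := by
  by_cases hW : G.Saturated W
  · rw [inducePart_of_saturated W hW, parity_chain_units]
    congr 2
    exact (Nat.card_eq_fintype_card (α := (G.induce W hW).V)).symm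
  · rw [inducePart_of_not_saturated W hW, map_zero, smul_zero]

end OGraph

/-- For signs β and γ, half of 1 + β + γ − βγ is −1 if both are −1, and 1 otherwise. -/
theorem gradedTensorMul_tmul {A : Type*} [AddCommGroup A] [Module ℝ A] {γ : A →ₗ[ℝ] A}
    {μ : A ⊗[ℝ] A →ₗ[ℝ] A} {b c : A} {m n : ℕ} (hb : γ b = (-1 : ℤˣ) ^ m • b)
    (hc : γ c = (-1 : ℤˣ) ^ n • c) (a d : A) :
    gradedTensorMul γ μ ((a ⊗ₜ b) ⊗ₜ (c ⊗ₜ d)) =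
      (-1 : ℤˣ) ^ (m * n) • (μ (a ⊗ₜ c) ⊗ₜ[ℝ] μ (b ⊗ₜ d)) := by
  have h : gradedTensorMul γ μ ((a ⊗ₜ b) ⊗ₜ (c ⊗ₜ d)) = (1 / 2 : ℝ) •
      (μ (a ⊗ₜ c) ⊗ₜ[ℝ] μ (b ⊗ₜ d) + μ (a ⊗ₜ c) ⊗ₜ[ℝ] μ (γ b ⊗ₜ d) +
        μ (a ⊗ₜ γ c) ⊗ₜ[ℝ] μ (b ⊗ₜ d) - μ (a ⊗ₜ γ c) ⊗ₜ[ℝ] μ (γ b ⊗ₜ d)) := by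
    simp only [gradedTensorMul, LinearMap.comp_apply, LinearMap.smul_apply, LinearMap.add_apply,
      LinearMap.sub_apply, LinearMap.id_apply, TensorProduct.map_tmul, map_smul, map_add, map_sub,
      LinearEquiv.coe_coe, TensorProduct.tensorTensorTensorComm_tmul]
  rw [h, hb, hc]
  simp only [units_smul_tmul, units_tmul_smul, units_smul_comm]
  rw [mul_comm m n, pow_mul]
  rcases Nat.even_or_odd m with hm | hm <;> rcases Nat.even_or_odd n with hn | hn <;>
    simp only [hm.neg_one_pow, hn.neg_one_pow, one_pow, one_smul, Units.neg_smul] <;> module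

namespace OGraph

open CyclicOperad OrientedGraph

variable {O : CyclicOperad.{u}} {G G' : OGraph O}

/-- A set of vertices of a disjoint union is a pair of sets, its subgraph is the product of the two
subgraphs, and `shuffleSign_sum` supplies the Koszul sign. -/
theorem comul_union (G G' : OGraph O) : Chains.comul O (G.union G').chain =
    gradedTensorMul (Chains.parity O) (Chains.mul O)
      (Chains.comul O G.chain ⊗ₜ[ℝ] Chains.comul O G'.chain) := by
  rw [comul_chain_eq, comul_chain_eq, comul_chain_eq, TensorProduct.sum_tmul]
  simp only [TensorProduct.tmul_sum, map_sum, units_smul_tmul, units_tmul_smul, units_smul_comm,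
    gradedTensorMul_tmul (parity_inducePart _) (parity_inducePart _)]
  rw [← Finset.sum_product', Finset.univ_product_univ]
  refine Fintype.sum_equiv (⟨fun W => (inlV G G' ⁻¹' W, inrV G G' ⁻¹' W),
    fun p => {v | Sum.elim (· ∈ p.1) (· ∈ p.2) (ofLex v)}, fun W => ?_, fun p => rfl⟩ :
      Set (G.union G').V ≃ Set G.V × Set G'.V) _ _ fun W => ?_
  · ext v
    rcases union_vert_cases _ _ v with ⟨v, rfl⟩ | ⟨v, rfl⟩ <;> exact Iff.rfl
  · rw [inducePart_union, inducePart_union, smul_smul, smul_smul]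
    refine congrArg (· • _) ((shuffleSign_sum W).trans ?_)
    exact congrArg (· * _) (mul_comm _ _)

end OGraph

namespace OGraph

open CyclicOperad OrientedGraph

variable {O : CyclicOperad.{u}} {G G' : OGraph O}

theorem prod_two_one {V : Type} [Fintype V] [DecidableEq V] (F : V → ℤˣ) {a b : V} (hab : a ≠ b) :
    ∏ u, (if u = a ∨ u = b then 1 else F u) = F a * F b * ∏ u, F u := by
  have h := prod_two (fun _ => 1) hab
  rw [mul_one, one_mul, Finset.prod_const_one] at h
  suffices e : ∏ u, (if u = a ∨ u = b then 1 else F u) =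
      (∏ u, if u = a ∨ u = b then -1 else F u) * ∏ u, (if u = a ∨ u = b then (-1 : ℤˣ) else 1) by
    rw [e, prod_two F hab, h, mul_one]
  rw [← Finset.prod_mul_distrib]
  refine Finset.prod_congr rfl fun u _ => ?_
  split_ifs
  · exact (neg_mul_neg (1 : ℤˣ) 1).symm
  · exact (mul_one _).symm

/-! ### The coproduct and the boundary operator -/

-- In the subgraph, rank signs involve only comparisons with vertices of `U`; the product consists
-- of the missing comparisons of the endpoints with the vertices outside `U`.
open Classical in
theorem contractSign_induce (U : Set G.V) (hU : G.Saturated U) (x : G.H) (hxU : G.vert x ∈ U)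
    (hx : G.vert x ≠ G.vert (G.inv x))
    (hx' : (G.induce U hU).vert ⟨x, hxU⟩ ≠ (G.induce U hU).vert ((G.induce U hU).inv ⟨x, hxU⟩)) :
    G.contractSign x hx = (G.induce U hU).contractSign ⟨x, hxU⟩ hx' *
      ∏ u, if u ∈ U then 1 else cmpSign (G.vert x) u * cmpSign (G.vert (G.inv x)) u := by
  have h : ∀ u : (G.induce U hU).V,
      rankSign u = ∏ v, if v ∈ U then cmpSign u.1 v else 1 := fun u =>
    prod_subtype_ite (fun v => v ∈ U) fun v => cmpSign u.1 v
  have h₁ : (G.induce U hU).contractSign ⟨x, hxU⟩ hx' = G.dir x *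
      (cmpSign (G.vert (G.inv x)) (G.vert x) * ((∏ v, if v ∈ U then cmpSign (G.vert x) v else 1) *
        ∏ v, if v ∈ U then cmpSign (G.vert (G.inv x)) v else 1)) := by
    refine (OrientedGraph.contractSign_eq _ _ _).trans ?_
    rw [h, h]
    rfl
  rw [h₁, OrientedGraph.contractSign_eq, mul_assoc, mul_assoc]
  congr 2
  unfold rankSign
  rw [← Finset.prod_mul_distrib, ← Finset.prod_mul_distrib, ← Finset.prod_mul_distrib]
  refine Finset.prod_congr rfl fun u _ => ?_
  split_ifs <;> simp

theorem mem_image_contractVert {x : G.H} {hx : G.vert x ≠ G.vert (G.inv x)} {W : Set G.V}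
    (hW : G.vert x ∈ W ↔ G.vert (G.inv x) ∈ W) (u : G.V) :
    G.contractVert x hx u ∈ G.contractVert x hx '' W ↔ u ∈ W := by
  constructor
  · rintro ⟨v, hv, he⟩
    rcases (G.contractVert_inj x hx).1 he with rfl | ⟨h₁, h₂⟩
    · exact hv
    · rcases h₁ with rfl | rfl <;> rcases h₂ with rfl | rfl <;> tauto
  · exact fun h => ⟨u, h, rfl⟩

open Classical in
theorem shuffleSign_contract {x : G.H} {hx : G.vert x ≠ G.vert (G.inv x)} {W : Set G.V}
    (hW : G.vert x ∈ W ↔ G.vert (G.inv x) ∈ W) :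
    shuffleSign (G.contractVert x hx '' W) =
      ((if G.vert x ∈ W ∧ G.vert x ∉ W then
          cmpSign (G.contractVert x hx (G.vert x)) (G.contractVert x hx (G.vert x)) else 1) *
        ∏ v, if G.vert x ∈ W ∧ v ∉ W then
          cmpSign (G.contractVert x hx (G.vert x)) (G.contractVert x hx v) else 1) *
      ∏ u, ((if u ∈ W ∧ G.vert x ∉ W then
          cmpSign (G.contractVert x hx u) (G.contractVert x hx (G.vert x)) else 1) *
        ∏ v, if u ∈ W ∧ v ∉ W then
          cmpSign (G.contractVert x hx u) (G.contractVert x hx v) else 1) := by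
  unfold shuffleSign
  rw [prod_contractV]
  simp only [prod_contractV, mem_image_contractVert hW]

-- The merged vertex is first, so it is not inverted with any vertex outside `W`. The product
-- consists of the inversions its two endpoints had in `G`; it is the product in
-- `contractSign_induce`, and the two cancel.
open Classical in
theorem shuffleSign_contract_of_mem {x : G.H} {hx : G.vert x ≠ G.vert (G.inv x)} {W : Set G.V}
    (h : G.vert x ∈ W) (h' : G.vert (G.inv x) ∈ W) :
    shuffleSign W = shuffleSign (G.contractVert x hx '' W) *
      ∏ u, if u ∈ W then 1 else cmpSign (G.vert x) u * cmpSign (G.vert (G.inv x)) u := by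
  have hne : ∀ v, v ∉ W → v ≠ G.vert x ∧ v ≠ G.vert (G.inv x) := fun v hv =>
    ⟨fun e => hv (e ▸ h), fun e => hv (e ▸ h')⟩
  have h₁ : ∀ u, u = G.vert x ∨ u = G.vert (G.inv x) → (∏ v, if u ∈ W ∧ v ∉ W then
      cmpSign (G.contractVert x hx u) (G.contractVert x hx v) else 1) = 1 := fun u hu =>
    Finset.prod_eq_one fun v _ => by
      split_ifs with hv
      · rw [cmpSign_contractVert_of_eq hu, if_neg (not_or.2 (hne v hv.2))]
      · rfl
  have h₂ : ∀ u, u ≠ G.vert x ∧ u ≠ G.vert (G.inv x) → (∏ v, if u ∈ W ∧ v ∉ W then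
      cmpSign (G.contractVert x hx u) (G.contractVert x hx v) else 1) =
      ∏ v, if u ∈ W ∧ v ∉ W then cmpSign u v else 1 := fun u hu =>
    Finset.prod_congr rfl fun v _ => by
      split_ifs with hv
      · rw [cmpSign_contractVert_of_ne hu, if_neg (not_or.2 (hne v hv.2))]
      · rfl
  have h₃ : shuffleSign (G.contractVert x hx '' W) =
      ∏ u, if u = G.vert x ∨ u = G.vert (G.inv x) then 1 else
        ∏ v, if u ∈ W ∧ v ∉ W then cmpSign u v else 1 := by
    rw [shuffleSign_contract (iff_of_true h h'), h₁ _ (.inl rfl), if_neg (fun hh => hh.2 h),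
      one_mul, one_mul]
    refine Finset.prod_congr rfl fun u _ => ?_
    rw [if_neg fun hh => hh.2 h, one_mul]
    split_ifs with hu
    · exact h₁ u hu
    · exact h₂ u (not_or.1 hu)
  rw [h₃, prod_two_one _ hx, ← Finset.prod_mul_distrib, mul_right_comm, ← Finset.prod_mul_distrib]
  refine (Eq.trans (congrArg (· * _) (Finset.prod_eq_one fun v _ => ?_)) (one_mul _)).symm
  by_cases hv : v ∈ W <;> simp [hv, h, h', mul_mul_mul_comm]

-- The merged vertex now lies outside `W` and comes first, so it is inverted once with every element
-- of `W`. The resulting sign is the Koszul sign of ∂_E acting on the second tensor factor.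
open Classical in
theorem shuffleSign_contract_of_notMem {x : G.H} {hx : G.vert x ≠ G.vert (G.inv x)} {W : Set G.V}
    (h : G.vert x ∉ W) (h' : G.vert (G.inv x) ∉ W) :
    (-1) ^ W.ncard * shuffleSign W = shuffleSign (G.contractVert x hx '' W) *
      ∏ u, @ite _ (u ∈ Wᶜ) (Classical.propDecidable _) 1
        (cmpSign (G.vert x) u * cmpSign (G.vert (G.inv x)) u) := by
  have hne : ∀ v, v ∈ W → v ≠ G.vert x ∧ v ≠ G.vert (G.inv x) := fun v hv =>
    ⟨fun e => h (e ▸ hv), fun e => h' (e ▸ hv)⟩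
  have h₁ : ∀ u, u ∈ W → (∏ v, if u ∈ W ∧ v ∉ W then
      cmpSign (G.contractVert x hx u) (G.contractVert x hx v) else 1) =
      cmpSign u (G.vert x) * cmpSign u (G.vert (G.inv x)) *
        ∏ v, if u ∈ W ∧ v ∉ W then cmpSign u v else 1 := fun u hu => by
    have := prod_two (fun v => if u ∈ W ∧ v ∉ W then cmpSign u v else 1) hx
    rw [if_pos ⟨hu, h⟩, if_pos ⟨hu, h'⟩] at this
    rw [← this]
    refine Finset.prod_congr rfl fun v _ => ?_
    rw [cmpSign_contractVert_of_ne (hne u hu)]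
    by_cases hv : v = G.vert x ∨ v = G.vert (G.inv x)
    · have : v ∉ W := by rcases hv with rfl | rfl <;> assumption
      simp only [if_pos hv, if_pos (show u ∈ W ∧ v ∉ W from ⟨hu, this⟩)]
    · rw [if_neg hv, if_neg hv]
  have h₂ : ((-1) ^ W.ncard : ℤˣ) = ∏ u, if u ∈ W then -1 else 1 := by
    rw [Finset.prod_ite, Finset.prod_const, Finset.prod_const_one, mul_one,
      Set.ncard_eq_toFinset_card']
    congr 2
    ext v
    simp
  rw [shuffleSign_contract (iff_of_false h h'), if_neg (fun hh => h hh.1), one_mul,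
    Finset.prod_eq_one (fun v _ => if_neg fun hh => h hh.1), one_mul, h₂]
  unfold shuffleSign
  rw [← Finset.prod_mul_distrib, ← Finset.prod_mul_distrib]
  refine Finset.prod_congr rfl fun u _ => ?_
  by_cases hu : u ∈ W
  · rw [h₁ u hu, if_pos hu, if_pos ⟨hu, h⟩, if_neg (show ¬ u ∈ Wᶜ from not_not_intro hu),
      cmpSign_contractVert_of_ne (hne u hu), if_pos (.inl rfl), cmpSign_swap (hne u hu).1,
      cmpSign_swap (hne u hu).2, neg_mul_neg]
    have e := Int.units_mul_self (cmpSign u (G.vert x) * cmpSign u (G.vert (G.inv x)))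
    generalize cmpSign u (G.vert x) * cmpSign u (G.vert (G.inv x)) = s at e ⊢
    rw [mul_assoc, mul_right_comm, e, one_mul]
  · simp [hu]

theorem Embed.strictMono_contract {A B : OGraph O} (e : Embed A B) (he : StrictMono e.onV)
    {x : A.H} {hx : A.vert x ≠ A.vert (A.inv x)}
    {hx' : B.vert (e.onH x) ≠ B.vert (B.inv (e.onH x))}
    (k : Embed (A.contract x hx) (B.contract (e.onH x) hx'))
    (hk : ∀ v, k.onV (A.contractVert x hx v) = B.contractVert (e.onH x) hx' (e.onV v)) :
    StrictMono k.onV := fun v w hvw => by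
  obtain ⟨v, rfl⟩ := Embed.exists_contractVert x hx v
  obtain ⟨w, rfl⟩ := Embed.exists_contractVert x hx w
  rw [contractVert_lt] at hvw
  rw [hk, hk, contractVert_lt, e.inv_onH, e.vert_onH, e.vert_onH, e.onV_injective.ne_iff,
    e.onV_injective.ne_iff, e.onV_injective.eq_iff, e.onV_injective.eq_iff, he.lt_iff_lt]
  exact hvw

theorem Embed.range_contract {A B : OGraph O} (e : Embed A B)
    {x : A.H} {hx : A.vert x ≠ A.vert (A.inv x)}
    {hx' : B.vert (e.onH x) ≠ B.vert (B.inv (e.onH x))}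
    (k : Embed (A.contract x hx) (B.contract (e.onH x) hx'))
    (hk : ∀ v, k.onV (A.contractVert x hx v) = B.contractVert (e.onH x) hx' (e.onV v)) :
    Set.range k.onV = B.contractVert (e.onH x) hx' '' Set.range e.onV := by
  ext v
  constructor
  · rintro ⟨v, rfl⟩
    obtain ⟨v, rfl⟩ := Embed.exists_contractVert x hx v
    exact ⟨_, ⟨v, rfl⟩, (hk v).symm⟩
  · rintro ⟨_, ⟨v, rfl⟩, rfl⟩
    exact ⟨_, hk v⟩

theorem inducePart_contract_of_mem (U : Set G.V) (hU : G.Saturated U) (x : G.H)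
    (hxU : G.vert x ∈ U) (hx : G.vert x ≠ G.vert (G.inv x))
    (hx' : (G.induce U hU).vert ⟨x, hxU⟩ ≠ (G.induce U hU).vert ((G.induce U hU).inv ⟨x, hxU⟩)) :
    (G.contract x hx).inducePart (G.contractVert x hx '' U) =
      ((G.induce U hU).contract ⟨x, hxU⟩ hx').chain := by
  obtain ⟨k, hk⟩ := (Embed.induce G U hU).exists_contract ⟨x, hxU⟩ hx' hx
  have h₁ := (Embed.induce G U hU).range_contract k hk
  rw [Embed.range_induce] at h₁
  refine Eq.trans (congrArg _ h₁.symm) (inducePart_of_embed k ?_)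
  exact (Embed.induce G U hU).strictMono_contract (fun _ _ h => h) k hk

theorem inducePart_contract_of_notMem (U : Set G.V) (hU : G.Saturated U) (x : G.H)
    (hxU : G.vert x ∉ U) (hx : G.vert x ≠ G.vert (G.inv x)) :
    (G.contract x hx).inducePart (G.contractVert x hx '' U) = G.inducePart U := by
  have hr := Embed.range_induce G U hU
  obtain ⟨k, hk⟩ := (Embed.induce G U hU).exists_contract_of_notMem x hx (hr.symm ▸ hxU)
  have h₁ : Set.range k.onV = G.contractVert x hx '' U := by
    refine Eq.trans ?_ (congrArg (G.contractVert x hx '' ·) hr)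
    exact (congrArg Set.range (funext hk)).trans (Set.range_comp (G.contractVert x hx) (Embed.induce G U hU).onV)
  rw [← h₁, inducePart_of_saturated U hU]
  refine inducePart_of_embed k fun v w hvw => ?_
  rw [hk, hk, contractVert_lt]
  exact ⟨⟨fun e => hxU (e ▸ w.2), fun e => hxU ((hU x).2 (e ▸ w.2))⟩, .inr hvw⟩

open Classical in
/-- The terms of the coproduct of the graph with the edge of `x` collapsed, indexed by sets of
vertices of the original graph. -/
def collapseSplit (G : OGraph O) (x : G.H) (W : Set G.V) : Chains O ⊗[ℝ] Chains O :=
  if h : G.vert x ≠ G.vert (G.inv x) ∧ G.Saturated W then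
    G.contractSign x h.1 • (G.contract x h.1).splitAt (G.contractVert x h.1 '' W) else 0

theorem compl_image_contractVert {x : G.H} {hx : G.vert x ≠ G.vert (G.inv x)} {W : Set G.V}
    (hW : G.vert x ∈ W ↔ G.vert (G.inv x) ∈ W) :
    (G.contractVert x hx '' W)ᶜ = G.contractVert x hx '' Wᶜ := by
  ext v
  obtain ⟨v, rfl⟩ := Embed.exists_contractVert x hx v
  rw [mem_image_contractVert (W := Wᶜ) (not_congr hW), Set.mem_compl_iff,
    mem_image_contractVert hW]
  rfl

theorem collapseSplit_of_mem (x : G.H) (W : Set G.V) (hW : G.Saturated W) (hxW : G.vert x ∈ W) :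
    G.collapseSplit x W =
      shuffleSign W • ((G.induce W hW).collapse ⟨x, hxW⟩ ⊗ₜ[ℝ] G.inducePart Wᶜ) := by
  unfold collapseSplit
  by_cases hx : G.vert x = G.vert (G.inv x)
  · rw [dif_neg fun h => h.1 hx, collapse_of_eq (G := G.induce W hW) ⟨x, hxW⟩ (Subtype.ext hx),
      TensorProduct.zero_tmul, smul_zero]
  have hx' : (G.induce W hW).vert ⟨x, hxW⟩ ≠ (G.induce W hW).vert ((G.induce W hW).inv ⟨x, hxW⟩) :=
    fun e => hx (congrArg Subtype.val e)
  rw [dif_pos ⟨hx, hW⟩, collapse_of_ne _ hx', splitAt_eq, compl_image_contractVert (hW x),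
    inducePart_contract_of_mem W hW x hxW hx hx',
    inducePart_contract_of_notMem Wᶜ hW.compl x (fun h => h hxW) hx, units_smul_tmul, smul_smul,
    smul_smul]
  refine congrArg (· • _) ?_
  rw [contractSign_induce W hW x hxW hx hx',
    shuffleSign_contract_of_mem (hx := hx) hxW ((hW x).1 hxW)]
  exact (by intros; ac_rfl : ∀ p q s : ℤˣ, p * q * s = s * q * p) _ _ _

theorem collapseSplit_of_notMem (x : G.H) (W : Set G.V) (hW : G.Saturated W)
    (hxW : G.vert x ∉ W) : G.collapseSplit x W = shuffleSign W •
      (Chains.parity O (G.inducePart W) ⊗ₜ[ℝ] (G.induce Wᶜ hW.compl).collapse ⟨x, hxW⟩) := by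
  unfold collapseSplit
  by_cases hx : G.vert x = G.vert (G.inv x)
  · rw [dif_neg fun h => h.1 hx, collapse_of_eq (G := G.induce Wᶜ hW.compl) ⟨x, hxW⟩ (Subtype.ext hx),
      TensorProduct.tmul_zero, smul_zero]
  have hx' : (G.induce Wᶜ hW.compl).vert ⟨x, hxW⟩ ≠
      (G.induce Wᶜ hW.compl).vert ((G.induce Wᶜ hW.compl).inv ⟨x, hxW⟩) :=
    fun e => hx (congrArg Subtype.val e)
  rw [dif_pos ⟨hx, hW⟩, collapse_of_ne _ hx', splitAt_eq, compl_image_contractVert (hW x),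
    inducePart_contract_of_mem Wᶜ hW.compl x hxW hx hx', parity_inducePart,
    inducePart_contract_of_notMem W hW x hxW hx, units_smul_tmul, units_tmul_smul, smul_smul,
    smul_smul, smul_smul]
  refine congrArg (· • _) ?_
  have h := shuffleSign_contract_of_notMem (hx := hx) hxW (mt (hW x).2 hxW)
  rw [contractSign_induce Wᶜ hW.compl x hxW hx hx', mul_comm (shuffleSign W), h]
  exact (by intros; ac_rfl : ∀ p q s : ℤˣ, p * q * s = s * q * p) _ _ _

theorem boundaryE_splitAt_left (W : Set G.V) [DecidablePred (· ∈ W)] :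
    TensorProduct.map (Chains.boundaryE O) LinearMap.id (G.splitAt W) =
      (1 / 2 : ℝ) • ∑ x, if G.vert x ∈ W then G.collapseSplit x W else 0 := by
  rw [splitAt_eq, units_smul_comm, TensorProduct.map_tmul]
  by_cases hW : G.Saturated W
  · rw [inducePart_of_saturated W hW, boundaryE_chain, boundaryE_eq, ← TensorProduct.smul_tmul',
      ← units_smul_real_comm, TensorProduct.sum_tmul, Finset.smul_sum]
    refine congrArg _ ((@sum_subtype_dite _ _ _ _ (fun x => G.vert x ∈ W) _
      (G.induce W hW).fintypeH _).trans (Finset.sum_congr rfl fun x _ => ?_))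
    split_ifs with h
    · exact (collapseSplit_of_mem x W hW h).symm
    · rfl
  · rw [inducePart_of_not_saturated W hW, map_zero, TensorProduct.zero_tmul, smul_zero]
    refine (smul_eq_zero.2 (.inr (Finset.sum_eq_zero fun x _ => ?_))).symm
    rw [collapseSplit, dif_neg fun h => hW h.2, ite_self]

theorem boundaryE_splitAt_right (W : Set G.V) [DecidablePred (· ∈ W)] :
    TensorProduct.map (Chains.parity O) (Chains.boundaryE O) (G.splitAt W) =
      (1 / 2 : ℝ) • ∑ x, if G.vert x ∈ W then 0 else G.collapseSplit x W := by
  classical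
  rw [splitAt_eq, units_smul_comm, TensorProduct.map_tmul]
  by_cases hW : G.Saturated W
  · rw [inducePart_of_saturated Wᶜ hW.compl, boundaryE_chain, boundaryE_eq,
      TensorProduct.tmul_smul,
      ← units_smul_real_comm, TensorProduct.tmul_sum, Finset.smul_sum]
    refine congrArg _ ((@sum_subtype_dite _ _ _ _ (fun x => G.vert x ∈ Wᶜ) _
      (G.induce Wᶜ hW.compl).fintypeH _).trans (Finset.sum_congr rfl fun x _ => ?_))
    by_cases h : G.vert x ∈ W
    · rw [if_pos h]; exact dif_neg (not_not_intro h)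
    · rw [if_neg h]
      exact (dif_pos (c := G.vert x ∈ Wᶜ) h).trans (collapseSplit_of_notMem x W hW h).symm
  · rw [inducePart_of_not_saturated W hW, map_zero, TensorProduct.zero_tmul, smul_zero]
    refine (smul_eq_zero.2 (.inr (Finset.sum_eq_zero fun x _ => ?_))).symm
    rw [collapseSplit, dif_neg fun h => hW h.2, ite_self]

theorem saturated_contract_iff {x : G.H} {hx : G.vert x ≠ G.vert (G.inv x)}
    (W : Set (G.contract x hx).V) :
    (G.contract x hx).Saturated W ↔ G.Saturated (G.contractVert x hx ⁻¹' W) := by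
  constructor
  · intro h y
    by_cases hy : y ≠ x ∧ y ≠ G.inv x
    · exact h (contractMk x hx y hy)
    · have h₁ : G.contractVert x hx (G.vert x) = G.contractVert x hx (G.vert (G.inv x)) :=
        (G.contractVert_inj x hx).2 (.inr ⟨.inl rfl, .inr rfl⟩)
      rcases not_and_or.1 hy with hy | hy <;> rw [not_not] at hy <;> subst hy
      · exact iff_of_eq (congrArg (· ∈ W) h₁)
      · rw [G.inv_inv]
        exact iff_of_eq (congrArg (· ∈ W) h₁.symm)
  · exact fun h y => h (G.contractIncl x hx y)

/-- Unions of components of the collapsed graph correspond to those of `G` by preimage, since a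
saturated set contains both endpoints of an edge or neither. -/
theorem comul_collapse (x : G.H) :
    Chains.comul O (G.collapse x) = ∑ W : Set G.V, G.collapseSplit x W := by
  classical
  by_cases hx : G.vert x = G.vert (G.inv x)
  · rw [collapse_of_eq x hx, map_zero]
    exact (Finset.sum_eq_zero fun W _ => dif_neg fun h => h.1 hx).symm
  rw [collapse_of_ne x hx, units_smul_comm, comul_chain, coproduct_eq, Finset.smul_sum]
  have h₁ : ∀ W : Set (G.contract x hx).V,
      G.contractSign x hx • (G.contract x hx).splitAt W ≠ 0 → (G.contract x hx).Saturated W := by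
    intro W h
    by_contra hW
    exact h (by rw [OGraph.splitAt, dif_neg hW, smul_zero])
  have h₂ : ∀ W : Set G.V, G.collapseSplit x W ≠ 0 → G.Saturated W := by
    intro W h
    by_contra hW
    exact h (dif_neg fun h => hW h.2)
  -- Image and preimage under the collapse are inverse to each other only on saturated sets, so the
  -- sums are restricted to these first.
  rw [← Finset.sum_filter_of_ne fun W _ => h₁ W, ← Finset.sum_filter_of_ne fun W _ => h₂ W]
  have hsurj : Function.Surjective (G.contractVert x hx) := Embed.exists_contractVert x hx
  have h₃ : ∀ W, G.Saturated W → G.contractVert x hx ⁻¹' (G.contractVert x hx '' W) = W :=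
    fun W hW => Set.ext fun v => mem_image_contractVert (hW x) v
  refine Finset.sum_bij' (fun W _ => G.contractVert x hx ⁻¹' W)
    (fun W _ => G.contractVert x hx '' W) ?_ ?_ ?_ ?_ ?_
  · intro W hW
    rw [Finset.mem_filter] at hW ⊢
    exact ⟨Finset.mem_univ _, (saturated_contract_iff W).1 hW.2⟩
  · intro W hW
    rw [Finset.mem_filter] at hW ⊢
    refine ⟨Finset.mem_univ _, (saturated_contract_iff _).2 ?_⟩
    rw [h₃ W hW.2]
    exact hW.2
  · exact fun W _ => Set.image_preimage_eq W hsurj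
  · exact fun W hW => h₃ W (Finset.mem_filter.1 hW).2
  · intro W hW
    rw [collapseSplit, dif_pos ⟨hx, (saturated_contract_iff W).1 (Finset.mem_filter.1 hW).2⟩,
      Set.image_preimage_eq W hsurj]

/-- For each `W` an edge lies either inside `W`, giving a term of ∂_E ⊗ 1, or outside, giving a term
of the second summand with its sign. -/
theorem comul_boundaryE (G : OGraph O) : Chains.comul O G.boundaryE =
    TensorProduct.map (Chains.boundaryE O) LinearMap.id G.coproduct +
      TensorProduct.map (Chains.parity O) (Chains.boundaryE O) G.coproduct := by
  classical
  rw [coproduct_eq, map_sum, map_sum, boundaryE_eq, map_smul, map_sum,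
    Finset.sum_congr rfl fun W _ => boundaryE_splitAt_left W,
    Finset.sum_congr rfl fun W _ => boundaryE_splitAt_right W, ← Finset.smul_sum,
    ← Finset.smul_sum, ← smul_add, ← Finset.sum_add_distrib]
  simp only [comul_collapse, ← Finset.sum_add_distrib]
  rw [Finset.sum_comm]
  refine congrArg _ (Finset.sum_congr rfl fun W _ => Finset.sum_congr rfl fun x _ => ?_)
  split_ifs
  · rw [add_zero]
  · rw [zero_add]

end OGraph

namespace Chains

variable (O : CyclicOperad.{u})

theorem comul_boundaryE : comul O ∘ₗ boundaryE O = boundaryE₂ O ∘ₗ comul O := by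
  refine OGraph.chains_hom_ext fun G => ?_
  rw [LinearMap.comp_apply, LinearMap.comp_apply, OGraph.boundaryE_chain, OGraph.comul_boundaryE,
    OGraph.comul_chain]
  rfl

end Chains

/-! ### Alternating sums over sets, and numbers of components -/

open Classical in
theorem sum_neg_one_pow_ncard (α : Type) [Fintype α] :
    ∑ K : Set α, (-1 : ℝ) ^ K.ncard = if IsEmpty α then 1 else 0 := by
  have h : ∑ K : Set α, (-1 : ℝ) ^ K.ncard = ∑ K : Finset α, (-1 : ℝ) ^ K.card :=
    (Fintype.sum_equiv Fintype.finsetEquivSet _ _ fun K => by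
      rw [Fintype.finsetEquivSet_apply, Set.ncard_coe_finset]).symm
  have h' := Finset.sum_powerset_neg_one_pow_card (x := (Finset.univ : Finset α))
  rw [Finset.powerset_univ] at h'
  rw [h]
  have h'' := congrArg (Int.cast : ℤ → ℝ) h'
  push_cast at h''
  rw [h'']
  simp [Finset.univ_eq_empty_iff]

open Classical in
theorem sum_neg_one_pow_ncard_compl (α : Type) [Fintype α] :
    ∑ K : Set α, (-1 : ℝ) ^ Kᶜ.ncard = if IsEmpty α then 1 else 0 := by
  rw [← sum_neg_one_pow_ncard]
  exact Fintype.sum_equiv (⟨compl, compl, compl_compl, compl_compl⟩ : Set α ≃ Set α)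
    (fun K => (-1 : ℝ) ^ Kᶜ.ncard) (fun K => (-1 : ℝ) ^ K.ncard) fun K => rfl

namespace OrientedGraph

variable (G : OrientedGraph)

/-- The map `ι` induced by inclusion is injective, with partial inverse `ρ`, and its image is `K`:
adjacency in the subgraph is adjacency in `G`, and no edge leaves a component. -/
theorem ncard_eq_card_components_restrict (K : Set G.Components) :
    K.ncard = Fintype.card (G.restrict K).Components := by
  classical
  let ι : (G.restrict K).Components → G.Components :=
    Quot.lift (fun v => G.component v.1) fun _ _ ⟨h, hu, hv⟩ =>
      Quot.sound ⟨h.1, congrArg Subtype.val hu, congrArg Subtype.val hv⟩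
  let ρ : G.Components → Option (G.restrict K).Components :=
    Quot.lift (fun v => if hv : G.component v ∈ K then
      some ((G.restrict K).component ⟨v, hv⟩) else none) (by
        rintro _ _ ⟨h, rfl, rfl⟩
        have hc := G.component_vert_inv h
        by_cases hv : G.component (G.vert h) ∈ K
        · rw [dif_pos hv, dif_pos (hc ▸ hv)]
          exact congrArg some (Quot.sound ⟨⟨h, hv⟩, rfl, rfl⟩)
        · rw [dif_neg hv, dif_neg (hc ▸ hv)])
  have hρ : ∀ c, ρ (ι c) = some c := by
    rintro ⟨v⟩
    exact dif_pos v.2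
  have hι : Function.Injective ι := fun c c' h =>
    Option.some_injective _ ((hρ c).symm.trans ((congrArg ρ h).trans (hρ c')))
  have hr : Set.range ι = K := by
    ext c
    obtain ⟨v, rfl⟩ := G.component_surjective c
    constructor
    · rintro ⟨⟨w⟩, hw⟩
      exact hw ▸ w.2
    · exact fun hv => ⟨(G.restrict K).component ⟨v, hv⟩, rfl⟩
  conv_lhs => rw [← hr]
  rw [← Set.image_univ, Set.ncard_image_of_injective _ hι, Set.ncard_univ,
    Nat.card_eq_fintype_card]

/-- A collapse merges two adjacent vertices, which lie in one component. Hence the antipode commutes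
with ∂_E. -/
theorem card_components_contract (x : G.H) (hx : G.vert x ≠ G.vert (G.inv x)) :
    Fintype.card (G.contract x hx).Components = Fintype.card G.Components := by
  let f : (G.contract x hx).V → G.Components := fun v => match v with
    | none => G.component (G.vert x)
    | some u => G.component u.1
  let cv : G.V → (G.contract x hx).V := fun v =>
    if h : v ≠ G.vert x ∧ v ≠ G.vert (G.inv x) then ((⟨v, h⟩ : G.Rest x) : WithBot (G.Rest x))
    else (⊥ : WithBot (G.Rest x))
  have hf : ∀ v, f (cv v) = G.component v := by
    intro v
    by_cases hh : v ≠ G.vert x ∧ v ≠ G.vert (G.inv x)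
    · exact congrArg f (dif_pos hh)
    · refine (congrArg f (dif_neg hh)).trans ?_
      rcases not_and_or.1 hh with h' | h' <;> rw [not_not] at h' <;> subst h'
      · rfl
      · exact (G.component_vert_inv x).symm
  have h₁ : cv (G.vert x) = (⊥ : WithBot (G.Rest x)) := dif_neg fun h => h.1 rfl
  have h₂ : cv (G.vert (G.inv x)) = (⊥ : WithBot (G.Rest x)) := dif_neg fun h => h.2 rfl
  refine Fintype.card_congr ⟨Quot.lift f ?_, Quot.lift (fun v => (G.contract x hx).component (cv v))
    ?_, ?_, ?_⟩
  · rintro _ _ ⟨h, rfl, rfl⟩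
    exact (hf (G.vert h.1)).trans ((G.component_vert_inv h.1).symm.trans (hf _).symm)
  · rintro _ _ ⟨h, rfl, rfl⟩
    by_cases h' : h ≠ x ∧ h ≠ G.inv x
    · exact Quot.sound ⟨⟨h, h'⟩, rfl, rfl⟩
    · refine congrArg (G.contract x hx).component ?_
      rcases not_and_or.1 h' with h' | h' <;> rw [not_not] at h' <;> subst h'
      · exact h₁.trans h₂.symm
      · rw [G.inv_inv]
        exact h₂.trans h₁.symm
  · rintro ⟨_ | u⟩
    · exact congrArg (G.contract x hx).component h₁
    · exact congrArg (G.contract x hx).component (dif_pos u.2)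
  · rintro ⟨v⟩
    exact hf v

end OrientedGraph

namespace OGraph

open CyclicOperad OrientedGraph

variable {O : CyclicOperad.{u}} {G G' : OGraph O}

/-! ### The antipode -/

/-- The union of the two subgraphs is `G` with its vertices reordered by the shuffle. -/
theorem mul_inducePart (W : Set G.V) (hW : G.Saturated W) :
    Chains.mul O (G.inducePart W ⊗ₜ[ℝ] G.inducePart Wᶜ) = shuffleSign W • G.chain := by
  rw [inducePart_of_saturated W hW, inducePart_of_saturated _ hW.compl, mul_chain]
  have hne : ∀ v w, (Embed.induce G W hW).onV v ≠ (Embed.induce G Wᶜ hW.compl).onV w :=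
    fun v w h => w.2 ((show v.1 = w.1 from h) ▸ v.2)
  obtain ⟨f, hf, -, hs⟩ := ((Embed.induce G W hW).union (Embed.induce G Wᶜ hW.compl)
    hne).exists_iso (Embed.refl G) (by
      refine (Embed.range_union _ _ _).trans ?_
      refine (congr_arg₂ (· ∪ ·) (Embed.range_induce G W hW)
        (Embed.range_induce G Wᶜ hW.compl)).trans ?_
      exact (Set.union_compl_self W).trans Set.range_id.symm)
  rw [isOriented_chain _ _ f, hs, ← orderSign_symm]
  refine congrArg (· • _) ?_
  refine orderSign_shuffle (A := (G.induce W hW).V) (B := (G.induce Wᶜ hW.compl).V) f.onV.symm W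
    Subtype.val Subtype.val (fun _ _ h => h) (fun _ _ h => h) ?_ ?_ (fun a => a.2) fun b => b.2
  · exact fun a => (Equiv.symm_apply_eq _).2 (hf (toLex (Sum.inl a))).symm
  · exact fun b => (Equiv.symm_apply_eq _).2 (hf (toLex (Sum.inr b))).symm

theorem mul_split (K : Set G.Components) : Chains.mul O (G.split K) = G.chain := by
  rw [split_eq_splitAt, splitAt_eq, units_smul_comm, mul_inducePart _ (saturated_preimage K),
    smul_smul, Int.units_mul_self, one_smul]

theorem antipode_split_left (K : Set G.Components) :
    TensorProduct.map (Chains.antipode O) LinearMap.id (G.split K) =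
      (-1 : ℝ) ^ K.ncard • G.split K := by
  rw [split, units_smul_comm, TensorProduct.map_tmul, antipode_chain,
    ← TensorProduct.smul_tmul', ← units_smul_real_comm, G.ncard_eq_card_components_restrict K]
  rfl

theorem antipode_split_right (K : Set G.Components) :
    TensorProduct.map LinearMap.id (Chains.antipode O) (G.split K) =
      (-1 : ℝ) ^ Kᶜ.ncard • G.split K := by
  rw [split, units_smul_comm, TensorProduct.map_tmul, antipode_chain,
    TensorProduct.tmul_smul, ← units_smul_real_comm, G.ncard_eq_card_components_restrict Kᶜ]
  rfl

theorem chain_of_isEmpty (h : IsEmpty G.V) : G.chain = (empty : OGraph O).chain := by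
  let e : Embed (empty : OGraph O) G :=
    ⟨fun v => v.elim, fun v => v.elim, fun v => v.elim, fun v => v.elim, fun v => v.elim,
      fun v => v.elim, fun v => v.elim, fun v => v.elim⟩
  exact (Embed.refl G).chain_eq e (Set.ext fun v => (h.false v).elim) strictMono_id
    fun v => v.elim

theorem smul_chain_eq (G : OGraph O) [Decidable (IsEmpty G.Components)] :
    (if IsEmpty G.Components then (1 : ℝ) else 0) • G.chain =
      Chains.counit O G.chain • (empty : OGraph O).chain := by
  rw [counit_chain]
  by_cases h : IsEmpty G.V
  · rw [if_pos h, if_pos ⟨fun c => by obtain ⟨v, -⟩ := G.component_surjective c; exact h.false v⟩,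
      chain_of_isEmpty h]
  · rw [if_neg h, if_neg (fun hc => h ⟨fun v => hc.false (G.component v)⟩), zero_smul, zero_smul]

/-- Multiplying the two parts of any splitting together gives back `G`, so the sum is `G` times the
alternating sum over all sets of components, which vanishes unless there are none. -/
theorem antipode_left_chain (G : OGraph O) :
    Chains.mul O (TensorProduct.map (Chains.antipode O) LinearMap.id (Chains.comul O G.chain)) =
      Chains.counit O G.chain • (empty : OGraph O).chain := by
  classical
  rw [comul_chain, coproduct, map_sum, map_sum]
  simp only [antipode_split_left, map_smul, mul_split]
  rw [← Finset.sum_smul, sum_neg_one_pow_ncard, smul_chain_eq]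

theorem antipode_right_chain (G : OGraph O) :
    Chains.mul O (TensorProduct.map LinearMap.id (Chains.antipode O) (Chains.comul O G.chain)) =
      Chains.counit O G.chain • (empty : OGraph O).chain := by
  classical
  rw [comul_chain, coproduct, map_sum, map_sum]
  simp only [antipode_split_right, map_smul, mul_split]
  rw [← Finset.sum_smul, sum_neg_one_pow_ncard_compl, smul_chain_eq]

theorem antipode_collapse (x : G.H) : Chains.antipode O (G.collapse x) =
    (-1 : ℝ) ^ Fintype.card G.Components • G.collapse x := by
  by_cases hx : G.vert x = G.vert (G.inv x)
  · rw [collapse_of_eq x hx, map_zero, smul_zero]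
  · rw [collapse_of_ne x hx, units_smul_comm, antipode_chain, units_smul_real_comm,
      ← G.card_components_contract x hx]
    rfl

theorem parity_collapse (x : G.H) : Chains.parity O (G.collapse x) =
    -((-1 : ℝ) ^ Fintype.card G.V • G.collapse x) := by
  by_cases hx : G.vert x = G.vert (G.inv x)
  · rw [collapse_of_eq x hx, map_zero, smul_zero, neg_zero]
  · rw [collapse_of_ne x hx, units_smul_comm, parity_chain, units_smul_real_comm,
      ← card_contract x hx, pow_succ, mul_neg_one, neg_smul, smul_neg, neg_neg]

theorem counit_collapse (x : G.H) : Chains.counit O (G.collapse x) = 0 := by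
  by_cases hx : G.vert x = G.vert (G.inv x)
  · rw [collapse_of_eq x hx, map_zero]
  · rw [collapse_of_ne x hx, units_smul_comm, counit_chain, if_neg, smul_zero]
    exact fun h => h.false (G.contractVert x hx (G.vert x))

end OGraph

namespace Chains

variable (O : CyclicOperad.{u})

open OGraph

theorem antipode_boundaryE : antipode O ∘ₗ boundaryE O = boundaryE O ∘ₗ antipode O := by
  refine chains_hom_ext fun G => ?_
  rw [LinearMap.comp_apply, LinearMap.comp_apply, antipode_chain, map_smul, boundaryE_chain,
    boundaryE_eq, map_smul, map_sum]
  simp only [antipode_collapse, ← Finset.smul_sum]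
  rw [smul_comm]

theorem parity_boundaryE : parity O ∘ₗ boundaryE O = -(boundaryE O ∘ₗ parity O) := by
  refine chains_hom_ext fun G => ?_
  rw [LinearMap.neg_apply, LinearMap.comp_apply, LinearMap.comp_apply, parity_chain, map_smul,
    boundaryE_chain, boundaryE_eq, map_smul, map_sum]
  simp only [parity_collapse, Finset.sum_neg_distrib, smul_neg, ← Finset.smul_sum]
  rw [smul_comm]

theorem counit_boundaryE : counit O ∘ₗ boundaryE O = 0 := by
  refine chains_hom_ext fun G => ?_
  rw [LinearMap.comp_apply, boundaryE_chain, boundaryE_eq, map_smul, map_sum]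
  simp only [counit_collapse, Finset.sum_const_zero, smul_zero, LinearMap.zero_apply]

theorem parity_parity : parity O ∘ₗ parity O = LinearMap.id := by
  refine chains_hom_ext fun G => ?_
  rw [LinearMap.comp_apply, parity_chain, map_smul, parity_chain, smul_smul, ← mul_pow,
    neg_one_mul, neg_neg, one_pow, one_smul, LinearMap.id_apply]

theorem antipode_parity : antipode O ∘ₗ parity O = parity O ∘ₗ antipode O := by
  refine chains_hom_ext fun G => ?_
  rw [LinearMap.comp_apply, LinearMap.comp_apply, parity_chain, antipode_chain, map_smul, map_smul,
    parity_chain, antipode_chain, smul_comm]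

theorem coassoc : (TensorProduct.assoc ℝ (Chains O) (Chains O) (Chains O)).toLinearMap ∘ₗ
    TensorProduct.map (comul O) LinearMap.id ∘ₗ comul O =
      TensorProduct.map LinearMap.id (comul O) ∘ₗ comul O :=
  chains_hom_ext coassoc_chain

theorem counit_comul : (TensorProduct.lid ℝ (Chains O)).toLinearMap ∘ₗ
    TensorProduct.map (counit O) LinearMap.id ∘ₗ comul O = LinearMap.id :=
  chains_hom_ext counit_comul_chain

theorem comul_counit : (TensorProduct.rid ℝ (Chains O)).toLinearMap ∘ₗ
    TensorProduct.map LinearMap.id (counit O) ∘ₗ comul O = LinearMap.id :=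
  chains_hom_ext comul_counit_chain

theorem antipode_left : mul O ∘ₗ TensorProduct.map (antipode O) LinearMap.id ∘ₗ comul O =
    (counit O).smulRight (empty : OGraph O).chain :=
  chains_hom_ext antipode_left_chain

theorem antipode_right : mul O ∘ₗ TensorProduct.map LinearMap.id (antipode O) ∘ₗ comul O =
    (counit O).smulRight (empty : OGraph O).chain :=
  chains_hom_ext antipode_right_chain

theorem comul_mul : comul O ∘ₗ mul O = gradedTensorMul (parity O) (mul O) ∘ₗ
    TensorProduct.map (comul O) (comul O) := by
  refine hom_ext_tmul O fun G G' => ?_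
  rw [LinearMap.comp_apply, LinearMap.comp_apply, mul_chain, comul_union, TensorProduct.map_tmul]

theorem counit_mul (a b : Chains O) : counit O (mul O (a ⊗ₜ b)) = counit O a * counit O b := by
  have : counit O ∘ₗ mul O = LinearMap.mul' ℝ ℝ ∘ₗ TensorProduct.map (counit O) (counit O) := by
    refine hom_ext_tmul O fun G G' => ?_
    rw [LinearMap.comp_apply, LinearMap.comp_apply, mul_chain, TensorProduct.map_tmul,
      LinearMap.mul'_apply, counit_chain, counit_chain, counit_chain]
    by_cases h : IsEmpty G.V <;> by_cases h' : IsEmpty G'.V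
    · rw [if_pos h, if_pos h', if_pos, one_mul]
      exact ⟨fun v => v.elim h.false h'.false⟩
    · rw [if_neg h', if_neg (fun hh => h' ⟨fun v => hh.false (inrV G G' v)⟩), mul_zero]
    all_goals rw [if_neg h, if_neg (fun hh => h ⟨fun v => hh.false (inlV G G' v)⟩), zero_mul]
  exact LinearMap.congr_fun this (a ⊗ₜ b)

theorem counit_empty : counit O (empty : OGraph O).chain = 1 :=
  (counit_chain _).trans (if_pos ⟨fun v => v.elim⟩)

end Chains

namespace Chains

open OGraph

variable (O : CyclicOperad.{u})

/-! ### The formula for `θ` -/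

theorem parity_reglueSum : parity O ∘ₗ reglueSum O = reglueSum O ∘ₗ parity O := by
  refine chains_hom_ext fun G => ?_
  rw [LinearMap.comp_apply, LinearMap.comp_apply, parity_chain, map_smul, reglueSum_chain,
    OGraph.reglueSum, map_smul, smul_comm, map_sum]
  congr 1
  rw [Finset.smul_sum]
  refine Finset.sum_congr rfl fun x _ => ?_
  rw [map_sum, Finset.smul_sum]
  refine Finset.sum_congr rfl fun y _ => ?_
  split_ifs with h
  · rw [units_smul_comm, parity_chain, units_smul_real_comm]
    rfl
  · rw [map_zero, smul_zero]

/-- The extension of `reglueSum` to the tensor square as a derivation. -/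
def reglueSum₂ : Chains O ⊗[ℝ] Chains O →ₗ[ℝ] Chains O ⊗[ℝ] Chains O :=
  TensorProduct.map (reglueSum O) LinearMap.id + TensorProduct.map LinearMap.id (reglueSum O)

/-- The operator `reglueSum` preserves the degree, so it commutes with the parity operator. In the
commutator of the two derivations the mixed terms therefore cancel. -/
theorem boundaryH₂_eq :
    boundaryH₂ O = boundaryE₂ O ∘ₗ reglueSum₂ O - reglueSum₂ O ∘ₗ boundaryE₂ O := by
  refine TensorProduct.ext' fun a b => ?_
  have h : ∀ a, parity O (reglueSum O a) = reglueSum O (parity O a) :=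
    LinearMap.congr_fun (parity_reglueSum O)
  simp only [boundaryH₂, boundaryE₂, gradedExtend, reglueSum₂, boundaryH_eq, LinearMap.sub_apply,
    LinearMap.add_apply, LinearMap.comp_apply, TensorProduct.map_tmul, LinearMap.id_apply, map_add,
    TensorProduct.sub_tmul, TensorProduct.tmul_sub, h]
  abel

/-- With ∂_H and T replaced by their commutator formulas, both sides expand to the same terms once Δ
has been moved past ∂_E. No graph is involved any more. -/
theorem theta_eq :
    theta O = boundaryE₂ O ∘ₗ separate O - separate O ∘ₗ boundaryE O := by
  refine LinearMap.ext fun c => ?_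
  have h : ∀ c, comul O (boundaryE O c) = boundaryE₂ O (comul O c) :=
    LinearMap.congr_fun (comul_boundaryE O)
  have h' : separate O = comul O ∘ₗ reglueSum O - reglueSum₂ O ∘ₗ comul O := separate_eq O
  simp only [theta, h', boundaryH₂_eq, boundaryH_eq, LinearMap.sub_apply, LinearMap.comp_apply,
    map_sub, h]
  abel

/-! ### The grading -/

variable {O}

theorem chain_mem_degree (G : OGraph O) : G.chain ∈ degree O (Fintype.card G.V) :=
  Submodule.subset_span ⟨G, rfl, rfl⟩

theorem degree_induction {k : ℕ} {p : Chains O → Prop}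
    (chain : ∀ G : OGraph O, Fintype.card G.V = k → p G.chain)
    (zero : p 0) (add : ∀ a b, p a → p b → p (a + b)) (smul : ∀ (r : ℝ) a, p a → p (r • a))
    {a : Chains O} (ha : a ∈ degree O k) : p a := by
  induction ha using Submodule.span_induction with
  | mem _ h => obtain ⟨G, hG, rfl⟩ := h; exact chain G hG
  | zero => exact zero
  | add a b _ _ ha hb => exact add a b ha hb
  | smul r a _ ha => exact smul r a ha

theorem map_mem_of_degree {k : ℕ} {M : Type*} [AddCommGroup M] [Module ℝ M]
    (φ : Chains O →ₗ[ℝ] M) (N : Submodule ℝ M)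
    (h : ∀ G : OGraph O, Fintype.card G.V = k → φ G.chain ∈ N) {a : Chains O}
    (ha : a ∈ degree O k) : φ a ∈ N :=
  degree_induction (p := fun a => φ a ∈ N) h (by rw [map_zero]; exact N.zero_mem)
    (fun a b ha hb => by rw [map_add]; exact N.add_mem ha hb)
    (fun r a ha => by rw [map_smul]; exact N.smul_mem r ha) ha

theorem hom_eq_of_degree {k : ℕ} {M : Type*} [AddCommGroup M] [Module ℝ M]
    {φ ψ : Chains O →ₗ[ℝ] M} (h : ∀ G : OGraph O, Fintype.card G.V = k → φ G.chain = ψ G.chain)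
    {a : Chains O} (ha : a ∈ degree O k) : φ a = ψ a := by
  have := map_mem_of_degree (φ - ψ) ⊥ (fun G hG => by
    rw [LinearMap.sub_apply, h G hG, sub_self]; exact Submodule.zero_mem _) ha
  exact sub_eq_zero.1 ((Submodule.mem_bot ℝ).1 this)

variable (O)

/-- The projection to the chains of degree `k`. -/
def proj (k : ℕ) : Chains O →ₗ[ℝ] Chains O :=
  extend fun G => (if Fintype.card G.V = k then LinearMap.id else 0 : Chains O →ₗ[ℝ] Chains O)
    G.chain

variable {O}

theorem proj_chain_of_eq {k : ℕ} {G : OGraph O} (h : Fintype.card G.V = k) :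
    proj O k G.chain = G.chain := by
  refine (extend_card (fun n => if n = k then LinearMap.id else 0) G).trans ?_
  rw [if_pos h, LinearMap.id_apply]

theorem proj_chain_of_ne {k : ℕ} {G : OGraph O} (h : Fintype.card G.V ≠ k) :
    proj O k G.chain = 0 := by
  refine (extend_card (fun n => if n = k then LinearMap.id else 0) G).trans ?_
  rw [if_neg h, LinearMap.zero_apply]

theorem proj_mem (k : ℕ) (a : Chains O) : proj O k a ∈ degree O k := by
  induction a using chain_induction with
  | chain G =>
    by_cases h : Fintype.card G.V = k
    · rw [proj_chain_of_eq h]; exact h ▸ chain_mem_degree G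
    · rw [proj_chain_of_ne h]; exact Submodule.zero_mem _
  | add a b ha hb => rw [map_add]; exact Submodule.add_mem _ ha hb
  | smul r a ha => rw [map_smul]; exact Submodule.smul_mem _ r ha

theorem proj_of_mem {k : ℕ} {a : Chains O} (ha : a ∈ degree O k) : proj O k a = a :=
  hom_eq_of_degree (ψ := LinearMap.id) (fun _ h => proj_chain_of_eq h) ha

theorem proj_of_mem_of_ne {j k : ℕ} (hjk : j ≠ k) {a : Chains O} (ha : a ∈ degree O j) :
    proj O k a = 0 :=
  hom_eq_of_degree (ψ := 0) (fun _ h => proj_chain_of_ne (h ▸ hjk)) ha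

/-- All large bounds are allowed, so that the sums for two chains can be taken over a common range.
-/
theorem exists_sum_proj (a : Chains O) : ∃ N, ∀ M, N ≤ M → a = ∑ k ∈ Finset.range M, proj O k a := by
  induction a using chain_induction with
  | chain G =>
    refine ⟨Fintype.card G.V + 1, fun M hM => ?_⟩
    rw [Finset.sum_eq_single (Fintype.card G.V) (fun k _ hk => proj_chain_of_ne hk.symm)
      fun h => absurd (Finset.mem_range.2 hM) h, proj_chain_of_eq rfl]
  | add a b ha hb =>
    obtain ⟨N, hN⟩ := ha
    obtain ⟨N', hN'⟩ := hb
    refine ⟨max N N', fun M hM => ?_⟩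
    simp only [map_add, Finset.sum_add_distrib]
    rw [← hN M (le_of_max_le_left hM), ← hN' M (le_of_max_le_right hM)]
  | smul r a ha =>
    obtain ⟨N, hN⟩ := ha
    refine ⟨N, fun M hM => ?_⟩
    simp only [map_smul, ← Finset.smul_sum]
    rw [← hN M hM]

theorem parity_of_mem {k : ℕ} {a : Chains O} (ha : a ∈ degree O k) :
    parity O a = (-1 : ℝ) ^ k • a :=
  hom_eq_of_degree (ψ := (-1 : ℝ) ^ k • LinearMap.id) (fun G h => by
    rw [parity_chain, h]; rfl) ha

theorem boundaryE_mem {k : ℕ} {a : Chains O} (ha : a ∈ degree O (k + 1)) :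
    boundaryE O a ∈ degree O k := by
  refine map_mem_of_degree (boundaryE O) _ (fun G h => ?_) ha
  rw [boundaryE_chain, boundaryE_eq]
  refine Submodule.smul_mem _ _ (Submodule.sum_mem _ fun x _ => ?_)
  by_cases hx : G.vert x = G.vert (G.inv x)
  · rw [collapse_of_eq x hx]; exact Submodule.zero_mem _
  · rw [collapse_of_ne x hx, Units.smul_def, ← Int.cast_smul_eq_zsmul ℝ]
    refine Submodule.smul_mem _ _ ?_
    have := card_contract x hx
    have h' : Fintype.card (G.contract x hx).V = k := by omega
    exact h' ▸ chain_mem_degree _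

theorem boundaryE_of_mem_zero {a : Chains O} (ha : a ∈ degree O 0) : boundaryE O a = 0 := by
  refine hom_eq_of_degree (ψ := 0) (fun G h => ?_) ha
  have := Fintype.card_eq_zero_iff.1 h
  rw [boundaryE_chain, boundaryE_eq, LinearMap.zero_apply]
  refine smul_eq_zero.2 (.inr (Finset.sum_eq_zero fun x _ => (this.false (G.vert x)).elim))

theorem proj_boundaryE (k : ℕ) :
    proj O k ∘ₗ boundaryE O = boundaryE O ∘ₗ proj O (k + 1) := by
  refine chains_hom_ext fun G => ?_
  rw [LinearMap.comp_apply, LinearMap.comp_apply]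
  rcases h : Fintype.card G.V with _ | m
  · have hG : G.chain ∈ degree O 0 := h ▸ chain_mem_degree G
    rw [boundaryE_of_mem_zero hG, proj_of_mem_of_ne (by omega) hG, map_zero, map_zero]
  · have hG : G.chain ∈ degree O (m + 1) := h ▸ chain_mem_degree G
    by_cases hm : m = k
    · subst hm
      rw [proj_of_mem hG, proj_of_mem (boundaryE_mem hG)]
    · rw [proj_of_mem_of_ne (by omega) hG, proj_of_mem_of_ne hm (boundaryE_mem hG), map_zero]

theorem hom_ext_degree {M : Type*} [AddCommGroup M] [Module ℝ M] {φ ψ : Chains O →ₗ[ℝ] M}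
    (h : ∀ k, ∀ a ∈ degree O k, φ a = ψ a) : φ = ψ :=
  chains_hom_ext fun G => h _ _ (chain_mem_degree G)

/-- A generalized inverse of the boundary operator which is homogeneous of degree one. -/
theorem exists_generalizedInverse (O : CyclicOperad.{u}) : ∃ g : Chains O →ₗ[ℝ] Chains O,
    (∀ a, boundaryE O (g (boundaryE O a)) = boundaryE O a) ∧
    ∀ k, ∀ a ∈ degree O k, g a ∈ degree O (k + 1) := by
  -- A linear section of ∂_E over its image, extended to all chains, satisfies the identity but need
  -- not be homogeneous.
  obtain ⟨s, hs⟩ := (boundaryE O).rangeRestrict.exists_rightInverse_of_surjective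
    (LinearMap.range_rangeRestrict _)
  obtain ⟨g₀, hg₀⟩ := LinearMap.exists_extend s
  have h₀ : ∀ a, boundaryE O (g₀ (boundaryE O a)) = boundaryE O a := fun a => by
    have h₁ := LinearMap.congr_fun hg₀ ⟨boundaryE O a, a, rfl⟩
    have h₂ := congrArg Subtype.val (LinearMap.congr_fun hs ⟨boundaryE O a, a, rfl⟩)
    rw [LinearMap.comp_apply] at h₁ h₂
    exact (congrArg (boundaryE O) h₁).trans h₂
  -- Only the component of degree one higher is kept; the identity survives because ∂_E lowers
  -- degrees by one.
  let g : Chains O →ₗ[ℝ] Chains O :=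
    extend fun G => (proj O (Fintype.card G.V + 1) ∘ₗ g₀) G.chain
  have hg : ∀ k, ∀ a ∈ degree O k, g a = proj O (k + 1) (g₀ a) := fun k a ha =>
    hom_eq_of_degree (ψ := proj O (k + 1) ∘ₗ g₀) (fun G hG =>
      (extend_card (fun n => proj O (n + 1) ∘ₗ g₀) G).trans (by rw [hG])) ha
  refine ⟨g, LinearMap.congr_fun (f := boundaryE O ∘ₗ g ∘ₗ boundaryE O) (hom_ext_degree ?_),
    fun k a ha => ?_⟩
  · rintro (_ | k) a ha
    · rw [LinearMap.comp_apply, LinearMap.comp_apply, boundaryE_of_mem_zero ha, map_zero, map_zero]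
    · have h₁ := boundaryE_mem ha
      rw [LinearMap.comp_apply, LinearMap.comp_apply, hg _ _ h₁]
      have h₂ := LinearMap.congr_fun (proj_boundaryE (O := O) k) (g₀ (boundaryE O a))
      rw [LinearMap.comp_apply, LinearMap.comp_apply, h₀, proj_of_mem h₁] at h₂
      exact h₂.symm
  · rw [hg k a ha]
    exact proj_mem _ _

end Chains

/-! ### Passage from chains to homology -/

/-- Data that exhibit the homology as a deformation retract of the chains: a map `quot` from chains
to homology, which is the class map on cycles, a section `sect`, and a homotopy `htpy` from
`sect ∘ quot` to the identity. -/
structure HomologySplitting (O : CyclicOperad.{u}) where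
  quot : Chains O →ₗ[ℝ] GraphHomology O
  sect : GraphHomology O →ₗ[ℝ] Chains O
  htpy : Chains O →ₗ[ℝ] Chains O
  boundaryE_sect : ∀ a, Chains.boundaryE O (sect a) = 0
  quot_boundaryE : ∀ a, quot (Chains.boundaryE O a) = 0
  quot_coe : ∀ z : Chains.cycles O, quot z = GraphHomology.cls O z
  homotopy : ∀ a, sect (quot a) =
    a - (Chains.boundaryE O (htpy a) + htpy (Chains.boundaryE O a))
  parity_htpy : ∀ a, Chains.parity O (htpy a) = -htpy (Chains.parity O a)
  parity_sect_quot : ∀ a, Chains.parity O (sect (quot a)) = sect (quot (Chains.parity O a))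
  quot_mem : ∀ k, ∀ a ∈ Chains.degree O k, quot a ∈ GraphHomology.degree O k

/-- For a generalized inverse g of ∂, the operator P = 1 − (∂g + g∂) takes values in cycles, kills
boundaries and does not change homology classes. It thus defines maps in both directions between
chains and homology, and degrees are respected because g is homogeneous. -/
theorem nonempty_homologySplitting (O : CyclicOperad.{u}) : Nonempty (HomologySplitting O) := by
  obtain ⟨g, hg, hg'⟩ := Chains.exists_generalizedInverse O
  set D := Chains.boundaryE O with hD
  have hDD : ∀ a, D (D a) = 0 := LinearMap.congr_fun (Chains.boundaryE_boundaryE O)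
  have hγD : ∀ a, Chains.parity O (D a) = -D (Chains.parity O a) :=
    LinearMap.congr_fun (Chains.parity_boundaryE O)
  have hγg : ∀ a, Chains.parity O (g a) = -g (Chains.parity O a) :=
    LinearMap.congr_fun (f := Chains.parity O ∘ₗ g) (g := -(g ∘ₗ Chains.parity O))
      (Chains.hom_ext_degree fun k a ha => by
        rw [LinearMap.neg_apply, LinearMap.comp_apply, LinearMap.comp_apply,
          Chains.parity_of_mem ha, Chains.parity_of_mem (hg' k a ha), map_smul, pow_succ,
          mul_neg_one, neg_smul])
  let P : Chains O →ₗ[ℝ] Chains O := LinearMap.id - (D ∘ₗ g + g ∘ₗ D)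
  have hP : ∀ a, P a = a - (D (g a) + g (D a)) := fun a => rfl
  have hDP : ∀ a, D (P a) = 0 := fun a => by
    rw [hP, map_sub, map_add, hDD, hg, zero_add, sub_self]
  have hPD : ∀ a, P (D a) = 0 := fun a => by
    rw [hP, hDD, map_zero, add_zero, hg, sub_self]
  have hPγ : ∀ a, Chains.parity O (P a) = P (Chains.parity O a) := fun a => by
    rw [hP, hP, map_sub, map_add, hγD, hγg, hγg, hγD, map_neg, map_neg, neg_neg, neg_neg]
  have hPdeg : ∀ k, ∀ a ∈ Chains.degree O k, P a ∈ Chains.degree O k := by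
    intro k a ha
    rw [hP]
    refine Submodule.sub_mem _ ha (Submodule.add_mem _ (Chains.boundaryE_mem (hg' k a ha)) ?_)
    rcases k with _ | k
    · rw [hD, Chains.boundaryE_of_mem_zero ha, map_zero]; exact Submodule.zero_mem _
    · exact hg' k _ (Chains.boundaryE_mem ha)
  let P' : Chains O →ₗ[ℝ] Chains.cycles O := P.codRestrict _ hDP
  have hP' : ∀ a, (P' a : Chains O) = P a := fun a => rfl
  have hcls : ∀ z : Chains.cycles O, GraphHomology.cls O (P' z) = GraphHomology.cls O z := by
    intro z
    refine (Submodule.Quotient.eq _).2 ⟨-g z, ?_⟩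
    have hz : D z = 0 := z.2
    show D (-g z) = P z - z
    rw [hP, hz, map_zero, add_zero, map_neg, sub_sub_cancel_left]
  let S : GraphHomology O →ₗ[ℝ] Chains O :=
    (Chains.boundaries O).liftQ (P ∘ₗ (Chains.cycles O).subtype) (by
      rintro ⟨_, _⟩ ⟨a, rfl⟩
      exact hPD a)
  have hS : ∀ z, S (GraphHomology.cls O z) = P z := fun z => Submodule.liftQ_apply _ _ _
  have hSQ : ∀ a, S (GraphHomology.cls O (P' a)) = P (P a) := fun a => hS _
  -- As `P` need not be idempotent, the composite of quotient map and section is P². Since ∂P = P∂ =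
  -- 0, it equals 1 − (∂h + h∂) with h = g(1 + P).
  refine ⟨⟨GraphHomology.cls O ∘ₗ P', S, g ∘ₗ (LinearMap.id + P), fun a => ?_, fun a => ?_, hcls,
    fun a => ?_, fun a => ?_, fun a => ?_, fun k a ha => ?_⟩⟩
  · obtain ⟨z, rfl⟩ := Submodule.mkQ_surjective _ a
    exact (congrArg D (hS z)).trans (hDP _)
  · have : P' (D a) = 0 := Subtype.ext (hPD a)
    rw [LinearMap.comp_apply, this, map_zero]
  · refine (hSQ a).trans ?_
    show P (P a) = a - (D (g (a + P a)) + g (D a + P (D a)))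
    rw [hPD, add_zero, hP (P a), hDP, map_zero, add_zero, map_add, map_add]
    nth_rewrite 1 [hP]
    abel
  · show Chains.parity O (g (a + P a)) = -g (Chains.parity O a + P (Chains.parity O a))
    rw [hγg, map_add, hPγ]
  · show Chains.parity O (S (GraphHomology.cls O (P' a))) =
      S (GraphHomology.cls O (P' (Chains.parity O a)))
    rw [hSQ, hSQ, hPγ, hPγ]
  · exact ⟨P' a, hPdeg k a ha, rfl⟩

/-! ### Tensor squares of graded complexes -/

section Graded

variable {A B M N : Type*} [AddCommGroup A] [Module ℝ A] [AddCommGroup B] [Module ℝ B]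
  [AddCommGroup M] [Module ℝ M] [AddCommGroup N] [Module ℝ N]

theorem gradedExtend_tmul (γ D : A →ₗ[ℝ] A) (a b : A) :
    gradedExtend γ D (a ⊗ₜ b) = D a ⊗ₜ b + γ a ⊗ₜ D b := rfl

/-- The maps f ⊗ g and f' ⊗ g differ by (k ⊗ g) composed with the differential of the tensor square,
because g kills boundaries. So a correction that vanishes on cycles of the first factor also
vanishes on cycles of the tensor square, which need not be sums of tensors of cycles. -/
theorem map_eq_of_gradedExtend_eq_zero_left {γ D : A →ₗ[ℝ] A} {f f' k : A →ₗ[ℝ] M}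
    {g : A →ₗ[ℝ] N} (hf : ∀ a, f a = f' a - k (D a)) (hg : ∀ a, g (D a) = 0) {t : A ⊗[ℝ] A}
    (ht : gradedExtend γ D t = 0) : TensorProduct.map f g t = TensorProduct.map f' g t := by
  have h : TensorProduct.map f g =
      TensorProduct.map f' g - TensorProduct.map k g ∘ₗ gradedExtend γ D :=
    TensorProduct.ext' fun a b => by
      rw [LinearMap.sub_apply, LinearMap.comp_apply, gradedExtend_tmul, map_add]
      simp only [TensorProduct.map_tmul, hf, hg, TensorProduct.tmul_zero, add_zero,
        TensorProduct.sub_tmul]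
  rw [h, LinearMap.sub_apply, LinearMap.comp_apply, ht, map_zero, sub_zero]

/-- In the second factor the differential carries the sign operator `γ`; it is compensated by
replacing `g` with `g ∘ₗ γ`, which still kills boundaries. -/
theorem map_eq_of_gradedExtend_eq_zero_right {γ D : A →ₗ[ℝ] A} (hγ : ∀ a, γ (γ a) = a)
    (hγD : ∀ a, γ (D a) = -D (γ a)) {f f' k : A →ₗ[ℝ] M}
    {g : A →ₗ[ℝ] N} (hf : ∀ a, f a = f' a - k (D a)) (hg : ∀ a, g (D a) = 0) {t : A ⊗[ℝ] A}
    (ht : gradedExtend γ D t = 0) : TensorProduct.map g f t = TensorProduct.map g f' t := by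
  have h : TensorProduct.map g f =
      TensorProduct.map g f' - TensorProduct.map (g ∘ₗ γ) k ∘ₗ gradedExtend γ D :=
    TensorProduct.ext' fun a b => by
      rw [LinearMap.sub_apply, LinearMap.comp_apply, gradedExtend_tmul, map_add]
      simp only [TensorProduct.map_tmul, LinearMap.comp_apply, hf, hγ, hγD, map_neg, hg, neg_zero,
        TensorProduct.zero_tmul, zero_add, TensorProduct.tmul_sub]
  rw [h, LinearMap.sub_apply, LinearMap.comp_apply, ht, map_zero, sub_zero]

theorem map_gradedExtend_eq_zero {γ D : A →ₗ[ℝ] A} {f : A →ₗ[ℝ] M} {g : A →ₗ[ℝ] N}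
    (hf : ∀ a, f (D a) = 0) (hg : ∀ a, g (D a) = 0) (t : A ⊗[ℝ] A) :
    TensorProduct.map f g (gradedExtend γ D t) = 0 :=
  LinearMap.congr_fun (f := TensorProduct.map f g ∘ₗ gradedExtend γ D) (g := 0)
    (TensorProduct.ext' fun a b => by
      rw [LinearMap.comp_apply, gradedExtend_tmul, map_add]
      simp only [TensorProduct.map_tmul, hf, hg, TensorProduct.zero_tmul, TensorProduct.tmul_zero,
        add_zero, LinearMap.zero_apply]) t

/-- The exchange `(a ⊗ b) ⊗ (c ⊗ d) ↦ (-1)^{|b| |c|} (a ⊗ c) ⊗ (b ⊗ d)`. -/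
def gradedExchange (γ : A →ₗ[ℝ] A) :
    (A ⊗[ℝ] A) ⊗[ℝ] (A ⊗[ℝ] A) →ₗ[ℝ] (A ⊗[ℝ] A) ⊗[ℝ] (A ⊗[ℝ] A) :=
  (TensorProduct.tensorTensorTensorComm ℝ A A A A).toLinearMap ∘ₗ
    ((1 / 2 : ℝ) • (LinearMap.id
      + TensorProduct.map (TensorProduct.map LinearMap.id γ) LinearMap.id
      + TensorProduct.map LinearMap.id (TensorProduct.map γ LinearMap.id)
      - TensorProduct.map (TensorProduct.map LinearMap.id γ) (TensorProduct.map γ LinearMap.id)))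

theorem gradedTensorMul_eq (γ : A →ₗ[ℝ] A) (μ : A ⊗[ℝ] A →ₗ[ℝ] A) :
    gradedTensorMul γ μ = TensorProduct.map μ μ ∘ₗ gradedExchange γ := rfl

theorem gradedExchange_tmul (γ : A →ₗ[ℝ] A) (a b c d : A) :
    gradedExchange γ ((a ⊗ₜ b) ⊗ₜ (c ⊗ₜ d)) = (1 / 2 : ℝ) •
      ((a ⊗ₜ c) ⊗ₜ (b ⊗ₜ d) + (a ⊗ₜ c) ⊗ₜ (γ b ⊗ₜ d) + (a ⊗ₜ γ c) ⊗ₜ (b ⊗ₜ d)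
        - (a ⊗ₜ γ c) ⊗ₜ (γ b ⊗ₜ d)) := by
  simp only [gradedExchange, LinearMap.comp_apply, LinearMap.smul_apply, LinearMap.add_apply,
    LinearMap.sub_apply, LinearMap.id_apply, TensorProduct.map_tmul, map_smul, map_add, map_sub,
    LinearEquiv.coe_coe, TensorProduct.tensorTensorTensorComm_tmul]

theorem map_gradedExchange {γ : A →ₗ[ℝ] A} {γ' : B →ₗ[ℝ] B} {f : A →ₗ[ℝ] B}
    (hf : ∀ a, f (γ a) = γ' (f a)) (t : (A ⊗[ℝ] A) ⊗[ℝ] (A ⊗[ℝ] A)) :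
    TensorProduct.map (TensorProduct.map f f) (TensorProduct.map f f) (gradedExchange γ t) =
      gradedExchange γ' (TensorProduct.map (TensorProduct.map f f) (TensorProduct.map f f) t) :=
  LinearMap.congr_fun (f := TensorProduct.map (TensorProduct.map f f) (TensorProduct.map f f) ∘ₗ
      gradedExchange γ)
    (g := gradedExchange γ' ∘ₗ TensorProduct.map (TensorProduct.map f f) (TensorProduct.map f f))
    (TensorProduct.ext_fourfold' fun a b c d => by
      simp only [LinearMap.comp_apply, gradedExchange_tmul, map_smul, map_add, map_sub,
        TensorProduct.map_tmul, hf]) t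

/-- The Koszul sign makes the exchange of the inner factors a chain map. On a cycle of the fourfold
tensor product the exchange therefore gives a cycle again. -/
theorem gradedExtend_gradedExchange {γ D : A →ₗ[ℝ] A} (hγ : ∀ a, γ (γ a) = a)
    (hγD : ∀ a, γ (D a) = -D (γ a)) (t : (A ⊗[ℝ] A) ⊗[ℝ] (A ⊗[ℝ] A)) :
    gradedExtend (TensorProduct.map γ γ) (gradedExtend γ D) (gradedExchange γ t) =
      gradedExchange γ (gradedExtend (TensorProduct.map γ γ) (gradedExtend γ D) t) :=
  LinearMap.congr_fun (f := gradedExtend (TensorProduct.map γ γ) (gradedExtend γ D) ∘ₗ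
      gradedExchange γ)
    (g := gradedExchange γ ∘ₗ gradedExtend (TensorProduct.map γ γ) (gradedExtend γ D))
    (TensorProduct.ext_fourfold' fun a b c d => by
      simp only [LinearMap.comp_apply, gradedExchange_tmul, map_smul, map_add, map_sub,
        gradedExtend_tmul, TensorProduct.map_tmul, hγ, hγD, TensorProduct.add_tmul,
        TensorProduct.tmul_add, TensorProduct.neg_tmul, TensorProduct.tmul_neg]
      module) t

theorem parity_gradedExtend {γ D : A →ₗ[ℝ] A} (hγD : ∀ a, γ (D a) = -D (γ a)) (t : A ⊗[ℝ] A) :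
    TensorProduct.map γ γ (gradedExtend γ D t) =
      -gradedExtend γ D (TensorProduct.map γ γ t) :=
  LinearMap.congr_fun (f := TensorProduct.map γ γ ∘ₗ gradedExtend γ D)
    (g := -(gradedExtend γ D ∘ₗ TensorProduct.map γ γ)) (TensorProduct.ext' fun a b => by
      simp only [LinearMap.neg_apply, LinearMap.comp_apply, gradedExtend_tmul, map_add,
        TensorProduct.map_tmul, hγD, TensorProduct.neg_tmul, TensorProduct.tmul_neg]
      abel) t

theorem parity_parity_tmul {γ : A →ₗ[ℝ] A} (hγ : ∀ a, γ (γ a) = a) (t : A ⊗[ℝ] A) :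
    TensorProduct.map γ γ (TensorProduct.map γ γ t) = t :=
  LinearMap.congr_fun (f := TensorProduct.map γ γ ∘ₗ TensorProduct.map γ γ) (g := LinearMap.id)
    (TensorProduct.ext' fun a b => by
      simp only [LinearMap.comp_apply, TensorProduct.map_tmul, hγ, LinearMap.id_apply]) t

end Graded

/-! ### Cycles and degrees under the operations on chains -/

namespace Chains

open OGraph

variable {O : CyclicOperad.{u}}

theorem comul_mem_cycles {z : Chains O} (hz : boundaryE O z = 0) :
    boundaryE₂ O (comul O z) = 0 := by
  have := LinearMap.congr_fun (comul_boundaryE O) z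
  rw [LinearMap.comp_apply, LinearMap.comp_apply, hz, map_zero] at this
  exact this.symm

theorem mul_mem_cycles {t : Chains O ⊗[ℝ] Chains O} (ht : boundaryE₂ O t = 0) :
    boundaryE O (mul O t) = 0 := by
  have := LinearMap.congr_fun (boundaryE_mul O) t
  rwa [LinearMap.comp_apply, LinearMap.comp_apply, ht, map_zero] at this

theorem tmul_mem_cycles {a b : Chains O} (ha : boundaryE O a = 0) (hb : boundaryE O b = 0) :
    boundaryE₂ O (a ⊗ₜ b) = 0 := by
  rw [boundaryE₂, gradedExtend_tmul, ha, hb, TensorProduct.zero_tmul, TensorProduct.tmul_zero,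
    add_zero]

theorem mul_mem_degree {i j : ℕ} {a b : Chains O} (ha : a ∈ degree O i) (hb : b ∈ degree O j) :
    mul O (a ⊗ₜ b) ∈ degree O (i + j) := by
  refine map_mem_of_degree (mul O ∘ₗ TensorProduct.mk ℝ _ _ a) _ (fun G' hG' => ?_) hb
  refine map_mem_of_degree (mul O ∘ₗ (TensorProduct.mk ℝ _ _).flip G'.chain) _ (fun G hG => ?_) ha
  have : mul O (G.chain ⊗ₜ G'.chain) ∈ degree O (i + j) := by
    rw [mul_chain, ← hG, ← hG', ← card_union]
    exact chain_mem_degree _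
  exact this

theorem antipode_mem_degree {k : ℕ} {a : Chains O} (ha : a ∈ degree O k) :
    antipode O a ∈ degree O k :=
  map_mem_of_degree (antipode O) _ (fun G hG => by
    rw [antipode_chain, ← hG]; exact Submodule.smul_mem _ _ (chain_mem_degree G)) ha

theorem counit_of_mem_degree {k : ℕ} (hk : k ≠ 0) {a : Chains O} (ha : a ∈ degree O k) :
    counit O a = 0 :=
  hom_eq_of_degree (ψ := 0) (fun G hG => by
    rw [counit_chain, LinearMap.zero_apply, if_neg]
    exact fun h => hk (hG ▸ Fintype.card_eq_zero_iff.2 h)) ha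

theorem inducePart_mem_degree (G : OGraph O) (W : Set G.V) :
    G.inducePart W ∈ degree O W.ncard := by
  by_cases hW : G.Saturated W
  · rw [inducePart_of_saturated W hW]
    have : Fintype.card (G.induce W hW).V = W.ncard := by
      rw [← Nat.card_eq_fintype_card]; exact Nat.card_coe_set_eq W
    exact this ▸ chain_mem_degree _
  · rw [inducePart_of_not_saturated W hW]; exact Submodule.zero_mem _

theorem empty_mem_degree : (OGraph.empty : OGraph O).chain ∈ degree O 0 := by
  have : Fintype.card (OGraph.empty : OGraph O).V = 0 :=
    Fintype.card_eq_zero_iff.2 ⟨fun v => v.elim⟩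
  exact this ▸ chain_mem_degree _

theorem empty_mem_cycles : boundaryE O (OGraph.empty : OGraph O).chain = 0 :=
  boundaryE_of_mem_zero empty_mem_degree

theorem antipode_mem_cycles {z : Chains O} (hz : boundaryE O z = 0) :
    boundaryE O (antipode O z) = 0 := by
  have := LinearMap.congr_fun (antipode_boundaryE O) z
  rw [LinearMap.comp_apply, LinearMap.comp_apply, hz, map_zero] at this
  exact this.symm

/-- On cycles, `∂_H` takes values in boundaries. -/
theorem boundaryH_of_cycle {z : Chains O} (hz : boundaryE O z = 0) :
    boundaryH O z = boundaryE O (reglueSum O z) := by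
  rw [boundaryH_eq, LinearMap.sub_apply, LinearMap.comp_apply, LinearMap.comp_apply, hz, map_zero,
    sub_zero]

end Chains

namespace HomologySplitting

open Chains

variable {O : CyclicOperad.{u}} (C : HomologySplitting O)

theorem exists_cycle (a : GraphHomology O) : ∃ z, boundaryE O z = 0 ∧ C.quot z = a := by
  obtain ⟨z, rfl⟩ := Submodule.mkQ_surjective _ a
  exact ⟨z, z.2, C.quot_coe z⟩

theorem exists_cycle_of_mem {k : ℕ} {a : GraphHomology O} (ha : a ∈ GraphHomology.degree O k) :
    ∃ z ∈ degree O k, boundaryE O z = 0 ∧ C.quot z = a := by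
  obtain ⟨z, hz, rfl⟩ := ha
  exact ⟨z, hz, z.2, C.quot_coe z⟩

theorem sect_quot {z : Chains O} (hz : boundaryE O z = 0) :
    C.sect (C.quot z) = z - boundaryE O (C.htpy z) := by
  rw [C.homotopy, hz, map_zero, add_zero]

theorem quot_sect (a : GraphHomology O) : C.quot (C.sect a) = a := by
  obtain ⟨z, hz, rfl⟩ := C.exists_cycle a
  rw [C.sect_quot hz, map_sub, C.quot_boundaryE, sub_zero]

/-- The homotopy on the tensor square. -/
def htpy₂ : Chains O ⊗[ℝ] Chains O →ₗ[ℝ] Chains O ⊗[ℝ] Chains O :=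
  TensorProduct.map C.htpy LinearMap.id +
    TensorProduct.map (Chains.parity O ∘ₗ C.sect ∘ₗ C.quot) C.htpy

theorem homotopy₂ (t : Chains O ⊗[ℝ] Chains O) :
    TensorProduct.map (C.sect ∘ₗ C.quot) (C.sect ∘ₗ C.quot) t =
      t - (boundaryE₂ O (C.htpy₂ t) + C.htpy₂ (boundaryE₂ O t)) := by
  have hγ : ∀ a, Chains.parity O (Chains.parity O a) = a := LinearMap.congr_fun (parity_parity O)
  have h : ∀ a, a - C.sect (C.quot a) = boundaryE O (C.htpy a) + C.htpy (boundaryE O a) :=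
    fun a => by rw [C.homotopy, sub_sub_cancel]
  refine LinearMap.congr_fun (f := TensorProduct.map (C.sect ∘ₗ C.quot) (C.sect ∘ₗ C.quot))
    (g := LinearMap.id - (boundaryE₂ O ∘ₗ C.htpy₂ + C.htpy₂ ∘ₗ boundaryE₂ O))
    (TensorProduct.ext' fun a b => ?_) t
  -- The difference is telescoped by changing one factor at a time, which accounts for the
  -- asymmetric form of `htpy₂`.
  have key : a ⊗ₜ[ℝ] b - C.sect (C.quot a) ⊗ₜ[ℝ] C.sect (C.quot b) =
      (a - C.sect (C.quot a)) ⊗ₜ[ℝ] b + C.sect (C.quot a) ⊗ₜ[ℝ] (b - C.sect (C.quot b)) := by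
    rw [TensorProduct.sub_tmul, TensorProduct.tmul_sub]; abel
  rw [h, h] at key
  simp only [LinearMap.sub_apply, LinearMap.add_apply, LinearMap.comp_apply, LinearMap.id_apply,
    htpy₂, boundaryE₂, gradedExtend_tmul, TensorProduct.map_tmul, map_add, C.boundaryE_sect, hγ,
    C.quot_boundaryE, C.parity_htpy, map_zero, TensorProduct.zero_tmul, C.parity_sect_quot]
  rw [eq_sub_iff_add_eq, ← eq_sub_iff_add_eq', key]
  simp only [TensorProduct.add_tmul, TensorProduct.tmul_add, TensorProduct.neg_tmul]
  abel

theorem quot₂_boundaryE₂ (t : Chains O ⊗[ℝ] Chains O) :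
    TensorProduct.map C.quot C.quot (boundaryE₂ O t) = 0 :=
  map_gradedExtend_eq_zero C.quot_boundaryE C.quot_boundaryE t

/-! ### The induced operations -/

/-- The induced product. -/
def mul : GraphHomology O ⊗[ℝ] GraphHomology O →ₗ[ℝ] GraphHomology O :=
  C.quot ∘ₗ Chains.mul O ∘ₗ TensorProduct.map C.sect C.sect

/-- The induced coproduct. -/
def comul : GraphHomology O →ₗ[ℝ] GraphHomology O ⊗[ℝ] GraphHomology O :=
  TensorProduct.map C.quot C.quot ∘ₗ Chains.comul O ∘ₗ C.sect

/-- The induced counit. -/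
def counit : GraphHomology O →ₗ[ℝ] ℝ := Chains.counit O ∘ₗ C.sect

/-- The induced antipode. -/
def antipode : GraphHomology O →ₗ[ℝ] GraphHomology O := C.quot ∘ₗ Chains.antipode O ∘ₗ C.sect

/-- The induced sign operator. -/
def parity : GraphHomology O →ₗ[ℝ] GraphHomology O := C.quot ∘ₗ Chains.parity O ∘ₗ C.sect

/-- The differential induced by `∂_H`. -/
def differential : GraphHomology O →ₗ[ℝ] GraphHomology O := C.quot ∘ₗ boundaryH O ∘ₗ C.sect

/-- The projection to the homology in degree `k`. -/
def proj (k : ℕ) : GraphHomology O →ₗ[ℝ] GraphHomology O := C.quot ∘ₗ Chains.proj O k ∘ₗ C.sect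

/-- The formula holds for all tensors, with an error that factors through the differential. This
form, rather than its restriction to cycles, is what the comparison of maps on tensor products
requires; the same applies to the coproduct, counit and antipode below. -/
theorem mul_quot (t : Chains O ⊗[ℝ] Chains O) :
    C.mul (TensorProduct.map C.quot C.quot t) =
      C.quot (Chains.mul O t) - C.quot (Chains.mul O (C.htpy₂ (boundaryE₂ O t))) := by
  have h : TensorProduct.map C.sect C.sect (TensorProduct.map C.quot C.quot t) =
      TensorProduct.map (C.sect ∘ₗ C.quot) (C.sect ∘ₗ C.quot) t := by
    rw [TensorProduct.map_comp]; rfl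
  have h' : Chains.mul O (boundaryE₂ O (C.htpy₂ t)) = boundaryE O (Chains.mul O (C.htpy₂ t)) :=
    (LinearMap.congr_fun (boundaryE_mul O) _).symm
  rw [mul, LinearMap.comp_apply, LinearMap.comp_apply, h, homotopy₂, map_sub, map_add, map_sub,
    map_add, h', C.quot_boundaryE, zero_add]

theorem mul_quot_of_cycle {t : Chains O ⊗[ℝ] Chains O} (ht : boundaryE₂ O t = 0) :
    C.mul (TensorProduct.map C.quot C.quot t) = C.quot (Chains.mul O t) := by
  rw [mul_quot, ht, map_zero, map_zero, map_zero, sub_zero]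

theorem mul_quot_tmul {a b : Chains O} (ha : boundaryE O a = 0) (hb : boundaryE O b = 0) :
    C.mul (C.quot a ⊗ₜ C.quot b) = C.quot (Chains.mul O (a ⊗ₜ b)) :=
  C.mul_quot_of_cycle (tmul_mem_cycles ha hb)

theorem comul_quot (a : Chains O) :
    C.comul (C.quot a) = TensorProduct.map C.quot C.quot (Chains.comul O a) -
      TensorProduct.map C.quot C.quot (Chains.comul O (C.htpy (boundaryE O a))) := by
  have h : ∀ a, Chains.comul O (boundaryE O a) = boundaryE₂ O (Chains.comul O a) :=
    LinearMap.congr_fun (comul_boundaryE O)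
  rw [comul, LinearMap.comp_apply, LinearMap.comp_apply, C.homotopy, map_sub, map_add, map_sub,
    map_add, h, C.quot₂_boundaryE₂, zero_add]

theorem comul_quot_of_cycle {z : Chains O} (hz : boundaryE O z = 0) :
    C.comul (C.quot z) = TensorProduct.map C.quot C.quot (Chains.comul O z) := by
  rw [comul_quot, hz, map_zero, map_zero, map_zero, sub_zero]

theorem counit_quot (a : Chains O) :
    C.counit (C.quot a) = Chains.counit O a - Chains.counit O (C.htpy (boundaryE O a)) := by
  have h : ∀ a, Chains.counit O (boundaryE O a) = 0 := LinearMap.congr_fun (counit_boundaryE O)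
  rw [counit, LinearMap.comp_apply, C.homotopy, map_sub, map_add, h, zero_add]

theorem counit_quot_of_cycle {z : Chains O} (hz : boundaryE O z = 0) :
    C.counit (C.quot z) = Chains.counit O z := by
  rw [counit_quot, hz, map_zero, map_zero, sub_zero]

theorem antipode_quot (a : Chains O) :
    C.antipode (C.quot a) =
      C.quot (Chains.antipode O a) - C.quot (Chains.antipode O (C.htpy (boundaryE O a))) := by
  have h : ∀ a, Chains.antipode O (boundaryE O a) = boundaryE O (Chains.antipode O a) :=
    LinearMap.congr_fun (antipode_boundaryE O)
  rw [antipode, LinearMap.comp_apply, LinearMap.comp_apply, C.homotopy, map_sub, map_add, map_sub,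
    map_add, h, C.quot_boundaryE, zero_add]

theorem antipode_quot_of_cycle {z : Chains O} (hz : boundaryE O z = 0) :
    C.antipode (C.quot z) = C.quot (Chains.antipode O z) := by
  rw [antipode_quot, hz, map_zero, map_zero, map_zero, sub_zero]

theorem parity_quot (a : Chains O) : C.parity (C.quot a) = C.quot (Chains.parity O a) := by
  rw [parity, LinearMap.comp_apply, LinearMap.comp_apply, C.parity_sect_quot, C.quot_sect]

/-- The commutator formula shows that ∂_H of a cycle is a boundary. -/
theorem differential_eq_zero : C.differential = 0 := by
  refine LinearMap.ext fun a => ?_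
  rw [differential, LinearMap.comp_apply, LinearMap.comp_apply,
    boundaryH_of_cycle (C.boundaryE_sect a), C.quot_boundaryE, LinearMap.zero_apply]

theorem proj_quot {k : ℕ} {z : Chains O} (hz : boundaryE O z = 0) :
    C.proj k (C.quot z) = C.quot (Chains.proj O k z) := by
  have h : ∀ a, Chains.proj O k (boundaryE O a) = boundaryE O (Chains.proj O (k + 1) a) :=
    LinearMap.congr_fun (proj_boundaryE k)
  rw [proj, LinearMap.comp_apply, LinearMap.comp_apply, C.sect_quot hz, map_sub, h, map_sub,
    C.quot_boundaryE, sub_zero]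

/-! ### The grading -/

theorem proj_of_mem {k : ℕ} {a : GraphHomology O} (ha : a ∈ GraphHomology.degree O k) :
    C.proj k a = a := by
  obtain ⟨z, hz, hD, rfl⟩ := C.exists_cycle_of_mem ha
  rw [C.proj_quot hD, Chains.proj_of_mem hz]

theorem proj_of_mem_of_ne {j k : ℕ} (hjk : j ≠ k) {a : GraphHomology O}
    (ha : a ∈ GraphHomology.degree O j) : C.proj k a = 0 := by
  obtain ⟨z, hz, hD, rfl⟩ := C.exists_cycle_of_mem ha
  rw [C.proj_quot hD, Chains.proj_of_mem_of_ne hjk hz, map_zero]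


/-- The projections of chains to a single degree commute with ∂_E up to the shift of degree, so they
induce projections on homology; these give independence, and the decomposition of a chain gives the
span. -/
theorem isInternal (C : HomologySplitting O) : DirectSum.IsInternal (GraphHomology.degree O) := by
  rw [DirectSum.isInternal_submodule_iff_iSupIndep_and_iSup_eq_top]
  constructor
  · intro k
    refine Submodule.disjoint_def.2 fun a ha ha' => ?_
    rw [← C.proj_of_mem ha]
    have : ⨆ j, ⨆ (_ : j ≠ k), GraphHomology.degree O j ≤ LinearMap.ker (C.proj k) :=
      iSup₂_le fun j hj b hb => C.proj_of_mem_of_ne hj hb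
    exact this ha'
  · refine eq_top_iff.2 fun a _ => ?_
    obtain ⟨z, -, rfl⟩ := C.exists_cycle a
    obtain ⟨N, hN⟩ := exists_sum_proj z
    rw [hN N le_rfl, map_sum]
    exact Submodule.sum_mem _ fun k _ =>
      Submodule.mem_iSup_of_mem k (C.quot_mem k _ (proj_mem k z))

theorem parity_apply {k : ℕ} {a : GraphHomology O} (ha : a ∈ GraphHomology.degree O k) :
    C.parity a = (-1 : ℝ) ^ k • a := by
  obtain ⟨z, hz, -, rfl⟩ := C.exists_cycle_of_mem ha
  rw [C.parity_quot, parity_of_mem hz, map_smul]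

theorem mul_mem {i j : ℕ} {a b : GraphHomology O} (ha : a ∈ GraphHomology.degree O i)
    (hb : b ∈ GraphHomology.degree O j) : C.mul (a ⊗ₜ b) ∈ GraphHomology.degree O (i + j) := by
  obtain ⟨z, hz, hDz, rfl⟩ := C.exists_cycle_of_mem ha
  obtain ⟨w, hw, hDw, rfl⟩ := C.exists_cycle_of_mem hb
  rw [C.mul_quot_tmul hDz hDw]
  exact C.quot_mem _ _ (mul_mem_degree hz hw)

theorem comul_mem {k : ℕ} {a : GraphHomology O} (ha : a ∈ GraphHomology.degree O k) :
    C.comul a ∈ ⨆ p ∈ Finset.HasAntidiagonal.antidiagonal k, LinearMap.range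
      (TensorProduct.map (GraphHomology.degree O p.1).subtype
        (GraphHomology.degree O p.2).subtype) := by
  obtain ⟨z, hz, hD, rfl⟩ := C.exists_cycle_of_mem ha
  rw [C.comul_quot_of_cycle hD]
  -- The map `quot` is defined on all chains and respects degrees, so it suffices to consider single
  -- graphs, although these need not be cycles.
  refine map_mem_of_degree (TensorProduct.map C.quot C.quot ∘ₗ Chains.comul O) _
    (fun G hG => ?_) hz
  rw [LinearMap.comp_apply, OGraph.comul_chain_eq, map_sum]
  refine Submodule.sum_mem _ fun W _ => ?_
  rw [Units.smul_def, map_zsmul, ← Int.cast_smul_eq_zsmul ℝ, TensorProduct.map_tmul]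
  refine Submodule.smul_mem _ _ (Submodule.mem_iSup_of_mem (W.ncard, Wᶜ.ncard)
    (Submodule.mem_iSup_of_mem ?_ ?_))
  · rw [Finset.HasAntidiagonal.mem_antidiagonal, Set.ncard_add_ncard_compl, Nat.card_eq_fintype_card, hG]
  · exact ⟨⟨_, C.quot_mem _ _ (inducePart_mem_degree G W)⟩ ⊗ₜ
      ⟨_, C.quot_mem _ _ (inducePart_mem_degree G Wᶜ)⟩, rfl⟩

theorem counit_eq_zero {k : ℕ} (hk : k ≠ 0) {a : GraphHomology O}
    (ha : a ∈ GraphHomology.degree O k) : C.counit a = 0 := by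
  obtain ⟨z, hz, hD, rfl⟩ := C.exists_cycle_of_mem ha
  rw [C.counit_quot_of_cycle hD, counit_of_mem_degree hk hz]

theorem antipode_mem {k : ℕ} {a : GraphHomology O} (ha : a ∈ GraphHomology.degree O k) :
    C.antipode a ∈ GraphHomology.degree O k := by
  obtain ⟨z, hz, hD, rfl⟩ := C.exists_cycle_of_mem ha
  rw [C.antipode_quot_of_cycle hD]
  exact C.quot_mem _ _ (antipode_mem_degree hz)

end HomologySplitting

namespace HomologySplitting

open Chains

variable {O : CyclicOperad.{u}} (C : HomologySplitting O)

/-! ### The axioms of a Hopf algebra -/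

theorem parity_boundaryE_apply (a : Chains O) :
    Chains.parity O (boundaryE O a) = -boundaryE O (Chains.parity O a) :=
  LinearMap.congr_fun (parity_boundaryE O) a

theorem parity_parity_apply (a : Chains O) : Chains.parity O (Chains.parity O a) = a :=
  LinearMap.congr_fun (parity_parity O) a

variable {M : Type*} [AddCommGroup M] [Module ℝ M]

theorem map_left_of_cycle {f f' k : Chains O →ₗ[ℝ] M}
    (hf : ∀ a, f a = f' a - k (boundaryE O a)) {t : Chains O ⊗[ℝ] Chains O}
    (ht : boundaryE₂ O t = 0) :
    TensorProduct.map f C.quot t = TensorProduct.map f' C.quot t :=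
  map_eq_of_gradedExtend_eq_zero_left hf C.quot_boundaryE ht

theorem map_right_of_cycle {f f' k : Chains O →ₗ[ℝ] M}
    (hf : ∀ a, f a = f' a - k (boundaryE O a)) {t : Chains O ⊗[ℝ] Chains O}
    (ht : boundaryE₂ O t = 0) :
    TensorProduct.map C.quot f t = TensorProduct.map C.quot f' t :=
  map_eq_of_gradedExtend_eq_zero_right parity_parity_apply parity_boundaryE_apply hf
    C.quot_boundaryE ht

theorem mul_assoc (a b c : GraphHomology O) :
    C.mul (C.mul (a ⊗ₜ b) ⊗ₜ c) = C.mul (a ⊗ₜ C.mul (b ⊗ₜ c)) := by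
  obtain ⟨a, ha, rfl⟩ := C.exists_cycle a
  obtain ⟨b, hb, rfl⟩ := C.exists_cycle b
  obtain ⟨c, hc, rfl⟩ := C.exists_cycle c
  rw [C.mul_quot_tmul ha hb, C.mul_quot_tmul (mul_mem_cycles (tmul_mem_cycles ha hb)) hc,
    C.mul_quot_tmul hb hc, C.mul_quot_tmul ha (mul_mem_cycles (tmul_mem_cycles hb hc)),
    Chains.mul_assoc]

theorem one_mul (a : GraphHomology O) :
    C.mul (C.quot (OGraph.empty : OGraph O).chain ⊗ₜ a) = a := by
  obtain ⟨a, ha, rfl⟩ := C.exists_cycle a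
  rw [C.mul_quot_tmul empty_mem_cycles ha, empty_mul]

theorem mul_one (a : GraphHomology O) :
    C.mul (a ⊗ₜ C.quot (OGraph.empty : OGraph O).chain) = a := by
  obtain ⟨a, ha, rfl⟩ := C.exists_cycle a
  rw [C.mul_quot_tmul ha empty_mem_cycles, mul_empty]

/-- Since Δ z is a cycle of the tensor square, the induced coproduct on either factor may be
replaced there by the one on chains. Coassociativity on chains then applies under three copies of
the quotient map. -/
theorem coassoc : (TensorProduct.assoc ℝ (GraphHomology O) (GraphHomology O)
      (GraphHomology O)).toLinearMap ∘ₗ TensorProduct.map C.comul LinearMap.id ∘ₗ C.comul =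
    TensorProduct.map LinearMap.id C.comul ∘ₗ C.comul := by
  refine LinearMap.ext fun a => ?_
  obtain ⟨z, hz, rfl⟩ := C.exists_cycle a
  have h₁ := C.map_left_of_cycle (f := C.comul ∘ₗ C.quot) C.comul_quot
    (f' := TensorProduct.map C.quot C.quot ∘ₗ Chains.comul O)
    (k := TensorProduct.map C.quot C.quot ∘ₗ Chains.comul O ∘ₗ C.htpy) (comul_mem_cycles hz)
  have h₂ := C.map_right_of_cycle (f := C.comul ∘ₗ C.quot) C.comul_quot
    (f' := TensorProduct.map C.quot C.quot ∘ₗ Chains.comul O)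
    (k := TensorProduct.map C.quot C.quot ∘ₗ Chains.comul O ∘ₗ C.htpy) (comul_mem_cycles hz)
  have h₃ : ∀ t : (Chains O ⊗[ℝ] Chains O) ⊗[ℝ] Chains O,
      TensorProduct.assoc ℝ _ _ _ (TensorProduct.map (TensorProduct.map C.quot C.quot) C.quot t) =
      TensorProduct.map C.quot (TensorProduct.map C.quot C.quot)
        (TensorProduct.assoc ℝ _ _ _ t) :=
    LinearMap.congr_fun (f := (TensorProduct.assoc ℝ _ _ _).toLinearMap ∘ₗ
        TensorProduct.map (TensorProduct.map C.quot C.quot) C.quot)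
      (g := TensorProduct.map C.quot (TensorProduct.map C.quot C.quot) ∘ₗ
        (TensorProduct.assoc ℝ _ _ _).toLinearMap)
      (TensorProduct.ext_threefold fun _ _ _ => rfl)
  have h₄ := LinearMap.congr_fun (Chains.coassoc O) z
  simp only [LinearMap.comp_apply, LinearEquiv.coe_coe] at h₄ ⊢
  rw [C.comul_quot_of_cycle hz, TensorProduct.map_map, TensorProduct.map_map, LinearMap.id_comp, h₁, h₂]
  refine Eq.trans ?_ ((h₃ _).trans ((congrArg _ h₄).trans ?_))
  · rw [TensorProduct.map_map, LinearMap.comp_id]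
  · rw [TensorProduct.map_map, LinearMap.comp_id]

theorem counit_comul (a : GraphHomology O) : TensorProduct.lid ℝ (GraphHomology O)
    (TensorProduct.map C.counit LinearMap.id (C.comul a)) = a := by
  obtain ⟨z, hz, rfl⟩ := C.exists_cycle a
  have h : ∀ t : Chains O ⊗[ℝ] Chains O,
      TensorProduct.lid ℝ _ (TensorProduct.map (Chains.counit O) C.quot t) =
      C.quot (TensorProduct.lid ℝ _ (TensorProduct.map (Chains.counit O) LinearMap.id t)) :=
    LinearMap.congr_fun (f := (TensorProduct.lid ℝ _).toLinearMap ∘ₗ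
        TensorProduct.map (Chains.counit O) C.quot)
      (g := C.quot ∘ₗ (TensorProduct.lid ℝ _).toLinearMap ∘ₗ
        TensorProduct.map (Chains.counit O) LinearMap.id)
      (TensorProduct.ext' fun a b => (map_smul C.quot (Chains.counit O a) b).symm)
  rw [C.comul_quot_of_cycle hz, TensorProduct.map_map, LinearMap.id_comp,
    C.map_left_of_cycle (f := C.counit ∘ₗ C.quot) (k := Chains.counit O ∘ₗ C.htpy) C.counit_quot
      (comul_mem_cycles hz), h]
  exact congrArg C.quot (LinearMap.congr_fun (Chains.counit_comul O) z)

theorem comul_counit (a : GraphHomology O) : TensorProduct.rid ℝ (GraphHomology O)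
    (TensorProduct.map LinearMap.id C.counit (C.comul a)) = a := by
  obtain ⟨z, hz, rfl⟩ := C.exists_cycle a
  have h : ∀ t : Chains O ⊗[ℝ] Chains O,
      TensorProduct.rid ℝ _ (TensorProduct.map C.quot (Chains.counit O) t) =
      C.quot (TensorProduct.rid ℝ _ (TensorProduct.map LinearMap.id (Chains.counit O) t)) :=
    LinearMap.congr_fun (f := (TensorProduct.rid ℝ _).toLinearMap ∘ₗ
        TensorProduct.map C.quot (Chains.counit O))
      (g := C.quot ∘ₗ (TensorProduct.rid ℝ _).toLinearMap ∘ₗ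
        TensorProduct.map LinearMap.id (Chains.counit O))
      (TensorProduct.ext' fun a b => (map_smul C.quot (Chains.counit O b) a).symm)
  rw [C.comul_quot_of_cycle hz, TensorProduct.map_map, LinearMap.id_comp,
    C.map_right_of_cycle (f := C.counit ∘ₗ C.quot) (k := Chains.counit O ∘ₗ C.htpy) C.counit_quot
      (comul_mem_cycles hz), h]
  exact congrArg C.quot (LinearMap.congr_fun (Chains.comul_counit O) z)

/-- The antipode commutes with ∂_E and with the parity operator, so its tensor product with the
identity is a chain map. -/
theorem boundaryE₂_antipode_left {t : Chains O ⊗[ℝ] Chains O} (ht : boundaryE₂ O t = 0) :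
    boundaryE₂ O (TensorProduct.map (Chains.antipode O) LinearMap.id t) = 0 := by
  have h : boundaryE₂ O ∘ₗ TensorProduct.map (Chains.antipode O) LinearMap.id =
      TensorProduct.map (Chains.antipode O) LinearMap.id ∘ₗ boundaryE₂ O :=
    TensorProduct.ext' fun a b => by
      have h₁ := LinearMap.congr_fun (antipode_boundaryE O) a
      have h₂ := LinearMap.congr_fun (antipode_parity O) a
      simp only [LinearMap.comp_apply, boundaryE₂, gradedExtend_tmul, TensorProduct.map_tmul,
        map_add, LinearMap.id_apply] at h₁ h₂ ⊢
      rw [h₁, h₂]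
  have := LinearMap.congr_fun h t
  rwa [LinearMap.comp_apply, LinearMap.comp_apply, ht, map_zero] at this

theorem boundaryE₂_antipode_right {t : Chains O ⊗[ℝ] Chains O} (ht : boundaryE₂ O t = 0) :
    boundaryE₂ O (TensorProduct.map LinearMap.id (Chains.antipode O) t) = 0 := by
  have h : boundaryE₂ O ∘ₗ TensorProduct.map LinearMap.id (Chains.antipode O) =
      TensorProduct.map LinearMap.id (Chains.antipode O) ∘ₗ boundaryE₂ O :=
    TensorProduct.ext' fun a b => by
      have h₁ := LinearMap.congr_fun (antipode_boundaryE O) b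
      simp only [LinearMap.comp_apply, boundaryE₂, gradedExtend_tmul, TensorProduct.map_tmul,
        map_add, LinearMap.id_apply] at h₁ ⊢
      rw [h₁]
  have := LinearMap.congr_fun h t
  rwa [LinearMap.comp_apply, LinearMap.comp_apply, ht, map_zero] at this

theorem antipode_left (a : GraphHomology O) :
    C.mul (TensorProduct.map C.antipode LinearMap.id (C.comul a)) =
      C.counit a • C.quot (OGraph.empty : OGraph O).chain := by
  obtain ⟨z, hz, rfl⟩ := C.exists_cycle a
  have h := C.mul_quot_of_cycle (boundaryE₂_antipode_left (comul_mem_cycles hz))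
  rw [TensorProduct.map_map, LinearMap.comp_id] at h
  rw [C.comul_quot_of_cycle hz, TensorProduct.map_map, LinearMap.id_comp,
    C.map_left_of_cycle (f := C.antipode ∘ₗ C.quot) (f' := C.quot ∘ₗ Chains.antipode O)
      (k := C.quot ∘ₗ Chains.antipode O ∘ₗ C.htpy) C.antipode_quot (comul_mem_cycles hz), h,
    C.counit_quot_of_cycle hz, ← map_smul]
  exact congrArg C.quot (LinearMap.congr_fun (Chains.antipode_left O) z)

theorem antipode_right (a : GraphHomology O) :
    C.mul (TensorProduct.map LinearMap.id C.antipode (C.comul a)) =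
      C.counit a • C.quot (OGraph.empty : OGraph O).chain := by
  obtain ⟨z, hz, rfl⟩ := C.exists_cycle a
  have h := C.mul_quot_of_cycle (boundaryE₂_antipode_right (comul_mem_cycles hz))
  rw [TensorProduct.map_map, LinearMap.comp_id] at h
  rw [C.comul_quot_of_cycle hz, TensorProduct.map_map, LinearMap.id_comp,
    C.map_right_of_cycle (f := C.antipode ∘ₗ C.quot) (f' := C.quot ∘ₗ Chains.antipode O)
      (k := C.quot ∘ₗ Chains.antipode O ∘ₗ C.htpy) C.antipode_quot (comul_mem_cycles hz), h,
    C.counit_quot_of_cycle hz, ← map_smul]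
  exact congrArg C.quot (LinearMap.congr_fun (Chains.antipode_right O) z)

theorem comul_one : C.comul (C.quot (OGraph.empty : OGraph O).chain) =
    C.quot (OGraph.empty : OGraph O).chain ⊗ₜ C.quot (OGraph.empty : OGraph O).chain := by
  rw [C.comul_quot_of_cycle empty_mem_cycles, OGraph.comul_empty, TensorProduct.map_tmul]

theorem counit_one : C.counit (C.quot (OGraph.empty : OGraph O).chain) = 1 := by
  rw [C.counit_quot_of_cycle empty_mem_cycles, counit_empty]

theorem counit_mul (a b : GraphHomology O) :
    C.counit (C.mul (a ⊗ₜ b)) = C.counit a * C.counit b := by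
  obtain ⟨a, ha, rfl⟩ := C.exists_cycle a
  obtain ⟨b, hb, rfl⟩ := C.exists_cycle b
  rw [C.mul_quot_tmul ha hb, C.counit_quot_of_cycle ha, C.counit_quot_of_cycle hb,
    C.counit_quot_of_cycle (mul_mem_cycles (tmul_mem_cycles ha hb)), Chains.counit_mul]

/-- The compatibility on chains writes the coproduct of a product as μ ⊗ μ applied to an exchanged
tensor `w`. It remains to move the quotient map past μ ⊗ μ, which is possible because `w` is a cycle
of the fourfold tensor product. -/
theorem comul_mul : C.comul ∘ₗ C.mul =
    gradedTensorMul C.parity C.mul ∘ₗ TensorProduct.map C.comul C.comul := by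
  refine TensorProduct.ext' fun a b => ?_
  obtain ⟨a, ha, rfl⟩ := C.exists_cycle a
  obtain ⟨b, hb, rfl⟩ := C.exists_cycle b
  let w := gradedExchange (Chains.parity O) (Chains.comul O a ⊗ₜ Chains.comul O b)
  have hw : gradedExtend (TensorProduct.map (Chains.parity O) (Chains.parity O))
      (boundaryE₂ O) w = 0 := by
    refine (gradedExtend_gradedExchange parity_parity_apply parity_boundaryE_apply _).trans ?_
    refine (congrArg _ ?_).trans (map_zero _)
    refine (gradedExtend_tmul _ _ _ _).trans ?_
    refine (congrArg₂ (fun s t => s ⊗ₜ Chains.comul O b + TensorProduct.map (Chains.parity O)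
      (Chains.parity O) (Chains.comul O a) ⊗ₜ[ℝ] t) (comul_mem_cycles ha)
      (comul_mem_cycles hb)).trans ?_
    rw [TensorProduct.zero_tmul, TensorProduct.tmul_zero, add_zero]
  have hQ : ∀ t, (C.quot ∘ₗ Chains.mul O) (boundaryE₂ O t) = 0 := fun t => by
    rw [LinearMap.comp_apply, ← LinearMap.comp_apply (Chains.mul O), ← boundaryE_mul,
      LinearMap.comp_apply, C.quot_boundaryE]
  have hm : ∀ t, (C.mul ∘ₗ TensorProduct.map C.quot C.quot) (boundaryE₂ O t) = 0 := fun t => by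
    rw [LinearMap.comp_apply, C.quot₂_boundaryE₂, map_zero]
  -- The induced product is replaced by the one on chains in the left factor first and then in the
  -- right one.
  have h₁ := map_eq_of_gradedExtend_eq_zero_left
    (f := C.mul ∘ₗ TensorProduct.map C.quot C.quot) (f' := C.quot ∘ₗ Chains.mul O)
    (k := C.quot ∘ₗ Chains.mul O ∘ₗ C.htpy₂) C.mul_quot hm hw
  have h₂ := map_eq_of_gradedExtend_eq_zero_right
    (f := C.mul ∘ₗ TensorProduct.map C.quot C.quot) (f' := C.quot ∘ₗ Chains.mul O)
    (k := C.quot ∘ₗ Chains.mul O ∘ₗ C.htpy₂) (parity_parity_tmul parity_parity_apply)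
    (parity_gradedExtend parity_boundaryE_apply) C.mul_quot hQ hw
  have h₃ := map_gradedExchange (f := C.quot) (γ := Chains.parity O) (γ' := C.parity)
    (fun a => (C.parity_quot a).symm) (Chains.comul O a ⊗ₜ Chains.comul O b)
  have h₄ := LinearMap.congr_fun (Chains.comul_mul O) (a ⊗ₜ b)
  rw [LinearMap.comp_apply, LinearMap.comp_apply, TensorProduct.map_tmul, gradedTensorMul_eq,
    LinearMap.comp_apply] at h₄
  rw [LinearMap.comp_apply, LinearMap.comp_apply, C.mul_quot_tmul ha hb,
    C.comul_quot_of_cycle (mul_mem_cycles (tmul_mem_cycles ha hb)), h₄, TensorProduct.map_map,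
    TensorProduct.map_tmul, C.comul_quot_of_cycle ha, C.comul_quot_of_cycle hb,
    gradedTensorMul_eq, LinearMap.comp_apply]
  refine (h₁.trans h₂).symm.trans ?_
  rw [← TensorProduct.map_map]
  exact congrArg _ h₃

/-- The Hopf algebra structure on graph homology. -/
def hopfAlgebra : DGHopfAlgebra (GraphHomology O) (GraphHomology.degree O) where
  mul := C.mul
  one := C.quot (OGraph.empty : OGraph O).chain
  comul := C.comul
  counit := C.counit
  antipode := C.antipode
  d := C.differential
  parity := C.parity
  isInternal := C.isInternal
  parity_apply _ _ := C.parity_apply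
  mul_mem _ _ _ ha _ hb := C.mul_mem ha hb
  one_mem := C.quot_mem _ _ empty_mem_degree
  comul_mem _ _ := C.comul_mem
  counit_eq_zero _ hk _ := C.counit_eq_zero hk
  antipode_mem _ _ := C.antipode_mem
  d_mem _ _ _ := by rw [C.differential_eq_zero]; exact Submodule.zero_mem _
  d_eq_zero _ _ := by rw [C.differential_eq_zero, LinearMap.zero_apply]
  mul_assoc := C.mul_assoc
  one_mul := C.one_mul
  mul_one := C.mul_one
  coassoc := C.coassoc
  counit_comul := C.counit_comul
  comul_counit := C.comul_counit
  comul_one := C.comul_one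
  comul_mul := C.comul_mul
  counit_one := C.counit_one
  counit_mul := C.counit_mul
  antipode_left := C.antipode_left
  antipode_right := C.antipode_right
  d_d _ := by rw [C.differential_eq_zero, LinearMap.zero_apply]
  d_mul := by
    rw [C.differential_eq_zero, LinearMap.zero_comp, gradedExtend, TensorProduct.map_zero_left,
      TensorProduct.map_zero_right, add_zero, LinearMap.comp_zero]
  comul_d := by
    rw [C.differential_eq_zero, LinearMap.comp_zero, gradedExtend, TensorProduct.map_zero_left,
      TensorProduct.map_zero_right, add_zero, LinearMap.zero_comp]
  counit_d _ := by rw [C.differential_eq_zero, LinearMap.zero_apply, map_zero]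
  antipode_d _ := by
    rw [C.differential_eq_zero, LinearMap.zero_apply, LinearMap.zero_apply, map_zero]

theorem isInduced : GraphHomology.IsInduced C.hopfAlgebra where
  mul_cls a b := by
    refine ⟨⟨_, mul_mem_cycles (tmul_mem_cycles a.2 b.2)⟩, rfl, ?_⟩
    rw [← C.quot_coe, ← C.quot_coe, ← C.quot_coe]
    exact C.mul_quot_tmul a.2 b.2
  one_eq := ⟨⟨_, empty_mem_cycles⟩, rfl, C.quot_coe ⟨_, empty_mem_cycles⟩⟩
  exists_comul z := by
    have h := C.homotopy₂ (Chains.comul O z)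
    rw [comul_mem_cycles z.2, map_zero, add_zero] at h
    -- The retraction of the tensor square applied to Δ z lies in the tensor square of the cycles
    -- and is homologous to Δ z by the homotopy `htpy₂`.
    refine ⟨TensorProduct.map (C.sect.codRestrict (cycles O) C.boundaryE_sect ∘ₗ C.quot)
      (C.sect.codRestrict (cycles O) C.boundaryE_sect ∘ₗ C.quot) (Chains.comul O z),
      C.htpy₂ (Chains.comul O z), ?_⟩
    rw [TensorProduct.map_map]
    exact eq_add_of_sub_eq h.symm
  comul_cls z t w h := by
    have h' : C.quot ∘ₗ (cycles O).subtype = GraphHomology.cls O := LinearMap.ext C.quot_coe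
    rw [← C.quot_coe]
    refine (C.comul_quot_of_cycle z.2).trans ?_
    -- The tensor square of the quotient map kills boundaries and is the class map on tensors of
    -- cycles, so every choice of `t` gives the same value.
    rw [h, map_add, C.quot₂_boundaryE₂, add_zero, TensorProduct.map_map, h']
  counit_cls z := by
    rw [← C.quot_coe]
    exact C.counit_quot_of_cycle z.2
  antipode_cls z := by
    refine ⟨⟨_, antipode_mem_cycles z.2⟩, rfl, ?_⟩
    rw [← C.quot_coe, ← C.quot_coe]
    exact C.antipode_quot_of_cycle z.2
  d_cls z := by
    have h := boundaryH_of_cycle z.2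
    have hz : boundaryE O (boundaryH O z) = 0 := by
      rw [h]
      exact LinearMap.congr_fun (boundaryE_boundaryE O) _
    -- The class of ∂_H z is zero, in agreement with the zero differential.
    have h' : C.quot (boundaryH O z) = 0 := by rw [h, C.quot_boundaryE]
    exact ⟨⟨_, hz⟩, rfl, (LinearMap.congr_fun C.differential_eq_zero _).trans
      (h'.symm.trans (C.quot_coe ⟨_, hz⟩))⟩

end HomologySplitting

theorem theta_mem_range_boundaryE₂ (O : CyclicOperad.{u}) {z : Chains O}
    (hz : z ∈ Chains.cycles O) : Chains.theta O z ∈ LinearMap.range (Chains.boundaryE₂ O) := by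
  have hz : Chains.boundaryE O z = 0 := hz
  refine ⟨Chains.separate O z, ?_⟩
  rw [Chains.theta_eq, LinearMap.sub_apply, LinearMap.comp_apply, LinearMap.comp_apply, hz,
    map_zero, sub_zero]

end

theorem mainTheorem12 (O : CyclicOperad.{u}) :
    Chains.WellDefined O ∧
    (∀ c, Chains.boundaryE O (Chains.boundaryE O c) = 0) ∧
    Chains.theta O =
      Chains.boundaryE₂ O ∘ₗ Chains.separate O - Chains.separate O ∘ₗ Chains.boundaryE O ∧
    (∀ z ∈ Chains.cycles O, Chains.theta O z ∈ LinearMap.range (Chains.boundaryE₂ O)) ∧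
    ∃ A : DGHopfAlgebra (GraphHomology O) (GraphHomology.degree O),
      GraphHomology.IsInduced A := by
  obtain ⟨C⟩ := nonempty_homologySplitting O
  exact ⟨Chains.wellDefined O, LinearMap.congr_fun (Chains.boundaryE_boundaryE O),
    Chains.theta_eq O, fun _ => theta_mem_range_boundaryE₂ O, C.hopfAlgebra, C.isInduced⟩
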